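/- Work with stacks on the site of affine $\mathbb C$-schemes with the fppf topology. Let $\check G$ be a complex linear algebraic group with an algebraic involution $\eta$ (for instance, the connected reductive Langlands dual group of an adjoint group $G$ with a quasi-split real form, with its dual involution). Let $\Gamma=\{1,\gamma\}\cong\mathbb Z/2$ be the Galois group of $\mathbb C/\mathbb R$, acting on $\check G$ through $\eta$, and let $G^L=\check G\rtimes\Gamma$. Let $\lambda\in\check{\mathfrak g}=\operatorname{Lie}\check G$ be semisimple, $\mathbb O_\lambda=\operatorname{Ad}(\check G)\lambda$, and $\alpha=\exp(2\pi i\lambda)$. Let $\check G(\alpha)$ be the centralizer of $\alpha$ in $\check G$. Let $\mathfrak n(\lambda)$ be the sum of the eigenspaces of $\operatorname{ad}\lambda$ on $\check{\mathfrak g}$ for the eigenvalues $1,2,3,\dots$, let $L(\lambda)$ be the centralizer of $\lambda$ in $\check G$ and $N(\lambda)=\exp\mathfrak n(\lambda)$, and let $\check P(\lambda)=L(\lambda)N(\lambda)\subset\check G(\alpha)$. The canonical flat of $\lambda$ is $F(\lambda)=\lambda+\mathfrak n(\lambda)$; let $F(\mathbb O_\lambda)\cong\check G/\check P(\lambda)$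 be the variety of the flats $\operatorname{Ad}(g)F(\lambda)$, and $e:F(\mathbb O_\lambda)\to\check G$ the map $\operatorname{Ad}(g)F(\lambda)\mapsto g\alpha g^{-1}$ induced by $x\mapsto\exp(2\pi i x)$. The ABV space is $$X(\mathbb O_\lambda,G^L)=\{(y,F)\;:\;y\in G^L\setminus\check G,\ F\in F(\mathbb O_\lambda),\ y^2=e(F)\},$$ with $\check G$ acting by conjugation, and $\mathcal X(\mathbb O_\lambda,G^L)=X(\mathbb O_\lambda,G^L)/\check G$ is its quotient stack. Put $$\Sigma(\eta,\alpha)=\{\sigma\in\check G\;:\;\sigma\eta(\sigma)=\alpha\}/\check G(\alpha),\qquad h\cdot\sigma=h\sigma\eta(h)^{-1}.$$ For $\sigma\in\check G$ with $\sigma\eta(\sigma)=\alpha$, the formula $\iota_\sigma(g)=\sigma\eta(g)\sigma^{-1}$ defines an involution of $\check G(\alpha)$; let $K_\sigma(\alpha)=\check G(\alpha)^{\iota_\sigma}$ be its fixed subgroup. Then: 1. For any choice of representatives $\sigma$ of the classes in $\Sigma(\eta,\alpha)$, there is an equivalence of stacks $$\mathcal X(\mathbb O_\lambda,G^L)\;\simeq\;\coprod_{\sigma\in\Sigma(\eta,\alpha)}K_\sigma(\alpha)\backslash\check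 G(\alpha)/\check P(\lambda).$$ 2. For every $\sigma\in\check G$ with $\sigma\eta(\sigma)=\alpha$, with $\check P'=\iota_\sigma(\check P(\lambda))$, there is an equivalence of stacks $$\mathcal X(\mathbb O_\lambda,G^L)\;\simeq\;\bigl(\check P(\lambda)\backslash\check G(\alpha)/\check P'\bigr)^{\Gamma},$$ where the right side is the homotopy fixed point stack for the action of $\Gamma$ on $\check P(\lambda)\backslash\check G(\alpha)/\check P'=\check G(\alpha)\backslash\bigl(\check G(\alpha)/\check P(\lambda)\times\check G(\alpha)/\check P'\bigr)$ exchanging the two factors and composing with $\iota_\sigma$, that is, induced by $g\mapsto\iota_\sigma(g)^{-1}$ and $(p,p')\mapsto(\iota_\sigma(p'),\iota_\sigma(p))$. In particular, if $\iota_\sigma$ preserves $\check P(\lambda)$, then $\mathcal X(\mathbb O_\lambda,G^L)\simeq(\check P(\lambda)\backslash\check G(\alpha)/\check P(\lambda))^\Gamma$. -/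

import Mathlib

open CategoryTheory

noncomputable section

namespace ABV

/-! ### Test algebras, presheaves and sheaves on affine schemes over the complex numbers -/

/-- Commutative `ℂ`-algebras; the opposite category is the category of affine schemes over `ℂ`. -/
abbrev TestAlg := CommAlgCat.{0} ℂ

/-- Presheaves of sets on affine `ℂ`-schemes, given by their functors of points. -/
abbrev Presh := TestAlg ⥤ Type

/-- Presheaves of groups on affine `ℂ`-schemes. -/
abbrev GrpPresh := TestAlg ⥤ GrpCat.{0}

/-- `Spec B → Spec A` is an fppf covering. -/
def IsFppf {A B : TestAlg} (f : A ⟶ B) : Prop :=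
  f.hom.toRingHom.FaithfullyFlat ∧ f.hom.toRingHom.FinitePresentation

/-- `Q` holds after passing to some fppf covering of `Spec A`. -/
def FppfLocally (A : TestAlg) (Q : ∀ B : TestAlg, (A ⟶ B) → Prop) : Prop :=
  ∃ (B : TestAlg) (f : A ⟶ B), IsFppf f ∧ Q B f

/-- Sheaves for the fppf topology on affine schemes: finite disjoint unions go to products, and
there is descent along every fppf covering `Spec B → Spec A`. The descent condition, usually
expressed through `B ⊗[A] B`, is expressed through all pairs of maps out of `B` which agree
on `A`. -/
structure IsFppfSheaf (F : Presh) : Prop where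
  zero : ∀ A : TestAlg, Subsingleton A → ∃! _z : F.obj A, True
  prod : ∀ (A B : TestAlg) (x : F.obj A) (y : F.obj B),
    ∃! z : F.obj (CommAlgCat.of ℂ (A × B)),
      F.map (CommAlgCat.ofHom (AlgHom.fst ℂ A B)) z = x ∧
      F.map (CommAlgCat.ofHom (AlgHom.snd ℂ A B)) z = y
  descent : ∀ {A B : TestAlg} (f : A ⟶ B), IsFppf f → ∀ x : F.obj B,
    (∀ (C : TestAlg) (u v : B ⟶ C), f ≫ u = f ≫ v → F.map u x = F.map v x) →
    ∃! y : F.obj A, F.map f y = x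

/-! ### Group actions and quotient stacks -/

/-- A left action of a presheaf of groups on a presheaf of sets. -/
structure GrpAction (𝔾 : GrpPresh) (X : Presh) where
  act : ∀ {A : TestAlg}, 𝔾.obj A → X.obj A → X.obj A
  one_act : ∀ {A : TestAlg} (x : X.obj A), act (1 : 𝔾.obj A) x = x
  mul_act : ∀ {A : TestAlg} (g h : 𝔾.obj A) (x : X.obj A), act (g * h) x = act g (act h x)
  map_act : ∀ {A B : TestAlg} (f : A ⟶ B) (g : 𝔾.obj A) (x : X.obj A),
    X.map f (act g x) = act (𝔾.map f g) (X.map f x)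

/-- An object of the quotient stack `[X/𝔾]` over `Spec base`: an fppf `𝔾`-torsor
`E → Spec base` together with a `𝔾`-equivariant map `E → X`. -/
structure QuotientStack {𝔾 : GrpPresh} {X : Presh} (a : GrpAction 𝔾 X) where
  base : TestAlg
  E : Presh
  sheaf : IsFppfSheaf E
  action : GrpAction 𝔾 E
  proj : ∀ {A : TestAlg}, E.obj A → (base ⟶ A)
  proj_map : ∀ {A B : TestAlg} (f : A ⟶ B) (e : E.obj A), proj (E.map f e) = proj e ≫ f
  proj_act : ∀ {A : TestAlg} (g : 𝔾.obj A) (e : E.obj A), proj (action.act g e) = proj e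
  simply_transitive : ∀ {A : TestAlg} (e e' : E.obj A), proj e = proj e' →
    ∃! g : 𝔾.obj A, action.act g e = e'
  locally_trivial : FppfLocally base fun _ f => ∃ e, proj e = f
  toX : ∀ {A : TestAlg}, E.obj A → X.obj A
  toX_map : ∀ {A B : TestAlg} (f : A ⟶ B) (e : E.obj A), toX (E.map f e) = X.map f (toX e)
  toX_act : ∀ {A : TestAlg} (g : 𝔾.obj A) (e : E.obj A),
    toX (action.act g e) = a.act g (toX e)

namespace QuotientStack

variable {𝔾 : GrpPresh} {X : Presh} {a : GrpAction 𝔾 X}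

/-- A morphism in the quotient stack, covering a morphism `Spec x.base → Spec y.base`. -/
@[ext]
structure Hom (x y : QuotientStack a) where
  base : y.base ⟶ x.base
  total : ∀ A : TestAlg, x.E.obj A → y.E.obj A
  total_map : ∀ {A B : TestAlg} (f : A ⟶ B) (e : x.E.obj A),
    total B (x.E.map f e) = y.E.map f (total A e)
  proj_total : ∀ {A : TestAlg} (e : x.E.obj A), y.proj (total A e) = base ≫ x.proj e
  total_act : ∀ {A : TestAlg} (g : 𝔾.obj A) (e : x.E.obj A),
    total A (x.action.act g e) = y.action.act g (total A e)
  toX_total : ∀ {A : TestAlg} (e : x.E.obj A), y.toX (total A e) = x.toX e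

instance : Category (QuotientStack a) where
  Hom x y := Hom x y
  id x :=
    { base := 𝟙 _
      total := fun _ e => e
      total_map := fun _ _ => rfl
      proj_total := fun _ => by simp
      total_act := fun _ _ => rfl
      toX_total := fun _ => rfl }
  comp {x y z} u v :=
    { base := v.base ≫ u.base
      total := fun A e => v.total A (u.total A e)
      total_map := fun f e => by rw [u.total_map, v.total_map]
      proj_total := fun e => by rw [v.proj_total, u.proj_total, Category.assoc]
      total_act := fun g e => by rw [u.total_act, v.total_act]
      toX_total := fun e => by rw [v.toX_total, u.toX_total] }
  id_comp u := Hom.ext (Category.comp_id u.base) rfl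
  comp_id u := Hom.ext (Category.id_comp u.base) rfl
  assoc u v w := Hom.ext (Category.assoc w.base v.base u.base).symm rfl

variable (a) in
/-- The projection of the quotient stack to affine `ℂ`-schemes; it makes the quotient stack a
category fibred in groupoids. -/
def π : QuotientStack a ⥤ TestAlgᵒᵖ where
  obj x := Opposite.op x.base
  map u := Quiver.Hom.op u.base
  map_id _ := rfl
  map_comp _ _ := rfl

end QuotientStack

/-- Equivalence of stacks: an equivalence of categories compatible with the projections to affine
`ℂ`-schemes. -/
def StackEquiv {𝒳 𝒴 : Type 1} [Category.{1} 𝒳] [Category.{1} 𝒴]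
    (p : 𝒳 ⥤ TestAlgᵒᵖ) (q : 𝒴 ⥤ TestAlgᵒᵖ) : Prop :=
  ∃ F : 𝒳 ⥤ 𝒴, F.IsEquivalence ∧ Nonempty (F ⋙ q ≅ p)

/-! ### Disjoint unions of stacks -/

/-- An object of the disjoint union `∐ᵢ 𝒳ᵢ` over `Spec base`: a decomposition of `Spec base`
into open and closed pieces indexed by `i`, almost all of them empty, and an object of `𝒳ᵢ` over
the `i`-th piece. -/
structure Coprod {I : Type} {𝒳 : I → Type 1} [∀ i, Category.{1} (𝒳 i)]
    (p : ∀ i, 𝒳 i ⥤ TestAlgᵒᵖ) where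
  base : TestAlg
  part : ∀ i, 𝒳 i
  incl : ∀ i, base ⟶ ((p i).obj (part i)).unop
  bijective : Function.Bijective
    fun (r : base) (i : I) => ((incl i).hom r : ((p i).obj (part i)).unop)
  finite : {i | Nontrivial ((p i).obj (part i)).unop}.Finite

namespace Coprod

variable {I : Type} {𝒳 : I → Type 1} [∀ i, Category.{1} (𝒳 i)] {p : ∀ i, 𝒳 i ⥤ TestAlgᵒᵖ}

/-- A morphism in the disjoint union: a morphism of bases respecting the decompositions, with
morphisms of the pieces above it. -/
@[ext]
structure Hom (x y : Coprod p) where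
  base : y.base ⟶ x.base
  part : ∀ i, x.part i ⟶ y.part i
  comm : ∀ i, y.incl i ≫ ((p i).map (part i)).unop = base ≫ x.incl i

instance : Category (Coprod p) where
  Hom x y := Hom x y
  id x := { base := 𝟙 _, part := fun _ => 𝟙 _, comm := fun i => by simp }
  comp {x y z} u v :=
    { base := v.base ≫ u.base
      part := fun i => u.part i ≫ v.part i
      comm := fun i => by
        rw [Functor.map_comp, unop_comp, ← Category.assoc, v.comm, Category.assoc, u.comm,
          Category.assoc] }
  id_comp u := Hom.ext (Category.comp_id u.base) (funext fun i => Category.id_comp (u.part i))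
  comp_id u := Hom.ext (Category.id_comp u.base) (funext fun i => Category.comp_id (u.part i))
  assoc u v w := Hom.ext (Category.assoc w.base v.base u.base).symm
    (funext fun i => Category.assoc (u.part i) (v.part i) (w.part i))

variable (p) in
/-- The projection of the disjoint union to affine `ℂ`-schemes. -/
def π : Coprod p ⥤ TestAlgᵒᵖ where
  obj x := Opposite.op x.base
  map u := Quiver.Hom.op u.base
  map_id _ := rfl
  map_comp _ _ := rfl

end Coprod

/-! ### Actions of the group of order two on a stack, and homotopy fixed points -/

/-- An action of `Γ = ℤ/2` on a stack `p : 𝒳 ⥤ TestAlgᵒᵖ` (over the base): an autoequivalence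
`T` over the base, and a coherent isomorphism of `T²` with the identity. -/
structure GammaAction {𝒳 : Type 1} [Category.{1} 𝒳] (p : 𝒳 ⥤ TestAlgᵒᵖ) where
  T : 𝒳 ⥤ 𝒳
  overBase : T ⋙ p ≅ p
  sq : T ⋙ T ≅ 𝟭 𝒳
  sq_coherent : ∀ x : 𝒳, T.map (sq.hom.app x) = sq.hom.app (T.obj x)
  sq_over : ∀ x : 𝒳, p.map (sq.hom.app x) = overBase.hom.app (T.obj x) ≫ overBase.hom.app x

/-- An object of the homotopy fixed point stack `𝒳^Γ`: an object `x` of `𝒳` with an isomorphism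
`T x ≅ x` in the fibre over the base of `x`, satisfying the cocycle condition. -/
structure HomotopyFixed {𝒳 : Type 1} [Category.{1} 𝒳] {p : 𝒳 ⥤ TestAlgᵒᵖ}
    (γ : GammaAction p) where
  pt : 𝒳
  iso : γ.T.obj pt ≅ pt
  iso_over : p.map iso.hom = γ.overBase.hom.app pt
  cocycle : γ.T.map iso.hom ≫ iso.hom = γ.sq.hom.app pt

namespace HomotopyFixed

variable {𝒳 : Type 1} [Category.{1} 𝒳] {p : 𝒳 ⥤ TestAlgᵒᵖ} {γ : GammaAction p}

/-- A morphism of homotopy fixed points: a morphism commuting with the given isomorphisms. -/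
@[ext]
structure Hom (x y : HomotopyFixed γ) where
  hom : x.pt ⟶ y.pt
  comm : γ.T.map hom ≫ y.iso.hom = x.iso.hom ≫ hom

instance : Category (HomotopyFixed γ) where
  Hom x y := Hom x y
  id x := { hom := 𝟙 _, comm := by simp }
  comp {x y z} u v :=
    { hom := u.hom ≫ v.hom
      comm := by
        rw [Functor.map_comp, Category.assoc, v.comm, ← Category.assoc, u.comm, Category.assoc] }
  id_comp u := Hom.ext (Category.id_comp u.hom)
  comp_id u := Hom.ext (Category.comp_id u.hom)
  assoc u v w := Hom.ext (Category.assoc u.hom v.hom w.hom)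

variable (γ) in
/-- The projection of the homotopy fixed point stack to affine `ℂ`-schemes. -/
def π : HomotopyFixed γ ⥤ TestAlgᵒᵖ where
  obj x := p.obj x.pt
  map u := p.map u.hom
  map_id x := p.map_id x.pt
  map_comp u v := p.map_comp u.hom v.hom

end HomotopyFixed

/-! ### Subgroups, products, double coset stacks -/

/-- A presheaf of subgroups of a presheaf of groups. -/
structure SubgroupPresh (𝔾 : GrpPresh) where
  carrier : ∀ A : TestAlg, Subgroup (𝔾.obj A)
  map_mem : ∀ {A B : TestAlg} (f : A ⟶ B) {g : 𝔾.obj A},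
    g ∈ carrier A → 𝔾.map f g ∈ carrier B

/-- The presheaf of groups underlying a presheaf of subgroups. -/
def SubgroupPresh.toGrp {𝔾 : GrpPresh} (K : SubgroupPresh 𝔾) : GrpPresh where
  obj A := GrpCat.of (K.carrier A)
  map f := GrpCat.ofHom
    (((𝔾.map f).hom.comp (K.carrier _).subtype).codRestrict (K.carrier _)
      fun g => K.map_mem f g.2)
  map_id A := GrpCat.ext fun g => Subtype.ext
    (show 𝔾.map (𝟙 A) g.1 = g.1 by simp)
  map_comp f f' := GrpCat.ext fun g => Subtype.ext
    (show 𝔾.map (f ≫ f') g.1 = 𝔾.map f' (𝔾.map f g.1) by simp)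

/-- The product of two presheaves of groups. -/
def prodGrp (𝔾 ℍ : GrpPresh) : GrpPresh where
  obj A := GrpCat.of (𝔾.obj A × ℍ.obj A)
  map f := GrpCat.ofHom ((𝔾.map f).hom.prodMap (ℍ.map f).hom)
  map_id A := GrpCat.ext fun g => Prod.ext
    (show 𝔾.map (𝟙 A) g.1 = g.1 by simp) (show ℍ.map (𝟙 A) g.2 = g.2 by simp)
  map_comp f f' := GrpCat.ext fun g => Prod.ext
    (show 𝔾.map (f ≫ f') g.1 = 𝔾.map f' (𝔾.map f g.1) by simp)
    (show ℍ.map (f ≫ f') g.2 = ℍ.map f' (ℍ.map f g.2) by simp)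

/-- The presheaf of sets underlying a presheaf of groups. -/
def setOf (𝔾 : GrpPresh) : Presh where
  obj A := 𝔾.obj A
  map f := TypeCat.ofHom (𝔾.map f)
  map_id A := by ext g; change 𝔾.map (𝟙 A) g = g; simp
  map_comp f f' := by
    ext g; change 𝔾.map (f ≫ f') g = 𝔾.map f' (𝔾.map f g); simp

/-- The action of `K × P` on `𝔾` by `(k, p) • g = k g p⁻¹`. The double coset stack
`K \ 𝔾 / P` is the quotient stack of this action. -/
def doubleCoset {𝔾 : GrpPresh} (K P : SubgroupPresh 𝔾) :
    GrpAction (prodGrp K.toGrp P.toGrp) (setOf 𝔾) where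
  act {A} x (g : 𝔾.obj A) := (x.1.1 * g * (x.2.1)⁻¹ : 𝔾.obj A)
  one_act {A} g := (show ∀ g : 𝔾.obj A, 1 * g * 1⁻¹ = g from fun g => by simp) g
  mul_act {A} x y g :=
    (show ∀ k k' g p p' : 𝔾.obj A, k * k' * g * (p * p')⁻¹ = k * (k' * g * p'⁻¹) * p⁻¹
      from fun k k' g p p' => by group) x.1.1 y.1.1 g x.2.1 y.2.1
  map_act {A B} f x g :=
    (show ∀ k g p : 𝔾.obj A, 𝔾.map f (k * g * p⁻¹) = 𝔾.map f k * 𝔾.map f g * (𝔾.map f p)⁻¹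
      from fun k g p => by rw [map_mul, map_mul, map_inv]) x.1.1 g x.2.1

/-! ### Involutions of quotient stacks -/

theorem invol_grp {𝔾 : GrpPresh} {j : 𝔾 ⟶ 𝔾} (hj : j ≫ j = 𝟙 𝔾) {A : TestAlg}
    (g : 𝔾.obj A) : j.app A (j.app A g) = g := by
  have h := congrArg (fun t : 𝔾 ⟶ 𝔾 => t.app A g) hj
  simpa using h

theorem invol_set {X : Presh} {τ : X ⟶ X} (hτ : τ ≫ τ = 𝟙 X) {A : TestAlg}
    (x : X.obj A) : τ.app A (τ.app A x) = x := by
  have h := congrArg (fun t : X ⟶ X => t.app A x) hτ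
  simpa using h

theorem nat_grp {𝔾 ℍ : GrpPresh} (j : 𝔾 ⟶ ℍ) {A B : TestAlg} (f : A ⟶ B)
    (g : 𝔾.obj A) : j.app B (𝔾.map f g) = ℍ.map f (j.app A g) := by
  simp

theorem nat_set {X Y : Presh} (τ : X ⟶ Y) {A B : TestAlg} (f : A ⟶ B)
    (x : X.obj A) : τ.app B (X.map f x) = Y.map f (τ.app A x) := by
  simp

/-- An involution `τ` of `X`, equivariant along an involution `j` of `𝔾`, acts on objects of
`[X/𝔾]`: the torsor `E` keeps its total space, `𝔾` acts through `j`, and `E → X` is composed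
with `τ`. -/
def twistObj {𝔾 : GrpPresh} {X : Presh} {a : GrpAction 𝔾 X} {j : 𝔾 ⟶ 𝔾} {τ : X ⟶ X}
    (hj : j ≫ j = 𝟙 𝔾)
    (hact : ∀ (A : TestAlg) (g : 𝔾.obj A) (x : X.obj A),
      τ.app A (a.act g x) = a.act (j.app A g) (τ.app A x))
    (x : QuotientStack a) : QuotientStack a where
  base := x.base
  E := x.E
  sheaf := x.sheaf
  action :=
    { act := fun {A} g e => x.action.act (j.app A g) e
      one_act := fun e => by rw [map_one, x.action.one_act]
      mul_act := fun g h e => by rw [map_mul, x.action.mul_act]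
      map_act := fun f g e => by rw [x.action.map_act, nat_grp] }
  proj := x.proj
  proj_map := x.proj_map
  proj_act g e := x.proj_act _ e
  simply_transitive {A} e e' h := by
    obtain ⟨g, hg, hu⟩ := x.simply_transitive e e' h
    refine ⟨j.app A g, ?_, fun g' hg' => ?_⟩
    · change x.action.act (j.app A (j.app A g)) e = e'
      rw [invol_grp hj, hg]
    · rw [← hu _ hg', invol_grp hj]
  locally_trivial := x.locally_trivial
  toX {A} e := τ.app A (x.toX e)
  toX_map f e := by rw [x.toX_map, nat_set]
  toX_act {A} g e := by rw [x.toX_act, hact, invol_grp hj]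

/-- The action of `Γ = ℤ/2` on the quotient stack `[X/𝔾]` induced by compatible involutions of
`X` and `𝔾`. -/
def twistAction {𝔾 : GrpPresh} {X : Presh} {a : GrpAction 𝔾 X} {j : 𝔾 ⟶ 𝔾} {τ : X ⟶ X}
    (hj : j ≫ j = 𝟙 𝔾) (hτ : τ ≫ τ = 𝟙 X)
    (hact : ∀ (A : TestAlg) (g : 𝔾.obj A) (x : X.obj A),
      τ.app A (a.act g x) = a.act (j.app A g) (τ.app A x)) :
    GammaAction (QuotientStack.π a) where
  T :=
    { obj := twistObj hj hact
      map := fun u =>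
        { base := u.base
          total := u.total
          total_map := u.total_map
          proj_total := u.proj_total
          total_act := fun _ e => u.total_act _ e
          toX_total := fun {A} e => congrArg (τ.app A) (u.toX_total e) }
      map_id := fun _ => rfl
      map_comp := fun _ _ => rfl }
  overBase := Iso.refl _
  sq := NatIso.ofComponents
    (fun x =>
      { hom :=
          { base := 𝟙 _
            total := fun _ e => e
            total_map := fun _ _ => rfl
            proj_total := fun e => (Category.id_comp (x.proj e)).symm
            total_act := fun g e =>
              congrArg (fun h => x.action.act h e) (invol_grp hj g)
            toX_total := fun e => (invol_set hτ (x.toX e)).symm }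
        inv :=
          { base := 𝟙 _
            total := fun _ e => e
            total_map := fun _ _ => rfl
            proj_total := fun e => (Category.id_comp (x.proj e)).symm
            total_act := fun g e =>
              congrArg (fun h => x.action.act h e) (invol_grp hj g).symm
            toX_total := fun e => invol_set hτ (x.toX e) }
        hom_inv_id := QuotientStack.Hom.ext (Category.id_comp _) rfl
        inv_hom_id := QuotientStack.Hom.ext (Category.id_comp _) rfl })
    (fun u => QuotientStack.Hom.ext
      ((Category.id_comp u.base).trans (Category.comp_id u.base).symm) rfl)
  sq_coherent _ := rfl
  sq_over x := (Category.id_comp (𝟙 (Opposite.op x.base))).symm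

/-- The inverse image of a presheaf of subgroups under an endomorphism. -/
def SubgroupPresh.comap {𝔾 : GrpPresh} (ι : 𝔾 ⟶ 𝔾) (P : SubgroupPresh 𝔾) :
    SubgroupPresh 𝔾 where
  carrier A := (P.carrier A).comap (ι.app A).hom
  map_mem {A B} f {g} hg := by
    change ι.app B (𝔾.map f g) ∈ P.carrier B
    rw [nat_grp]
    exact P.map_mem f hg

/-- For an involution `ι` of `𝔾` and a subgroup `P`, with `P' = ι(P)`: the involution
`(p, p') ↦ (ι p', ι p)` of `P × P'`. -/
def swapGrp {𝔾 : GrpPresh} {ι : 𝔾 ⟶ 𝔾} (hι : ι ≫ ι = 𝟙 𝔾) {P P' : SubgroupPresh 𝔾}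
    (hP' : P' = P.comap ι) : prodGrp P.toGrp P'.toGrp ⟶ prodGrp P.toGrp P'.toGrp where
  app A := GrpCat.ofHom
    { toFun := fun x => (⟨ι.app A x.2.1, by
          have h := x.2.2
          subst hP'
          exact h⟩, ⟨ι.app A x.1.1, by
          subst hP'
          change ι.app A (ι.app A x.1.1) ∈ P.carrier A
          rw [invol_grp hι]
          exact x.1.2⟩)
      map_one' := Prod.ext (Subtype.ext (map_one (ι.app A).hom))
        (Subtype.ext (map_one (ι.app A).hom))
      map_mul' := fun x y => Prod.ext (Subtype.ext (map_mul (ι.app A).hom x.2.1 y.2.1))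
        (Subtype.ext (map_mul (ι.app A).hom x.1.1 y.1.1)) }
  naturality A B f := GrpCat.ext fun x => Prod.ext
    (Subtype.ext (nat_grp ι f x.2.1)) (Subtype.ext (nat_grp ι f x.1.1))

/-- The involution `g ↦ (ι g)⁻¹` of the presheaf of sets underlying `𝔾`. -/
def swapSet {𝔾 : GrpPresh} (ι : 𝔾 ⟶ 𝔾) : setOf 𝔾 ⟶ setOf 𝔾 where
  app A := TypeCat.ofHom (X := 𝔾.obj A) (Y := 𝔾.obj A) fun g => (ι.app A g)⁻¹
  naturality A B f := by
    ext g
    exact (show ∀ g : 𝔾.obj A, (ι.app B (𝔾.map f g))⁻¹ = 𝔾.map f (ι.app A g)⁻¹ from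
      fun g => by rw [nat_grp, map_inv]) g

/-- For an involution `ι` of `𝔾` and `P' = ι(P)`: the action of `Γ = ℤ/2` on
`P \ 𝔾 / P' = 𝔾 \ (𝔾/P × 𝔾/P')` which exchanges the two factors and composes with `ι`. The pair
`(xP, yP')`, which corresponds to the double coset of `x⁻¹ y`, goes to `(ι(y)P, ι(x)P')`, so that
`g` goes to `(ι g)⁻¹`. -/
def swapAction {𝔾 : GrpPresh} {ι : 𝔾 ⟶ 𝔾} (hι : ι ≫ ι = 𝟙 𝔾) {P P' : SubgroupPresh 𝔾}
    (hP' : P' = P.comap ι) : GammaAction (QuotientStack.π (doubleCoset P P')) :=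
  twistAction (j := swapGrp hι hP') (τ := swapSet ι)
    (by
      refine NatTrans.ext (funext fun A => GrpCat.ext fun x => Prod.ext
        (Subtype.ext ?_) (Subtype.ext ?_))
      · exact invol_grp hι x.1.1
      · exact invol_grp hι x.2.1)
    (by
      refine NatTrans.ext (funext fun A => ?_)
      ext g
      exact (show ∀ g : 𝔾.obj A, (ι.app A (ι.app A g)⁻¹)⁻¹ = g from
        fun g => by rw [map_inv, inv_inv, invol_grp hι]) g)
    (fun A x g =>
      (show ∀ p g p' : 𝔾.obj A, (ι.app A (p * g * p'⁻¹))⁻¹ =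
          ι.app A p' * (ι.app A g)⁻¹ * (ι.app A p)⁻¹ from
        fun p g p' => by
          rw [map_mul, map_mul, map_inv, mul_inv_rev, mul_inv_rev, inv_inv, mul_assoc])
        x.1.1 g x.2.1)

/-! ### Linear algebraic groups -/

/-- The presheaf of groups `GL_d`. -/
def glGrp (d : ℕ) : GrpPresh where
  obj A := GrpCat.of (GL (Fin d) A)
  map f := GrpCat.ofHom (Matrix.GeneralLinearGroup.map f.hom.toRingHom)
  map_id _ := rfl
  map_comp _ _ := rfl

/-- The entries of a matrix and of its inverse. -/
def coords {d : ℕ} {A : Type} [CommRing A] (g : GL (Fin d) A) :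
    (Fin d × Fin d) ⊕ (Fin d × Fin d) → A :=
  Sum.elim (fun ij => g.val ij.1 ij.2) (fun ij => (g⁻¹).val ij.1 ij.2)

/-- The value at `g` of the regular function on `GL_d` given by a polynomial in the entries of
a matrix and of its inverse. -/
def evalGL {d : ℕ} {A : Type} [CommRing A] [Algebra ℂ A]
    (f : MvPolynomial ((Fin d × Fin d) ⊕ (Fin d × Fin d)) ℂ) (g : GL (Fin d) A) : A :=
  MvPolynomial.aeval (coords g) f

/-- A complex linear algebraic group: a Zariski closed subgroup of `GL_d(ℂ)`. -/
structure LinearAlgebraicGroup (d : ℕ) where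
  pts : Subgroup (GL (Fin d) ℂ)
  closed : ∃ S : Set (MvPolynomial ((Fin d × Fin d) ⊕ (Fin d × Fin d)) ℂ),
    ∀ g : GL (Fin d) ℂ, g ∈ pts ↔ ∀ f ∈ S, evalGL f g = 0

namespace LinearAlgebraicGroup

variable {d : ℕ} (G : LinearAlgebraicGroup d)

/-- `g` satisfies all polynomial equations which hold on the group. -/
def Satisfies {A : Type} [CommRing A] [Algebra ℂ A] (g : GL (Fin d) A) : Prop :=
  ∀ f : MvPolynomial ((Fin d × Fin d) ⊕ (Fin d × Fin d)) ℂ,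
    (∀ h ∈ G.pts, evalGL f h = 0) → evalGL f g = 0

theorem coords_map {A B : Type} [CommRing A] [CommRing B] (φ : A →+* B) (g : GL (Fin d) A)
    (k : (Fin d × Fin d) ⊕ (Fin d × Fin d)) :
    coords (Matrix.GeneralLinearGroup.map φ g) k = φ (coords g k) := by
  cases k with
  | inl ij => rfl
  | inr ij =>
    change ((Matrix.GeneralLinearGroup.map φ g)⁻¹).val ij.1 ij.2 = φ ((g⁻¹).val ij.1 ij.2)
    rw [← map_inv]
    rfl

theorem evalGL_map {A B : Type} [CommRing A] [CommRing B] [Algebra ℂ A] [Algebra ℂ B]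
    (φ : A →ₐ[ℂ] B) (f : MvPolynomial ((Fin d × Fin d) ⊕ (Fin d × Fin d)) ℂ)
    (g : GL (Fin d) A) :
    evalGL f (Matrix.GeneralLinearGroup.map φ.toRingHom g) = φ (evalGL f g) := by
  unfold evalGL
  have h : coords (Matrix.GeneralLinearGroup.map φ.toRingHom g) = fun k => φ (coords g k) :=
    funext fun k => coords_map φ.toRingHom g k
  rw [h, ← AlgHom.comp_apply]
  congr 1
  ext k
  simp

theorem Satisfies.map {A B : Type} [CommRing A] [CommRing B] [Algebra ℂ A] [Algebra ℂ B]
    (φ : A →ₐ[ℂ] B) {g : GL (Fin d) A} (hg : G.Satisfies g) :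
    G.Satisfies (Matrix.GeneralLinearGroup.map φ.toRingHom g) := fun f hf => by
  rw [evalGL_map, hg f hf, map_zero]

theorem satisfies_one {A : Type} [CommRing A] [Algebra ℂ A] :
    G.Satisfies (1 : GL (Fin d) A) := fun f hf => by
  have h := evalGL_map (Algebra.ofId ℂ A) f (1 : GL (Fin d) ℂ)
  rw [hf 1 G.pts.one_mem, map_zero, map_one] at h
  exact h

theorem satisfies_inv {A : Type} [CommRing A] [Algebra ℂ A] {g : GL (Fin d) A}
    (hg : G.Satisfies g) : G.Satisfies g⁻¹ := fun f hf => by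
  have key : ∀ {B : Type} [CommRing B] [Algebra ℂ B] (h : GL (Fin d) B),
      evalGL (MvPolynomial.rename Sum.swap f) h = evalGL f h⁻¹ := by
    intro B _ _ h
    unfold evalGL
    rw [MvPolynomial.aeval_rename]
    congr 2
    funext k
    rcases k with k | k <;> simp [coords]
  rw [← key]
  exact hg _ fun h hh => by rw [key]; exact hf _ (G.pts.inv_mem hh)

/-- A polynomial with coefficients in `A` which vanishes on the group vanishes on all points
satisfying the equations of the group. -/
theorem eval_eq_zero {A : Type} [CommRing A] [Algebra ℂ A]
    (P : MvPolynomial ((Fin d × Fin d) ⊕ (Fin d × Fin d)) A)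
    (hP : ∀ h ∈ G.pts,
      MvPolynomial.eval (fun k => algebraMap ℂ A (coords h k)) P = 0)
    {g : GL (Fin d) A} (hg : G.Satisfies g) : MvPolynomial.eval (coords g) P = 0 := by
  classical
  let b := Module.Basis.ofVectorSpace ℂ A
  let Q : (Module.Basis.ofVectorSpaceIndex ℂ A) →
      MvPolynomial ((Fin d × Fin d) ⊕ (Fin d × Fin d)) ℂ := fun i =>
    ∑ m ∈ P.support, MvPolynomial.monomial m (b.repr (P.coeff m) i)
  have hQ : ∀ i, ∀ h ∈ G.pts, evalGL (Q i) h = 0 := by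
    intro i h hh
    have h1 := congrArg (fun a => b.repr a i) (hP h hh)
    rw [MvPolynomial.eval_eq] at h1
    simp only [map_sum, map_zero, Finsupp.coe_zero, Pi.zero_apply, Finsupp.finsetSum_apply] at h1
    rw [← h1]
    simp only [Q, evalGL, map_sum, MvPolynomial.aeval_monomial]
    refine Finset.sum_congr rfl fun m _ => ?_
    have h2 : P.coeff m * ∏ k ∈ m.support, algebraMap ℂ A (coords h k) ^ m k =
        (∏ k ∈ m.support, coords h k ^ m k) • P.coeff m := by
      rw [Algebra.smul_def, mul_comm, map_prod]
      simp
    rw [h2, map_smul, Finsupp.smul_apply, smul_eq_mul, mul_comm]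
    rfl
  let T : Finset (Module.Basis.ofVectorSpaceIndex ℂ A) :=
    P.support.biUnion fun m => (b.repr (P.coeff m)).support
  have hsum : MvPolynomial.eval (coords g) P = ∑ i ∈ T, evalGL (Q i) g * b i := by
    rw [MvPolynomial.eval_eq]
    simp only [Q, evalGL, map_sum, MvPolynomial.aeval_monomial, Finset.sum_mul]
    rw [Finset.sum_comm]
    refine Finset.sum_congr rfl fun m hm => ?_
    have h3 : P.coeff m = ∑ i ∈ T, b.repr (P.coeff m) i • b i := by
      conv_lhs => rw [← b.linearCombination_repr (P.coeff m)]
      rw [Finsupp.linearCombination_apply]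
      exact Finsupp.sum_of_support_subset _
        (Finset.subset_biUnion_of_mem (fun m => (b.repr (P.coeff m)).support) hm) _ (by simp)
    conv_lhs => rw [h3]
    rw [Finset.sum_mul]
    refine Finset.sum_congr rfl fun i _ => ?_
    rw [Algebra.smul_def, Finsupp.prod]
    ring
  rw [hsum]
  exact Finset.sum_eq_zero fun i _ => by rw [hg _ (hQ i), zero_mul]

theorem satisfies_mul {A : Type} [CommRing A] [Algebra ℂ A] {g h : GL (Fin d) A}
    (hg : G.Satisfies g) (hh : G.Satisfies h) : G.Satisfies (g * h) := fun f hf => by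
  let L : GL (Fin d) A → MvPolynomial ((Fin d × Fin d) ⊕ (Fin d × Fin d)) A := fun u =>
    MvPolynomial.aeval (Sum.elim
      (fun ij => ∑ k, MvPolynomial.C (u.val ij.1 k) * MvPolynomial.X (Sum.inl (k, ij.2)))
      (fun ij => ∑ k, MvPolynomial.X (Sum.inr (ij.1, k)) * MvPolynomial.C ((u⁻¹).val k ij.2))) f
  let R : GL (Fin d) A → MvPolynomial ((Fin d × Fin d) ⊕ (Fin d × Fin d)) A := fun v =>
    MvPolynomial.aeval (Sum.elim
      (fun ij => ∑ k, MvPolynomial.X (Sum.inl (ij.1, k)) * MvPolynomial.C (v.val k ij.2))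
      (fun ij => ∑ k, MvPolynomial.C ((v⁻¹).val ij.1 k) * MvPolynomial.X (Sum.inr (k, ij.2)))) f
  have hL : ∀ u v : GL (Fin d) A, MvPolynomial.eval (coords v) (L u) = evalGL f (u * v) := by
    intro u v
    simp only [L, evalGL, MvPolynomial.aeval_def, MvPolynomial.eval₂_eq, map_sum, map_mul,
      map_prod, map_pow]
    refine Finset.sum_congr rfl fun m _ => ?_
    congr 1
    · rw [IsScalarTower.algebraMap_apply ℂ A (MvPolynomial _ A), MvPolynomial.algebraMap_eq,
        MvPolynomial.eval_C]
    · refine Finset.prod_congr rfl fun k _ => ?_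
      rcases k with k | k <;> simp [coords, Matrix.mul_apply]
  have hR : ∀ u v : GL (Fin d) A, MvPolynomial.eval (coords u) (R v) = evalGL f (u * v) := by
    intro u v
    simp only [R, evalGL, MvPolynomial.aeval_def, MvPolynomial.eval₂_eq, map_sum, map_mul,
      map_prod, map_pow]
    refine Finset.sum_congr rfl fun m _ => ?_
    congr 1
    · rw [IsScalarTower.algebraMap_apply ℂ A (MvPolynomial _ A), MvPolynomial.algebraMap_eq,
        MvPolynomial.eval_C]
    · refine Finset.prod_congr rfl fun k _ => ?_
      rcases k with k | k <;> simp [coords, Matrix.mul_apply]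
  let c : GL (Fin d) ℂ →* GL (Fin d) A :=
    Matrix.GeneralLinearGroup.map (Algebra.ofId ℂ A).toRingHom
  have hc : ∀ k : GL (Fin d) ℂ, (fun l => algebraMap ℂ A (coords k l)) = coords (c k) :=
    fun k => funext fun l => (coords_map (Algebra.ofId ℂ A).toRingHom k l).symm
  have h1 : ∀ k ∈ G.pts, evalGL f (g * c k) = 0 := fun k hk => by
    rw [← hR]
    refine G.eval_eq_zero _ (fun l hl => ?_) hg
    rw [hc, hR, ← map_mul, evalGL_map, hf _ (G.pts.mul_mem hl hk), map_zero]
  rw [← hL]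
  refine G.eval_eq_zero _ (fun k hk => ?_) hh
  rw [hc, hL, h1 k hk]

/-- The functor of points of `G`: the subgroup scheme of `GL_d` cut out by all polynomial
equations which hold on the group. -/
def sub : SubgroupPresh (glGrp d) where
  carrier A :=
    { carrier := {g : GL (Fin d) A | G.Satisfies g}
      one_mem' := G.satisfies_one
      mul_mem' := G.satisfies_mul
      inv_mem' := G.satisfies_inv }
  map_mem f _ hg := Satisfies.map G f.hom hg

/-- `G` as a presheaf of groups. -/
def grp : GrpPresh := G.sub.toGrp

/-- The invertible matrix underlying a point of `G`. -/
def mat {A : TestAlg} : G.grp.obj A →* GL (Fin d) A := (G.sub.carrier A).subtype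

end LinearAlgebraicGroup

/-- The map `GL_d(A) → GL_d(B)` induced by `A ⟶ B`. -/
def glMap {d : ℕ} {A B : TestAlg} (f : A ⟶ B) : GL (Fin d) A →* GL (Fin d) B :=
  Matrix.GeneralLinearGroup.map f.hom.toRingHom

/-- The complex numbers as a test algebra. -/
abbrev CC : TestAlg := CommAlgCat.of ℂ ℂ

/-- The structure morphism of a test algebra. -/
def str (A : TestAlg) : CC ⟶ A := CommAlgCat.ofHom (Algebra.ofId ℂ A)

theorem str_comp {A B : TestAlg} (f : A ⟶ B) : str A ≫ f = str B :=
  CommAlgCat.hom_ext (Subsingleton.elim (α := ℂ →ₐ[ℂ] B) _ _)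

/-! ### The parabolic, canonical flats, and geometric parameters -/

section Parameters

variable {d : ℕ}

/-- The Lie algebra of `G`, inside `d × d` matrices: all `X` such that `1 + ε X` is a point of
`G` over the dual numbers. -/
def lieSet (G : LinearAlgebraicGroup d) : Set (Matrix (Fin d) (Fin d) ℂ) :=
  {X | ∃ g : G.grp.obj (CommAlgCat.of ℂ (DualNumber ℂ)),
    (G.mat g).val = 1 + X.map TrivSqZeroExt.inr}

/-- The element `α = exp(2πiλ)`. -/
def alpha (lam : Matrix (Fin d) (Fin d) ℂ) : GL (Fin d) ℂ :=
  (Matrix.isUnit_exp ((2 * Real.pi * Complex.I : ℂ) • lam)).unit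

/-- The element `α` as a point over a test algebra. -/
def alphaAt (lam : Matrix (Fin d) (Fin d) ℂ) (A : TestAlg) : GL (Fin d) A :=
  glMap (str A) (alpha lam)

/-- The matrix `λ` over a test algebra. -/
def lamAt (lam : Matrix (Fin d) (Fin d) ℂ) (A : TestAlg) : Matrix (Fin d) (Fin d) A :=
  lam.map (algebraMap ℂ A)

theorem alphaAt_map (lam : Matrix (Fin d) (Fin d) ℂ) {A B : TestAlg} (f : A ⟶ B) :
    glMap f (alphaAt lam A) = alphaAt lam B := by
  unfold alphaAt
  rw [← str_comp f]
  rfl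

theorem lamAt_map (lam : Matrix (Fin d) (Fin d) ℂ) {A B : TestAlg} (f : A ⟶ B) :
    (lamAt lam A).map f.hom = lamAt lam B := by
  ext i j
  simp [lamAt]

theorem mat_map (G : LinearAlgebraicGroup d) {A B : TestAlg} (f : A ⟶ B) (g : G.grp.obj A) :
    G.mat (G.grp.map f g) = glMap f (G.mat g) := rfl

/-- The centralizer `G(α)` of `α = exp(2πiλ)` in `G`. -/
def centralizer (G : LinearAlgebraicGroup d) (lam : Matrix (Fin d) (Fin d) ℂ) :
    SubgroupPresh G.grp where
  carrier A := (Subgroup.centralizer {alphaAt lam A}).comap G.mat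
  map_mem {A B} f {g} hg := by
    rw [Subgroup.mem_comap, Subgroup.mem_centralizer_singleton_iff] at hg ⊢
    rw [mat_map, ← alphaAt_map lam f, ← map_mul, ← map_mul, hg]

/-- `G(α)` as a presheaf of groups. -/
def cent (G : LinearAlgebraicGroup d) (lam : Matrix (Fin d) (Fin d) ℂ) : GrpPresh :=
  (centralizer G lam).toGrp

/-- The inclusion `G(α) ⊆ G` on points. -/
def centIncl (G : LinearAlgebraicGroup d) (lam : Matrix (Fin d) (Fin d) ℂ) {A : TestAlg} :
    (cent G lam).obj A →* G.grp.obj A :=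
  ((centralizer G lam).carrier A).subtype

/-- The nilpotent Lie algebra `𝔫(λ)`: the sum of the eigenspaces of `ad λ` on the Lie algebra of
`G` for the eigenvalues `1, 2, 3, …`. -/
def nilLie (G : LinearAlgebraicGroup d) (lam : Matrix (Fin d) (Fin d) ℂ) :
    Submodule ℂ (Matrix (Fin d) (Fin d) ℂ) :=
  Submodule.span ℂ {X | X ∈ lieSet G ∧ ∃ k : ℕ, 1 ≤ k ∧ lam * X - X * lam = (k : ℂ) • X}

/-- `𝔫(λ) ⊗ A`, inside `d × d` matrices over `A`. -/
def nilAt (G : LinearAlgebraicGroup d) (lam : Matrix (Fin d) (Fin d) ℂ) (A : TestAlg) :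
    Submodule A (Matrix (Fin d) (Fin d) A) :=
  Submodule.span A ((fun X : Matrix (Fin d) (Fin d) ℂ => X.map (algebraMap ℂ A)) '' (nilLie G lam))

/-- The exponential of a matrix `X` with `X ^ d = 0`. -/
def nilExp {A : TestAlg} (X : Matrix (Fin d) (Fin d) A) : Matrix (Fin d) (Fin d) A :=
  ∑ k ∈ Finset.range d, ((k.factorial : ℂ)⁻¹) • X ^ k

theorem nilExp_map {A B : TestAlg} (f : A ⟶ B) (X : Matrix (Fin d) (Fin d) A) :
    (nilExp X).map f.hom = nilExp (X.map f.hom) := by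
  change f.hom.mapMatrix (nilExp X) = nilExp (f.hom.mapMatrix X)
  simp [nilExp, map_sum, map_smul, map_pow]

theorem nilAt_map (G : LinearAlgebraicGroup d) (lam : Matrix (Fin d) (Fin d) ℂ)
    {A B : TestAlg} (f : A ⟶ B) {X : Matrix (Fin d) (Fin d) A} (hX : X ∈ nilAt G lam A) :
    X.map f.hom ∈ nilAt G lam B := by
  change f.hom.mapMatrix X ∈ nilAt G lam B
  unfold nilAt at hX
  induction hX using Submodule.span_induction with
  | mem X h =>
    obtain ⟨Y, hY, rfl⟩ := h
    refine Submodule.subset_span ⟨Y, hY, ?_⟩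
    ext i j
    simp
  | zero => rw [map_zero]; exact Submodule.zero_mem _
  | add X Y _ _ hX hY => rw [map_add]; exact Submodule.add_mem _ hX hY
  | smul r X _ hX =>
    have h : f.hom.mapMatrix (r • X) = f.hom r • f.hom.mapMatrix X := by
      ext i j
      simp
    rw [h]
    exact Submodule.smul_mem _ _ hX

/-- The parabolic subgroup `P(λ) = L(λ) N(λ)` of `G(α)`, generated by the centralizer `L(λ)` of
`λ` and by the unipotent subgroup `N(λ) = exp 𝔫(λ)`. -/
def parabolic (G : LinearAlgebraicGroup d) (lam : Matrix (Fin d) (Fin d) ℂ) :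
    SubgroupPresh (cent G lam) where
  carrier A := Subgroup.closure
    ({h | (G.mat (centIncl G lam h)).val * lamAt lam A =
        lamAt lam A * (G.mat (centIncl G lam h)).val} ∪
      {h | ∃ X ∈ nilAt G lam A, (G.mat (centIncl G lam h)).val = nilExp X})
  map_mem {A B} f {g} hg := by
    refine (Subgroup.closure_le (K := (Subgroup.closure _).comap ((cent G lam).map f).hom)).2
      ?_ hg
    rintro h (hh | ⟨X, hX, hh⟩)
    · refine Subgroup.subset_closure (Or.inl ?_)
      change f.hom.mapMatrix (G.mat (centIncl G lam h)).val * lamAt lam B =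
        lamAt lam B * f.hom.mapMatrix (G.mat (centIncl G lam h)).val
      rw [← lamAt_map lam f]
      change _ * f.hom.mapMatrix _ = f.hom.mapMatrix _ * _
      rw [← map_mul, ← map_mul]
      exact congrArg _ hh
    · refine Subgroup.subset_closure (Or.inr ⟨X.map f.hom, nilAt_map G lam f hX, ?_⟩)
      rw [← nilExp_map, ← hh]
      rfl

/-- The elements `σ` of `G(ℂ)` with `σ η(σ) = α`. -/
abbrev TwistedPts (G : LinearAlgebraicGroup d) (η : G.grp ⟶ G.grp)
    (lam : Matrix (Fin d) (Fin d) ℂ) : Type :=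
  {σ : G.grp.obj CC // G.mat (σ * η.app CC σ) = alpha lam}

/-- Conjugacy of such elements under `G(α)`, acting by `h • σ = h σ η(h)⁻¹`. -/
def twistedSetoid (G : LinearAlgebraicGroup d) (η : G.grp ⟶ G.grp)
    (lam : Matrix (Fin d) (Fin d) ℂ) : Setoid (TwistedPts G η lam) where
  r σ σ' := ∃ h : (cent G lam).obj CC,
    σ'.1 = centIncl G lam h * σ.1 * (η.app CC (centIncl G lam h))⁻¹
  iseqv :=
    { refl := fun σ => ⟨1, by simp⟩
      symm := fun {σ σ'} ⟨h, hh⟩ => ⟨h⁻¹, by rw [hh, map_inv, map_inv]; group⟩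
      trans := fun {σ σ' σ''} ⟨h, hh⟩ ⟨k, hk⟩ => ⟨k * h, by
        rw [hk, hh, map_mul, map_mul]; group⟩ }

/-- The set `Σ(η, α)`. -/
def SigmaSet (G : LinearAlgebraicGroup d) (η : G.grp ⟶ G.grp)
    (lam : Matrix (Fin d) (Fin d) ℂ) : Type :=
  Quotient (twistedSetoid G η lam)

/-- The endomorphism `g ↦ σ η(g) σ⁻¹` of `G` attached to a point `σ` of `G(ℂ)`, on points. -/
def innerTwist (G : LinearAlgebraicGroup d) (η : G.grp ⟶ G.grp) (σ : G.grp.obj CC)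
    (A : TestAlg) : G.grp.obj A →* G.grp.obj A :=
  (MulAut.conj (G.grp.map (str A) σ)).toMonoidHom.comp (η.app A).hom

theorem innerTwist_apply (G : LinearAlgebraicGroup d) (η : G.grp ⟶ G.grp) (σ : G.grp.obj CC)
    (A : TestAlg) (g : G.grp.obj A) : innerTwist G η σ A g =
      G.grp.map (str A) σ * η.app A g * (G.grp.map (str A) σ)⁻¹ := rfl

theorem innerTwist_map (G : LinearAlgebraicGroup d) (η : G.grp ⟶ G.grp) (σ : G.grp.obj CC)
    {A B : TestAlg} (f : A ⟶ B) (g : G.grp.obj A) :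
    innerTwist G η σ B (G.grp.map f g) = G.grp.map f (innerTwist G η σ A g) := by
  have h : G.grp.map (str B) σ = G.grp.map f (G.grp.map (str A) σ) := by
    rw [← str_comp f]; simp
  rw [innerTwist_apply, innerTwist_apply, h, nat_grp, map_mul, map_mul, map_inv]

theorem mat_injective (G : LinearAlgebraicGroup d) (A : TestAlg) :
    Function.Injective (G.mat (A := A)) := Subtype.val_injective

/-- The symmetric subgroup `K_σ(α)` of `G(α)`: the fixed points of `g ↦ σ η(g) σ⁻¹`. -/
def symmetricSubgroup (G : LinearAlgebraicGroup d) (η : G.grp ⟶ G.grp)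
    (lam : Matrix (Fin d) (Fin d) ℂ) (σ : TwistedPts G η lam) :
    SubgroupPresh (cent G lam) where
  carrier A := ((innerTwist G η σ.1 A).comp (centIncl G lam)).eqLocus (centIncl G lam)
  map_mem {A B} f {g} hg := by
    change innerTwist G η σ.1 B (G.grp.map f (centIncl G lam g)) =
      G.grp.map f (centIncl G lam g)
    rw [innerTwist_map]
    exact congrArg _ hg

/-- For `σ η(σ) = α`, the point `α` of `G`. -/
theorem mat_twisted (G : LinearAlgebraicGroup d) (η : G.grp ⟶ G.grp)
    (lam : Matrix (Fin d) (Fin d) ℂ) (σ : TwistedPts G η lam) (A : TestAlg) :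
    G.mat (G.grp.map (str A) σ.1 * η.app A (G.grp.map (str A) σ.1)) = alphaAt lam A := by
  rw [nat_grp, ← map_mul, mat_map, σ.2]
  rfl

theorem innerTwist_sq (G : LinearAlgebraicGroup d) {η : G.grp ⟶ G.grp} (hη : η ≫ η = 𝟙 _)
    (lam : Matrix (Fin d) (Fin d) ℂ) (σ : TwistedPts G η lam) {A : TestAlg}
    (g : (cent G lam).obj A) :
    innerTwist G η σ.1 A (innerTwist G η σ.1 A (centIncl G lam g)) = centIncl G lam g := by
  have h1 : ∀ s t x : G.grp.obj A, s * (t * x * t⁻¹) * s⁻¹ = s * t * x * (s * t)⁻¹ := by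
    intros; group
  rw [innerTwist_apply, innerTwist_apply, map_mul, map_mul, map_inv, invol_grp hη, h1]
  apply mat_injective
  rw [map_mul, map_mul, map_inv, mat_twisted]
  have h2 := Subgroup.mem_centralizer_singleton_iff.1 (show G.mat (centIncl G lam g) ∈ _ from g.2)
  rw [← h2, mul_inv_cancel_right]

theorem innerTwist_mem (G : LinearAlgebraicGroup d) {η : G.grp ⟶ G.grp} (hη : η ≫ η = 𝟙 _)
    (lam : Matrix (Fin d) (Fin d) ℂ) (σ : TwistedPts G η lam) {A : TestAlg}
    (g : (cent G lam).obj A) :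
    innerTwist G η σ.1 A (centIncl G lam g) ∈ (centralizer G lam).carrier A := by
  refine Subgroup.mem_centralizer_singleton_iff.2 ?_
  set s := G.grp.map (str A) σ.1 with hs
  have ha : innerTwist G η σ.1 A (s * η.app A s) = s * η.app A s := by
    rw [innerTwist_apply, ← hs, map_mul, invol_grp hη]
    group
  have hg : centIncl G lam g * (s * η.app A s) = s * η.app A s * centIncl G lam g := by
    apply mat_injective
    rw [map_mul G.mat _ (s * η.app A s), map_mul G.mat (s * η.app A s), hs, mat_twisted]
    exact Subgroup.mem_centralizer_singleton_iff.1 (show G.mat (centIncl G lam g) ∈ _ from g.2)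
  rw [← mat_twisted G η lam σ A, ← map_mul, ← map_mul, ← hs]
  have h := congrArg (innerTwist G η σ.1 A) hg
  rw [map_mul _ _ (s * η.app A s), map_mul _ (s * η.app A s), ha] at h
  rw [h]

/-- For `σ η(σ) = α`, the involution `g ↦ σ η(g) σ⁻¹` of `G(α)`. -/
def twistedInvolution (G : LinearAlgebraicGroup d) {η : G.grp ⟶ G.grp} (hη : η ≫ η = 𝟙 _)
    (lam : Matrix (Fin d) (Fin d) ℂ) (σ : TwistedPts G η lam) : cent G lam ⟶ cent G lam where
  app A := GrpCat.ofHom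
    (((innerTwist G η σ.1 A).comp (centIncl G lam)).codRestrict ((centralizer G lam).carrier A)
      (innerTwist_mem G hη lam σ))
  naturality _ _ f := GrpCat.ext fun g => Subtype.ext
    (innerTwist_map G η σ.1 f (centIncl G lam g))

theorem twistedInvolution_sq (G : LinearAlgebraicGroup d) {η : G.grp ⟶ G.grp}
    (hη : η ≫ η = 𝟙 _) (lam : Matrix (Fin d) (Fin d) ℂ) (σ : TwistedPts G η lam) :
    twistedInvolution G hη lam σ ≫ twistedInvolution G hη lam σ = 𝟙 (cent G lam) :=
  NatTrans.ext (funext fun _ => GrpCat.ext fun g => Subtype.ext (innerTwist_sq G hη lam σ g))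

/-- Base change of an affine subspace of the space of matrices along `A ⟶ B`. -/
def baseChange {A B : TestAlg} (f : A ⟶ B) (F : AffineSubspace A (Matrix (Fin d) (Fin d) A)) :
    AffineSubspace B (Matrix (Fin d) (Fin d) B) :=
  affineSpan B ((fun X : Matrix (Fin d) (Fin d) A => X.map f.hom) '' F)

theorem baseChange_id {A : TestAlg} (F : AffineSubspace A (Matrix (Fin d) (Fin d) A)) :
    baseChange (𝟙 A) F = F := by
  unfold baseChange
  have h : (fun X : Matrix (Fin d) (Fin d) A => X.map (𝟙 A : A ⟶ A).hom) = id := by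
    ext X i j; simp
  rw [h, Set.image_id, AffineSubspace.affineSpan_coe]

theorem map_mem_baseChange {A B : TestAlg} (f : A ⟶ B)
    (s : Set (Matrix (Fin d) (Fin d) A)) {X : Matrix (Fin d) (Fin d) A}
    (hX : X ∈ affineSpan A s) :
    X.map f.hom ∈ affineSpan B ((fun X : Matrix (Fin d) (Fin d) A => X.map f.hom) '' s) := by
  refine affineSpan_induction (p := fun X : Matrix (Fin d) (Fin d) A => X.map f.hom ∈
    affineSpan B ((fun X : Matrix (Fin d) (Fin d) A => X.map f.hom) '' s)) hX
    (fun X h => subset_affineSpan _ _ ⟨X, h, rfl⟩) ?_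
  intro c u v w hu hv hw
  have h : (c • (u -ᵥ v) +ᵥ w).map f.hom =
      f.hom c • (u.map f.hom -ᵥ v.map f.hom) +ᵥ w.map f.hom := by
    ext i j
    simp
  rw [h]
  exact AffineSubspace.smul_vsub_vadd_mem _ _ hu hv hw

theorem baseChange_span {A B : TestAlg} (f : A ⟶ B) (s : Set (Matrix (Fin d) (Fin d) A)) :
    baseChange f (affineSpan A s) =
      affineSpan B ((fun X : Matrix (Fin d) (Fin d) A => X.map f.hom) '' s) := by
  refine le_antisymm (affineSpan_le.2 ?_)
    (affineSpan_mono B (Set.image_mono (subset_affineSpan A s)))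
  rintro _ ⟨X, hX, rfl⟩
  exact map_mem_baseChange f s hX

theorem baseChange_comp {A B C : TestAlg} (f : A ⟶ B) (g : B ⟶ C)
    (F : AffineSubspace A (Matrix (Fin d) (Fin d) A)) :
    baseChange (f ≫ g) F = baseChange g (baseChange f F) := by
  conv_rhs => rw [baseChange.eq_def f F, baseChange_span, Set.image_image]
  rfl

/-- The linear automorphism `X ↦ g X g⁻¹` of the space of matrices. -/
def conjLin {A : Type} [CommRing A] (g : GL (Fin d) A) :
    Matrix (Fin d) (Fin d) A →ₗ[A] Matrix (Fin d) (Fin d) A :=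
  (LinearMap.mulLeft A g.val).comp (LinearMap.mulRight A (g⁻¹).val)

/-- The image `Ad(g) F = g F g⁻¹` of an affine subspace of the space of matrices. -/
def adFlat {A : Type} [CommRing A] (g : GL (Fin d) A)
    (F : AffineSubspace A (Matrix (Fin d) (Fin d) A)) :
    AffineSubspace A (Matrix (Fin d) (Fin d) A) :=
  F.map (conjLin g).toAffineMap

theorem adFlat_one {A : Type} [CommRing A]
    (F : AffineSubspace A (Matrix (Fin d) (Fin d) A)) : adFlat 1 F = F := by
  have h : (conjLin (1 : GL (Fin d) A)).toAffineMap = AffineMap.id A _ := by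
    ext X : 1
    simp [conjLin]
  rw [adFlat, h, AffineSubspace.map_id]

theorem adFlat_mul {A : Type} [CommRing A] (g h : GL (Fin d) A)
    (F : AffineSubspace A (Matrix (Fin d) (Fin d) A)) :
    adFlat (g * h) F = adFlat g (adFlat h F) := by
  rw [adFlat, adFlat, adFlat, AffineSubspace.map_map]
  congr 1
  ext X : 1
  simp [conjLin, mul_assoc]

theorem baseChange_adFlat {A B : TestAlg} (f : A ⟶ B) (g : GL (Fin d) A)
    (F : AffineSubspace A (Matrix (Fin d) (Fin d) A)) :
    baseChange f (adFlat g F) = adFlat (glMap f g) (baseChange f F) := by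
  unfold baseChange adFlat
  rw [AffineSubspace.map_span, AffineSubspace.coe_map, Set.image_image, Set.image_image]
  congr 2
  ext X : 1
  change f.hom.mapMatrix (g.val * (X * (g⁻¹).val)) =
    (glMap f g).val * (f.hom.mapMatrix X * ((glMap f g)⁻¹).val)
  rw [map_mul, map_mul, ← map_inv]
  rfl

/-- The canonical flat `F(λ) = λ + 𝔫(λ)` over a test algebra. -/
def flatAt (G : LinearAlgebraicGroup d) (lam : Matrix (Fin d) (Fin d) ℂ) (A : TestAlg) :
    AffineSubspace A (Matrix (Fin d) (Fin d) A) :=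
  AffineSubspace.mk' (lamAt lam A) (nilAt G lam A)

/-- `F` is an `A`-point of the variety `F(𝕆)` of canonical flats in the orbit `𝕆 = Ad(G) λ`, and
`c = e(F)`. Here `F(𝕆) = G/P(λ)` is the
`G`-orbit of `F(λ)`, so that fppf locally `F = Ad(g) F(λ)` for a point `g` of `G`, and
`e = exp(2πi ·) : F(𝕆) → G` is the equivariant map with `e(F(λ)) = α`, so that
`e(F) = g α g⁻¹`. -/
def IsFlatWithExp (G : LinearAlgebraicGroup d) (lam : Matrix (Fin d) (Fin d) ℂ) (A : TestAlg)
    (F : AffineSubspace A (Matrix (Fin d) (Fin d) A)) (c : GL (Fin d) A) : Prop :=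
  FppfLocally A fun B f => ∃ g : G.grp.obj B,
    baseChange f F = adFlat (G.mat g) (flatAt G lam B) ∧
      glMap f c = G.mat g * alphaAt lam B * (G.mat g)⁻¹

theorem mem_flatAt (G : LinearAlgebraicGroup d) (lam : Matrix (Fin d) (Fin d) ℂ) (A : TestAlg)
    (X : Matrix (Fin d) (Fin d) A) :
    X ∈ flatAt G lam A ↔ X - lamAt lam A ∈ nilAt G lam A :=
  AffineSubspace.mem_mk'

theorem baseChange_flatAt (G : LinearAlgebraicGroup d) (lam : Matrix (Fin d) (Fin d) ℂ)
    {A B : TestAlg} (f : A ⟶ B) : baseChange f (flatAt G lam A) = flatAt G lam B := by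
  have h0 : lamAt lam B ∈ baseChange f (flatAt G lam A) :=
    subset_affineSpan _ _ ⟨lamAt lam A, AffineSubspace.self_mem_mk' _ _, lamAt_map lam f⟩
  refine le_antisymm (affineSpan_le.2 ?_) fun X hX => ?_
  · rintro _ ⟨X, hX, rfl⟩
    have h := nilAt_map G lam f ((mem_flatAt G lam A X).1 hX)
    refine (mem_flatAt G lam B _).2 ?_
    have h2 : (X - lamAt lam A).map f.hom = X.map f.hom - lamAt lam B := by
      rw [← lamAt_map lam f]
      ext i j
      simp
    exact h2 ▸ h
  · have hle : nilAt G lam B ≤ (baseChange f (flatAt G lam A)).direction := by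
      refine Submodule.span_le.2 ?_
      rintro _ ⟨Y, hY, rfl⟩
      have h1 : Y.map (algebraMap ℂ A) + lamAt lam A ∈ flatAt G lam A := by
        rw [mem_flatAt, add_sub_cancel_right]
        exact Submodule.subset_span ⟨Y, hY, rfl⟩
      have h2 : (Y.map (algebraMap ℂ A) + lamAt lam A).map f.hom ∈
          baseChange f (flatAt G lam A) := subset_affineSpan _ _ ⟨_, h1, rfl⟩
      have h3 := AffineSubspace.vsub_mem_direction h2 h0
      have h4 : (Y.map (algebraMap ℂ A) + lamAt lam A).map f.hom -ᵥ lamAt lam B =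
          Y.map (algebraMap ℂ B) := by
        rw [← lamAt_map lam f]
        ext i j
        simp
      exact (congrArg (· ∈ (baseChange f (flatAt G lam A)).direction) h4).mp h3
    have h := AffineSubspace.vadd_mem_of_mem_direction (hle ((mem_flatAt G lam B X).1 hX)) h0
    rwa [vadd_eq_add, sub_add_cancel] at h

/-- Fppf coverings are stable under base change. -/
theorem FppfLocally.baseChange {A A' : TestAlg} (h : A ⟶ A')
    {Q : ∀ B : TestAlg, (A ⟶ B) → Prop} {Q' : ∀ B : TestAlg, (A' ⟶ B) → Prop}
    (hQ : ∀ (B B' : TestAlg) (f : A ⟶ B) (f' : A' ⟶ B') (k : B ⟶ B'),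
      f ≫ k = h ≫ f' → Q B f → Q' B' f')
    (H : FppfLocally A Q) : FppfLocally A' Q' := by
  obtain ⟨B, f, ⟨hf1, hf2⟩, hq⟩ := H
  let _ : Algebra A A' := h.hom.toRingHom.toAlgebra
  let _ : Algebra A B := f.hom.toRingHom.toAlgebra
  have : IsScalarTower ℂ A A' := IsScalarTower.of_algebraMap_eq fun c => (h.hom.commutes c).symm
  have : IsScalarTower ℂ A B := IsScalarTower.of_algebraMap_eq fun c => (f.hom.commutes c).symm
  have : Module.FaithfullyFlat A B := hf1
  have : Algebra.FinitePresentation A B := hf2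
  let f' : A' →ₐ[ℂ] TensorProduct A A' B :=
    (Algebra.TensorProduct.includeLeft : A' →ₐ[ℂ] TensorProduct A A' B)
  let k : B →ₐ[ℂ] TensorProduct A A' B :=
    (Algebra.TensorProduct.includeRight : B →ₐ[A] TensorProduct A A' B).restrictScalars ℂ
  refine ⟨CommAlgCat.of ℂ (TensorProduct A A' B), CommAlgCat.ofHom f', ⟨?_, ?_⟩,
    hQ B _ f _ (CommAlgCat.ofHom k) ?_ hq⟩
  · exact (RingHom.faithfullyFlat_algebraMap_iff (R := A') (S := TensorProduct A A' B)).2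
      inferInstance
  · exact (RingHom.finitePresentation_algebraMap (A := A') (B := TensorProduct A A' B)).2
      inferInstance
  · ext a
    change (1 : A') ⊗ₜ[A] (algebraMap A B a) = (algebraMap A A' a) ⊗ₜ[A] (1 : B)
    rw [Algebra.algebraMap_eq_smul_one, Algebra.algebraMap_eq_smul_one, TensorProduct.tmul_smul,
      TensorProduct.smul_tmul']

theorem IsFlatWithExp.map {G : LinearAlgebraicGroup d} {lam : Matrix (Fin d) (Fin d) ℂ}
    {A B : TestAlg} (h : A ⟶ B) {F : AffineSubspace A (Matrix (Fin d) (Fin d) A)}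
    {c : GL (Fin d) A} (H : IsFlatWithExp G lam A F c) :
    IsFlatWithExp G lam B (baseChange h F) (glMap h c) := by
  refine FppfLocally.baseChange h ?_ H
  rintro C C' f f' k hk ⟨g, hF, hc⟩
  refine ⟨G.grp.map k g, ?_, ?_⟩
  · rw [← baseChange_comp, ← hk, baseChange_comp, hF, baseChange_adFlat, baseChange_flatAt]
    rfl
  · have h1 : glMap f' (glMap h c) = glMap k (glMap f c) := by
      change glMap (h ≫ f') c = glMap (f ≫ k) c
      rw [hk]
    rw [h1, hc, map_mul, map_mul, map_inv, alphaAt_map, mat_map]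

theorem IsFlatWithExp.conj {G : LinearAlgebraicGroup d} {lam : Matrix (Fin d) (Fin d) ℂ}
    {A : TestAlg} {F : AffineSubspace A (Matrix (Fin d) (Fin d) A)}
    {c : GL (Fin d) A} (k : G.grp.obj A) (H : IsFlatWithExp G lam A F c) :
    IsFlatWithExp G lam A (adFlat (G.mat k) F) (G.mat k * c * (G.mat k)⁻¹) := by
  obtain ⟨B, f, hf, g, hF, hc⟩ := H
  refine ⟨B, f, hf, G.grp.map f k * g, ?_, ?_⟩
  · rw [baseChange_adFlat, hF, map_mul, adFlat_mul, mat_map]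
  · rw [map_mul, map_mul, map_inv, hc, map_mul, mat_map]
    group

/-! ### The L-group and the stack of geometric parameters -/

/-- The Galois group `Γ = Gal(ℂ/ℝ)`, a group of order two. -/
abbrev Gal2 : Type := Multiplicative (ZMod 2)

/-- The action of `Γ` on the points of `G`, the nontrivial element acting by `η`. -/
def galAct (G : LinearAlgebraicGroup d) {η : G.grp ⟶ G.grp} (hη : η ≫ η = 𝟙 _) (A : TestAlg) :
    Gal2 →* MulAut (G.grp.obj A) where
  toFun c := if c = 1 then 1 else
    { (η.app A).hom with
      invFun := η.app A
      left_inv := fun g => invol_grp hη g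
      right_inv := fun g => invol_grp hη g }
  map_one' := if_pos rfl
  map_mul' c c' := by
    have h : ∀ c : Gal2, c = 1 ∨ c = Multiplicative.ofAdd 1 := by decide
    have h1 : (Multiplicative.ofAdd 1 : Gal2) ≠ 1 := by decide
    have h2 : (Multiplicative.ofAdd 1 : Gal2) * Multiplicative.ofAdd 1 = 1 := by decide
    rcases h c with rfl | rfl <;> rcases h c' with rfl | rfl
    · simp
    · simp
    · simp
    · rw [h2, if_pos rfl, if_neg h1]
      ext g
      exact (invol_grp hη g).symm

/-- The points of the L-group `G^L = G ⋊ Γ` whose component in `Γ` is constant. -/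
abbrev LGroup (G : LinearAlgebraicGroup d) {η : G.grp ⟶ G.grp} (hη : η ≫ η = 𝟙 _)
    (A : TestAlg) : Type :=
  SemidirectProduct (G.grp.obj A) Gal2 (galAct G hη A)

/-- The geometric parameters over `Spec A`: pairs `(y, F)` of a point `y` of `G^L - G` and a
canonical flat `F ∈ F(𝕆)` with `y² = e(F)`. -/
def ParamSet (G : LinearAlgebraicGroup d) {η : G.grp ⟶ G.grp} (hη : η ≫ η = 𝟙 _)
    (lam : Matrix (Fin d) (Fin d) ℂ) (A : TestAlg) : Type :=
  {x : LGroup G hη A × AffineSubspace A (Matrix (Fin d) (Fin d) A) //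
    x.1.right ≠ 1 ∧ IsFlatWithExp G lam A x.2 (G.mat (x.1 * x.1).left)}

section ParamStack

variable (G : LinearAlgebraicGroup d) {η : G.grp ⟶ G.grp} (hη : η ≫ η = 𝟙 _)
  (lam : Matrix (Fin d) (Fin d) ℂ)

theorem left_sq {A : TestAlg} (y : LGroup G hη A) (hy : y.right ≠ 1) :
    (y * y).left = y.left * η.app A y.left := by
  rw [SemidirectProduct.mul_left]
  congr 1
  change (if y.right = 1 then _ else _ : MulAut (G.grp.obj A)) y.left = _
  rw [if_neg hy]
  rfl

/-- The map `G^L(A) → G^L(B)` induced by `A ⟶ B`. -/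
def lMap {A B : TestAlg} (f : A ⟶ B) (y : LGroup G hη A) : LGroup G hη B :=
  ⟨G.grp.map f y.left, y.right⟩

/-- The presheaf `X(𝕆, G^L)` of geometric parameters. -/
def paramPresh : Presh where
  obj A := ParamSet G hη lam A
  map {A B} f := TypeCat.ofHom (X := ParamSet G hη lam A) (Y := ParamSet G hη lam B) fun x =>
    ⟨(lMap G hη f x.1.1, baseChange f x.1.2), x.2.1, by
      have h := x.2.2.map f
      rw [← mat_map, left_sq G hη _ x.2.1, map_mul, ← nat_grp] at h
      rw [left_sq G hη (lMap G hη f x.1.1) x.2.1]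
      exact h⟩
  map_id A := by
    ext x
    refine Subtype.ext (Prod.ext (SemidirectProduct.ext ?_ rfl) (baseChange_id _))
    change G.grp.map (𝟙 A) _ = _
    simp
  map_comp f g := by
    ext x
    refine Subtype.ext (Prod.ext (SemidirectProduct.ext ?_ rfl) (baseChange_comp f g _))
    change G.grp.map (f ≫ g) _ = G.grp.map g (G.grp.map f _)
    simp

/-- Conjugation of a point of `G^L` by a point of `G`. -/
def lConj {A : TestAlg} (k : G.grp.obj A) (y : LGroup G hη A) : LGroup G hη A :=
  SemidirectProduct.inl k * y * (SemidirectProduct.inl k)⁻¹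

theorem lConj_right {A : TestAlg} (k : G.grp.obj A) (y : LGroup G hη A) :
    (lConj G hη k y).right = y.right := by
  simp [lConj]

theorem lConj_left {A : TestAlg} (k : G.grp.obj A) (y : LGroup G hη A) (hy : y.right ≠ 1) :
    (lConj G hη k y).left = k * y.left * (η.app A k)⁻¹ := by
  unfold lConj
  rw [← map_inv, SemidirectProduct.mul_left, SemidirectProduct.mul_left,
    SemidirectProduct.mul_right, SemidirectProduct.right_inl, SemidirectProduct.left_inl,
    SemidirectProduct.left_inl, map_one, one_mul, MulAut.one_apply]
  congr 1
  change (if y.right = 1 then _ else _ : MulAut (G.grp.obj A)) k⁻¹ = _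
  rw [if_neg hy]
  exact map_inv (η.app A).hom k

/-- The action of `G` on geometric parameters by conjugation. -/
def paramAction : GrpAction G.grp (paramPresh G hη lam) where
  act {A} k x :=
    (⟨(lConj G hη k x.1.1, adFlat (G.mat k) x.1.2),
      by rw [lConj_right]; exact x.2.1, by
        have h := x.2.2.conj k
        have hr : (lConj G hη k x.1.1).right ≠ 1 := by rw [lConj_right]; exact x.2.1
        rw [left_sq G hη _ x.2.1, ← map_inv, ← map_mul, ← map_mul] at h
        have e : ∀ l : G.grp.obj A, k * l * (η.app A k)⁻¹ * η.app A (k * l * (η.app A k)⁻¹) =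
            k * (l * η.app A l) * k⁻¹ := fun l => by
          rw [map_mul, map_mul, map_inv, invol_grp hη]
          group
        rw [left_sq G hη _ hr, lConj_left G hη k _ x.2.1, e]
        exact h⟩ : ParamSet G hη lam A)
  one_act {A} x := Subtype.ext (Prod.ext
    (show lConj G hη 1 x.1.1 = x.1.1 by simp [lConj])
    (show adFlat (G.mat 1) x.1.2 = x.1.2 by rw [map_one, adFlat_one]))
  mul_act {A} g h x := Subtype.ext (Prod.ext
    (show lConj G hη (g * h) x.1.1 = lConj G hη g (lConj G hη h x.1.1) by
      simp [lConj, mul_assoc])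
    (show adFlat (G.mat (g * h)) x.1.2 = adFlat (G.mat g) (adFlat (G.mat h) x.1.2) by
      rw [map_mul, adFlat_mul]))
  map_act {A B} f g x := Subtype.ext (Prod.ext
    (show lMap G hη f (lConj G hη g x.1.1) = lConj G hη (G.grp.map f g) (lMap G hη f x.1.1) from
      SemidirectProduct.ext
        (by
          rw [lConj_left G hη _ (lMap G hη f x.1.1) x.2.1]
          change G.grp.map f (lConj G hη g x.1.1).left = _
          rw [lConj_left G hη _ _ x.2.1, map_mul, map_mul, map_inv, nat_grp]
          rfl)
        (by
          rw [lConj_right]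
          exact lConj_right G hη g x.1.1))
    (baseChange_adFlat f (G.mat g) x.1.2))

end ParamStack

end Parameters

end ABV

end

open ABV

/-!
A quotient stack is analysed through charts (`Charts`): families of groups `Q i → 𝔾` acting on
presheaves `Y i`, with equivariant maps `Y i → X` such that locally every point of `X` is
`𝔾`-conjugate to a point of some `Y i`, such that `𝔾`-conjugacies between points of one `Y i` come
from unique elements of `Q i`, and such that points of different `Y i` are nowhere conjugate. If
`X`, `𝔾` and the `Y i` are fppf sheaves, the quotient stack `X/𝔾` is then the disjoint union of the
stacks `Y i/Q i` (`Charts.stackEquiv`): a torsor over `A` splits `A` by idempotents into pieces, one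
for each chart, and over its piece the points of the chart form a `Q i`-torsor. Conversely a
`Q i`-torsor over `Y i` induces a `𝔾`-torsor over `X`; it is glued from local data by
`DescentData.glued`.

By definition `e(Ad(g) F(λ)) = g α g⁻¹`, so that locally every geometric parameter is conjugate to
some `(s γ, F(λ))` with `s η(s) = α` (`cov_stdParam`), and the elements conjugating such parameters
to each other fix `F(λ)`, hence centralize `α`. These are the elements of `Ǧ(α)` which map `λ` into
`λ + 𝔫(λ)`. They form the parabolic `P(λ)`: the degrees of `Ad(h) λ - λ` with respect to `ad λ` are
cleared one after the other by exponentials of elements of `𝔫(λ)`, until an element of `L(λ)` is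
left (`mem_parabolic_iff`).

For the first equivalence one needs that the solutions of `s η(s) = α` are, locally, twisted
conjugates of the chosen complex points `σ`. If `t = s σ⁻¹` has a square root `u` in `Ǧ` with
`ι_σ(u) = u⁻¹`, then `u` lies in `Ǧ(α)` and `s = u σ η(u)⁻¹` (`exists_cent_of_sqrt`). Where `s`
specializes to `σ` at a complex point, such a root exists on an étale neighbourhood: the scheme of
square roots of an invertible matrix is smooth at the root `1` (`exists_universal_sqrt`), and the
root through `1` lies in the group near the point. Indeed an equation of the group that holds at all
powers of `t = u²` holds at `u` as soon as `u` is unipotent modulo powers of the maximal ideal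
(`satisfies_of_mul_self`), and Krull's intersection theorem carries this over to a neighbourhood
(`exists_satisfies_away`). The root is unique near the point (`exists_mul_sub_eq_zero`), and
`ι_σ(u)⁻¹` is another one, so that `ι_σ(u) = u⁻¹`. As every closed point of a scheme of finite type
is a complex point, these neighbourhoods cover (`cov_twisted_conj`). By the Nullstellensatz, complex
points of different classes are not conjugate over any nonzero algebra
(`twisted_conj_of_nontrivial`). The charts `sigmaCharts` are thus the actions of `K_σ(α) × P(λ)` on
`Ǧ(α)`, where `h` stands for the parameter of `h⁻¹ σ η(h)`.

For the second equivalence one fixes `σ` and writes `s = t σ`, which turns `s η(s) = α` into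
`t ι_σ(t) = 1` with `t` in `Ǧ(α)`. So there is a single chart (`antiFixedChart`), on which `P(λ)`
acts by `p · t = p t ι_σ(p)⁻¹`. On the other side, an object of the homotopy fixed stack of
`P\Ǧ(α)/P'` is a `P × P'`-torsor with an involution that exchanges the two groups. The fixed points
of the involution form a `P`-torsor which maps to the solutions of `t ι_σ(t) = 1`, and this is an
equivalence for every involution of a group and every subgroup `P` whose image `P'` is a sheaf
(`stackEquiv_homotopyFixed`).

Both arguments use that the presheaves involved are fppf sheaves. For the flats and the subgroups
this is faithfully flat descent of submodules and of elements (`isFppfSheaf_paramPresh`,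
`isFppfSheaf_comap_parabolic`).
-/

noncomputable section

namespace ABV

/-! ### Coverings and gluing -/

/-- Pushouts of `ℂ`-algebras. -/
theorem exists_pushout {A B C : TestAlg} (f : A ⟶ B) (hf : IsFppf f) (h : A ⟶ C) :
    ∃ (D : TestAlg) (g : C ⟶ D) (k : B ⟶ D), IsFppf g ∧ f ≫ k = h ≫ g := by
  obtain ⟨D, g, hg, k, hk⟩ := FppfLocally.baseChange (A := A) (A' := C) h
    (Q := fun B' f' => ∃ e : B ⟶ B', f ≫ e = f') (Q' := fun D g => ∃ k : B ⟶ D, f ≫ k = h ≫ g)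
    (fun B' D f' g k hk ⟨e, he⟩ => ⟨e ≫ k, by rw [← hk, ← he, Category.assoc]⟩)
    ⟨B, f, hf, 𝟙 B, Category.comp_id f⟩
  exact ⟨D, g, k, hg, hk⟩

theorem exists_split_pushout {A A₁ A₂ C : TestAlg} (p₁ : A ⟶ A₁) (p₂ : A ⟶ A₂)
    (hp : Function.Bijective fun a : A => (p₁.hom a, p₂.hom a)) (h : A ⟶ C) :
    ∃ (C₁ C₂ : TestAlg) (q₁ : C ⟶ C₁) (q₂ : C ⟶ C₂) (k₁ : A₁ ⟶ C₁) (k₂ : A₂ ⟶ C₂),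
      (Function.Bijective fun c : C => (q₁.hom c, q₂.hom c)) ∧
        p₁ ≫ k₁ = h ≫ q₁ ∧ p₂ ≫ k₂ = h ≫ q₂ := by
  let _ : Algebra A A₁ := p₁.hom.toRingHom.toAlgebra
  let _ : Algebra A A₂ := p₂.hom.toRingHom.toAlgebra
  let _ : Algebra A C := h.hom.toRingHom.toAlgebra
  have : IsScalarTower ℂ A C := IsScalarTower.of_algebraMap_eq fun c => (h.hom.commutes c).symm
  have : IsScalarTower ℂ A A₁ := IsScalarTower.of_algebraMap_eq fun c => (p₁.hom.commutes c).symm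
  have : IsScalarTower ℂ A A₂ := IsScalarTower.of_algebraMap_eq fun c => (p₂.hom.commutes c).symm
  let e : A ≃ₗ[A] A₁ × A₂ := LinearEquiv.ofBijective
    ((Algebra.linearMap A A₁).prod (Algebra.linearMap A A₂)) hp
  let E : C ≃ₗ[A] TensorProduct A C A₁ × TensorProduct A C A₂ :=
    (TensorProduct.rid A C).symm ≪≫ₗ LinearEquiv.lTensor C e ≪≫ₗ
      TensorProduct.prodRight A A C A₁ A₂
  refine ⟨CommAlgCat.of ℂ (TensorProduct A C A₁), CommAlgCat.of ℂ (TensorProduct A C A₂),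
    CommAlgCat.ofHom Algebra.TensorProduct.includeLeft,
    CommAlgCat.ofHom Algebra.TensorProduct.includeLeft,
    CommAlgCat.ofHom ((Algebra.TensorProduct.includeRight :
      A₁ →ₐ[A] TensorProduct A C A₁).restrictScalars ℂ),
    CommAlgCat.ofHom ((Algebra.TensorProduct.includeRight :
      A₂ →ₐ[A] TensorProduct A C A₂).restrictScalars ℂ), ?_, ?_, ?_⟩
  · have : (fun c : C => ((c ⊗ₜ[A] (1 : A₁) : TensorProduct A C A₁),
        (c ⊗ₜ[A] (1 : A₂) : TensorProduct A C A₂))) = E := by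
      funext c
      have he : e 1 = (1, 1) := Prod.ext (map_one p₁.hom) (map_one p₂.hom)
      simp [E, he]
    exact this ▸ E.bijective
  · ext a
    change (1 : C) ⊗ₜ[A] (algebraMap A A₁ a) = (algebraMap A C a) ⊗ₜ[A] (1 : A₁)
    rw [Algebra.algebraMap_eq_smul_one, Algebra.algebraMap_eq_smul_one, TensorProduct.tmul_smul,
      TensorProduct.smul_tmul']
  · ext a
    change (1 : C) ⊗ₜ[A] (algebraMap A A₂ a) = (algebraMap A C a) ⊗ₜ[A] (1 : A₂)
    rw [Algebra.algebraMap_eq_smul_one, Algebra.algebraMap_eq_smul_one, TensorProduct.tmul_smul,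
      TensorProduct.smul_tmul']

/-- `Cov A W` says that `W` holds locally on `Spec A` for the Grothendieck topology generated by
fppf coverings and finite disjoint unions: `Spec A` is reached from test schemes over which `W`
holds, and keeps holding after every further base change, in finitely many steps, each of which is
the empty covering of the empty scheme, a decomposition into two open and closed pieces, or an
fppf covering. -/
inductive Cov : (A : TestAlg) → (∀ B : TestAlg, (A ⟶ B) → Prop) → Prop
  | base {A : TestAlg} {W : ∀ B : TestAlg, (A ⟶ B) → Prop} (h : ∀ B f, W B f) : Cov A W
  | zero {A : TestAlg} {W : ∀ B : TestAlg, (A ⟶ B) → Prop} (h : Subsingleton A) : Cov A W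
  | split {A A₁ A₂ : TestAlg} {W : ∀ B : TestAlg, (A ⟶ B) → Prop} (p₁ : A ⟶ A₁) (p₂ : A ⟶ A₂)
      (hp : Function.Bijective fun a : A => (p₁.hom a, p₂.hom a))
      (h₁ : Cov A₁ fun B f => W B (p₁ ≫ f)) (h₂ : Cov A₂ fun B f => W B (p₂ ≫ f)) : Cov A W
  | cover {A A' : TestAlg} {W : ∀ B : TestAlg, (A ⟶ B) → Prop} (f : A ⟶ A') (hf : IsFppf f)
      (h : Cov A' fun B g => W B (f ≫ g)) : Cov A W

theorem Cov.mono {A : TestAlg} {W W' : ∀ B : TestAlg, (A ⟶ B) → Prop} (H : Cov A W)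
    (h : ∀ B f, W B f → W' B f) : Cov A W' := by
  induction H with
  | base h' => exact .base fun B f => h B f (h' B f)
  | zero h' => exact .zero h'
  | split p₁ p₂ hp _ _ ih₁ ih₂ =>
    exact .split p₁ p₂ hp (ih₁ fun B f => h B _) (ih₂ fun B f => h B _)
  | cover f hf _ ih => exact .cover f hf (ih fun B g => h B _)

theorem subsingleton_of_hom {A B : TestAlg} (f : A ⟶ B) (h : Subsingleton A) : Subsingleton B :=
  f.hom.toRingHom.codomain_trivial

theorem Cov.pullback {A C : TestAlg} {W : ∀ B : TestAlg, (A ⟶ B) → Prop} (H : Cov A W)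
    (h : A ⟶ C) : Cov C fun B f => W B (h ≫ f) := by
  induction H generalizing C with
  | base h' => exact .base fun B f => h' B _
  | zero h' => exact .zero (subsingleton_of_hom h h')
  | split p₁ p₂ hp _ _ ih₁ ih₂ =>
    obtain ⟨C₁, C₂, q₁, q₂, k₁, k₂, hq, e₁, e₂⟩ := exists_split_pushout p₁ p₂ hp h
    refine .split q₁ q₂ hq ?_ ?_
    · simpa only [← Category.assoc, e₁] using ih₁ k₁
    · simpa only [← Category.assoc, e₂] using ih₂ k₂
  | cover f hf _ ih =>
    obtain ⟨D, g, k, hg, e⟩ := exists_pushout f hf h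
    refine .cover g hg ?_
    simpa only [← Category.assoc, e] using ih k

theorem Cov.trans {A : TestAlg} {W W' : ∀ B : TestAlg, (A ⟶ B) → Prop} (H : Cov A W)
    (h : ∀ B f, W B f → Cov B fun C g => W' C (f ≫ g)) : Cov A W' := by
  induction H with
  | base h' =>
    rename_i A _
    simpa using h A (𝟙 A) (h' _ _)
  | zero h' => exact .zero h'
  | split p₁ p₂ hp _ _ ih₁ ih₂ =>
    refine .split p₁ p₂ hp (ih₁ fun B f hf => ?_) (ih₂ fun B f hf => ?_)
    · simpa using h B _ hf
    · simpa using h B _ hf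
  | cover f hf _ ih =>
    refine .cover f hf (ih fun B g hg => ?_)
    simpa using h B _ hg

/-- Every covering is refined by a finite family of test schemes. -/
theorem Cov.exists_finite {A : TestAlg} {W : ∀ B : TestAlg, (A ⟶ B) → Prop} (H : Cov A W) :
    ∃ (J : Type) (_ : Finite J) (B : J → TestAlg) (k : ∀ j, A ⟶ B j), (∀ j, W _ (k j)) ∧
      Cov A fun C h => ∃ j, ∃ l : B j ⟶ C, h = k j ≫ l := by
  induction H with
  | base h =>
    rename_i A _
    exact ⟨Unit, inferInstance, fun _ => A, fun _ => 𝟙 A, fun _ => h _ _,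
      .base fun B f => ⟨(), f, by simp⟩⟩
  | zero h => exact ⟨Empty, inferInstance, nofun, nofun, nofun, .zero h⟩
  | split p₁ p₂ hp _ _ ih₁ ih₂ =>
    obtain ⟨J₁, _, B₁, k₁, w₁, c₁⟩ := ih₁
    obtain ⟨J₂, _, B₂, k₂, w₂, c₂⟩ := ih₂
    refine ⟨J₁ ⊕ J₂, inferInstance, Sum.elim B₁ B₂,
      fun j => match j with
        | .inl j => p₁ ≫ k₁ j
        | .inr j => p₂ ≫ k₂ j, ?_, ?_⟩
    · rintro (j | j)
      · exact w₁ j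
      · exact w₂ j
    · refine .split p₁ p₂ hp (c₁.mono ?_) (c₂.mono ?_)
      · rintro B _ ⟨j, l, rfl⟩
        exact ⟨.inl j, l, by simp⟩
      · rintro B _ ⟨j, l, rfl⟩
        exact ⟨.inr j, l, by simp⟩
  | cover f hf _ ih =>
    obtain ⟨J, hJ, B, k, w, c⟩ := ih
    refine ⟨J, hJ, B, fun j => f ≫ k j, w, .cover f hf (c.mono ?_)⟩
    rintro C _ ⟨j, l, rfl⟩
    exact ⟨j, l, by simp⟩

theorem FppfLocally.cov {A : TestAlg} {Q : ∀ B : TestAlg, (A ⟶ B) → Prop}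
    (H : FppfLocally A Q) (hQ : ∀ B C (f : A ⟶ B) (g : B ⟶ C), Q B f → Q C (f ≫ g)) :
    Cov A Q := by
  obtain ⟨B, f, hf, h⟩ := H
  exact .cover f hf (.base fun C g => hQ _ _ _ _ h)

theorem map_comp_apply (S : Presh) {A B C : TestAlg} (f : A ⟶ B) (g : B ⟶ C) (x : S.obj A) :
    S.map (f ≫ g) x = S.map g (S.map f x) := by simp

theorem map_id_apply (S : Presh) {A : TestAlg} (x : S.obj A) : S.map (𝟙 A) x = x := by simp

/-- The inverse of a decomposition of `Spec A` into two open and closed pieces. -/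
def splitIso {A A₁ A₂ : TestAlg} (p₁ : A ⟶ A₁) (p₂ : A ⟶ A₂)
    (hp : Function.Bijective fun a : A => (p₁.hom a, p₂.hom a)) :
    A ≅ CommAlgCat.of ℂ (A₁ × A₂) :=
  CommAlgCat.isoMk (AlgEquiv.ofBijective (p₁.hom.prod p₂.hom) hp)

theorem splitIso_fst {A A₁ A₂ : TestAlg} (p₁ : A ⟶ A₁) (p₂ : A ⟶ A₂)
    (hp : Function.Bijective fun a : A => (p₁.hom a, p₂.hom a)) :
    (splitIso p₁ p₂ hp).inv ≫ p₁ = CommAlgCat.ofHom (AlgHom.fst ℂ A₁ A₂) := by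
  rw [Iso.inv_comp_eq]; rfl

theorem splitIso_snd {A A₁ A₂ : TestAlg} (p₁ : A ⟶ A₁) (p₂ : A ⟶ A₂)
    (hp : Function.Bijective fun a : A => (p₁.hom a, p₂.hom a)) :
    (splitIso p₁ p₂ hp).inv ≫ p₂ = CommAlgCat.ofHom (AlgHom.snd ℂ A₁ A₂) := by
  rw [Iso.inv_comp_eq]; rfl

namespace IsFppfSheaf

variable {S : Presh} (hS : IsFppfSheaf S)
include hS

theorem subsingleton {A : TestAlg} (h : Subsingleton A) (x y : S.obj A) : x = y :=
  (hS.zero A h).unique trivial trivial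

theorem split_ext {A A₁ A₂ : TestAlg} (p₁ : A ⟶ A₁) (p₂ : A ⟶ A₂)
    (hp : Function.Bijective fun a : A => (p₁.hom a, p₂.hom a)) {x y : S.obj A}
    (h₁ : S.map p₁ x = S.map p₁ y) (h₂ : S.map p₂ x = S.map p₂ y) : x = y := by
  let e := splitIso p₁ p₂ hp
  have key : S.map e.hom x = S.map e.hom y := by
    refine (hS.prod A₁ A₂ (S.map p₁ y) (S.map p₂ y)).unique ⟨?_, ?_⟩ ⟨?_, ?_⟩ <;>
    rw [← map_comp_apply]
    · exact h₁
    · exact h₂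
    · rfl
    · rfl
  have := congrArg (S.map e.inv) key
  rwa [← map_comp_apply, ← map_comp_apply, e.hom_inv_id, map_id_apply, map_id_apply] at this

theorem split_glue {A A₁ A₂ : TestAlg} (p₁ : A ⟶ A₁) (p₂ : A ⟶ A₂)
    (hp : Function.Bijective fun a : A => (p₁.hom a, p₂.hom a)) (x₁ : S.obj A₁) (x₂ : S.obj A₂) :
    ∃ x : S.obj A, S.map p₁ x = x₁ ∧ S.map p₂ x = x₂ := by
  let e := splitIso p₁ p₂ hp
  obtain ⟨z, ⟨h₁, h₂⟩, -⟩ := hS.prod A₁ A₂ x₁ x₂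
  refine ⟨S.map e.inv z, ?_, ?_⟩
  · rw [← map_comp_apply, splitIso_fst, h₁]
  · rw [← map_comp_apply, splitIso_snd, h₂]

theorem fppf_ext {A B : TestAlg} {f : A ⟶ B} (hf : IsFppf f) {x y : S.obj A}
    (h : S.map f x = S.map f y) : x = y :=
  (hS.descent f hf (S.map f y) fun C u v huv => by
    rw [← map_comp_apply, ← map_comp_apply, huv]).unique h rfl

/-- Sections of a sheaf which agree locally are equal. -/
theorem sep {A : TestAlg} {W : ∀ B : TestAlg, (A ⟶ B) → Prop} (H : Cov A W) {x y : S.obj A}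
    (h : ∀ B f, W B f → S.map f x = S.map f y) : x = y := by
  induction H with
  | base h' => simpa only [map_id_apply] using h _ (𝟙 _) (h' _ _)
  | zero h' => exact hS.subsingleton h' x y
  | split p₁ p₂ hp _ _ ih₁ ih₂ =>
    refine hS.split_ext p₁ p₂ hp (ih₁ fun B f hf => ?_) (ih₂ fun B f hf => ?_)
    · simpa only [map_comp_apply] using h _ _ hf
    · simpa only [map_comp_apply] using h _ _ hf
  | cover f hf _ ih =>
    refine hS.fppf_ext hf (ih fun B g hg => ?_)
    simpa only [map_comp_apply] using h _ _ hg

/-- Gluing in a sheaf. The local sections are given by a relation, functional and stable under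
base change, between test schemes over `Spec A` and sections. -/
theorem glue {A : TestAlg} (R : ∀ B : TestAlg, (A ⟶ B) → S.obj B → Prop)
    (hnat : ∀ B C (f : A ⟶ B) (g : B ⟶ C) s, R B f s → R C (f ≫ g) (S.map g s))
    (huniq : ∀ B (f : A ⟶ B) s s', R B f s → R B f s' → s = s')
    (H : Cov A fun B f => ∃ s, R B f s) :
    ∃ x : S.obj A, ∀ B f s, R B f s → S.map f x = s := by
  generalize hW : (fun B (f : A ⟶ B) => ∃ s, R B f s) = W at H
  induction H with
  | base h' =>
    rename_i A W
    subst hW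
    obtain ⟨s, hs⟩ := h' A (𝟙 A)
    refine ⟨s, fun B f t ht => huniq B f _ _ ?_ ht⟩
    simpa using hnat _ _ _ f _ hs
  | zero h' =>
    obtain ⟨x, -, -⟩ := hS.zero _ h'
    exact ⟨x, fun B f s _ => hS.subsingleton (subsingleton_of_hom f h') _ _⟩
  | split p₁ p₂ hp _ _ ih₁ ih₂ =>
    subst hW
    obtain ⟨x₁, h₁⟩ := ih₁ (fun B f s => R B (p₁ ≫ f) s)
      (fun B C f g s hs => by simpa using hnat _ _ _ g _ hs)
      (fun B f s s' => huniq B _ s s') rfl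
    obtain ⟨x₂, h₂⟩ := ih₂ (fun B f s => R B (p₂ ≫ f) s)
      (fun B C f g s hs => by simpa using hnat _ _ _ g _ hs)
      (fun B f s s' => huniq B _ s s') rfl
    obtain ⟨x, e₁, e₂⟩ := hS.split_glue p₁ p₂ hp x₁ x₂
    refine ⟨x, fun B f s hs => ?_⟩
    obtain ⟨C₁, C₂, q₁, q₂, k₁, k₂, hq, c₁, c₂⟩ := exists_split_pushout p₁ p₂ hp f
    refine hS.split_ext q₁ q₂ hq ?_ ?_
    · rw [← map_comp_apply, ← c₁, map_comp_apply, e₁]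
      exact h₁ _ _ _ (c₁ ▸ hnat _ _ _ q₁ _ hs)
    · rw [← map_comp_apply, ← c₂, map_comp_apply, e₂]
      exact h₂ _ _ _ (c₂ ▸ hnat _ _ _ q₂ _ hs)
  | cover f hf hcov ih =>
    subst hW
    obtain ⟨y, hy⟩ := ih (fun B g s => R B (f ≫ g) s)
      (fun B C g g' s hs => by simpa using hnat _ _ _ g' _ hs)
      (fun B g s s' => huniq B _ s s') rfl
    obtain ⟨x, hx, -⟩ := hS.descent f hf y fun C u v huv => by
      refine hS.sep (hcov.pullback u) fun B g ⟨s, hs⟩ => ?_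
      rw [← map_comp_apply, ← map_comp_apply, hy _ _ _ hs, hy _ (v ≫ g) s]
      simpa only [← Category.assoc, huv] using hs
    refine ⟨x, fun B g s hs => ?_⟩
    obtain ⟨D, q, k, hq, e⟩ := exists_pushout f hf g
    refine hS.fppf_ext hq ?_
    rw [← map_comp_apply, ← e, map_comp_apply, hx]
    exact hy _ _ _ (e ▸ hnat _ _ _ q _ hs)

end IsFppfSheaf

/-- A presheaf with unique gluing for all coverings is a sheaf. -/
theorem isFppfSheaf_of_glue {S : Presh}
    (sep : ∀ {A : TestAlg} {W : ∀ B : TestAlg, (A ⟶ B) → Prop}, Cov A W → ∀ {x y : S.obj A},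
      (∀ B f, W B f → S.map f x = S.map f y) → x = y)
    (glue : ∀ {A : TestAlg} (R : ∀ B : TestAlg, (A ⟶ B) → S.obj B → Prop),
      (∀ B C (f : A ⟶ B) (g : B ⟶ C) s, R B f s → R C (f ≫ g) (S.map g s)) →
      (∀ B (f : A ⟶ B) s s', R B f s → R B f s' → s = s') →
      (Cov A fun B f => ∃ s, R B f s) →
      ∃ x : S.obj A, ∀ B f s, R B f s → S.map f x = s) : IsFppfSheaf S := by
  have hsub : ∀ {A : TestAlg}, Subsingleton A → ∀ x y : S.obj A, x = y := fun h x y =>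
    sep (W := fun _ _ => False) (.zero h) fun _ _ h => h.elim
  refine ⟨fun A hA => ?_, fun A B x y => ?_, fun {A B} f hf x hx => ?_⟩
  · obtain ⟨x, -⟩ := glue (A := A) (fun _ _ _ => False) (fun _ _ _ _ _ h => h)
      (fun _ _ _ _ h => h.elim) (.zero hA)
    exact ⟨x, trivial, fun y _ => hsub hA _ _⟩
  · let p₁ : CommAlgCat.of ℂ (A × B) ⟶ A := CommAlgCat.ofHom (AlgHom.fst ℂ A B)
    let p₂ : CommAlgCat.of ℂ (A × B) ⟶ B := CommAlgCat.ofHom (AlgHom.snd ℂ A B)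
    have hp : Function.Bijective fun a : CommAlgCat.of ℂ (A × B) => (p₁.hom a, p₂.hom a) :=
      Function.bijective_id
    have hdisj : ∀ (C : TestAlg) (k : A ⟶ C) (l : B ⟶ C), p₁ ≫ k = p₂ ≫ l → Subsingleton C := by
      intro C k l h
      refine subsingleton_of_zero_eq_one ?_
      have h' := congrArg (fun t : CommAlgCat.of ℂ (A × B) ⟶ C => t.hom ((0, 1) : A × B)) h
      change k.hom 0 = l.hom 1 at h'
      simpa using h'
    have hs : ∀ (C : TestAlg) (k l : A ⟶ C), p₁ ≫ k = p₁ ≫ l → k = l := by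
      intro C k l h
      ext a
      exact congrArg (fun t : CommAlgCat.of ℂ (A × B) ⟶ C => t.hom ((a, 0) : A × B)) h
    have hs' : ∀ (C : TestAlg) (k l : B ⟶ C), p₂ ≫ k = p₂ ≫ l → k = l := by
      intro C k l h
      ext a
      exact congrArg (fun t : CommAlgCat.of ℂ (A × B) ⟶ C => t.hom ((0, a) : A × B)) h
    obtain ⟨z, hz⟩ := glue (A := CommAlgCat.of ℂ (A × B))
      (fun C h s => (∃ k, h = p₁ ≫ k ∧ s = S.map k x) ∨ (∃ k, h = p₂ ≫ k ∧ s = S.map k y))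
      (by
        rintro C D h g s (⟨k, rfl, rfl⟩ | ⟨k, rfl, rfl⟩)
        · exact Or.inl ⟨k ≫ g, by simp, by rw [map_comp_apply]⟩
        · exact Or.inr ⟨k ≫ g, by simp, by rw [map_comp_apply]⟩)
      (by
        rintro C h s s' (⟨k, rfl, rfl⟩ | ⟨k, rfl, rfl⟩) (⟨l, h, rfl⟩ | ⟨l, h, rfl⟩)
        · rw [hs _ _ _ h]
        · exact hsub (hdisj _ _ _ h) _ _
        · exact hsub (hdisj _ _ _ h.symm) _ _
        · rw [hs' _ _ _ h])
      (.split p₁ p₂ hp (.base fun C k => ⟨_, Or.inl ⟨k, rfl, rfl⟩⟩)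
        (.base fun C k => ⟨_, Or.inr ⟨k, rfl, rfl⟩⟩))
    refine ⟨z, ⟨hz _ _ _ (Or.inl ⟨𝟙 _, by simp; rfl, by simp⟩),
      hz _ _ _ (Or.inr ⟨𝟙 _, by simp; rfl, by simp⟩)⟩, fun z' ⟨h₁, h₂⟩ => ?_⟩
    refine sep (W := fun C h => (∃ k, h = p₁ ≫ k) ∨ (∃ k, h = p₂ ≫ k))
      (.split p₁ p₂ hp (.base fun C k => Or.inl ⟨k, rfl⟩) (.base fun C k => Or.inr ⟨k, rfl⟩)) ?_
    rintro C h (⟨k, rfl⟩ | ⟨k, rfl⟩)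
    · rw [hz _ _ _ (Or.inl ⟨k, rfl, rfl⟩), map_comp_apply, ← h₁]
    · rw [hz _ _ _ (Or.inr ⟨k, rfl, rfl⟩), map_comp_apply, ← h₂]
  · obtain ⟨z, hz⟩ := glue (A := A) (fun C h s => ∃ k, h = f ≫ k ∧ s = S.map k x)
      (by
        rintro C D h g s ⟨k, rfl, rfl⟩
        exact ⟨k ≫ g, by simp, by rw [map_comp_apply]⟩)
      (by
        rintro C h s s' ⟨k, rfl, rfl⟩ ⟨l, h, rfl⟩
        exact hx _ _ _ h)
      (.cover f hf (.base fun C k => ⟨_, k, rfl, rfl⟩))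
    refine ⟨z, hz _ _ _ ⟨𝟙 _, by simp, by simp⟩, fun z' h => ?_⟩
    refine sep (W := fun C h => ∃ k, h = f ≫ k) (.cover f hf (.base fun C k => ⟨k, rfl⟩)) ?_
    rintro C h ⟨k, rfl⟩
    rw [hz _ _ _ ⟨k, rfl, rfl⟩, map_comp_apply]
    simp_all

/-! ### Properties of fppf coverings -/

theorem IsFppf.of_bijective {A B : TestAlg} {f : A ⟶ B} (hf : Function.Bijective f.hom) :
    IsFppf f :=
  ⟨.of_bijective hf, .of_bijective hf⟩

theorem IsFppf.comp {A B C : TestAlg} {f : A ⟶ B} {g : B ⟶ C} (hf : IsFppf f) (hg : IsFppf g) :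
    IsFppf (f ≫ g) :=
  ⟨RingHom.FaithfullyFlat.stableUnderComposition _ _ hf.1 hg.1, hg.2.comp hf.2⟩

theorem IsFppf.injective {A B : TestAlg} {f : A ⟶ B} (hf : IsFppf f) :
    Function.Injective f.hom := hf.1.injective

section Product

variable {A B₁ B₂ : Type} [CommRing A] [CommRing B₁] [CommRing B₂]

theorem prod_of_ofLocalizationSpanTarget
    {P : ∀ {R S : Type} [CommRing R] [CommRing S], (R →+* S) → Prop}
    (hP : RingHom.OfLocalizationSpanTarget P) (hP' : RingHom.RespectsIso P)
    {f₁ : A →+* B₁} {f₂ : A →+* B₂} (h₁ : P f₁) (h₂ : P f₂) : P (f₁.prod f₂) := by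
  refine hP.ofIsLocalization hP' _ {((1, 0) : B₁ × B₂), ((0, 1) : B₁ × B₂)} ?_ ?_
  · rw [Ideal.eq_top_iff_one]
    have h := Ideal.add_mem _
      (Ideal.subset_span (s := {((1, 0) : B₁ × B₂), ((0, 1) : B₁ × B₂)}) (Or.inl rfl))
      (Ideal.subset_span (Or.inr rfl))
    have e : ((1, 0) : B₁ × B₂) + (0, 1) = 1 := Prod.ext (add_zero _) (zero_add _)
    rwa [e] at h
  · rintro ⟨r, rfl | rfl⟩
    · exact ⟨B₁, _, (RingHom.fst B₁ B₂).toAlgebra, IsLocalization.away_fst, h₁⟩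
    · exact ⟨B₂, _, (RingHom.snd B₁ B₂).toAlgebra, IsLocalization.away_snd, h₂⟩

theorem flat_fst : (RingHom.fst B₁ B₂).Flat := by
  let _ := (RingHom.fst B₁ B₂).toAlgebra
  have := IsLocalization.away_fst (R := B₁) (S := B₂)
  exact IsLocalization.flat B₁ (Submonoid.powers ((1, 0) : B₁ × B₂))

theorem flat_snd : (RingHom.snd B₁ B₂).Flat := by
  let _ := (RingHom.snd B₁ B₂).toAlgebra
  have := IsLocalization.away_snd (R := B₁) (S := B₂)
  exact IsLocalization.flat B₂ (Submonoid.powers ((0, 1) : B₁ × B₂))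

theorem finitePresentation_fst : (RingHom.fst B₁ B₂).FinitePresentation := by
  let _ := (RingHom.fst B₁ B₂).toAlgebra
  have := IsLocalization.away_fst (R := B₁) (S := B₂)
  exact IsLocalization.Away.finitePresentation ((1, 0) : B₁ × B₂)

theorem finitePresentation_snd : (RingHom.snd B₁ B₂).FinitePresentation := by
  let _ := (RingHom.snd B₁ B₂).toAlgebra
  have := IsLocalization.away_snd (R := B₁) (S := B₂)
  exact IsLocalization.Away.finitePresentation ((0, 1) : B₁ × B₂)

end Product

/-- The product of two fppf coverings. -/
theorem IsFppf.prodMap {A₁ A₂ B₁ B₂ : TestAlg} {f₁ : A₁ ⟶ B₁} {f₂ : A₂ ⟶ B₂} (h₁ : IsFppf f₁)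
    (h₂ : IsFppf f₂) : IsFppf (A := CommAlgCat.of ℂ (A₁ × A₂)) (B := CommAlgCat.of ℂ (B₁ × B₂))
      (CommAlgCat.ofHom (f₁.hom.prodMap f₂.hom)) := by
  have e : (CommAlgCat.ofHom (f₁.hom.prodMap f₂.hom) : CommAlgCat.of ℂ (A₁ × A₂) ⟶
      CommAlgCat.of ℂ (B₁ × B₂)).hom.toRingHom =
      (f₁.hom.toRingHom.comp (RingHom.fst A₁ A₂)).prod
        (f₂.hom.toRingHom.comp (RingHom.snd A₁ A₂)) := rfl
  refine ⟨?_, ?_⟩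
  · rw [RingHom.FaithfullyFlat.iff_flat_and_comap_surjective, e]
    refine ⟨prod_of_ofLocalizationSpanTarget RingHom.Flat.ofLocalizationSpanTarget
      RingHom.Flat.respectsIso (flat_fst.comp h₁.1.flat) (flat_snd.comp h₂.1.flat), fun p => ?_⟩
    obtain ⟨-, s₁⟩ := RingHom.FaithfullyFlat.iff_flat_and_comap_surjective.1 h₁.1
    obtain ⟨-, s₂⟩ := RingHom.FaithfullyFlat.iff_flat_and_comap_surjective.1 h₂.1
    obtain ⟨q, rfl⟩ | ⟨q, rfl⟩ : p ∈ Set.range (PrimeSpectrum.comap (RingHom.fst A₁ A₂)) ∨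
        p ∈ Set.range (PrimeSpectrum.comap (RingHom.snd A₁ A₂)) := by
      rw [range_comap_of_surjective _ _ Prod.fst_surjective,
        range_comap_of_surjective _ _ Prod.snd_surjective]
      have h01 : ((1, 0) : A₁ × A₂) * (0, 1) ∈ p.asIdeal := by
        rw [Prod.mk_mul_mk, mul_zero, zero_mul]
        exact p.asIdeal.zero_mem
      rcases p.2.mem_or_mem h01 with h | h
      · refine Or.inr ?_
        rintro ⟨x, y⟩ (rfl : y = 0)
        simpa using p.asIdeal.mul_mem_left (x, 0) h
      · refine Or.inl ?_
        rintro ⟨x, y⟩ (rfl : x = 0)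
        simpa using p.asIdeal.mul_mem_left (0, y) h
    · obtain ⟨q, rfl⟩ := s₁ q
      exact ⟨PrimeSpectrum.comap (RingHom.fst B₁ B₂) q, rfl⟩
    · obtain ⟨q, rfl⟩ := s₂ q
      exact ⟨PrimeSpectrum.comap (RingHom.snd B₁ B₂) q, rfl⟩
  · rw [e]
    exact prod_of_ofLocalizationSpanTarget RingHom.finitePresentation_ofLocalizationSpanTarget
      RingHom.finitePresentation_respectsIso (h₁.2.comp finitePresentation_fst)
      (h₂.2.comp finitePresentation_snd)

/-- A property which is stable under base change and finite products, and which holds locally for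
coverings built from fppf coverings and decompositions, holds after one fppf covering. -/
theorem Cov.fppfLocally {A : TestAlg} {W : ∀ B : TestAlg, (A ⟶ B) → Prop} (H : Cov A W)
    (hzero : ∀ B (f : A ⟶ B), Subsingleton B → W B f)
    (hprod : ∀ B₁ B₂ (f₁ : A ⟶ B₁) (f₂ : A ⟶ B₂), W B₁ f₁ → W B₂ f₂ →
      W (CommAlgCat.of ℂ (B₁ × B₂)) (CommAlgCat.ofHom (f₁.hom.prod f₂.hom))) :
    FppfLocally A W := by
  induction H with
  | base h =>
    rename_i A _
    exact ⟨A, 𝟙 A, .of_bijective Function.bijective_id, h _ _⟩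
  | zero h =>
    rename_i A _
    exact ⟨A, 𝟙 A, .of_bijective Function.bijective_id, hzero _ _ h⟩
  | @split A A₁ A₂ _ p₁ p₂ hp _ _ ih₁ ih₂ =>
    obtain ⟨B₁, f₁, h₁, w₁⟩ := ih₁ (fun B f => hzero B _) fun B₁ B₂ f₁ f₂ => hprod B₁ B₂ _ _
    obtain ⟨B₂, f₂, h₂, w₂⟩ := ih₂ (fun B f => hzero B _) fun B₁ B₂ f₁ f₂ => hprod B₁ B₂ _ _
    refine ⟨_, _, ?_, hprod _ _ _ _ w₁ w₂⟩
    exact (IsFppf.of_bijective (A := A) (B := CommAlgCat.of ℂ (A₁ × A₂))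
      (f := (splitIso p₁ p₂ hp).hom) hp).comp (h₁.prodMap h₂)
  | cover f hf _ ih =>
    obtain ⟨B, g, hg, w⟩ := ih (fun B f => hzero B _) fun B₁ B₂ f₁ f₂ => hprod B₁ B₂ _ _
    exact ⟨B, f ≫ g, hf.comp hg, w⟩

/-! ### Faithfully flat descent of elements -/

/-- The affine line as a presheaf of sets. -/
def affineLine : Presh where
  obj A := A
  map f := TypeCat.ofHom f.hom
  map_id _ := rfl
  map_comp _ _ := rfl

theorem isFppfSheaf_affineLine : IsFppfSheaf affineLine where
  zero A hA := ⟨(0 : A), trivial, fun y _ => hA.elim y 0⟩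
  prod A B x y := ⟨((x, y) : A × B), ⟨rfl, rfl⟩, fun z ⟨h₁, h₂⟩ => Prod.ext h₁ h₂⟩
  descent {A B} f hf x hx := by
    let _ : Algebra A B := f.hom.toRingHom.toAlgebra
    have : IsScalarTower ℂ A B := IsScalarTower.of_algebraMap_eq fun c => (f.hom.commutes c).symm
    have : Module.FaithfullyFlat A B := hf.1
    change B at x
    have hx' : (x : B) ⊗ₜ[A] (1 : B) = (1 : B) ⊗ₜ[A] (x : B) := by
      refine hx (CommAlgCat.of ℂ (TensorProduct A B B))
        (CommAlgCat.ofHom Algebra.TensorProduct.includeLeft)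
        (CommAlgCat.ofHom ((Algebra.TensorProduct.includeRight :
          B →ₐ[A] TensorProduct A B B).restrictScalars ℂ)) ?_
      ext a
      change (algebraMap A B a) ⊗ₜ[A] (1 : B) = (1 : B) ⊗ₜ[A] (algebraMap A B a)
      rw [Algebra.algebraMap_eq_smul_one, TensorProduct.tmul_smul, TensorProduct.smul_tmul']
    obtain ⟨a, ha⟩ : ∃ a : A, algebraMap A B a = x := by
      let N : Submodule A B := LinearMap.range (Algebra.linearMap A B)
      -- `B/A → B ⊗ (B/A)` is injective, and the class of `x` goes to zero
      have h0 : N.mkQ x = 0 := by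
        apply Module.FaithfullyFlat.tensorProduct_mk_injective (A := A) (B := B) (B ⧸ N)
        change (1 : B) ⊗ₜ[A] N.mkQ x = (1 : B) ⊗ₜ[A] (0 : B ⧸ N)
        have h := congrArg (N.mkQ.lTensor B) hx'
        rw [LinearMap.lTensor_tmul, LinearMap.lTensor_tmul] at h
        rw [← h, TensorProduct.tmul_zero]
        have : N.mkQ (1 : B) = 0 := by
          rw [Submodule.mkQ_apply, Submodule.Quotient.mk_eq_zero]
          exact ⟨1, map_one (algebraMap A B)⟩
        rw [this, TensorProduct.tmul_zero]
      rw [Submodule.mkQ_apply, Submodule.Quotient.mk_eq_zero] at h0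
      exact h0
    exact ⟨a, ha, fun y hy => hf.injective (hy.trans ha.symm)⟩

theorem elem_ext_of_cov {A : TestAlg} {W : ∀ B : TestAlg, (A ⟶ B) → Prop} (H : Cov A W)
    {a b : A} (h : ∀ B (f : A ⟶ B), W B f → f.hom a = f.hom b) : a = b :=
  isFppfSheaf_affineLine.sep H h

/-- Morphisms out of a test algebra which agree locally are equal. -/
theorem hom_ext_of_cov {R A : TestAlg} {W : ∀ B : TestAlg, (A ⟶ B) → Prop} (H : Cov A W)
    {u v : R ⟶ A} (h : ∀ B (f : A ⟶ B), W B f → u ≫ f = v ≫ f) : u = v := by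
  ext r
  exact elem_ext_of_cov H fun B f hf => congrArg (fun t : R ⟶ B => t.hom r) (h B f hf)

/-! ### Torsors -/

namespace GrpAction

variable {𝔾 : GrpPresh} {X : Presh} (a : GrpAction 𝔾 X)

theorem inv_act_act {A : TestAlg} (g : 𝔾.obj A) (x : X.obj A) : a.act g⁻¹ (a.act g x) = x := by
  rw [← a.mul_act, inv_mul_cancel, a.one_act]

theorem act_inv_act {A : TestAlg} (g : 𝔾.obj A) (x : X.obj A) : a.act g (a.act g⁻¹ x) = x := by
  rw [← a.mul_act, mul_inv_cancel, a.one_act]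

end GrpAction

namespace QuotientStack

variable {𝔾 : GrpPresh} {X : Presh} {a : GrpAction 𝔾 X}

theorem act_injective (x : QuotientStack a) {A : TestAlg} {g h : 𝔾.obj A} {e : x.E.obj A}
    (H : x.action.act g e = x.action.act h e) : g = h :=
  (x.simply_transitive e _ (x.proj_act h e).symm).unique H rfl

theorem cov_base (x : QuotientStack a) : Cov x.base fun _ f => ∃ e, x.proj e = f :=
  x.locally_trivial.cov fun _ _ f g ⟨e, he⟩ => ⟨x.E.map g e, by rw [x.proj_map, he]⟩

@[ext] theorem hom_ext {x y : QuotientStack a} {u v : x ⟶ y} (h₁ : u.base = v.base)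
    (h₂ : ∀ A e, u.total A e = v.total A e) : u = v :=
  Hom.ext h₁ (funext fun A => funext fun e => h₂ A e)

/-- A morphism of torsors over an isomorphism of base schemes is an isomorphism. -/
theorem isIso_of_isIso_base {x y : QuotientStack a} (u : x ⟶ y) [IsIso u.base] : IsIso u := by
  have inj : ∀ A (e e' : x.E.obj A), u.total A e = u.total A e' → e = e' := by
    intro A e e' h
    have hp : x.proj e = x.proj e' := by
      have h' := congrArg y.proj h
      rw [u.proj_total, u.proj_total] at h'
      exact (cancel_epi _).1 h'
    obtain ⟨g, rfl, -⟩ := x.simply_transitive e e' hp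
    rw [u.total_act] at h
    have hg : g = 1 := y.act_injective (h.symm.trans (y.action.one_act _).symm)
    rw [hg, x.action.one_act]
  have surj : ∀ A (e' : y.E.obj A), ∃ e, u.total A e = e' := by
    intro A e'
    let f : x.base ⟶ A := inv u.base ≫ y.proj e'
    have hloc : Cov A fun B h => ∃ e, u.total B e = y.E.map h e' := by
      refine (x.cov_base.pullback f).mono fun B h ⟨e, he⟩ => ?_
      obtain ⟨g, hg, -⟩ := y.simply_transitive (u.total B e) (y.E.map h e') (by
        rw [u.proj_total, he, y.proj_map]; simp [f])
      exact ⟨x.action.act g e, by rw [u.total_act, hg]⟩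
    obtain ⟨e, he⟩ := x.sheaf.glue (fun B h e => u.total B e = y.E.map h e')
      (fun B C f g s hs => by rw [u.total_map, hs, map_comp_apply])
      (fun B f s s' hs hs' => inj _ _ _ (hs.trans hs'.symm)) hloc
    refine ⟨e, y.sheaf.sep hloc fun B h ⟨s, hs⟩ => ?_⟩
    rw [← u.total_map, he _ _ _ hs, hs]
  choose t ht using surj
  refine ⟨⟨{
    base := inv u.base
    total := t
    total_map := fun f e => inj _ _ _ (by rw [ht, u.total_map, ht])
    proj_total := fun e => by
      rw [IsIso.eq_inv_comp, ← u.proj_total, ht]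
    total_act := fun g e => inj _ _ _ (by rw [ht, u.total_act, ht])
    toX_total := fun e => by rw [← u.toX_total, ht] }, ?_, ?_⟩⟩
  · exact hom_ext (IsIso.inv_hom_id _) fun A e => inj _ _ _ (ht _ _)
  · exact hom_ext (IsIso.hom_inv_id _) fun A e => ht _ _

end QuotientStack

/-- If `S` is a sheaf over `Spec R`, and sections exist locally, they exist after one fppf
covering. -/
theorem fppfLocally_section {S : Presh} (hS : IsFppfSheaf S) {R : TestAlg}
    (proj : ∀ {A : TestAlg}, S.obj A → (R ⟶ A))
    (proj_map : ∀ {A B : TestAlg} (f : A ⟶ B) (e : S.obj A), proj (S.map f e) = proj e ≫ f)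
    (H : Cov R fun _ f => ∃ e : S.obj _, proj e = f) :
    FppfLocally R fun _ f => ∃ e : S.obj _, proj e = f := by
  refine H.fppfLocally ?_ ?_
  · intro B f hB
    obtain ⟨e, -⟩ := hS.zero B hB
    exact ⟨e, CommAlgCat.hom_ext (AlgHom.ext fun _ => hB.elim _ _)⟩
  · rintro B₁ B₂ f₁ f₂ ⟨e₁, rfl⟩ ⟨e₂, rfl⟩
    obtain ⟨e, ⟨h₁, h₂⟩, -⟩ := hS.prod _ _ e₁ e₂
    refine ⟨e, ?_⟩
    rw [← h₁, ← h₂, proj_map, proj_map]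
    rfl

/-! ### Descent of torsors -/

/-- Descent data for a torsor under `𝔾` over `Spec base` with an equivariant map to `X`: a
presheaf `D` over `Spec base` which has sections locally, where any two sections with the same
image in `Spec base` differ by a point of `𝔾`, subject to a cocycle condition, and a compatible
map to `X`. -/
structure DescentData {𝔾 : GrpPresh} {X : Presh} (a : GrpAction 𝔾 X) where
  base : TestAlg
  D : Presh
  proj : ∀ {A : TestAlg}, D.obj A → (base ⟶ A)
  proj_map : ∀ {A B : TestAlg} (f : A ⟶ B) (d : D.obj A), proj (D.map f d) = proj d ≫ f
  cov : Cov base fun _ f => ∃ d, proj d = f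
  rel : ∀ {A : TestAlg}, D.obj A → D.obj A → 𝔾.obj A → Prop
  exists_rel : ∀ {A : TestAlg} (d d' : D.obj A), proj d = proj d' → ∃ g, rel d d' g
  rel_unique : ∀ {A : TestAlg} {d d' : D.obj A} {g g' : 𝔾.obj A}, rel d d' g → rel d d' g' → g = g'
  rel_proj : ∀ {A : TestAlg} {d d' : D.obj A} {g : 𝔾.obj A}, rel d d' g → proj d = proj d'
  rel_map : ∀ {A B : TestAlg} (f : A ⟶ B) {d d' : D.obj A} {g : 𝔾.obj A},
    rel d d' g → rel (D.map f d) (D.map f d') (𝔾.map f g)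
  rel_trans : ∀ {A : TestAlg} {d d' d'' : D.obj A} {g g' : 𝔾.obj A},
    rel d d' g → rel d' d'' g' → rel d d'' (g' * g)
  toX : ∀ {A : TestAlg}, D.obj A → X.obj A
  toX_map : ∀ {A B : TestAlg} (f : A ⟶ B) (d : D.obj A), toX (D.map f d) = X.map f (toX d)
  toX_rel : ∀ {A : TestAlg} {d d' : D.obj A} {g : 𝔾.obj A}, rel d d' g →
    toX d' = a.act g (toX d)

namespace DescentData

variable {𝔾 : GrpPresh} {X : Presh} {a : GrpAction 𝔾 X} (δ : DescentData a)

/-- A point of the torsor defined by descent data, before restriction of universes: a point of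
the base together with a natural family of coordinates with respect to the sections of `D`. -/
structure Raw (A : TestAlg) where
  pt : δ.base ⟶ A
  coord : ∀ {B : TestAlg} (h : A ⟶ B) (d : δ.D.obj B), δ.proj d = pt ≫ h → 𝔾.obj B
  coord_map : ∀ {B C : TestAlg} (h : A ⟶ B) (k : B ⟶ C) (d : δ.D.obj B) (hd : δ.proj d = pt ≫ h)
    (hd' : δ.proj (δ.D.map k d) = pt ≫ h ≫ k),
    coord (h ≫ k) (δ.D.map k d) hd' = 𝔾.map k (coord h d hd)
  coord_rel : ∀ {B : TestAlg} (h : A ⟶ B) (d d' : δ.D.obj B) (hd : δ.proj d = pt ≫ h)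
    (hd' : δ.proj d' = pt ≫ h) (g : 𝔾.obj B), δ.rel d d' g →
    coord h d hd = coord h d' hd' * g

variable {δ}

namespace Raw

theorem coord_congr {A B : TestAlg} (r : δ.Raw A) {h h' : A ⟶ B} {d d' : δ.D.obj B}
    (hd : δ.proj d = r.pt ≫ h) (hd' : δ.proj d' = r.pt ≫ h') (eh : h = h') (ed : d = d') :
    r.coord h d hd = r.coord h' d' hd' := by
  subst eh ed; rfl

theorem ext' {A : TestAlg} {r s : δ.Raw A} (hp : r.pt = s.pt)
    (hc : ∀ B (h : A ⟶ B) (d : δ.D.obj B) (hr : δ.proj d = r.pt ≫ h) (hs : δ.proj d = s.pt ≫ h),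
      r.coord h d hr = s.coord h d hs) : r = s := by
  obtain ⟨p, c, _, _⟩ := r
  obtain ⟨p', c', _, _⟩ := s
  obtain rfl : p = p' := hp
  congr
  funext B h d hd
  exact hc B h d hd hd

/-- Base change of points. -/
def map {A B : TestAlg} (f : A ⟶ B) (r : δ.Raw A) : δ.Raw B where
  pt := r.pt ≫ f
  coord h d hd := r.coord (f ≫ h) d (by rw [hd, Category.assoc])
  coord_map h k d hd hd' := by
    rw [← r.coord_map (f ≫ h) k d _ (by simpa using hd')]
    exact r.coord_congr _ _ (by simp) rfl
  coord_rel h d d' hd hd' g H := r.coord_rel _ _ _ _ _ _ H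

theorem map_id {A : TestAlg} (r : δ.Raw A) : r.map (𝟙 A) = r :=
  ext' (Category.comp_id _) fun _ h _ _ _ => r.coord_congr _ _ (Category.id_comp h) rfl

theorem map_comp {A B C : TestAlg} (f : A ⟶ B) (g : B ⟶ C) (r : δ.Raw A) :
    r.map (f ≫ g) = (r.map f).map g :=
  ext' (Category.assoc _ _ _).symm fun _ _ _ _ _ => r.coord_congr _ _ (Category.assoc _ _ _) rfl

/-- Two points over the same point of the base with the same coordinates locally are equal. -/
theorem eq_of_cov (h𝔾 : IsFppfSheaf (setOf 𝔾)) {A : TestAlg} {r s : δ.Raw A} (hp : r.pt = s.pt)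
    {W : ∀ B : TestAlg, (A ⟶ B) → Prop} (hW : Cov A W)
    (hc : ∀ B (h : A ⟶ B), W B h → ∃ (d : δ.D.obj B) (hr : δ.proj d = r.pt ≫ h)
      (hs : δ.proj d = s.pt ≫ h), r.coord h d hr = s.coord h d hs) : r = s := by
  refine ext' hp fun B h d hr hs => ?_
  refine h𝔾.sep (hW.pullback h) fun C k hk => ?_
  obtain ⟨d', hr', hs', e⟩ := hc _ _ hk
  change 𝔾.map k _ = 𝔾.map k _
  have h₁ : δ.proj (δ.D.map k d) = r.pt ≫ h ≫ k := by rw [δ.proj_map, hr, Category.assoc]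
  have h₂ : δ.proj (δ.D.map k d) = s.pt ≫ h ≫ k := by rw [δ.proj_map, hs, Category.assoc]
  rw [← r.coord_map h k d hr h₁, ← s.coord_map h k d hs h₂]
  obtain ⟨g, hg⟩ := δ.exists_rel (δ.D.map k d) d' (h₁.trans hr'.symm)
  rw [r.coord_rel _ _ _ h₁ hr' g hg, s.coord_rel _ _ _ h₂ hs' g hg, e]

end Raw

variable (δ)

/-- A point is determined by its coordinates along a finite family covering `Spec A`. -/
theorem small_raw (h𝔾 : IsFppfSheaf (setOf 𝔾)) (A : TestAlg) : Small.{0} (δ.Raw A) := by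
  choose J _ B k hk hc using fun f : δ.base ⟶ A => (δ.cov.pullback f).exists_finite
  choose d hd using hk
  refine small_of_injective
    (β := Σ f : δ.base ⟶ A, ∀ j : J f, 𝔾.obj (B f j))
    (f := fun r => ⟨r.pt, fun j => r.coord (k r.pt j) (d r.pt j) (hd r.pt j)⟩) ?_
  intro r s h
  have hp : r.pt = s.pt := congrArg Sigma.fst h
  refine Raw.eq_of_cov h𝔾 hp (hc r.pt) ?_
  rintro C _ ⟨j, l, rfl⟩
  have h₁ : δ.proj (δ.D.map l (d r.pt j)) = r.pt ≫ k r.pt j ≫ l := by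
    rw [δ.proj_map, hd, Category.assoc]
  refine ⟨δ.D.map l (d r.pt j), h₁, by rw [← hp, h₁], ?_⟩
  rw [r.coord_map (k r.pt j) l (d r.pt j) (hd r.pt j),
    s.coord_map (k r.pt j) l (d r.pt j) (by rw [← hp, hd])]
  congr 1
  obtain ⟨p, c, _, _⟩ := r
  obtain ⟨p', c', _, _⟩ := s
  obtain rfl : p = p' := hp
  have h' := eq_of_heq (Sigma.mk.inj h).2
  exact congrFun h' j

end DescentData

/-- The functor of points of `Spec R`. -/
def homPresh (R : TestAlg) : Presh where
  obj A := R ⟶ A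
  map f := TypeCat.ofHom fun p => p ≫ f
  map_id A := by ext p; rfl
  map_comp f g := by ext p; rfl

theorem isFppfSheaf_homPresh (R : TestAlg) : IsFppfSheaf (homPresh R) where
  zero A hA := ⟨CommAlgCat.ofHom
    { toFun := fun _ => 0
      map_one' := hA.elim _ _
      map_mul' := fun _ _ => hA.elim _ _
      map_zero' := rfl
      map_add' := fun _ _ => hA.elim _ _
      commutes' := fun _ => hA.elim _ _ }, trivial,
    fun _ _ => CommAlgCat.hom_ext (AlgHom.ext fun _ => hA.elim _ _)⟩
  prod A B (x : R ⟶ A) (y : R ⟶ B) := ⟨CommAlgCat.ofHom (x.hom.prod y.hom), ⟨rfl, rfl⟩,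
    fun z ⟨h₁, h₂⟩ => CommAlgCat.hom_ext (AlgHom.ext fun r => Prod.ext
      (congrArg (fun t : R ⟶ A => t.hom r) h₁) (congrArg (fun t : R ⟶ B => t.hom r) h₂))⟩
  descent {A B} f hf (x : R ⟶ B) hx := by
    have key : ∀ r : R, ∃ t : A, f.hom t = x.hom r := fun r =>
      (isFppfSheaf_affineLine.descent f hf (x.hom r) fun C u v huv =>
        congrArg (fun t : R ⟶ C => t.hom r) (hx C u v huv)).exists
    choose t ht using key
    refine ⟨CommAlgCat.ofHom
      { toFun := t
        map_one' := hf.injective (by simp [ht])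
        map_mul' := fun _ _ => hf.injective (by simp [ht])
        map_zero' := hf.injective (by simp [ht])
        map_add' := fun _ _ => hf.injective (by simp [ht])
        commutes' := fun _ => hf.injective (by simp [ht]) },
      CommAlgCat.hom_ext (AlgHom.ext ht), fun y hy => ?_⟩
    refine CommAlgCat.hom_ext (AlgHom.ext fun r => hf.injective ?_)
    exact (congrArg (fun t : R ⟶ B => t.hom r) hy).trans (ht r).symm

namespace DescentData

variable {𝔾 : GrpPresh} {X : Presh} {a : GrpAction 𝔾 X} (δ : DescentData a)

theorem Raw.sep (h𝔾 : IsFppfSheaf (setOf 𝔾)) {A : TestAlg} {W : ∀ B : TestAlg, (A ⟶ B) → Prop}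
    (H : Cov A W) {r s : δ.Raw A} (h : ∀ B f, W B f → r.map f = s.map f) : r = s := by
  have hp : r.pt = s.pt := hom_ext_of_cov H fun B f hf => congrArg Raw.pt (h B f hf)
  refine Raw.ext' hp fun B k d hr hs => ?_
  refine h𝔾.sep (H.pullback k) fun C l hl => ?_
  change 𝔾.map l _ = 𝔾.map l _
  have h₁ : δ.proj (δ.D.map l d) = r.pt ≫ k ≫ l := by rw [δ.proj_map, hr, Category.assoc]
  have h₂ : δ.proj (δ.D.map l d) = s.pt ≫ k ≫ l := by rw [δ.proj_map, hs, Category.assoc]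
  rw [← r.coord_map k l d hr h₁, ← s.coord_map k l d hs h₂]
  have e : ∀ (u v : δ.Raw C) (_ : u = v) (hu : δ.proj (δ.D.map l d) = u.pt ≫ 𝟙 C)
    (hv : δ.proj (δ.D.map l d) = v.pt ≫ 𝟙 C),
    u.coord (𝟙 C) (δ.D.map l d) hu = v.coord (𝟙 C) (δ.D.map l d) hv := by
    rintro u _ rfl _ _; rfl
  have e' := e _ _ (h C (k ≫ l) hl) (by simpa [Raw.map] using h₁) (by simpa [Raw.map] using h₂)
  exact (r.coord_congr _ _ (Category.comp_id _).symm rfl).trans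
    (e'.trans (s.coord_congr _ _ (Category.comp_id _) rfl))

theorem Raw.glue (h𝔾 : IsFppfSheaf (setOf 𝔾)) {A : TestAlg}
    (R : ∀ B : TestAlg, (A ⟶ B) → δ.Raw B → Prop)
    (hnat : ∀ B C (f : A ⟶ B) (g : B ⟶ C) s, R B f s → R C (f ≫ g) (s.map g))
    (huniq : ∀ B (f : A ⟶ B) s s', R B f s → R B f s' → s = s')
    (H : Cov A fun B f => ∃ s, R B f s) :
    ∃ x : δ.Raw A, ∀ B f s, R B f s → x.map f = s := by
  obtain ⟨p, hp⟩ : ∃ p : δ.base ⟶ A, ∀ B f (t : δ.base ⟶ B), (∃ s, R B f s ∧ s.pt = t) →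
      p ≫ f = t := (isFppfSheaf_homPresh δ.base).glue (fun B f t => ∃ s, R B f s ∧ s.pt = t)
    (by
      rintro B C f g _ ⟨s, hs, rfl⟩
      exact ⟨_, hnat _ _ _ g _ hs, rfl⟩)
    (by
      rintro B f _ _ ⟨s, hs, rfl⟩ ⟨s', hs', rfl⟩
      rw [huniq _ _ _ _ hs hs'])
    (H.mono fun B f ⟨s, hs⟩ => ⟨s.pt, s, hs, rfl⟩)
  have hp' : ∀ B f s, R B f s → p ≫ f = s.pt := fun B f s hs => hp B f _ ⟨s, hs, rfl⟩
  have hproj : ∀ {B : TestAlg} (h : A ⟶ B) (d : δ.D.obj B), δ.proj d = p ≫ h →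
      ∀ {C : TestAlg} (k : B ⟶ C) (s : δ.Raw C), R C (h ≫ k) s →
      δ.proj (δ.D.map k d) = s.pt ≫ 𝟙 C := by
    intro B h d hd C k s hs
    rw [δ.proj_map, hd, Category.assoc, hp' _ _ _ hs, Category.comp_id]
  have key : ∀ {B : TestAlg} (h : A ⟶ B) (d : δ.D.obj B) (hd : δ.proj d = p ≫ h),
      ∃ g : 𝔾.obj B, ∀ C (k : B ⟶ C) (s : δ.Raw C) (hs : R C (h ≫ k) s),
        𝔾.map k g = s.coord (𝟙 C) (δ.D.map k d) (hproj h d hd k s hs) := by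
    intro B h d hd
    obtain ⟨g, hg⟩ := h𝔾.glue (A := B) (fun C k (t : 𝔾.obj C) => ∃ (s : δ.Raw C)
        (hs : R C (h ≫ k) s), t = s.coord (𝟙 C) (δ.D.map k d) (hproj h d hd k s hs))
      (by
        rintro C C' k l _ ⟨s, hs, rfl⟩
        have hs' : R C' (h ≫ k ≫ l) (s.map l) := by simpa using hnat _ _ _ l _ hs
        refine ⟨s.map l, hs', ?_⟩
        change 𝔾.map l _ = _
        rw [← s.coord_map (𝟙 C) l (δ.D.map k d) (hproj h d hd k s hs) (by
          rw [δ.proj_map, hproj h d hd k s hs]; simp)]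
        exact s.coord_congr _ _ (by simp) (map_comp_apply _ _ _ _).symm)
      (by
        rintro C k _ _ ⟨s, hs, rfl⟩ ⟨s', hs', rfl⟩
        obtain rfl := huniq _ _ _ _ hs hs'
        rfl)
      ((H.pullback h).mono fun C k ⟨s, hs⟩ => ⟨_, s, hs, rfl⟩)
    exact ⟨g, fun C k s hs => hg C k _ ⟨s, hs, rfl⟩⟩
  choose c hc using @key
  refine ⟨⟨p, c, ?_, ?_⟩, ?_⟩
  · intro B C h k d hd hd'
    refine h𝔾.sep (H.pullback (h ≫ k)) fun C' l ⟨s, hs⟩ => ?_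
    change 𝔾.map l _ = 𝔾.map l _
    have hs' : R C' (h ≫ k ≫ l) s := by simpa using hs
    rw [hc (h ≫ k) _ hd' C' l s hs]
    refine Eq.trans ?_ (show 𝔾.map (k ≫ l) (c h d hd) = 𝔾.map l (𝔾.map k (c h d hd)) by simp)
    rw [hc h d hd C' (k ≫ l) s hs']
    exact s.coord_congr _ _ rfl (map_comp_apply _ _ _ _).symm
  · intro B h d d' hd hd' g hg
    refine h𝔾.sep (H.pullback h) fun C k ⟨s, hs⟩ => ?_
    change 𝔾.map k _ = 𝔾.map k _
    rw [map_mul, hc h d hd C k s hs, hc h d' hd' C k s hs]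
    exact s.coord_rel _ _ _ _ _ _ (δ.rel_map k hg)
  · intro B f s hs
    refine Raw.ext' (hp' B f s hs) fun C h d hr hs' => ?_
    change c (f ≫ h) d _ = _
    have h₁ := hc (f ≫ h) d (by rw [hs', hp' _ _ _ (hnat _ _ _ h _ hs)]; rfl) C (𝟙 C) (s.map h)
      (by simpa using hnat _ _ _ h _ hs)
    refine (show c (f ≫ h) d _ = 𝔾.map (𝟙 C) (c (f ≫ h) d _) by simp).trans (h₁.trans ?_)
    exact s.coord_congr _ _ (by simp) (map_id_apply _ _)

end DescentData

namespace DescentData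

variable {𝔾 : GrpPresh} {X : Presh} {a : GrpAction 𝔾 X} {δ : DescentData a}

variable (δ) in
/-- The point of `𝔾` by which two sections of `D` over the same point of the base differ. -/
def cocycle {A : TestAlg} (d d' : δ.D.obj A) (h : δ.proj d = δ.proj d') : 𝔾.obj A :=
  (δ.exists_rel d d' h).choose

variable (δ) in
theorem cocycle_rel {A : TestAlg} (d d' : δ.D.obj A) (h : δ.proj d = δ.proj d') :
    δ.rel d d' (δ.cocycle d d' h) := (δ.exists_rel d d' h).choose_spec

namespace Raw

/-- The action of `𝔾` on coordinates by left multiplication. -/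
def act {A : TestAlg} (g : 𝔾.obj A) (r : δ.Raw A) : δ.Raw A where
  pt := r.pt
  coord h d hd := 𝔾.map h g * r.coord h d hd
  coord_map h k d hd hd' := by
    rw [map_mul, ← r.coord_map h k d hd hd']
    congr 1
    simp
  coord_rel h d d' hd hd' c H := by rw [r.coord_rel h d d' hd hd' c H, mul_assoc]

theorem one_act {A : TestAlg} (r : δ.Raw A) : r.act 1 = r :=
  ext' rfl fun B h d _ _ => by simp [act]

theorem mul_act {A : TestAlg} (g g' : 𝔾.obj A) (r : δ.Raw A) :
    r.act (g * g') = (r.act g').act g :=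
  ext' rfl fun B h d _ _ => by simp [act, mul_assoc]

theorem map_act {A B : TestAlg} (f : A ⟶ B) (g : 𝔾.obj A) (r : δ.Raw A) :
    (r.act g).map f = (r.map f).act (𝔾.map f g) :=
  ext' rfl fun B h d _ _ => by simp [act, map]

theorem cov {A : TestAlg} (r : δ.Raw A) : Cov A fun B h => ∃ d : δ.D.obj B,
    δ.proj d = r.pt ≫ h := δ.cov.pullback r.pt

theorem proj_map_eq {A B C : TestAlg} (r : δ.Raw A) {h : A ⟶ B} (k : B ⟶ C) {d : δ.D.obj B}
    (hd : δ.proj d = r.pt ≫ h) : δ.proj (δ.D.map k d) = r.pt ≫ h ≫ k := by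
  rw [δ.proj_map, hd, Category.assoc]

theorem simply_transitive (h𝔾 : IsFppfSheaf (setOf 𝔾)) {A : TestAlg} (r s : δ.Raw A)
    (hp : r.pt = s.pt) : ∃! g : 𝔾.obj A, r.act g = s := by
  obtain ⟨g, hg⟩ := h𝔾.glue (A := A) (fun B h (t : 𝔾.obj B) => ∃ (d : δ.D.obj B)
      (hr : δ.proj d = r.pt ≫ h) (hs : δ.proj d = s.pt ≫ h),
      t = s.coord h d hs * (r.coord h d hr)⁻¹)
    (by
      rintro B C h k _ ⟨d, hr, hs, rfl⟩
      refine ⟨δ.D.map k d, r.proj_map_eq k hr, s.proj_map_eq k hs, ?_⟩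
      rw [s.coord_map h k d hs, r.coord_map h k d hr, ← map_inv, ← map_mul]
      rfl)
    (by
      rintro B h _ _ ⟨d, hr, hs, rfl⟩ ⟨d', hr', hs', rfl⟩
      obtain ⟨c, hc⟩ := δ.exists_rel d d' (hr.trans hr'.symm)
      rw [r.coord_rel h d d' hr hr' c hc, s.coord_rel h d d' hs hs' c hc, mul_inv_rev, mul_assoc,
        mul_inv_cancel_left])
    (r.cov.mono fun B h ⟨d, hd⟩ => ⟨_, d, hd, hp ▸ hd, rfl⟩)
  refine ⟨g, eq_of_cov h𝔾 hp r.cov fun B h ⟨d, hd⟩ => ⟨d, hd, hp ▸ hd, ?_⟩, ?_⟩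
  · have e : 𝔾.map h g = _ := hg B h _ ⟨d, hd, hp ▸ hd, rfl⟩
    change 𝔾.map h g * _ = _
    rw [e, inv_mul_cancel_right]
  · rintro g' rfl
    refine h𝔾.sep r.cov fun B h ⟨d, hd⟩ => ?_
    refine Eq.trans ?_ (hg B h _ ⟨d, hd, hd, rfl⟩).symm
    exact (mul_inv_cancel_right (𝔾.map h g') (r.coord h d hd)).symm

theorem exists_toX (hX : IsFppfSheaf X) {A : TestAlg} (r : δ.Raw A) :
    ∃ x : X.obj A, ∀ B (h : A ⟶ B) (d : δ.D.obj B) (hd : δ.proj d = r.pt ≫ h),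
      X.map h x = a.act (r.coord h d hd) (δ.toX d) := by
  obtain ⟨x, hx⟩ := hX.glue (A := A) (fun B h t => ∃ (d : δ.D.obj B)
      (hd : δ.proj d = r.pt ≫ h), t = a.act (r.coord h d hd) (δ.toX d))
    (by
      rintro B C h k _ ⟨d, hd, rfl⟩
      refine ⟨δ.D.map k d, r.proj_map_eq k hd, ?_⟩
      rw [a.map_act, δ.toX_map, r.coord_map h k d hd])
    (by
      rintro B h _ _ ⟨d, hd, rfl⟩ ⟨d', hd', rfl⟩
      obtain ⟨c, hc⟩ := δ.exists_rel d d' (hd.trans hd'.symm)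
      rw [r.coord_rel h d d' hd hd' c hc, a.mul_act, δ.toX_rel hc])
    (r.cov.mono fun B h ⟨d, hd⟩ => ⟨_, d, hd, rfl⟩)
  exact ⟨x, fun B h d hd => hx B h _ ⟨d, hd, rfl⟩⟩

/-- The equivariant map from the torsor to `X`. -/
def toX (hX : IsFppfSheaf X) {A : TestAlg} (r : δ.Raw A) : X.obj A := (r.exists_toX hX).choose

theorem map_toX (hX : IsFppfSheaf X) {A : TestAlg} (r : δ.Raw A) {B : TestAlg} (h : A ⟶ B)
    (d : δ.D.obj B) (hd : δ.proj d = r.pt ≫ h) :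
    X.map h (r.toX hX) = a.act (r.coord h d hd) (δ.toX d) := (r.exists_toX hX).choose_spec B h d hd

theorem toX_map (hX : IsFppfSheaf X) {A B : TestAlg} (f : A ⟶ B) (r : δ.Raw A) :
    (r.map f).toX hX = X.map f (r.toX hX) := by
  refine hX.sep (r.map f).cov fun C h ⟨d, hd⟩ => ?_
  rw [(r.map f).map_toX hX h d hd, ← map_comp_apply, r.map_toX hX (f ≫ h) d (by
    rw [hd]; exact Category.assoc _ _ _)]
  rfl

theorem toX_act (hX : IsFppfSheaf X) {A : TestAlg} (g : 𝔾.obj A) (r : δ.Raw A) :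
    (r.act g).toX hX = a.act g (r.toX hX) := by
  refine hX.sep r.cov fun C h ⟨d, hd⟩ => ?_
  rw [(r.act g).map_toX hX h d hd, a.map_act, r.map_toX hX h d hd, ← a.mul_act]
  rfl

variable (δ) in
/-- The point of the torsor defined by a section of `D`. -/
def ofSection {A : TestAlg} (d₀ : δ.D.obj A) : δ.Raw A where
  pt := δ.proj d₀
  coord h d hd := δ.cocycle d (δ.D.map h d₀) (hd.trans (δ.proj_map h d₀).symm)
  coord_map h k d hd hd' := by
    refine δ.rel_unique (δ.cocycle_rel _ _ _) ?_
    rw [map_comp_apply]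
    exact δ.rel_map k (δ.cocycle_rel d (δ.D.map h d₀) _)
  coord_rel h d d' hd hd' g H := by
    refine δ.rel_unique (δ.cocycle_rel _ _ _) ?_
    exact δ.rel_trans H (δ.cocycle_rel d' (δ.D.map h d₀) _)

theorem ofSection_rel {A B : TestAlg} (d₀ : δ.D.obj A) (h : A ⟶ B) (d : δ.D.obj B)
    (hd : δ.proj d = (ofSection δ d₀).pt ≫ h) :
    δ.rel d (δ.D.map h d₀) ((ofSection δ d₀).coord h d hd) :=
  δ.cocycle_rel d (δ.D.map h d₀) (hd.trans (δ.proj_map h d₀).symm)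

theorem ofSection_map {A B : TestAlg} (f : A ⟶ B) (d₀ : δ.D.obj A) :
    ofSection δ (δ.D.map f d₀) = (ofSection δ d₀).map f := by
  refine ext' (δ.proj_map f d₀) fun C h d hr hs => ?_
  refine δ.rel_unique (ofSection_rel _ h d hr) ?_
  rw [← map_comp_apply]
  exact ofSection_rel d₀ (f ≫ h) d (hs.trans (Category.assoc _ _ _))

theorem ofSection_act {A : TestAlg} {d d' : δ.D.obj A} {g : 𝔾.obj A} (H : δ.rel d d' g) :
    ofSection δ d' = (ofSection δ d).act g :=
  ext' (δ.rel_proj H).symm fun _ h x hr hs => δ.rel_unique (ofSection_rel d' h x hr)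
    (δ.rel_trans (ofSection_rel d h x hs) (δ.rel_map h H))

theorem toX_ofSection (hX : IsFppfSheaf X) {A : TestAlg} (d : δ.D.obj A) :
    (ofSection δ d).toX hX = δ.toX d := by
  have hd : δ.proj d = (ofSection δ d).pt ≫ 𝟙 A := (Category.comp_id _).symm
  have h := (ofSection δ d).map_toX hX (𝟙 A) d hd
  rw [map_id_apply] at h
  rw [h, ← δ.toX_rel (ofSection_rel d (𝟙 A) d hd), map_id_apply]

end Raw

variable (δ) (h𝔾 : IsFppfSheaf (setOf 𝔾))

/-- The torsor defined by descent data, as a presheaf of sets. -/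
def total : Presh where
  obj A := @Shrink (δ.Raw A) (δ.small_raw h𝔾 A)
  map {A B} f := TypeCat.ofHom fun r =>
    @equivShrink (δ.Raw B) (δ.small_raw h𝔾 B)
      (((@equivShrink (δ.Raw A) (δ.small_raw h𝔾 A)).symm r).map f)
  map_id A := by
    ext r
    simp [Raw.map_id]
  map_comp f g := by
    ext r
    simp [Raw.map_comp]

/-- The points of the torsor defined by descent data. -/
def raw (A : TestAlg) : (δ.total h𝔾).obj A ≃ δ.Raw A :=
  (@equivShrink (δ.Raw A) (δ.small_raw h𝔾 A)).symm

theorem raw_map {A B : TestAlg} (f : A ⟶ B) (r : (δ.total h𝔾).obj A) :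
    δ.raw h𝔾 B ((δ.total h𝔾).map f r) = (δ.raw h𝔾 A r).map f := by
  exact Equiv.symm_apply_apply _ _

theorem isFppfSheaf_total : IsFppfSheaf (δ.total h𝔾) := by
  refine isFppfSheaf_of_glue (fun {A W} hW {x y} h => ?_) (fun {A} R hnat huniq H => ?_)
  · refine (δ.raw h𝔾 A).injective (Raw.sep δ h𝔾 hW fun B f hf => ?_)
    rw [← raw_map, ← raw_map, h B f hf]
  · obtain ⟨x, hx⟩ := Raw.glue δ h𝔾 (A := A) (fun B f s => R B f ((δ.raw h𝔾 B).symm s))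
      (fun B C f g s hs => by
        have h := hnat _ _ _ g _ hs
        rwa [← (δ.raw h𝔾 C).symm_apply_apply ((δ.total h𝔾).map g _), raw_map,
          Equiv.apply_symm_apply] at h)
      (fun B f s s' hs hs' => (δ.raw h𝔾 B).symm.injective (huniq _ _ _ _ hs hs'))
      (H.mono fun B f ⟨s, hs⟩ => ⟨δ.raw h𝔾 B s, by simpa using hs⟩)
    refine ⟨(δ.raw h𝔾 A).symm x, fun B f s hs => (δ.raw h𝔾 B).injective ?_⟩
    rw [raw_map, Equiv.apply_symm_apply]
    exact hx B f _ (by simpa using hs)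

/-- Effective descent: the object of the quotient stack defined by descent data. -/
def glued (hX : IsFppfSheaf X) : QuotientStack a where
  base := δ.base
  E := δ.total h𝔾
  sheaf := δ.isFppfSheaf_total h𝔾
  action :=
    { act := fun {A} g r => (δ.raw h𝔾 A).symm ((δ.raw h𝔾 A r).act g)
      one_act := fun r => by rw [Raw.one_act, Equiv.symm_apply_apply]
      mul_act := fun g g' r => by rw [Raw.mul_act, Equiv.apply_symm_apply]
      map_act := fun {A B} f g r => (δ.raw h𝔾 B).injective (by
        rw [raw_map, Equiv.apply_symm_apply, Equiv.apply_symm_apply, Raw.map_act, raw_map]) }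
  proj {A} r := (δ.raw h𝔾 A r).pt
  proj_map f r := by rw [raw_map]; rfl
  proj_act g r := by rw [Equiv.apply_symm_apply]; rfl
  simply_transitive {A} r s h := by
    obtain ⟨g, hg, hu⟩ := Raw.simply_transitive h𝔾 _ _ h
    exact ⟨g, by simp [hg], fun g' hg' => hu g' ((δ.raw h𝔾 A).symm.injective (by simpa using hg'))⟩
  locally_trivial := by
    refine fppfLocally_section (δ.isFppfSheaf_total h𝔾) (fun {A} r => (δ.raw h𝔾 A r).pt)
      (fun f r => by rw [raw_map]; rfl) (δ.cov.mono fun B f ⟨d, hd⟩ => ?_)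
    exact ⟨(δ.raw h𝔾 B).symm (Raw.ofSection δ d), by rw [Equiv.apply_symm_apply]; exact hd⟩
  toX {A} r := (δ.raw h𝔾 A r).toX hX
  toX_map f r := by rw [raw_map, Raw.toX_map]
  toX_act g r := by rw [Equiv.apply_symm_apply, Raw.toX_act]

/-- The tautological map from the presheaf of descent data to the torsor. -/
def toGlued (hX : IsFppfSheaf X) {A : TestAlg} (d : δ.D.obj A) : (δ.glued h𝔾 hX).E.obj A :=
  (δ.raw h𝔾 A).symm (Raw.ofSection δ d)

variable (hX : IsFppfSheaf X)

theorem toGlued_map {A B : TestAlg} (f : A ⟶ B) (d : δ.D.obj A) :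
    δ.toGlued h𝔾 hX (δ.D.map f d) = (δ.glued h𝔾 hX).E.map f (δ.toGlued h𝔾 hX d) := by
  refine (δ.raw h𝔾 B).injective ?_
  refine Eq.trans ?_ (δ.raw_map h𝔾 f _).symm
  simp [toGlued, Raw.ofSection_map]

theorem proj_toGlued {A : TestAlg} (d : δ.D.obj A) :
    (δ.glued h𝔾 hX).proj (δ.toGlued h𝔾 hX d) = δ.proj d := by
  simp [toGlued, glued, Raw.ofSection]

theorem toX_toGlued {A : TestAlg} (d : δ.D.obj A) :
    (δ.glued h𝔾 hX).toX (δ.toGlued h𝔾 hX d) = δ.toX d := by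
  simp [toGlued, glued, Raw.toX_ofSection]

theorem toGlued_rel {A : TestAlg} {d d' : δ.D.obj A} {g : 𝔾.obj A} (H : δ.rel d d' g) :
    δ.toGlued h𝔾 hX d' = (δ.glued h𝔾 hX).action.act g (δ.toGlued h𝔾 hX d) := by
  simp [toGlued, glued, Raw.ofSection_act H]

end DescentData

/-! ### Quotient stacks covered by charts -/

/-- Charts of a quotient stack `[X/𝔾]`: presheaves `Y i` with actions of groups `Q i`, and maps
`φ i : Y i → X` equivariant along `ρ i : Q i → 𝔾`, such that locally every point of `X` lies in
the `𝔾`-orbit of the image of some `φ i`, such that the translates of the images for different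
indices are disjoint, and such that each `[Y i/Q i] → [X/𝔾]` is a monomorphism. -/
structure Charts {𝔾 : GrpPresh} {X : Presh} (a : GrpAction 𝔾 X) (I : Type) where
  Q : I → GrpPresh
  Y : I → Presh
  b : ∀ i, GrpAction (Q i) (Y i)
  ρ : ∀ i {A : TestAlg}, (Q i).obj A →* 𝔾.obj A
  ρ_map : ∀ i {A B : TestAlg} (f : A ⟶ B) (q : (Q i).obj A), ρ i ((Q i).map f q) = 𝔾.map f (ρ i q)
  φ : ∀ i {A : TestAlg}, (Y i).obj A → X.obj A
  φ_map : ∀ i {A B : TestAlg} (f : A ⟶ B) (y : (Y i).obj A), φ i ((Y i).map f y) = X.map f (φ i y)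
  φ_act : ∀ i {A : TestAlg} (q : (Q i).obj A) (y : (Y i).obj A),
    φ i ((b i).act q y) = a.act (ρ i q) (φ i y)
  existsUnique : ∀ {i} {A : TestAlg} {g : 𝔾.obj A} {y y' : (Y i).obj A},
    a.act g (φ i y) = φ i y' → ∃! q, ρ i q = g ∧ (b i).act q y = y'
  disjoint : ∀ {i j} {A : TestAlg} {g : 𝔾.obj A} {y : (Y i).obj A} {y' : (Y j).obj A},
    i ≠ j → a.act g (φ i y) = φ j y' → Subsingleton A
  cov : ∀ {A : TestAlg} (x : X.obj A),
    Cov A fun _ h => ∃ i g, ∃ y : (Y i).obj _, X.map h x = a.act g (φ i y)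

namespace Charts

variable {𝔾 : GrpPresh} {X : Presh} {a : GrpAction 𝔾 X} {I : Type} (C : Charts a I)
  (x y z : QuotientStack a)

/-- The pullback to `Y i` of a torsor with an equivariant map to `X`. -/
def chart (i : I) : Presh where
  obj A := {p : x.E.obj A × (C.Y i).obj A // x.toX p.1 = C.φ i p.2}
  map f := TypeCat.ofHom fun p => ⟨(x.E.map f p.1.1, (C.Y i).map f p.1.2), by
    rw [x.toX_map, p.2, C.φ_map]⟩
  map_id A := by
    ext p
    · exact map_id_apply x.E p.1.1
    · exact map_id_apply (C.Y i) p.1.2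
  map_comp f g := by
    ext p
    · exact map_comp_apply x.E f g p.1.1
    · exact map_comp_apply (C.Y i) f g p.1.2

variable {C x}

theorem chart_map_fst {i : I} {A B : TestAlg} (f : A ⟶ B) (c : (C.chart x i).obj A) :
    ((C.chart x i).map f c).1.1 = x.E.map f c.1.1 := rfl

theorem isFppfSheaf_chart (hX : IsFppfSheaf X) (hY : ∀ i, IsFppfSheaf (C.Y i)) (i : I) :
    IsFppfSheaf (C.chart x i) := by
  refine isFppfSheaf_of_glue (fun {A W} hW {c c'} h => ?_) (fun {A} R hnat huniq H => ?_)
  · refine Subtype.ext (Prod.ext ?_ ?_)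
    · exact x.sheaf.sep hW fun B f hf => congrArg (fun t => t.1.1) (h B f hf)
    · exact (hY i).sep hW fun B f hf => congrArg (fun t => t.1.2) (h B f hf)
  · obtain ⟨e, he⟩ := x.sheaf.glue (A := A) (fun B f s => ∃ c, R B f c ∧ s = c.1.1)
      (by rintro B D f g _ ⟨c, hc, rfl⟩; exact ⟨_, hnat _ _ _ g _ hc, rfl⟩)
      (by rintro B f _ _ ⟨c, hc, rfl⟩ ⟨c', hc', rfl⟩; rw [huniq _ _ _ _ hc hc'])
      (H.mono fun B f ⟨c, hc⟩ => ⟨_, c, hc, rfl⟩)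
    obtain ⟨y, hy⟩ := (hY i).glue (A := A) (fun B f s => ∃ c, R B f c ∧ s = c.1.2)
      (by rintro B D f g _ ⟨c, hc, rfl⟩; exact ⟨_, hnat _ _ _ g _ hc, rfl⟩)
      (by rintro B f _ _ ⟨c, hc, rfl⟩ ⟨c', hc', rfl⟩; rw [huniq _ _ _ _ hc hc'])
      (H.mono fun B f ⟨c, hc⟩ => ⟨_, c, hc, rfl⟩)
    refine ⟨⟨(e, y), hX.sep H fun B f ⟨c, hc⟩ => ?_⟩, fun B f c hc => ?_⟩
    · rw [← x.toX_map, ← C.φ_map, he B f _ ⟨c, hc, rfl⟩, hy B f _ ⟨c, hc, rfl⟩, c.2]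
    · exact Subtype.ext (Prod.ext (he B f _ ⟨c, hc, rfl⟩) (hy B f _ ⟨c, hc, rfl⟩))

/-- Locally, every point of the torsor is a translate of a point of a chart. -/
theorem cov_total {A : TestAlg} (e : x.E.obj A) : Cov A fun B h =>
    ∃ (i : I) (g : 𝔾.obj B) (c : (C.chart x i).obj B), x.E.map h e = x.action.act g c.1.1 := by
  refine (C.cov (x.toX e)).mono fun B h ⟨i, g, y, hy⟩ => ?_
  refine ⟨i, g, ⟨(x.action.act g⁻¹ (x.E.map h e), y), ?_⟩, ?_⟩
  · change x.toX (x.action.act g⁻¹ (x.E.map h e)) = _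
    rw [x.toX_act, x.toX_map, hy, a.inv_act_act]
  · exact (x.action.act_inv_act _ _).symm

theorem cov_chart : Cov x.base fun B f => ∃ (i : I) (c : (C.chart x i).obj B),
    x.proj c.1.1 = f := by
  refine x.cov_base.trans ?_
  rintro B _ ⟨e, rfl⟩
  refine (cov_total (C := C) e).mono fun D h ⟨i, g, c, hc⟩ => ⟨i, c, ?_⟩
  rw [← x.proj_map, hc, x.proj_act]

theorem chart_disjoint {i j : I} (hij : i ≠ j) {A : TestAlg} (c : (C.chart x i).obj A)
    (c' : (C.chart x j).obj A) (h : x.proj c.1.1 = x.proj c'.1.1) : Subsingleton A := by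
  obtain ⟨g, hg, -⟩ := x.simply_transitive _ _ h
  refine C.disjoint hij (g := g) (y := c.1.2) (y' := c'.1.2) ?_
  rw [← c.2, ← c'.2, ← hg, x.toX_act]

theorem chart_transitive {i : I} {A : TestAlg} (c c' : (C.chart x i).obj A)
    {g : 𝔾.obj A} (hg : x.action.act g c.1.1 = c'.1.1) :
    ∃! q : (C.Q i).obj A, C.ρ i q = g ∧ (C.b i).act q c.1.2 = c'.1.2 :=
  C.existsUnique (by rw [← c.2, ← c'.2, ← hg, x.toX_act])

variable (C x)

/-- The ideal of the open and closed piece of the base over which the torsor maps to the `i`-th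
chart: the functions which vanish wherever there is a point of the chart. -/
def ideal (i : I) : Ideal x.base where
  carrier := {r | ∀ B (c : (C.chart x i).obj B), (x.proj c.1.1).hom r = 0}
  add_mem' h h' B c := by rw [map_add, h, h', add_zero]
  zero_mem' B c := map_zero _
  smul_mem' r s h B c := by rw [smul_eq_mul, map_mul, h, mul_zero]

/-- The coordinate ring of the `i`-th piece of the base. -/
abbrev pieceRing (i : I) : TestAlg := CommAlgCat.of ℂ (x.base ⧸ C.ideal x i)

/-- The inclusion of the `i`-th piece of the base. -/
def incl (i : I) : x.base ⟶ C.pieceRing x i := CommAlgCat.ofHom (Ideal.Quotient.mkₐ ℂ _)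

variable {C x}

theorem incl_surjective (i : I) : Function.Surjective (C.incl x i).hom :=
  Ideal.Quotient.mk_surjective

theorem incl_eq_zero {i : I} {r : x.base} : (C.incl x i).hom r = 0 ↔ r ∈ C.ideal x i :=
  Ideal.Quotient.eq_zero_iff_mem

theorem incl_cancel {i : I} {B : TestAlg} {u v : C.pieceRing x i ⟶ B}
    (h : C.incl x i ≫ u = C.incl x i ≫ v) : u = v := by
  ext r
  obtain ⟨r, rfl⟩ := incl_surjective i r
  exact congrArg (fun t : x.base ⟶ B => t.hom r) h

/-- The map from the `i`-th chart to the `i`-th piece of the base. -/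
def chartProj {i : I} {A : TestAlg} (c : (C.chart x i).obj A) : C.pieceRing x i ⟶ A :=
  CommAlgCat.ofHom (Ideal.Quotient.liftₐ _ (x.proj c.1.1).hom fun _ hr => hr A c)

theorem incl_chartProj {i : I} {A : TestAlg} (c : (C.chart x i).obj A) :
    C.incl x i ≫ chartProj c = x.proj c.1.1 := rfl

theorem incl_chartProj_apply {i : I} {A : TestAlg} (c : (C.chart x i).obj A) (r : x.base) :
    (chartProj c).hom ((C.incl x i).hom r) = (x.proj c.1.1).hom r := rfl

/-- The base is the disjoint union of its pieces: functions on the pieces, pulled back to the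
charts, glue because charts with different indices never meet over a nonempty scheme. -/
theorem incl_bijective : Function.Bijective fun (r : x.base) (i : I) => (C.incl x i).hom r := by
  constructor
  · intro r s h
    refine elem_ext_of_cov (cov_chart (C := C) (x := x)) ?_
    rintro B _ ⟨i, c, rfl⟩
    rw [← incl_chartProj_apply, ← incl_chartProj_apply]
    exact congrArg _ (congrFun h i)
  · intro r
    obtain ⟨(s : x.base), hs⟩ := isFppfSheaf_affineLine.glue (A := x.base)
      (fun B f (t : B) => ∃ (i : I) (c : (C.chart x i).obj B), x.proj c.1.1 = f ∧
        t = (chartProj c).hom (r i))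
      (by
        rintro B D _ g _ ⟨i, c, rfl, rfl⟩
        refine ⟨i, (C.chart x i).map g c, x.proj_map _ _, ?_⟩
        change (chartProj c ≫ g).hom (r i) = _
        congr 2
        refine incl_cancel ?_
        rw [incl_chartProj, chart_map_fst, x.proj_map]
        rfl)
      (by
        rintro B f _ _ ⟨i, c, hc, rfl⟩ ⟨j, c', hc', rfl⟩
        by_cases hij : i = j
        · subst hij
          obtain ⟨s, hs⟩ := incl_surjective i (r i)
          rw [← hs, incl_chartProj_apply, incl_chartProj_apply, hc, hc']
        · exact (chart_disjoint hij c c' (hc.trans hc'.symm)).elim _ _)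
      (cov_chart.mono fun B f ⟨i, c, hc⟩ => ⟨_, i, c, hc, rfl⟩)
    refine ⟨s, funext fun i => ?_⟩
    obtain ⟨t, ht⟩ := incl_surjective i (r i)
    dsimp only
    rw [← ht, ← sub_eq_zero, ← map_sub, incl_eq_zero]
    intro B c
    have h : (x.proj c.1.1).hom s = (chartProj c).hom (r i) := hs B _ _ ⟨i, c, rfl, rfl⟩
    rw [map_sub, h, ← ht, incl_chartProj_apply, sub_self]

/-- Only finitely many pieces are nonempty, since a covering is refined by a finite one. -/
theorem finite_pieces : {i | Nontrivial (C.pieceRing x i)}.Finite := by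
  obtain ⟨J, _, B, k, hk, hc⟩ := (cov_chart (C := C) (x := x)).exists_finite
  choose i c hc' using hk
  refine (Set.finite_range i).subset fun i₀ hi₀ => ?_
  by_contra hi
  have h1 : (1 : x.base) ∈ C.ideal x i₀ := by
    intro A c₀
    refine elem_ext_of_cov (hc.pullback (x.proj c₀.1.1)) ?_
    rintro D h ⟨j, l, hl⟩
    have : Subsingleton D := by
      refine chart_disjoint (i := i j) (j := i₀) (fun h => hi ⟨j, h⟩)
        ((C.chart x (i j)).map l (c j)) ((C.chart x i₀).map h c₀) ?_
      rw [chart_map_fst, chart_map_fst, x.proj_map, x.proj_map, hl, hc']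
    exact Subsingleton.elim _ _
  rw [← incl_eq_zero, map_one] at h1
  have : Nontrivial (C.pieceRing x i₀) := hi₀
  exact one_ne_zero h1

/-- The `i`-th chart has local sections over the `i`-th piece; where another chart has a section,
the piece is empty. -/
theorem cov_piece (hX : IsFppfSheaf X) (hY : ∀ i, IsFppfSheaf (C.Y i)) (i : I) :
    Cov (C.pieceRing x i) fun B f => ∃ c : (C.chart x i).obj B, chartProj c = f := by
  classical
  refine ((cov_chart (C := C) (x := x)).pullback (C.incl x i)).mono ?_
  rintro B f ⟨j, c, hc⟩
  by_cases hij : j = i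
  · subst hij
    exact ⟨c, incl_cancel (by rw [incl_chartProj, hc])⟩
  · have hB : Subsingleton B := by
      obtain ⟨ε, hε⟩ := (incl_bijective (C := C) (x := x)).2 (Pi.single i 1)
      have h₁ := congrFun hε i
      have h₂ := congrFun hε j
      rw [Pi.single_eq_same] at h₁
      rw [Pi.single_eq_of_ne hij] at h₂
      have h₃ := congrArg (fun t : x.base ⟶ B => t.hom ε) hc
      change (x.proj c.1.1).hom ε = f.hom ((C.incl x i).hom ε) at h₃
      dsimp only at h₁ h₂
      rw [h₁, map_one, ← incl_chartProj_apply, h₂, map_zero] at h₃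
      exact subsingleton_of_zero_eq_one h₃
    obtain ⟨c', -⟩ := (isFppfSheaf_chart (x := x) hX hY i).zero B hB
    exact ⟨c', CommAlgCat.hom_ext (AlgHom.ext fun _ => hB.elim _ _)⟩

variable (C x)

/-- The `i`-th piece of a torsor with an equivariant map to `X`, as an object of the quotient
stack `[Y i/Q i]`. -/
def piece (hX : IsFppfSheaf X) (hY : ∀ i, IsFppfSheaf (C.Y i)) (i : I) :
    QuotientStack (C.b i) where
  base := C.pieceRing x i
  E := C.chart x i
  sheaf := isFppfSheaf_chart hX hY i
  action :=
    { act := fun {A} q c => ⟨(x.action.act (C.ρ i q) c.1.1, (C.b i).act q c.1.2), by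
        rw [x.toX_act, c.2, C.φ_act]⟩
      one_act := fun c => Subtype.ext (Prod.ext
        ((congrArg (fun g => x.action.act g c.1.1) (map_one (C.ρ i))).trans
          (x.action.one_act _)) ((C.b i).one_act _))
      mul_act := fun q q' c => Subtype.ext (Prod.ext
        ((congrArg (fun g => x.action.act g c.1.1) (map_mul (C.ρ i) q q')).trans
          (x.action.mul_act _ _ _)) ((C.b i).mul_act _ _ _))
      map_act := fun f q c => Subtype.ext (Prod.ext
        ((x.action.map_act f _ _).trans (by rw [← C.ρ_map]; rfl)) ((C.b i).map_act f _ _)) }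
  proj := chartProj
  proj_map f c := incl_cancel (x.proj_map f c.1.1)
  proj_act q c := incl_cancel (x.proj_act _ c.1.1)
  simply_transitive c c' h := by
    have h' : x.proj c.1.1 = x.proj c'.1.1 := by rw [← incl_chartProj, h, incl_chartProj]
    obtain ⟨g, hg, hu⟩ := x.simply_transitive _ _ h'
    obtain ⟨q, ⟨h₁, h₂⟩, hq⟩ := chart_transitive c c' hg
    refine ⟨q, Subtype.ext (Prod.ext (by rw [← hg, ← h₁]) h₂), fun q' hq' => hq q' ⟨?_, ?_⟩⟩
    · exact hu _ (congrArg (fun t => t.1.1) hq')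
    · exact congrArg (fun t => t.1.2) hq'
  locally_trivial := fppfLocally_section (isFppfSheaf_chart hX hY i) chartProj
    (fun f c => incl_cancel (x.proj_map f c.1.1)) (cov_piece hX hY i)
  toX c := c.1.2
  toX_map _ _ := rfl
  toX_act _ _ := rfl

variable {C x y}

/-- The map on charts induced by a morphism of torsors. -/
def chartMap (u : x ⟶ y) {i : I} {A : TestAlg} (c : (C.chart x i).obj A) : (C.chart y i).obj A :=
  ⟨(u.total A c.1.1, c.1.2), by rw [← c.2]; exact u.toX_total _⟩

/-- The morphism of pieces induced by a morphism of torsors. -/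
def pieceMap (hX : IsFppfSheaf X) (hY : ∀ i, IsFppfSheaf (C.Y i)) (u : x ⟶ y) (i : I) :
    C.piece x hX hY i ⟶ C.piece y hX hY i :=
  QuotientStack.Hom.mk (x := C.piece x hX hY i) (y := C.piece y hX hY i)
    (CommAlgCat.ofHom (Ideal.quotientMapₐ (C.ideal x i) u.base.hom fun r hr B c => by
      have h := hr B (chartMap u c)
      change (y.proj (u.total B c.1.1)).hom r = 0 at h
      rwa [u.proj_total] at h))
    (fun _ c => chartMap u c)
    (fun f c => Subtype.ext (Prod.ext (u.total_map f c.1.1) rfl))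
    (fun c => incl_cancel (u.proj_total c.1.1))
    (fun q c => Subtype.ext (Prod.ext (u.total_act _ c.1.1) rfl))
    (fun _ => rfl)

theorem incl_pieceMap_base (hX : IsFppfSheaf X) (hY : ∀ i, IsFppfSheaf (C.Y i)) (u : x ⟶ y)
    (i : I) : C.incl y i ≫ (pieceMap hX hY u i).base = u.base ≫ C.incl x i := rfl

variable (C)

/-- The decomposition of an object of `[X/𝔾]` according to the charts. -/
def toCoprod (hX : IsFppfSheaf X) (hY : ∀ i, IsFppfSheaf (C.Y i)) :
    QuotientStack a ⥤ Coprod (fun i => QuotientStack.π (C.b i)) where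
  obj x :=
    { base := x.base
      part := C.piece x hX hY
      incl := C.incl x
      bijective := incl_bijective
      finite := finite_pieces }
  map u :=
    { base := u.base
      part := pieceMap hX hY u
      comm := fun i => incl_pieceMap_base hX hY u i }
  map_id x := by
    refine Coprod.Hom.ext rfl (funext fun i => QuotientStack.hom_ext ?_ fun A e => rfl)
    exact incl_cancel rfl
  map_comp u v := by
    refine Coprod.Hom.ext rfl (funext fun i => QuotientStack.hom_ext ?_ fun A e => rfl)
    exact incl_cancel rfl

end Charts

namespace Charts

variable {𝔾 : GrpPresh} {X : Presh} {a : GrpAction 𝔾 X} {I : Type} {C : Charts a I}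
  (hX : IsFppfSheaf X) (hY : ∀ i, IsFppfSheaf (C.Y i))

theorem chart_ext {x : QuotientStack a} {i : I} {A : TestAlg} {c c' : (C.chart x i).obj A}
    (h₁ : c.1.1 = c'.1.1) (h₂ : c.1.2 = c'.1.2) : c = c' := Subtype.ext (Prod.ext h₁ h₂)

theorem toCoprod_faithful : (C.toCoprod hX hY).Faithful where
  map_injective {x y u v} h := by
    have hb : u.base = v.base := congrArg Coprod.Hom.base h
    refine QuotientStack.hom_ext hb fun A e => ?_
    refine y.sheaf.sep (cov_total (C := C) e) fun B k ⟨i, g, c, hc⟩ => ?_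
    rw [← u.total_map, ← v.total_map, hc, u.total_act, v.total_act]
    have hp : pieceMap hX hY u i = pieceMap hX hY v i := congrFun (congrArg Coprod.Hom.part h) i
    have ht := congrArg (fun t : C.piece x hX hY i ⟶ C.piece y hX hY i => (t.total B c).1.1) hp
    exact congrArg _ ht

section Full

variable {x y : QuotientStack a} (w : (C.toCoprod hX hY).obj x ⟶ (C.toCoprod hX hY).obj y)

/-- The morphism of bases underlying a morphism between decompositions. -/
def homBase : y.base ⟶ x.base := w.base

/-- The morphism of pieces of the bases underlying a morphism between decompositions. -/
def pieceBase (i : I) : C.pieceRing y i ⟶ C.pieceRing x i := (w.part i).base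

/-- The effect on points of charts of a morphism between decompositions. -/
def partMap {i : I} {A : TestAlg} (c : (C.chart x i).obj A) : (C.chart y i).obj A :=
  (w.part i).total A c

theorem partMap_snd {i : I} {A : TestAlg} (c : (C.chart x i).obj A) :
    (partMap hX hY w c).1.2 = c.1.2 := (w.part i).toX_total c

theorem partMap_map {i : I} {A B : TestAlg} (f : A ⟶ B) (c : (C.chart x i).obj A) :
    partMap hX hY w ((C.chart x i).map f c) = (C.chart y i).map f (partMap hX hY w c) :=
  (w.part i).total_map f c

theorem partMap_act {i : I} {A : TestAlg} (q : (C.Q i).obj A) (c c' : (C.chart x i).obj A)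
    (h₁ : c'.1.1 = x.action.act (C.ρ i q) c.1.1) (h₂ : c'.1.2 = (C.b i).act q c.1.2) :
    (partMap hX hY w c').1.1 = y.action.act (C.ρ i q) (partMap hX hY w c).1.1 := by
  have h := (w.part i).total_act q c
  have hc : c' = (C.piece x hX hY i).action.act q c := chart_ext h₁ h₂
  rw [hc]
  exact congrArg (fun t : (C.chart y i).obj A => t.1.1) h

theorem proj_partMap {i : I} {A : TestAlg} (c : (C.chart x i).obj A) :
    y.proj (partMap hX hY w c).1.1 = homBase hX hY w ≫ x.proj c.1.1 := by
  have h : chartProj (partMap hX hY w c) = pieceBase hX hY w i ≫ chartProj c :=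
    (w.part i).proj_total c
  have h' : C.incl y i ≫ pieceBase hX hY w i = homBase hX hY w ≫ C.incl x i := w.comm i
  rw [← incl_chartProj, ← incl_chartProj, ← Category.assoc, ← h', Category.assoc, h]

/-- The local description of the morphism of torsors glued from morphisms of charts. -/
def GluedRel {A : TestAlg} (e : x.E.obj A) (B : TestAlg) (h : A ⟶ B) (s : y.E.obj B) : Prop :=
  ∃ (i : I) (g : 𝔾.obj B) (c : (C.chart x i).obj B), x.E.map h e = x.action.act g c.1.1 ∧
    s = y.action.act g (partMap hX hY w c).1.1

/-- Morphisms of charts glue: two descriptions of a point of the torsor as a translate of a point of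
a chart differ by a point of the group of that chart. -/
theorem exists_glued {A : TestAlg} (e : x.E.obj A) :
    ∃ s : y.E.obj A, ∀ B h t, GluedRel hX hY w e B h t → y.E.map h s = t := by
  refine y.sheaf.glue (A := A) (GluedRel hX hY w e) ?_ ?_ ?_
  · rintro B D h k _ ⟨i, g, c, hc, rfl⟩
    refine ⟨i, 𝔾.map k g, (C.chart x i).map k c, ?_, ?_⟩
    · rw [map_comp_apply, hc, x.action.map_act]
      rfl
    · rw [y.action.map_act, partMap_map]
      rfl
  · rintro B h _ _ ⟨i, g, c, hc, rfl⟩ ⟨j, g', c', hc', rfl⟩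
    have hcc : x.action.act (g'⁻¹ * g) c.1.1 = c'.1.1 := by
      rw [x.action.mul_act, ← hc, hc', x.action.inv_act_act]
    by_cases hij : i = j
    · subst hij
      obtain ⟨q, ⟨hq, hq'⟩, -⟩ := chart_transitive c c' hcc
      rw [partMap_act hX hY w q c c' (by rw [hq, hcc]) hq'.symm, ← y.action.mul_act, hq,
        mul_inv_cancel_left]
    · refine y.sheaf.subsingleton (chart_disjoint hij c c' ?_) _ _
      rw [← hcc, x.proj_act]
  · exact (cov_total (C := C) e).mono fun B h ⟨i, g, c, hc⟩ => ⟨_, i, g, c, hc, rfl⟩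

theorem toCoprod_map_surjective : ∃ u : x ⟶ y, (C.toCoprod hX hY).map u = w := by
  choose t ht using fun A => exists_glued hX hY w (A := A)
  have loc : ∀ {A : TestAlg} (e : x.E.obj A), Cov A fun B h => ∃ (i : I) (g : 𝔾.obj B)
      (c : (C.chart x i).obj B), x.E.map h e = x.action.act g c.1.1 ∧
        y.E.map h (t A e) = y.action.act g (partMap hX hY w c).1.1 := fun {A} e =>
    (cov_total (C := C) e).mono fun B h ⟨i, g, c, hc⟩ =>
      ⟨i, g, c, hc, ht A e B h _ ⟨i, g, c, hc, rfl⟩⟩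
  let u : QuotientStack.Hom x y :=
    { base := homBase hX hY w
      total := t
      total_map := fun {A B} f e => by
        refine y.sheaf.sep (loc (x.E.map f e)) ?_
        rintro D h ⟨i, g, c, hc, hc'⟩
        rw [hc', ← map_comp_apply]
        rw [← map_comp_apply] at hc
        exact (ht A e D (f ≫ h) _ ⟨i, g, c, hc, rfl⟩).symm
      proj_total := fun {A} e => by
        refine hom_ext_of_cov (loc e) ?_
        rintro D h ⟨i, g, c, hc, hc'⟩
        rw [← y.proj_map, hc', y.proj_act, proj_partMap, Category.assoc, ← x.proj_map, hc]
        exact congrArg _ (x.proj_act _ _).symm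
      total_act := fun {A} k e => by
        refine y.sheaf.sep (loc e) ?_
        rintro D h ⟨i, g, c, hc, hc'⟩
        rw [y.action.map_act, hc', ← y.action.mul_act]
        refine ht A _ D h _ ⟨i, 𝔾.map h k * g, c, ?_, rfl⟩
        rw [x.action.map_act, hc, x.action.mul_act]
      toX_total := fun {A} e => by
        refine hX.sep (loc e) ?_
        rintro D h ⟨i, g, c, hc, hc'⟩
        rw [← y.toX_map, ← x.toX_map, hc', hc, y.toX_act, x.toX_act, c.2,
          (partMap hX hY w c).2, partMap_snd] }
  refine ⟨u, Coprod.Hom.ext rfl (funext fun i => QuotientStack.hom_ext ?_ fun A c => ?_)⟩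
  · exact incl_cancel ((incl_pieceMap_base hX hY u i).trans (w.comm i).symm)
  · refine chart_ext ?_ (partMap_snd hX hY w c).symm
    have h := ht A c.1.1 A (𝟙 A) _ ⟨i, 1, c, by rw [map_id_apply, x.action.one_act], rfl⟩
    rw [map_id_apply, y.action.one_act] at h
    exact h

end Full

theorem toCoprod_full : (C.toCoprod hX hY).Full where
  map_surjective := toCoprod_map_surjective hX hY

/-! ### Essential surjectivity -/

end Charts

section Decomposition

variable {I : Type} {R : TestAlg} {P : I → TestAlg} (incl : ∀ i, R ⟶ P i)

/-- Idempotents with sum `1` give a covering on each member of which one of them is `1`. -/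
theorem cov_of_idempotents (J : Finset I) : ∀ {A : TestAlg} (ε : I → A),
    (∀ i, ε i * ε i = ε i) → ∑ i ∈ J, ε i = 1 →
    Cov A fun _ h => ∃ i, h.hom (ε i) = 1 := by
  classical
  induction J using Finset.induction_on with
  | empty =>
    intro A ε _ h
    exact .zero (subsingleton_of_zero_eq_one (by simpa using h))
  | insert j J hj ih =>
    intro A ε hε h
    have hidem : IsIdempotentElem (ε j) := hε j
    let p₁ : A ⟶ CommAlgCat.of ℂ (A ⧸ Ideal.span {1 - ε j}) :=
      CommAlgCat.ofHom (Ideal.Quotient.mkₐ ℂ _)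
    let p₂ : A ⟶ CommAlgCat.of ℂ (A ⧸ Ideal.span {ε j}) :=
      CommAlgCat.ofHom (Ideal.Quotient.mkₐ ℂ _)
    have e₁ : p₁.hom (ε j) = 1 := by
      rw [← sub_eq_zero, ← neg_eq_zero, neg_sub, ← map_one p₁.hom, ← map_sub]
      exact Ideal.Quotient.eq_zero_iff_mem.2 (Ideal.mem_span_singleton_self _)
    have e₂ : p₂.hom (ε j) = 0 :=
      Ideal.Quotient.eq_zero_iff_mem.2 (Ideal.mem_span_singleton_self _)
    refine .split p₁ p₂ ⟨?_, ?_⟩ (.base fun B f => ⟨j, ?_⟩) ?_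
    · intro r s hrs
      obtain ⟨h₁, h₂⟩ := Prod.mk.inj hrs
      rw [← sub_eq_zero, ← map_sub] at h₁ h₂
      obtain ⟨u, hu⟩ := Ideal.mem_span_singleton'.1 (Ideal.Quotient.eq_zero_iff_mem.1 h₁)
      obtain ⟨v, hv⟩ := Ideal.mem_span_singleton'.1 (Ideal.Quotient.eq_zero_iff_mem.1 h₂)
      have hz : (r - s) * ε j = 0 := by
        rw [← hu, mul_assoc, sub_mul, one_mul, hε, sub_self, mul_zero]
      rw [← sub_eq_zero, ← hv, ← hz, ← hv, mul_assoc, hε]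
    · rintro ⟨r, s⟩
      obtain ⟨r, rfl⟩ := Ideal.Quotient.mk_surjective r
      obtain ⟨s, rfl⟩ := Ideal.Quotient.mk_surjective s
      refine ⟨r * ε j + s * (1 - ε j), Prod.ext ?_ ?_⟩
      · change p₁.hom _ = p₁.hom r
        simp [e₁]
      · change p₂.hom _ = p₂.hom s
        simp [e₂]
    · change f.hom (p₁.hom (ε j)) = 1
      rw [e₁, map_one]
    · refine ih (fun i => p₂.hom (ε i)) (fun i => by rw [← map_mul, hε]) ?_
      rw [Finset.sum_insert hj] at h
      have h' := congrArg p₂.hom h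
      rwa [map_add, e₂, zero_add, map_one, map_sum] at h'

variable {incl} (hbij : Function.Bijective fun (r : R) (i : I) => (incl i).hom r)
include hbij

theorem decomp_surjective (i : I) : Function.Surjective (incl i).hom := by
  classical
  intro r
  obtain ⟨s, hs⟩ := hbij.2 (Pi.single i r)
  exact ⟨s, by simpa using congrFun hs i⟩

theorem decomp_cancel {i : I} {B : TestAlg} {u v : P i ⟶ B} (h : incl i ≫ u = incl i ≫ v) :
    u = v := by
  ext r
  obtain ⟨r, rfl⟩ := decomp_surjective hbij i r
  exact congrArg (fun t : R ⟶ B => t.hom r) h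

theorem decomp_disjoint {i j : I} (hij : i ≠ j) {B : TestAlg} {u : P i ⟶ B} {v : P j ⟶ B}
    (h : incl i ≫ u = incl j ≫ v) : Subsingleton B := by
  classical
  obtain ⟨ε, hε⟩ := hbij.2 (Pi.single i 1)
  have h₁ : (incl i).hom ε = 1 := by simpa using congrFun hε i
  have h₂ : (incl j).hom ε = 0 := by simpa [hij.symm] using congrFun hε j
  have h₃ := congrArg (fun t : R ⟶ B => t.hom ε) h
  change u.hom ((incl i).hom ε) = v.hom ((incl j).hom ε) at h₃
  rw [h₁, h₂, map_one, map_zero] at h₃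
  exact (subsingleton_of_zero_eq_one h₃.symm)

/-- The pieces of a decomposition cover the base. -/
theorem decomp_cov (hfin : {i | Nontrivial (P i)}.Finite) :
    Cov R fun B h => ∃ (i : I) (k : P i ⟶ B), h = incl i ≫ k := by
  classical
  choose ε hε using fun i : I => hbij.2 (Pi.single i 1)
  have h₁ : ∀ i, (incl i).hom (ε i) = 1 := fun i => by simpa using congrFun (hε i) i
  have h₂ : ∀ i j, j ≠ i → (incl j).hom (ε i) = 0 := fun i j hij => by
    simpa [hij] using congrFun (hε i) j
  refine (cov_of_idempotents hfin.toFinset ε (fun i => hbij.1 (funext fun j => ?_))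
    (hbij.1 (funext fun j => ?_))).mono ?_
  · by_cases hij : j = i
    · subst hij; simp [h₁]
    · simp [h₂ _ _ hij]
  · dsimp only
    rw [map_sum, map_one]
    by_cases hj : Nontrivial (P j)
    · rw [Finset.sum_eq_single j (fun i _ hi => h₂ i j hi.symm)
        (fun h => (h (hfin.mem_toFinset.2 hj)).elim), h₁]
    · have := not_nontrivial_iff_subsingleton.1 hj
      exact Subsingleton.elim _ _
  · rintro B h ⟨i, hi⟩
    have hker : ∀ r : R, (incl i).hom r = 0 → h.hom r = 0 := by
      intro r hr
      have : r * ε i = 0 := hbij.1 (funext fun j => by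
        by_cases hij : j = i
        · subst hij; simp [hr]
        · simp [h₂ _ _ hij])
      rw [← mul_one (h.hom r), ← hi, ← map_mul, this, map_zero]
    refine ⟨i, CommAlgCat.ofHom (AlgHom.liftOfSurjective (incl i).hom
      (decomp_surjective hbij i) h.hom hker), ?_⟩
    ext r
    exact (AlgHom.liftOfSurjective_apply (incl i).hom
      (decomp_surjective hbij i) h.hom hker r).symm

end Decomposition

namespace Charts

variable {𝔾 : GrpPresh} {X : Presh} {a : GrpAction 𝔾 X} {I : Type} {C : Charts a I}

section EssSurj

variable (z : Coprod (fun i => QuotientStack.π (C.b i)))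

/-- The inclusion of the `i`-th piece of the base. -/
def pieceIncl (i : I) : z.base ⟶ (z.part i).base := z.incl i

theorem pieceIncl_bijective :
    Function.Bijective fun (r : z.base) (i : I) => (pieceIncl z i).hom r := z.bijective

theorem pieceIncl_cov : Cov z.base fun B h => ∃ (i : I) (k : (z.part i).base ⟶ B),
    h = pieceIncl z i ≫ k := decomp_cov (pieceIncl_bijective z) z.finite

/-- The disjoint union of the total spaces of the torsors in a decomposition. -/
def sigmaPresh : Presh where
  obj A := Σ i : I, (z.part i).E.obj A
  map f := TypeCat.ofHom fun p => ⟨p.1, (z.part p.1).E.map f p.2⟩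
  map_id A := by
    refine ConcreteCategory.hom_ext _ _ fun p : Σ i : I, (z.part i).E.obj A => ?_
    exact congrArg (fun e => (⟨p.1, e⟩ : Σ i : I, (z.part i).E.obj A))
      (map_id_apply (z.part p.1).E p.2)
  map_comp {A _ D} f g := by
    refine ConcreteCategory.hom_ext _ _ fun p : Σ i : I, (z.part i).E.obj A => ?_
    exact congrArg (fun e => (⟨p.1, e⟩ : Σ i : I, (z.part i).E.obj D))
      (map_comp_apply (z.part p.1).E f g p.2)

/-- Two points lie in the same torsor, where they differ by a point of the group which maps
to `g`. -/
def sigmaRel {A : TestAlg} (p p' : (sigmaPresh z).obj A) (g : 𝔾.obj A) : Prop :=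
  (∃ (i : I) (d : (z.part i).E.obj A) (q : (C.Q i).obj A), p = ⟨i, d⟩ ∧
    p' = ⟨i, (z.part i).action.act q d⟩ ∧ g = C.ρ i q) ∨ Subsingleton A

/-- The descent data for a `𝔾`-torsor given by torsors under the groups of the charts over the
pieces of a decomposition. -/
def descentData (h𝔾 : IsFppfSheaf (setOf 𝔾)) (hX : IsFppfSheaf X) : DescentData a where
  base := z.base
  D := sigmaPresh z
  proj p := pieceIncl z p.1 ≫ (z.part p.1).proj p.2
  proj_map f p := by
    rw [Category.assoc, ← (z.part p.1).proj_map]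
    rfl
  cov := by
    refine (pieceIncl_cov z).trans ?_
    rintro B _ ⟨i, k, rfl⟩
    refine ((z.part i).cov_base.pullback k).mono ?_
    rintro D h ⟨e, he⟩
    exact ⟨⟨i, e⟩, by rw [he, Category.assoc]⟩
  rel := sigmaRel z
  exists_rel := by
    rintro A ⟨i, d⟩ ⟨j, d'⟩ h
    by_cases hij : i = j
    · subst hij
      obtain ⟨q, rfl, -⟩ := (z.part i).simply_transitive d d'
        (decomp_cancel (pieceIncl_bijective z) h)
      exact ⟨_, Or.inl ⟨i, d, q, rfl, rfl, rfl⟩⟩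
    · exact ⟨1, Or.inr (decomp_disjoint (pieceIncl_bijective z) hij h)⟩
  rel_unique := by
    rintro A p p' g g' (⟨i, d, q, rfl, rfl, rfl⟩ | hA) H
    · rcases H with ⟨j, d', q', h, h', rfl⟩ | hA
      · cases h
        rw [(z.part i).act_injective (eq_of_heq (Sigma.mk.inj h').2)]
      · exact h𝔾.subsingleton hA _ _
    · exact h𝔾.subsingleton hA _ _
  rel_proj := by
    rintro A p p' g (⟨i, d, q, rfl, rfl, rfl⟩ | hA)
    · exact congrArg _ ((z.part i).proj_act q d).symm
    · exact CommAlgCat.hom_ext (AlgHom.ext fun _ => hA.elim _ _)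
  rel_map := by
    rintro A B f p p' g (⟨i, d, q, rfl, rfl, rfl⟩ | hA)
    · refine Or.inl ⟨i, (z.part i).E.map f d, (C.Q i).map f q, rfl, ?_, (C.ρ_map i f q).symm⟩
      exact congrArg (Sigma.mk i) ((z.part i).action.map_act f q d)
    · exact Or.inr (subsingleton_of_hom f hA)
  rel_trans := by
    rintro A p p' p'' g g' (⟨i, d, q, rfl, rfl, rfl⟩ | hA) H
    · rcases H with ⟨j, d', q', h, rfl, rfl⟩ | hA
      · cases h
        refine Or.inl ⟨i, d, q' * q, rfl, ?_, (map_mul _ _ _).symm⟩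
        exact congrArg (Sigma.mk i) ((z.part i).action.mul_act q' q d).symm
      · exact Or.inr hA
    · exact Or.inr hA
  toX p := C.φ p.1 ((z.part p.1).toX p.2)
  toX_map f p := by
    rw [← C.φ_map, ← (z.part p.1).toX_map]
    rfl
  toX_rel := by
    rintro A p p' g (⟨i, d, q, rfl, rfl, rfl⟩ | hA)
    · rw [← C.φ_act, ← (z.part i).toX_act]
    · exact hX.subsingleton hA _ _

variable (h𝔾 : IsFppfSheaf (setOf 𝔾)) (hX : IsFppfSheaf X) (hY : ∀ i, IsFppfSheaf (C.Y i))

/-- The torsor with an equivariant map to `X` glued from a decomposition. -/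
def ofCoprod : QuotientStack a := (descentData z h𝔾 hX).glued h𝔾 hX

/-- A point of the `i`-th torsor gives a point of the `i`-th chart of the glued torsor. -/
def toChart {i : I} {A : TestAlg} (d : (z.part i).E.obj A) :
    (C.chart (ofCoprod z h𝔾 hX) i).obj A :=
  ⟨((descentData z h𝔾 hX).toGlued h𝔾 hX ⟨i, d⟩, (z.part i).toX d),
    (descentData z h𝔾 hX).toX_toGlued h𝔾 hX ⟨i, d⟩⟩

theorem proj_toChart {i : I} {A : TestAlg} (d : (z.part i).E.obj A) :
    (ofCoprod z h𝔾 hX).proj (toChart z h𝔾 hX d).1.1 = pieceIncl z i ≫ (z.part i).proj d :=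
  (descentData z h𝔾 hX).proj_toGlued h𝔾 hX ⟨i, d⟩

/-- The inclusion of the `i`-th piece, as a map out of the base of the glued torsor. -/
def gluedIncl (i : I) : (ofCoprod z h𝔾 hX).base ⟶ (z.part i).base := pieceIncl z i

theorem gluedIncl_injective :
    Function.Injective fun (r : (ofCoprod z h𝔾 hX).base) (i : I) => (gluedIncl z h𝔾 hX i).hom r :=
  (pieceIncl_bijective z).1

/-- The pieces of the base of the glued torsor, as defined by the charts, are the given ones. -/
theorem ideal_ofCoprod (i : I) (r : (ofCoprod z h𝔾 hX).base) :
    r ∈ C.ideal (ofCoprod z h𝔾 hX) i ↔ (gluedIncl z h𝔾 hX i).hom r = 0 := by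
  have key : ∀ (i : I) (r : (ofCoprod z h𝔾 hX).base), r ∈ C.ideal (ofCoprod z h𝔾 hX) i →
      (gluedIncl z h𝔾 hX i).hom r = 0 := by
    intro i r hr
    refine elem_ext_of_cov (z.part i).cov_base ?_
    rintro B _ ⟨d, rfl⟩
    have h := hr B (toChart z h𝔾 hX d)
    rw [proj_toChart] at h
    rw [map_zero]
    exact h
  classical
  refine ⟨key i r, fun hr => ?_⟩
  -- Compare `r` with the function equal to `r` on the `i`-th piece of the decomposition by charts
  -- and to `0` on the other pieces.
  obtain ⟨s, hs⟩ := (incl_bijective (C := C) (x := ofCoprod z h𝔾 hX)).2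
    (Pi.single i ((C.incl (ofCoprod z h𝔾 hX) i).hom r))
  have h₁ : r - s ∈ C.ideal (ofCoprod z h𝔾 hX) i := by
    rw [← incl_eq_zero, map_sub, sub_eq_zero]
    simpa using (congrFun hs i).symm
  have h₂ : ∀ j, j ≠ i → s ∈ C.ideal (ofCoprod z h𝔾 hX) j := fun j hj => by
    rw [← incl_eq_zero]
    simpa [hj] using congrFun hs j
  have hs0 : s = 0 := gluedIncl_injective z h𝔾 hX (funext fun j => by
    dsimp only
    rw [map_zero]
    by_cases hj : j = i
    · subst hj
      have h := key j _ h₁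
      rw [map_sub, hr, zero_sub, neg_eq_zero] at h
      exact h
    · exact key j _ (h₂ j hj))
  rwa [hs0, sub_zero] at h₁

/-- The comparison of the pieces of the two bases. -/
def pieceHom (i : I) : C.pieceRing (ofCoprod z h𝔾 hX) i ⟶ (z.part i).base :=
  CommAlgCat.ofHom (Ideal.Quotient.liftₐ _ (gluedIncl z h𝔾 hX i).hom fun r hr =>
    (ideal_ofCoprod z h𝔾 hX i r).1 hr)

theorem incl_pieceHom (i : I) :
    C.incl (ofCoprod z h𝔾 hX) i ≫ pieceHom z h𝔾 hX i = pieceIncl z i := rfl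

instance isIso_pieceHom (i : I) : IsIso (pieceHom z h𝔾 hX i) := by
  refine (CommAlgCat.isoMk (AlgEquiv.ofBijective (pieceHom z h𝔾 hX i).hom ⟨?_, ?_⟩)).isIso_hom
  · rw [injective_iff_map_eq_zero]
    intro r hr
    obtain ⟨r, rfl⟩ := incl_surjective i r
    exact incl_eq_zero.2 ((ideal_ofCoprod z h𝔾 hX i r).2 hr)
  · intro r
    obtain ⟨s, rfl⟩ := decomp_surjective (pieceIncl_bijective z) i r
    exact ⟨(C.incl (ofCoprod z h𝔾 hX) i).hom s, rfl⟩

/-- The comparison of the torsors in a decomposition with the charts of the glued torsor. -/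
def partHom (i : I) : z.part i ⟶ C.piece (ofCoprod z h𝔾 hX) hX hY i :=
  QuotientStack.Hom.mk (x := z.part i) (y := C.piece (ofCoprod z h𝔾 hX) hX hY i)
    (pieceHom z h𝔾 hX i)
    (fun _ d => toChart z h𝔾 hX d)
    (fun f d => chart_ext ((descentData z h𝔾 hX).toGlued_map h𝔾 hX f ⟨i, d⟩)
      ((z.part i).toX_map f d))
    (fun d => incl_cancel (proj_toChart z h𝔾 hX d))
    (fun q d => chart_ext ((descentData z h𝔾 hX).toGlued_rel h𝔾 hX
      (Or.inl ⟨i, d, q, rfl, rfl, rfl⟩)) ((z.part i).toX_act q d))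
    (fun _ => rfl)

instance isIso_partHom (i : I) : IsIso (partHom z h𝔾 hX hY i) := by
  have : IsIso (partHom z h𝔾 hX hY i).base := isIso_pieceHom z h𝔾 hX i
  exact QuotientStack.isIso_of_isIso_base _

/-- The torsors in a decomposition are the charts of the glued torsor. -/
def partIso (i : I) : z.part i ≅ C.piece (ofCoprod z h𝔾 hX) hX hY i :=
  @asIso _ _ _ _ (partHom z h𝔾 hX hY i) (isIso_partHom z h𝔾 hX hY i)

theorem pieceIncl_partIso_inv (i : I) :
    pieceIncl z i ≫ (partIso z h𝔾 hX hY i).inv.base = C.incl (ofCoprod z h𝔾 hX) i := by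
  have h : pieceHom z h𝔾 hX i ≫ (partIso z h𝔾 hX hY i).inv.base = 𝟙 _ :=
    congrArg QuotientStack.Hom.base (partIso z h𝔾 hX hY i).inv_hom_id
  exact (congrArg (· ≫ _) (incl_pieceHom z h𝔾 hX i).symm).trans
    ((Category.assoc _ _ _).trans ((congrArg (_ ≫ ·) h).trans (Category.comp_id _)))

/-- The decomposition of the glued torsor is the given one. -/
def ofCoprodIso : (C.toCoprod hX hY).obj (ofCoprod z h𝔾 hX) ≅ z where
  hom := Coprod.Hom.mk (x := (C.toCoprod hX hY).obj (ofCoprod z h𝔾 hX)) (y := z) (𝟙 z.base)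
    (fun i => (partIso z h𝔾 hX hY i).inv)
    (fun i => (pieceIncl_partIso_inv z h𝔾 hX hY i).trans
      (Category.id_comp (C.incl (ofCoprod z h𝔾 hX) i)).symm)
  inv := Coprod.Hom.mk (y := (C.toCoprod hX hY).obj (ofCoprod z h𝔾 hX)) (x := z) (𝟙 z.base)
    (fun i => (partIso z h𝔾 hX hY i).hom)
    (fun i => (incl_pieceHom z h𝔾 hX i).trans (Category.id_comp (pieceIncl z i)).symm)
  hom_inv_id := Coprod.Hom.ext (Category.comp_id _)
    (funext fun i => (partIso z h𝔾 hX hY i).inv_hom_id)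
  inv_hom_id := Coprod.Hom.ext (Category.comp_id _)
    (funext fun i => (partIso z h𝔾 hX hY i).hom_inv_id)

end EssSurj

/-- A quotient stack covered by charts is the disjoint union of the quotient stacks of its
charts. -/
theorem stackEquiv (h𝔾 : IsFppfSheaf (setOf 𝔾)) (hX : IsFppfSheaf X)
    (hY : ∀ i, IsFppfSheaf (C.Y i)) :
    StackEquiv (QuotientStack.π a) (Coprod.π fun i => QuotientStack.π (C.b i)) := by
  have := toCoprod_faithful (C := C) hX hY
  have := toCoprod_full (C := C) hX hY
  have : (C.toCoprod hX hY).EssSurj := ⟨fun z => ⟨_, ⟨ofCoprodIso z h𝔾 hX hY⟩⟩⟩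
  exact ⟨C.toCoprod hX hY, {}, ⟨Iso.refl _⟩⟩

end Charts

/-! ### Equivalences of stacks -/

theorem StackEquiv.trans {𝒳 𝒴 𝒵 : Type 1} [Category.{1} 𝒳] [Category.{1} 𝒴] [Category.{1} 𝒵]
    {p : 𝒳 ⥤ TestAlgᵒᵖ} {q : 𝒴 ⥤ TestAlgᵒᵖ} {r : 𝒵 ⥤ TestAlgᵒᵖ} (h : StackEquiv p q)
    (h' : StackEquiv q r) : StackEquiv p r := by
  obtain ⟨F, hF, ⟨e⟩⟩ := h
  obtain ⟨F', hF', ⟨e'⟩⟩ := h'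
  exact ⟨F ⋙ F', inferInstance, ⟨Functor.associator _ _ _ ≪≫ Functor.isoWhiskerLeft F e' ≪≫ e⟩⟩

section CoprodUnit

variable {𝒳 : Type 1} [Category.{1} 𝒳] (p : 𝒳 ⥤ TestAlgᵒᵖ)

theorem isIso_coprod_incl (x : Coprod fun _ : Unit => p) : IsIso (x.incl ()) := by
  refine (CommAlgCat.isoMk (AlgEquiv.ofBijective (x.incl ()).hom ⟨fun r s h => ?_, fun r => ?_⟩)
    ).isIso_hom
  · exact x.bijective.1 (funext fun _ => h)
  · obtain ⟨s, hs⟩ := x.bijective.2 fun _ => r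
    exact ⟨s, congrFun hs ()⟩

/-- The functor from a disjoint union with one term to that term. -/
def coprodUnit : (Coprod fun _ : Unit => p) ⥤ 𝒳 where
  obj x := x.part ()
  map u := u.part ()
  map_id _ := rfl
  map_comp _ _ := rfl

theorem stackEquiv_coprodUnit : StackEquiv (Coprod.π fun _ : Unit => p) p := by
  have hI := isIso_coprod_incl p
  have : (coprodUnit p).Faithful := ⟨fun {x y u v} h => by
    refine Coprod.Hom.ext ?_ (funext fun _ => h)
    have := hI x
    rw [← cancel_mono (x.incl ()), ← u.comm, ← v.comm]
    exact congrArg (fun w => y.incl () ≫ (p.map w).unop) h⟩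
  have : (coprodUnit p).Full := ⟨fun {x y} w => by
    let i := @asIso _ _ _ _ (x.incl ()) (hI x)
    refine ⟨Coprod.Hom.mk (x := x) (y := y) ((y.incl () ≫ (p.map w).unop) ≫ i.inv) (fun _ => w)
      fun _ => ?_, rfl⟩
    exact (Category.comp_id _).symm.trans ((congrArg (_ ≫ ·) i.inv_hom_id.symm).trans
      (Category.assoc _ _ _).symm)⟩
  have : (coprodUnit p).EssSurj := ⟨fun y => ⟨
    { base := (p.obj y).unop
      part := fun _ => y
      incl := fun _ => 𝟙 _
      bijective := ⟨fun r s h => congrFun h (), fun r => ⟨r (), rfl⟩⟩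
      finite := Set.toFinite _ }, ⟨Iso.refl _⟩⟩⟩
  refine ⟨coprodUnit p, {}, ⟨NatIso.ofComponents (fun x => ?_) ?_⟩⟩
  · have := hI x
    exact (asIso (x.incl ())).op
  · intro x y u
    exact Quiver.Hom.unop_inj (u.comm ())

end CoprodUnit

/-! ### Subsheaves and products of sheaves -/

/-- A presheaf of sets `Y` is a sheaf when it embeds in a sheaf `S` such that the sections of `S`
which lie locally in `Y` lie in `Y`. -/
theorem isFppfSheaf_of_injective {S Y : Presh} (hS : IsFppfSheaf S) (m : Y ⟶ S)
    (hinj : ∀ A, Function.Injective (m.app A))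
    (hloc : ∀ (A : TestAlg) (s : S.obj A),
      Cov A (fun B f => ∃ y : Y.obj B, m.app B y = S.map f s) → ∃ y : Y.obj A, m.app A y = s) :
    IsFppfSheaf Y := by
  refine isFppfSheaf_of_glue (fun {A W} H x y h => hinj A (hS.sep H fun B f hf => ?_))
    (fun {A} R hnat huniq H => ?_)
  · rw [← nat_set, ← nat_set, h B f hf]
  · obtain ⟨s, hs⟩ := hS.glue (fun B f t => ∃ y, R B f y ∧ m.app B y = t)
      (fun B C f g s ⟨y, hy, e⟩ => ⟨Y.map g y, hnat _ _ _ _ _ hy, by rw [nat_set, e]⟩)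
      (fun B f s s' ⟨y, hy, e⟩ ⟨y', hy', e'⟩ => by rw [← e, ← e', huniq B f y y' hy hy'])
      (H.mono fun B f ⟨y, hy⟩ => ⟨_, y, hy, rfl⟩)
    obtain ⟨y, rfl⟩ := hloc A s (H.mono fun B f ⟨y, hy⟩ => ⟨y, (hs B f _ ⟨y, hy, rfl⟩).symm⟩)
    exact ⟨y, fun B f y' hy' => hinj B (by rw [nat_set, hs B f _ ⟨y', hy', rfl⟩])⟩

/-- The product of two presheaves of sets. -/
def prodPresh (S T : Presh) : Presh where
  obj A := S.obj A × T.obj A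
  map f := TypeCat.ofHom fun p => (S.map f p.1, T.map f p.2)
  map_id A := by
    refine ConcreteCategory.hom_ext _ _ fun p : S.obj A × T.obj A => ?_
    exact Prod.ext (map_id_apply S p.1) (map_id_apply T p.2)
  map_comp {A _ _} f g := by
    refine ConcreteCategory.hom_ext _ _ fun p : S.obj A × T.obj A => ?_
    exact Prod.ext (map_comp_apply S f g p.1) (map_comp_apply T f g p.2)

theorem isFppfSheaf_prodPresh {S T : Presh} (hS : IsFppfSheaf S) (hT : IsFppfSheaf T) :
    IsFppfSheaf (prodPresh S T) := by
  refine isFppfSheaf_of_glue (fun {A W} H x y h =>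
    show (x : S.obj A × T.obj A) = y from Prod.ext ?_ ?_) (fun {A} R hnat huniq H => ?_)
  · exact hS.sep H fun B f hf => congrArg Prod.fst (h B f hf)
  · exact hT.sep H fun B f hf => congrArg Prod.snd (h B f hf)
  · obtain ⟨s, hs⟩ := hS.glue (fun B f s => ∃ p, R B f p ∧ p.1 = s)
      (fun B C f g s ⟨p, hp, e⟩ => ⟨_, hnat _ _ _ g _ hp, congrArg _ e⟩)
      (fun B f s s' ⟨p, hp, e⟩ ⟨p', hp', e'⟩ => by rw [← e, ← e', huniq B f p p' hp hp'])
      (H.mono fun B f ⟨p, hp⟩ => ⟨_, p, hp, rfl⟩)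
    obtain ⟨t, ht⟩ := hT.glue (fun B f s => ∃ p, R B f p ∧ p.2 = s)
      (fun B C f g s ⟨p, hp, e⟩ => ⟨_, hnat _ _ _ g _ hp, congrArg _ e⟩)
      (fun B f s s' ⟨p, hp, e⟩ ⟨p', hp', e'⟩ => by rw [← e, ← e', huniq B f p p' hp hp'])
      (H.mono fun B f ⟨p, hp⟩ => ⟨_, p, hp, rfl⟩)
    exact ⟨(s, t), fun B f p hp => Prod.ext (hs B f _ ⟨p, hp, rfl⟩) (ht B f _ ⟨p, hp, rfl⟩)⟩

/-! ### Homotopy fixed points of a double coset stack -/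

section FixedPoints

variable {ℍ : GrpPresh} {ι : ℍ ⟶ ℍ} (hι : ι ≫ ι = 𝟙 ℍ) {P P' : SubgroupPresh ℍ}
  (hP' : P' = P.comap ι)

variable (ι) in
/-- The presheaf of the elements `t` with `t ι(t) = 1`, the fixed points of `g ↦ ι(g)⁻¹`. -/
def antiFixed : Presh where
  obj A := {t : ℍ.obj A // t * ι.app A t = 1}
  map {A B} f := TypeCat.ofHom (X := {t : ℍ.obj A // t * ι.app A t = 1})
    (Y := {t : ℍ.obj B // t * ι.app B t = 1}) fun t =>
    ⟨ℍ.map f t.1, by rw [nat_grp, ← map_mul, t.2, map_one]⟩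
  map_id A := ConcreteCategory.hom_ext _ _ fun t : {t : ℍ.obj A // t * ι.app A t = 1} =>
    Subtype.ext (show ℍ.map (𝟙 A) t.1 = t.1 by simp)
  map_comp {A B C} f g := ConcreteCategory.hom_ext _ _ fun t : {t : ℍ.obj A // t * ι.app A t = 1} =>
    Subtype.ext (show ℍ.map (f ≫ g) t.1 = ℍ.map g (ℍ.map f t.1) by simp)

theorem isFppfSheaf_antiFixed (hℍ : IsFppfSheaf (setOf ℍ)) : IsFppfSheaf (antiFixed ι) := by
  refine isFppfSheaf_of_injective hℍ
    { app := fun A => TypeCat.ofHom (X := {t : ℍ.obj A // t * ι.app A t = 1}) (Y := ℍ.obj A)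
        fun t => t.1
      naturality := fun _ _ _ => rfl } (fun A => Subtype.val_injective) (fun A s H => ?_)
  have key : ∀ s : ℍ.obj A, Cov A (fun B f => ∃ y : {t : ℍ.obj B // t * ι.app B t = 1},
      y.1 = ℍ.map f s) → s * ι.app A s = 1 := by
    intro s H
    refine hℍ.sep (x := s * ι.app A s) (y := (1 : ℍ.obj A)) H fun B f ⟨y, hy⟩ => ?_
    change ℍ.map f (s * ι.app A s) = ℍ.map f 1
    rw [map_mul, map_one, ← nat_grp, ← hy, y.2]
  exact ⟨⟨s, key s H⟩, rfl⟩

variable {A : TestAlg}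

/-- The isomorphism `P → P'` given by `ι`. -/
def toOpp : P.toGrp.obj A →* P'.toGrp.obj A :=
  (MonoidHom.snd _ _).comp (((swapGrp hι hP').app A).hom.comp (MonoidHom.inl _ _))

/-- The isomorphism `P' → P` given by `ι`. -/
def ofOpp : P'.toGrp.obj A →* P.toGrp.obj A :=
  (MonoidHom.fst _ _).comp (((swapGrp hι hP').app A).hom.comp (MonoidHom.inr _ _))

theorem toOpp_ofOpp (p : P'.toGrp.obj A) : toOpp hι hP' (ofOpp hι hP' p) = p :=
  Subtype.ext (invol_grp hι p.1)

theorem ofOpp_toOpp (p : P.toGrp.obj A) : ofOpp hι hP' (toOpp hι hP' p) = p :=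
  Subtype.ext (invol_grp hι p.1)

theorem toOpp_map {B : TestAlg} (f : A ⟶ B) (p : P.toGrp.obj A) :
    toOpp hι hP' (P.toGrp.map f p) = P'.toGrp.map f (toOpp hι hP' p) :=
  Subtype.ext (nat_grp ι f p.1)

theorem ofOpp_map {B : TestAlg} (f : A ⟶ B) (p : P'.toGrp.obj A) :
    ofOpp hι hP' (P'.toGrp.map f p) = P.toGrp.map f (ofOpp hι hP' p) :=
  Subtype.ext (nat_grp ι f p.1)

/-- A point of `P × P'`. -/
def pair (p : P.toGrp.obj A) (p' : P'.toGrp.obj A) : (prodGrp P.toGrp P'.toGrp).obj A := (p, p')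

theorem pair_mul (p q : P.toGrp.obj A) (p' q' : P'.toGrp.obj A) :
    pair p p' * pair q q' = pair (p * q) (p' * q') := rfl

theorem swapGrp_pair (p : P.toGrp.obj A) (p' : P'.toGrp.obj A) :
    (swapGrp hι hP').app A (pair p p') = pair (ofOpp hι hP' p') (toOpp hι hP' p) := rfl

theorem map_pair {B : TestAlg} (f : A ⟶ B) (p : P.toGrp.obj A) (p' : P'.toGrp.obj A) :
    (prodGrp P.toGrp P'.toGrp).map f (pair p p') = pair (P.toGrp.map f p) (P'.toGrp.map f p') :=
  rfl

variable (P) in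
/-- The action of `P` on `{t | t ι(t) = 1}` by `p • t = p t ι(p)⁻¹`. -/
def antiAction : GrpAction P.toGrp (antiFixed ι) where
  act {A} p t := (⟨p.1 * t.1 * (ι.app A p.1)⁻¹,
    (show ∀ p t : ℍ.obj A, t * ι.app A t = 1 → ι.app A (ι.app A p) = p →
        p * t * (ι.app A p)⁻¹ * ι.app A (p * t * (ι.app A p)⁻¹) = 1 from fun p t ht hp => by
      rw [map_mul, map_mul, map_inv, hp, mul_assoc p, mul_assoc (ι.app A p),
        mul_assoc p (t * _), mul_assoc t, inv_mul_cancel_left, ← mul_assoc t, ht, one_mul,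
        mul_inv_cancel]) p.1 t.1 t.2 (invol_grp hι p.1)⟩ : {t : ℍ.obj A // t * ι.app A t = 1})
  one_act {A} t := Subtype.ext ((show ∀ t : ℍ.obj A, 1 * t * (ι.app A 1)⁻¹ = t from
    fun t => by simp) t.1)
  mul_act {A} p q t := Subtype.ext ((show ∀ p q t : ℍ.obj A, p * q * t * (ι.app A (p * q))⁻¹ =
      p * (q * t * (ι.app A q)⁻¹) * (ι.app A p)⁻¹ from fun p q t => by
    rw [map_mul]; group) p.1 q.1 t.1)
  map_act {A B} f p t := Subtype.ext ((show ∀ p t : ℍ.obj A, ℍ.map f (p * t * (ι.app A p)⁻¹) =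
      ℍ.map f p * ℍ.map f t * (ι.app B (ℍ.map f p))⁻¹ from fun p t => by
    rw [map_mul, map_mul, map_inv, nat_grp]) p.1 t.1)

variable (hP's : IsFppfSheaf (setOf P'.toGrp))

/-- The action of `P × P'` on the torsor `E × P'` induced by a `P`-torsor `E` along
`p ↦ (p, ι(p))`. -/
def inducedAction {E : Presh} (b : GrpAction P.toGrp E) :
    GrpAction (prodGrp P.toGrp P'.toGrp) (prodPresh E (setOf P'.toGrp)) where
  act {A} g x := ((b.act g.1 x.1, (fun r : P'.toGrp.obj A => g.2 * r * (toOpp hι hP' g.1)⁻¹) x.2) :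
    E.obj A × P'.toGrp.obj A)
  one_act {A} x := Prod.ext (b.one_act x.1) ((show ∀ r : P'.toGrp.obj A,
    1 * r * (toOpp hι hP' (1 : P.toGrp.obj A))⁻¹ = r from fun r => by simp) x.2)
  mul_act {A} g h x := Prod.ext (b.mul_act g.1 h.1 x.1) ((show ∀ (p q : P.toGrp.obj A)
      (p' q' r : P'.toGrp.obj A), p' * q' * r * (toOpp hι hP' (p * q))⁻¹ =
      p' * (q' * r * (toOpp hι hP' q)⁻¹) * (toOpp hι hP' p)⁻¹ from fun p q p' q' r => by
    rw [map_mul]; group) g.1 h.1 g.2 h.2 x.2)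
  map_act {A B} f g x := Prod.ext (b.map_act f g.1 x.1) ((show ∀ (p : P.toGrp.obj A)
      (p' r : P'.toGrp.obj A), P'.toGrp.map f (p' * r * (toOpp hι hP' p)⁻¹) =
      P'.toGrp.map f p' * P'.toGrp.map f r * (toOpp hι hP' (P.toGrp.map f p))⁻¹ from
    fun p p' r => by rw [map_mul, map_mul, map_inv, toOpp_map]) g.1 g.2 x.2)

/-- The object of the double coset stack induced by a `P`-torsor with an equivariant map to
`{t | t ι(t) = 1}`. -/
def induced (x : QuotientStack (antiAction hι P)) : QuotientStack (doubleCoset P P') where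
  base := x.base
  E := prodPresh x.E (setOf P'.toGrp)
  sheaf := isFppfSheaf_prodPresh x.sheaf hP's
  action := inducedAction hι hP' x.action
  proj e := x.proj e.1
  proj_map f e := x.proj_map f e.1
  proj_act g e := x.proj_act g.1 e.1
  simply_transitive {A} e e' h := by
    obtain ⟨p, hp, hu⟩ := x.simply_transitive e.1 e'.1 h
    have key : ∀ r r' : P'.toGrp.obj A, ∃! p', p' * r * (toOpp hι hP' p)⁻¹ = r' :=
      fun r r' => ⟨r' * toOpp hι hP' p * r⁻¹, by simp, fun q hq => by rw [← hq]; group⟩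
    obtain ⟨p', hp', hu'⟩ := key e.2 e'.2
    refine ⟨pair p p', Prod.ext hp hp', fun g hg => ?_⟩
    have h1 : g.1 = p := hu _ (congrArg Prod.fst hg)
    refine Prod.ext h1 (hu' _ ?_)
    have h2 : (fun r : P'.toGrp.obj A => g.2 * r * (toOpp hι hP' g.1)⁻¹) e.2 = e'.2 :=
      congrArg Prod.snd hg
    dsimp only
    rw [← h1]
    exact h2
  locally_trivial := by
    obtain ⟨B, f, hf, e, he⟩ := x.locally_trivial
    exact ⟨B, f, hf, (e, (1 : P'.toGrp.obj B)), he⟩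
  toX {A} e := ((x.toX e.1).1 * (e.2.1)⁻¹ : ℍ.obj A)
  toX_map {A B} f e := by
    rw [show x.toX ((prodPresh x.E (setOf P'.toGrp)).map f e).1 = _ from x.toX_map f e.1]
    exact (show ∀ t r : ℍ.obj A, ℍ.map f t * (ℍ.map f r)⁻¹ = ℍ.map f (t * r⁻¹) from
      fun t r => by rw [map_mul, map_inv]) (x.toX e.1).1 e.2.1
  toX_act {A} g e := by
    rw [show x.toX ((inducedAction hι hP' x.action).act g e).1 = _ from x.toX_act g.1 e.1]
    exact (show ∀ p t p' r i : ℍ.obj A, p * t * i⁻¹ * (p' * r * i⁻¹)⁻¹ = p * (t * r⁻¹) * p'⁻¹ from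
      fun p t p' r i => by group) g.1.1 (x.toX e.1).1 g.2.1 e.2.1 (ι.app A g.1.1)

/-- The involution `(e, r) ↦ (ι(r) e, r⁻¹)` of an induced torsor. -/
def inducedSwap (x : QuotientStack (antiAction hι P)) (e : (induced hι hP' hP's x).E.obj A) :
    (induced hι hP' hP's x).E.obj A :=
  (x.action.act (ofOpp hι hP' e.2) e.1, (fun r : P'.toGrp.obj A => r⁻¹) e.2)

end FixedPoints

section FixedPoints

variable {ℍ : GrpPresh} {ι : ℍ ⟶ ℍ} (hι : ι ≫ ι = 𝟙 ℍ) {P P' : SubgroupPresh ℍ}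
  (hP' : P' = P.comap ι) (hP's : IsFppfSheaf (setOf P'.toGrp)) {A : TestAlg}

/-- A point of an induced torsor. -/
def inducedPt (x : QuotientStack (antiAction hι P)) (e : x.E.obj A) (r : P'.toGrp.obj A) :
    (induced hι hP' hP's x).E.obj A := (e, r)

theorem exists_inducedPt (x : QuotientStack (antiAction hι P))
    (e : (induced hι hP' hP's x).E.obj A) : ∃ e₀ r, e = inducedPt hι hP' hP's x e₀ r :=
  ⟨_, _, rfl⟩

theorem inducedPt_inj {x : QuotientStack (antiAction hι P)} {e e' : x.E.obj A}
    {r r' : P'.toGrp.obj A} (h : inducedPt hι hP' hP's x e r = inducedPt hι hP' hP's x e' r') :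
    e = e' ∧ r = r' := Prod.ext_iff.1 h

theorem act_inducedPt (x : QuotientStack (antiAction hι P)) (p : P.toGrp.obj A)
    (p' : P'.toGrp.obj A) (e : x.E.obj A) (r : P'.toGrp.obj A) :
    (induced hι hP' hP's x).action.act (pair p p') (inducedPt hι hP' hP's x e r) =
      inducedPt hι hP' hP's x (x.action.act p e) (p' * r * (toOpp hι hP' p)⁻¹) := rfl

theorem inducedSwap_pt (x : QuotientStack (antiAction hι P)) (e : x.E.obj A)
    (r : P'.toGrp.obj A) : inducedSwap hι hP' hP's x (inducedPt hι hP' hP's x e r) =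
      inducedPt hι hP' hP's x (x.action.act (ofOpp hι hP' r) e) r⁻¹ := rfl

theorem inducedSwap_sq (x : QuotientStack (antiAction hι P))
    (e : (induced hι hP' hP's x).E.obj A) :
    inducedSwap hι hP' hP's x (inducedSwap hι hP' hP's x e) = e := by
  obtain ⟨e, r, rfl⟩ := exists_inducedPt hι hP' hP's x e
  rw [inducedSwap_pt, inducedSwap_pt, map_inv, x.action.inv_act_act, inv_inv]

theorem inducedSwap_map (x : QuotientStack (antiAction hι P)) {B : TestAlg} (f : A ⟶ B)
    (e : (induced hι hP' hP's x).E.obj A) :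
    inducedSwap hι hP' hP's x ((induced hι hP' hP's x).E.map f e) =
      (induced hι hP' hP's x).E.map f (inducedSwap hι hP' hP's x e) := by
  obtain ⟨e, r, rfl⟩ := exists_inducedPt hι hP' hP's x e
  have h : ∀ (e : x.E.obj A) (r : P'.toGrp.obj A),
      (induced hι hP' hP's x).E.map f (inducedPt hι hP' hP's x e r) =
        inducedPt hι hP' hP's x (x.E.map f e) (P'.toGrp.map f r) := fun _ _ => rfl
  rw [h, inducedSwap_pt, inducedSwap_pt, h, x.action.map_act, ofOpp_map, map_inv]

theorem inducedSwap_act (x : QuotientStack (antiAction hι P))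
    (g : (prodGrp P.toGrp P'.toGrp).obj A) (e : (induced hι hP' hP's x).E.obj A) :
    inducedSwap hι hP' hP's x ((induced hι hP' hP's x).action.act g e) =
      (induced hι hP' hP's x).action.act ((swapGrp hι hP').app A g)
        (inducedSwap hι hP' hP's x e) := by
  obtain ⟨e, r, rfl⟩ := exists_inducedPt hι hP' hP's x e
  obtain ⟨p, p', rfl⟩ : ∃ p p', g = pair p p' := ⟨g.1, g.2, rfl⟩
  rw [act_inducedPt, inducedSwap_pt, inducedSwap_pt, swapGrp_pair, act_inducedPt,
    ← x.action.mul_act, ← x.action.mul_act, map_mul, map_mul, map_inv, ofOpp_toOpp,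
    inv_mul_cancel_right, toOpp_ofOpp, mul_inv_rev, mul_inv_rev, inv_inv, mul_assoc]

theorem toX_inducedSwap (x : QuotientStack (antiAction hι P))
    (e : (induced hι hP' hP's x).E.obj A) :
    (induced hι hP' hP's x).toX (inducedSwap hι hP' hP's x e) =
      (swapSet ι).app A ((induced hι hP' hP's x).toX e) := by
  obtain ⟨e, r, rfl⟩ := exists_inducedPt hι hP' hP's x e
  have h := congrArg Subtype.val (x.toX_act (ofOpp hι hP' r) e)
  have key : ∀ t t' r : ℍ.obj A, t * ι.app A t = 1 →
      t' = ι.app A r * t * (ι.app A (ι.app A r))⁻¹ → t' * (r⁻¹)⁻¹ = (ι.app A (t * r⁻¹))⁻¹ := by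
    intro t t' r h1 h2
    rw [h2, invol_grp hι, inv_inv, inv_mul_cancel_right, map_mul, map_inv, mul_inv_rev, inv_inv,
      (eq_inv_of_mul_eq_one_left h1).symm]
  exact key (x.toX e).1 _ r.1 (x.toX e).2 h

theorem proj_inducedSwap (x : QuotientStack (antiAction hι P))
    (e : (induced hι hP' hP's x).E.obj A) :
    (induced hι hP' hP's x).proj (inducedSwap hι hP' hP's x e) =
      𝟙 x.base ≫ (induced hι hP' hP's x).proj e :=
  (x.proj_act _ e.1).trans (Category.id_comp (x.proj e.1)).symm

/-- The involution of an induced torsor, as an isomorphism with its twist. -/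
def swapIso (x : QuotientStack (antiAction hι P)) :
    (swapAction hι hP').T.obj (induced hι hP' hP's x) ≅ induced hι hP' hP's x where
  hom := QuotientStack.Hom.mk (x := (swapAction hι hP').T.obj (induced hι hP' hP's x))
    (y := induced hι hP' hP's x) (𝟙 x.base) (fun _ e => inducedSwap hι hP' hP's x e)
    (fun f e => inducedSwap_map hι hP' hP's x f e) (fun e => proj_inducedSwap hι hP' hP's x e)
    (fun {A} g e => (inducedSwap_act hι hP' hP's x _ e).trans
      (congrArg (fun g => (induced hι hP' hP's x).action.act g _)
        (show (swapGrp hι hP').app A ((swapGrp hι hP').app A g) = g from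
          Prod.ext (ofOpp_toOpp hι hP' _) (toOpp_ofOpp hι hP' _))))
    (fun e => toX_inducedSwap hι hP' hP's x e)
  inv := QuotientStack.Hom.mk (y := (swapAction hι hP').T.obj (induced hι hP' hP's x))
    (x := induced hι hP' hP's x) (𝟙 x.base) (fun _ e => inducedSwap hι hP' hP's x e)
    (fun f e => inducedSwap_map hι hP' hP's x f e) (fun e => proj_inducedSwap hι hP' hP's x e)
    (inducedSwap_act hι hP' hP's x)
    (fun e => ((toX_inducedSwap hι hP' hP's x _).symm.trans
      (congrArg _ (inducedSwap_sq hι hP' hP's x e))))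
  hom_inv_id := QuotientStack.Hom.ext (Category.id_comp _)
    (funext fun _ => funext fun e => inducedSwap_sq hι hP' hP's x e)
  inv_hom_id := QuotientStack.Hom.ext (Category.id_comp _)
    (funext fun _ => funext fun e => inducedSwap_sq hι hP' hP's x e)

/-- The morphism of induced torsors attached to a morphism of torsors. -/
def inducedHom {x y : QuotientStack (antiAction hι P)} (u : x ⟶ y) :
    induced hι hP' hP's x ⟶ induced hι hP' hP's y :=
  QuotientStack.Hom.mk (x := induced hι hP' hP's x) (y := induced hι hP' hP's y) u.base
    (fun A e => inducedPt hι hP' hP's y (u.total A e.1) e.2)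
    (fun f e => Prod.ext (u.total_map f e.1) rfl)
    (fun e => u.proj_total e.1)
    (fun g e => Prod.ext (u.total_act g.1 e.1) rfl)
    (fun {A} e => congrArg (fun t => (fun t r : ℍ.obj A => t * r⁻¹) t e.2.1)
      (congrArg Subtype.val (u.toX_total e.1)))

/-- The functor from the quotient of `{t | t ι(t) = 1}` by `P` to the homotopy fixed points of
`P \ ℍ / P'`. -/
def toFixed : QuotientStack (antiAction hι P) ⥤ HomotopyFixed (swapAction hι hP') where
  obj x :=
    { pt := induced hι hP' hP's x
      iso := swapIso hι hP' hP's x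
      iso_over := rfl
      cocycle := QuotientStack.Hom.ext (Category.id_comp _)
        (funext fun A => funext fun e => by exact inducedSwap_sq hι hP' hP's x e) }
  map {x y} u :=
    { hom := inducedHom hι hP' hP's u
      comm := QuotientStack.Hom.ext
        ((Category.id_comp u.base).trans (Category.comp_id u.base).symm)
        (funext fun A => funext fun e => Prod.ext (u.total_act _ _).symm rfl) }
  map_id x := HomotopyFixed.Hom.ext (QuotientStack.Hom.ext rfl rfl)
  map_comp u v := HomotopyFixed.Hom.ext (QuotientStack.Hom.ext rfl rfl)

theorem toFixed_faithful : (toFixed hι hP' hP's).Faithful where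
  map_injective {x y u v} h := by
    have h' : inducedHom hι hP' hP's u = inducedHom hι hP' hP's v :=
      congrArg HomotopyFixed.Hom.hom h
    refine QuotientStack.Hom.ext
      (show (inducedHom hι hP' hP's u).base = (inducedHom hι hP' hP's v).base by rw [h'])
      (funext fun A => funext fun e => ?_)
    exact congrArg Prod.fst (congrFun (congrFun (congrArg QuotientStack.Hom.total h') A)
      (inducedPt hι hP' hP's x e 1))

/-- A morphism of induced torsors commuting with the involutions preserves the points `(e, 1)`, so
that it is induced by a morphism of `P`-torsors. -/
theorem toFixed_full : (toFixed hι hP' hP's).Full where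
  map_surjective {x y} w := by
    let v : induced hι hP' hP's x ⟶ induced hι hP' hP's y := w.hom
    have hv : ∀ {A : TestAlg} (e : (induced hι hP' hP's x).E.obj A),
        inducedSwap hι hP' hP's y (v.total A e) = v.total A (inducedSwap hι hP' hP's x e) :=
      fun {A} e => congrFun (congrFun (congrArg QuotientStack.Hom.total w.comm) A) e
    -- The points `(e, 1)` are the fixed points of the involution.
    have key : ∀ {A : TestAlg} (e : x.E.obj A), v.total A (inducedPt hι hP' hP's x e 1) =
        inducedPt hι hP' hP's y (v.total A (inducedPt hι hP' hP's x e 1)).1 1 := by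
      intro A e
      obtain ⟨f, s, hfs⟩ := exists_inducedPt hι hP' hP's y
        (v.total A (inducedPt hι hP' hP's x e 1))
      have h := hv (inducedPt hι hP' hP's x e 1)
      rw [inducedSwap_pt, map_one, x.action.one_act, inv_one, hfs, inducedSwap_pt] at h
      obtain ⟨h1, -⟩ := inducedPt_inj hι hP' hP's h
      have h2 := y.act_injective (h1.trans (y.action.one_act f).symm)
      have h3 : s = 1 := by rw [← toOpp_ofOpp hι hP' s, h2, map_one]
      rw [hfs, h3]
      rfl
    have act_one : ∀ (x : QuotientStack (antiAction hι P)) {A : TestAlg} (p : P.toGrp.obj A)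
        (e : x.E.obj A), inducedPt hι hP' hP's x (x.action.act p e) 1 =
          (induced hι hP' hP's x).action.act (pair p (toOpp hι hP' p))
            (inducedPt hι hP' hP's x e 1) := fun x A p e => by
      rw [act_inducedPt, mul_one, mul_inv_cancel]
    let u : x ⟶ y := QuotientStack.Hom.mk (x := x) (y := y) v.base
      (fun A e => (v.total A (inducedPt hι hP' hP's x e 1)).1)
      (fun {A B} f e => by
        have h := v.total_map f (inducedPt hι hP' hP's x e 1)
        have h' : (induced hι hP' hP's x).E.map f (inducedPt hι hP' hP's x e 1) =
            inducedPt hι hP' hP's x (x.E.map f e) 1 := Prod.ext rfl (map_one (P'.toGrp.map f).hom)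
        rw [h'] at h
        exact congrArg Prod.fst h)
      (fun e => v.proj_total (inducedPt hι hP' hP's x e 1))
      (fun {A} p e => by
        rw [act_one, v.total_act]
        rfl)
      (fun {A} e => Subtype.ext <| by
        have h := v.toX_total (inducedPt hι hP' hP's x e 1)
        rw [key] at h
        have h1 : ∀ (x : QuotientStack (antiAction hι P)) (e : x.E.obj A),
            (induced hι hP' hP's x).toX (inducedPt hι hP' hP's x e 1) = (x.toX e).1 := fun x e =>
          (show ∀ t : ℍ.obj A, t * 1⁻¹ = t from fun t => by rw [inv_one, mul_one]) _
        rw [h1, h1] at h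
        exact h)
    refine ⟨u, HomotopyFixed.Hom.ext (QuotientStack.Hom.ext rfl
      (funext fun A => funext fun e => ?_))⟩
    obtain ⟨e, r, rfl⟩ := exists_inducedPt hι hP' hP's x e
    have h : ∀ (x : QuotientStack (antiAction hι P)) (e : x.E.obj A), inducedPt hι hP' hP's x e r =
        (induced hι hP' hP's x).action.act (pair 1 r) (inducedPt hι hP' hP's x e 1) := fun x e => by
      rw [act_inducedPt, map_one, x.action.one_act, mul_one, inv_one, mul_one]
    change inducedPt hι hP' hP's y (u.total A e) r = v.total A _
    rw [h, h, v.total_act, key]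

end FixedPoints

/-- An isomorphism of homotopy fixed points. -/
def HomotopyFixed.isoMk {𝒳 : Type 1} [Category.{1} 𝒳] {p : 𝒳 ⥤ TestAlgᵒᵖ} {γ : GammaAction p}
    {x y : HomotopyFixed γ} (i : x.pt ≅ y.pt)
    (comm : γ.T.map i.hom ≫ y.iso.hom = x.iso.hom ≫ i.hom) :
    x ≅ y where
  hom := { hom := i.hom, comm := comm }
  inv :=
    { hom := i.inv
      comm := by
        rw [← cancel_mono i.hom, Category.assoc, ← comm, ← Category.assoc, ← Functor.map_comp,
          i.inv_hom_id, CategoryTheory.Functor.map_id, Category.id_comp, Category.assoc,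
          i.inv_hom_id, Category.comp_id] }
  hom_inv_id := HomotopyFixed.Hom.ext i.hom_inv_id
  inv_hom_id := HomotopyFixed.Hom.ext i.inv_hom_id

section FixedPoints

variable {ℍ : GrpPresh} {ι : ℍ ⟶ ℍ} (hι : ι ≫ ι = 𝟙 ℍ) {P P' : SubgroupPresh ℍ}
  (hP' : P' = P.comap ι)

section EssSurj

variable (z : HomotopyFixed (swapAction hι hP')) {A : TestAlg}

/-- The involution of the torsor underlying a homotopy fixed point. -/
def fixedSwap (e : z.pt.E.obj A) : z.pt.E.obj A := z.iso.hom.total A e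

theorem iso_base : z.iso.hom.base = 𝟙 z.pt.base :=
  Quiver.Hom.op_inj z.iso_over

theorem fixedSwap_sq (e : z.pt.E.obj A) :
    fixedSwap hι hP' z (fixedSwap hι hP' z e) = e :=
  congrFun (congrFun (congrArg QuotientStack.Hom.total z.cocycle) A) e

theorem fixedSwap_map {B : TestAlg} (f : A ⟶ B) (e : z.pt.E.obj A) :
    fixedSwap hι hP' z (z.pt.E.map f e) = z.pt.E.map f (fixedSwap hι hP' z e) :=
  z.iso.hom.total_map f e

theorem proj_fixedSwap (e : z.pt.E.obj A) :
    z.pt.proj (fixedSwap hι hP' z e) = z.pt.proj e :=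
  (z.iso.hom.proj_total e).trans ((congrArg (· ≫ z.pt.proj e) (iso_base hι hP' z)).trans
    (Category.id_comp _))

theorem fixedSwap_act (p : P.toGrp.obj A) (p' : P'.toGrp.obj A) (e : z.pt.E.obj A) :
    fixedSwap hι hP' z (z.pt.action.act (pair p p') e) =
      z.pt.action.act (pair (ofOpp hι hP' p') (toOpp hι hP' p)) (fixedSwap hι hP' z e) := by
  have h := z.iso.hom.total_act (pair (ofOpp hι hP' p') (toOpp hι hP' p)) e
  refine Eq.trans (congrArg (fun g => z.iso.hom.total A (z.pt.action.act g e)) ?_) h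
  exact Prod.ext (ofOpp_toOpp hι hP' p).symm (toOpp_ofOpp hι hP' p').symm

theorem toX_fixedSwap (e : z.pt.E.obj A) :
    z.pt.toX (fixedSwap hι hP' z e) = (swapSet ι).app A (z.pt.toX e) :=
  z.iso.hom.toX_total e

/-- The fixed points of the involution on the torsor underlying a homotopy fixed point. -/
def fixedTotal : Presh where
  obj A := {e : z.pt.E.obj A // fixedSwap hι hP' z e = e}
  map {A B} f := TypeCat.ofHom (X := {e : z.pt.E.obj A // fixedSwap hι hP' z e = e})
    (Y := {e : z.pt.E.obj B // fixedSwap hι hP' z e = e}) fun e =>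
    ⟨z.pt.E.map f e.1, by rw [fixedSwap_map, e.2]⟩
  map_id A := by
    refine ConcreteCategory.hom_ext _ _ fun e : {e : z.pt.E.obj A // fixedSwap hι hP' z e = e} => ?_
    exact Subtype.ext (map_id_apply z.pt.E e.1)
  map_comp {A B C} f g := by
    refine ConcreteCategory.hom_ext _ _ fun e : {e : z.pt.E.obj A // fixedSwap hι hP' z e = e} => ?_
    exact Subtype.ext (map_comp_apply z.pt.E f g e.1)

theorem isFppfSheaf_fixedTotal : IsFppfSheaf (fixedTotal hι hP' z) := by
  refine isFppfSheaf_of_injective z.pt.sheaf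
    { app := fun A => TypeCat.ofHom (X := {e : z.pt.E.obj A // fixedSwap hι hP' z e = e})
        (Y := z.pt.E.obj A) fun e => e.1
      naturality := fun _ _ _ => rfl } (fun A => Subtype.val_injective) (fun A e H => ?_)
  refine ⟨⟨e, z.pt.sheaf.sep H fun B f ⟨y, hy⟩ => ?_⟩, rfl⟩
  have hy : y.1 = z.pt.E.map f e := hy
  rw [← fixedSwap_map, ← hy, y.2]

/-- Any point of the torsor underlying a homotopy fixed point can be moved by `P` to a point fixed
by the involution. -/
theorem exists_fixedSwap_eq (e : z.pt.E.obj A) :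
    ∃ p : P.toGrp.obj A, fixedSwap hι hP' z (z.pt.action.act (pair p 1) e) =
      z.pt.action.act (pair p 1) e := by
  obtain ⟨g, hg, -⟩ := z.pt.simply_transitive e _ (proj_fixedSwap hι hP' z e).symm
  obtain ⟨p, p', rfl⟩ : ∃ p p', g = pair p p' := ⟨g.1, g.2, rfl⟩
  have h := fixedSwap_act hι hP' z p p' e
  rw [hg, fixedSwap_sq, ← hg, ← z.pt.action.mul_act, pair_mul] at h
  have h1 : ofOpp hι hP' p' * p = 1 := (congrArg Prod.fst
    (z.pt.act_injective ((z.pt.action.one_act e).trans h))).symm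
  have h2 : toOpp hι hP' p * p' = 1 := by
    rw [← toOpp_ofOpp hι hP' p', ← map_mul, mul_eq_one_comm.1 h1, map_one]
  refine ⟨p, ?_⟩
  rw [fixedSwap_act, map_one, ← hg, ← z.pt.action.mul_act, pair_mul, one_mul, h2]

/-- The `P`-torsor of the points fixed by the involution. -/
def fixedPart : QuotientStack (antiAction hι P) where
  base := z.pt.base
  E := fixedTotal hι hP' z
  sheaf := isFppfSheaf_fixedTotal hι hP' z
  action :=
    { act := fun {A} p e => (⟨z.pt.action.act (pair p (toOpp hι hP' p)) e.1, by
        rw [fixedSwap_act, ofOpp_toOpp, e.2]⟩ : {e : z.pt.E.obj A // fixedSwap hι hP' z e = e})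
      one_act := fun {A} e => Subtype.ext (by
        change z.pt.action.act (pair 1 (toOpp hι hP' 1)) e.1 = e.1
        rw [map_one]
        exact z.pt.action.one_act e.1)
      mul_act := fun {A} p q e => Subtype.ext (by
        change z.pt.action.act (pair (p * q) (toOpp hι hP' (p * q))) e.1 =
          z.pt.action.act (pair p _) (z.pt.action.act (pair q _) e.1)
        rw [← z.pt.action.mul_act, pair_mul, map_mul])
      map_act := fun {A B} f p e => Subtype.ext (by
        change z.pt.E.map f (z.pt.action.act (pair p (toOpp hι hP' p)) e.1) =
          z.pt.action.act (pair (P.toGrp.map f p) (toOpp hι hP' (P.toGrp.map f p)))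
            (z.pt.E.map f e.1)
        rw [z.pt.action.map_act, map_pair, toOpp_map]) }
  proj e := z.pt.proj e.1
  proj_map f e := z.pt.proj_map f e.1
  proj_act g e := z.pt.proj_act _ e.1
  simply_transitive {A} e e' h := by
    obtain ⟨g, hg, -⟩ := z.pt.simply_transitive e.1 e'.1 h
    obtain ⟨p, p', rfl⟩ : ∃ p p', g = pair p p' := ⟨g.1, g.2, rfl⟩
    have h1 := fixedSwap_act hι hP' z p p' e.1
    rw [hg, e.2, e'.2, ← hg] at h1
    have h2 : p' = toOpp hι hP' p := congrArg Prod.snd (z.pt.act_injective h1)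
    refine ⟨p, Subtype.ext ?_, fun q hq => ?_⟩
    · subst h2
      exact hg
    have hq' : z.pt.action.act (pair q (toOpp hι hP' q)) e.1 = e'.1 := congrArg Subtype.val hq
    exact congrArg Prod.fst (z.pt.act_injective (hq'.trans hg.symm))
  locally_trivial := by
    obtain ⟨B, f, hf, e, he⟩ := z.pt.locally_trivial
    obtain ⟨p, hp⟩ := exists_fixedSwap_eq hι hP' z e
    exact ⟨B, f, hf, ⟨_, hp⟩, (z.pt.proj_act _ e).trans he⟩
  toX {A} e := (⟨z.pt.toX e.1, by
    have h := toX_fixedSwap hι hP' z e.1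
    rw [e.2] at h
    exact (show ∀ t : ℍ.obj A, t = (ι.app A t)⁻¹ → t * ι.app A t = 1 from
      fun t ht => mul_eq_one_iff_eq_inv.2 ht) _ h⟩ : {t : ℍ.obj A // t * ι.app A t = 1})
  toX_map f e := Subtype.ext (z.pt.toX_map f e.1)
  toX_act g e := Subtype.ext (z.pt.toX_act _ e.1)

variable (hP's : IsFppfSheaf (setOf P'.toGrp))

/-- The morphism `(e, r) ↦ (1, r) e` from the torsor induced by the fixed points of the
involution. -/
def fixedHom : induced hι hP' hP's (fixedPart hι hP' z) ⟶ z.pt :=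
  QuotientStack.Hom.mk (x := induced hι hP' hP's (fixedPart hι hP' z)) (y := z.pt) (𝟙 z.pt.base)
    (fun A e => z.pt.action.act (pair 1 e.2) e.1.1)
    (fun {A B} f e => by
      refine Eq.trans ?_ (z.pt.action.map_act f (pair 1 e.2) e.1.1).symm
      exact congrArg (fun g => z.pt.action.act g (z.pt.E.map f e.1.1))
        (Prod.ext (map_one (P.toGrp.map f).hom).symm rfl))
    (fun e => (z.pt.proj_act _ e.1.1).trans (Category.id_comp (z.pt.proj e.1.1)).symm)
    (fun {A} g e => by
      obtain ⟨p, p', rfl⟩ : ∃ p p', g = pair p p' := ⟨g.1, g.2, rfl⟩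
      have h : ∀ r : P'.toGrp.obj A, z.pt.action.act (pair 1 (p' * r * (toOpp hι hP' p)⁻¹))
          (z.pt.action.act (pair p (toOpp hι hP' p)) e.1.1) =
          z.pt.action.act (pair p p') (z.pt.action.act (pair 1 r) e.1.1) := fun r => by
        rw [← z.pt.action.mul_act, ← z.pt.action.mul_act, pair_mul, pair_mul,
          inv_mul_cancel_right, one_mul, mul_one]
      exact h e.2)
    (fun {A} e => (z.pt.toX_act _ e.1.1).trans
      ((show ∀ t r : ℍ.obj A, 1 * t * r⁻¹ = t * r⁻¹ from fun t r => by rw [one_mul])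
        (z.pt.toX e.1.1) e.2.1))

/-- A homotopy fixed point is induced by the fixed points of its involution. -/
def fixedIso : (toFixed hι hP' hP's).obj (fixedPart hι hP' z) ≅ z := by
  have : IsIso (fixedHom hι hP' z hP's).base := inferInstanceAs (IsIso (𝟙 z.pt.base))
  have := QuotientStack.isIso_of_isIso_base (fixedHom hι hP' z hP's)
  let i := asIso (fixedHom hι hP' z hP's)
  let x := (toFixed hι hP' hP's).obj (fixedPart hι hP' z)
  have comm : (swapAction hι hP').T.map i.hom ≫ z.iso.hom = x.iso.hom ≫ i.hom := by
    refine QuotientStack.Hom.ext ?_ (funext fun A => funext fun e => ?_)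
    · exact congrArg (· ≫ 𝟙 z.pt.base) (iso_base hι hP' z)
    · obtain ⟨e, r, rfl⟩ := exists_inducedPt hι hP' hP's _ e
      change fixedSwap hι hP' z (z.pt.action.act (pair 1 r) e.1) = z.pt.action.act (pair 1 r⁻¹)
        (z.pt.action.act (pair (ofOpp hι hP' r) (toOpp hι hP' (ofOpp hι hP' r))) e.1)
      rw [fixedSwap_act, e.2, ← z.pt.action.mul_act, pair_mul, map_one, one_mul, toOpp_ofOpp,
        inv_mul_cancel]
  exact HomotopyFixed.isoMk (x := x) i comm

end EssSurj

/-- The homotopy fixed points of `P \ ℍ / P'` are the quotient of `{t | t ι(t) = 1}` by `P`. -/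
theorem stackEquiv_homotopyFixed (hP's : IsFppfSheaf (setOf P'.toGrp)) :
    StackEquiv (QuotientStack.π (antiAction hι P)) (HomotopyFixed.π (swapAction hι hP')) := by
  have := toFixed_faithful hι hP' hP's
  have := toFixed_full hι hP' hP's
  have : (toFixed hι hP' hP's).EssSurj := ⟨fun z => ⟨_, ⟨fixedIso hι hP' z hP's⟩⟩⟩
  exact ⟨toFixed hι hP' hP's, {}, ⟨Iso.refl _⟩⟩

end FixedPoints

/-! ### Extension of scalars of spaces of complex matrices -/

section Extend

variable {d : ℕ} {A : Type} [CommRing A] [Algebra ℂ A]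

/-- The space of matrices over `A` spanned by a space `U` of complex matrices. -/
def extendScalars (U : Submodule ℂ (Matrix (Fin d) (Fin d) ℂ)) (A : Type) [CommRing A]
    [Algebra ℂ A] : Submodule A (Matrix (Fin d) (Fin d) A) :=
  Submodule.span A ((fun X : Matrix (Fin d) (Fin d) ℂ => X.map (algebraMap ℂ A)) '' U)

/-- A matrix over `A` is a combination of complex matrices, with coefficients in a basis of `A`. -/
theorem exists_sum_smul_map (X : Matrix (Fin d) (Fin d) A) :
    ∃ (T : Finset (Module.Basis.ofVectorSpaceIndex ℂ A)),
      X = ∑ i ∈ T, Module.Basis.ofVectorSpace ℂ A i •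
        (X.map ((Module.Basis.ofVectorSpace ℂ A).coord i)).map (algebraMap ℂ A) := by
  classical
  let b := Module.Basis.ofVectorSpace ℂ A
  refine ⟨Finset.univ.biUnion fun ij : Fin d × Fin d => (b.repr (X ij.1 ij.2)).support, ?_⟩
  ext k l
  rw [Matrix.sum_apply]
  conv_lhs => rw [← b.linearCombination_repr (X k l), Finsupp.linearCombination_apply]
  rw [Finsupp.sum_of_support_subset _ (Finset.subset_biUnion_of_mem
    (fun ij : Fin d × Fin d => (b.repr (X ij.1 ij.2)).support) (Finset.mem_univ (k, l))) _
    (by simp)]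
  refine Finset.sum_congr rfl fun i _ => ?_
  rw [Algebra.smul_def, mul_comm]
  rfl

/-- A matrix lies in the extension of scalars of `U` when all its complex coefficients lie
in `U`. -/
theorem mem_extendScalars_iff (U : Submodule ℂ (Matrix (Fin d) (Fin d) ℂ))
    (X : Matrix (Fin d) (Fin d) A) :
    X ∈ extendScalars U A ↔ ∀ ψ : A →ₗ[ℂ] ℂ, X.map ψ ∈ U := by
  constructor
  · intro hX
    unfold extendScalars at hX
    induction hX using Submodule.span_induction with
    | mem X h =>
      obtain ⟨Y, hY, rfl⟩ := h
      intro ψ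
      have h : (Y.map (algebraMap ℂ A)).map ψ = ψ 1 • Y := by
        ext i j
        simp [Algebra.algebraMap_eq_smul_one, mul_comm]
      rw [h]
      exact U.smul_mem _ hY
    | zero =>
      intro ψ
      rw [Matrix.map_zero _ (map_zero ψ)]
      exact U.zero_mem
    | add X Y _ _ hX hY =>
      intro ψ
      rw [Matrix.map_add _ (map_add ψ)]
      exact U.add_mem (hX ψ) (hY ψ)
    | smul r X _ hX =>
      intro ψ
      exact hX (ψ.comp (LinearMap.mulLeft ℂ r))
  · intro h
    obtain ⟨T, hT⟩ := exists_sum_smul_map X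
    rw [hT]
    exact Submodule.sum_mem _ fun i _ => Submodule.smul_mem _ _
      (Submodule.subset_span ⟨_, h _, rfl⟩)

theorem map_mem_extendScalars {U : Submodule ℂ (Matrix (Fin d) (Fin d) ℂ)}
    {X : Matrix (Fin d) (Fin d) ℂ} (hX : X ∈ U) : X.map (algebraMap ℂ A) ∈ extendScalars U A :=
  Submodule.subset_span ⟨X, hX, rfl⟩

theorem extendScalars_inf (U V : Submodule ℂ (Matrix (Fin d) (Fin d) ℂ))
    {X : Matrix (Fin d) (Fin d) A} (hU : X ∈ extendScalars U A) (hV : X ∈ extendScalars V A) :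
    X ∈ extendScalars (U ⊓ V) A :=
  (mem_extendScalars_iff _ _).2 fun ψ =>
    ⟨(mem_extendScalars_iff _ _).1 hU ψ, (mem_extendScalars_iff _ _).1 hV ψ⟩

theorem extendScalars_mono {U V : Submodule ℂ (Matrix (Fin d) (Fin d) ℂ)} (h : U ≤ V) :
    extendScalars U A ≤ extendScalars V A :=
  Submodule.span_mono (Set.image_mono h)

theorem extendScalars_sup (U V : Submodule ℂ (Matrix (Fin d) (Fin d) ℂ))
    {X : Matrix (Fin d) (Fin d) A} (h : X ∈ extendScalars (U ⊔ V) A) :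
    ∃ Y ∈ extendScalars U A, ∃ Z ∈ extendScalars V A, X = Y + Z := by
  have hle : extendScalars (U ⊔ V) A ≤ extendScalars U A ⊔ extendScalars V A := by
    refine Submodule.span_le.2 ?_
    rintro _ ⟨X, hX, rfl⟩
    obtain ⟨Y, hY, Z, hZ, rfl⟩ := Submodule.mem_sup.1 hX
    change (Y + Z).map (algebraMap ℂ A) ∈ _
    rw [Matrix.map_add _ (map_add _)]
    exact Submodule.add_mem_sup (map_mem_extendScalars hY) (map_mem_extendScalars hZ)
  obtain ⟨Y, hY, Z, hZ, h⟩ := Submodule.mem_sup.1 (hle h)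
  exact ⟨Y, hY, Z, hZ, h.symm⟩

theorem extendScalars_bot {X : Matrix (Fin d) (Fin d) A} (h : X ∈ extendScalars ⊥ A) : X = 0 := by
  obtain ⟨T, hT⟩ := exists_sum_smul_map X
  rw [hT]
  refine Finset.sum_eq_zero fun i _ => ?_
  rw [(Submodule.mem_bot ℂ).1 ((mem_extendScalars_iff _ _).1 h _), Matrix.map_zero _ (map_zero _),
    smul_zero]

theorem mul_mem_extendScalars {U V W : Submodule ℂ (Matrix (Fin d) (Fin d) ℂ)}
    (h : ∀ X ∈ U, ∀ Y ∈ V, X * Y ∈ W) {X Y : Matrix (Fin d) (Fin d) A}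
    (hX : X ∈ extendScalars U A) (hY : Y ∈ extendScalars V A) : X * Y ∈ extendScalars W A := by
  have h1 : extendScalars U A * extendScalars V A ≤ extendScalars W A := by
    unfold extendScalars
    rw [Submodule.span_mul_span, Submodule.span_le]
    rintro _ ⟨_, ⟨X, hX, rfl⟩, _, ⟨Y, hY, rfl⟩, rfl⟩
    dsimp only
    rw [← Matrix.map_mul]
    exact map_mem_extendScalars (h X hX Y hY)
  exact h1 (Submodule.mul_mem_mul hX hY)

end Extend

/-! ### Degrees with respect to `ad λ` -/

section Degree

variable {d : ℕ} (lam : Matrix (Fin d) (Fin d) ℂ)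

/-- The span of the elements of `U` of degree at least `k`, where `X` has degree `j` when
`[λ, X] = j X`. -/
def degGE (U : Submodule ℂ (Matrix (Fin d) (Fin d) ℂ)) (k : ℕ) :
    Submodule ℂ (Matrix (Fin d) (Fin d) ℂ) :=
  Submodule.span ℂ {X | X ∈ U ∧ ∃ j : ℕ, k ≤ j ∧ lam * X - X * lam = (j : ℂ) • X}

/-- The elements of `U` of degree `k`, where `X` has degree `k` when `[λ, X] = k X`. -/
def degEq (U : Submodule ℂ (Matrix (Fin d) (Fin d) ℂ)) (k : ℕ) :
    Submodule ℂ (Matrix (Fin d) (Fin d) ℂ) where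
  carrier := {X | X ∈ U ∧ lam * X - X * lam = (k : ℂ) • X}
  add_mem' := fun {X Y} hX hY => ⟨U.add_mem hX.1 hY.1, by
    rw [smul_add, ← hX.2, ← hY.2, mul_add, add_mul]; abel⟩
  zero_mem' := ⟨U.zero_mem, by simp⟩
  smul_mem' := fun c _ hX => ⟨U.smul_mem c hX.1, by
    rw [smul_comm, ← hX.2, smul_sub, mul_smul_comm, smul_mul_assoc]⟩

variable {lam}

theorem degEq_le_degGE (U : Submodule ℂ (Matrix (Fin d) (Fin d) ℂ)) {j k : ℕ} (h : k ≤ j) :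
    degEq lam U j ≤ degGE lam U k := fun _ hX => Submodule.subset_span ⟨hX.1, j, h, hX.2⟩

theorem degGE_anti (U : Submodule ℂ (Matrix (Fin d) (Fin d) ℂ)) {j k : ℕ} (h : k ≤ j) :
    degGE lam U j ≤ degGE lam U k :=
  Submodule.span_mono fun _ ⟨hX, i, hi, e⟩ => ⟨hX, i, h.trans hi, e⟩

theorem degGE_le (U : Submodule ℂ (Matrix (Fin d) (Fin d) ℂ)) (k : ℕ) : degGE lam U k ≤ U :=
  Submodule.span_le.2 fun _ hX => hX.1

theorem degGE_mono {U V : Submodule ℂ (Matrix (Fin d) (Fin d) ℂ)} (h : U ≤ V) (k : ℕ) :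
    degGE lam U k ≤ degGE lam V k :=
  Submodule.span_mono fun _ ⟨hX, i, hi, e⟩ => ⟨h hX, i, hi, e⟩

theorem degGE_le_sup (U : Submodule ℂ (Matrix (Fin d) (Fin d) ℂ)) (k : ℕ) :
    degGE lam U k ≤ degEq lam U k ⊔ degGE lam U (k + 1) := by
  refine Submodule.span_le.2 ?_
  rintro X ⟨hX, j, hj, e⟩
  rcases hj.eq_or_lt with rfl | hj
  · exact Submodule.mem_sup_left ⟨hX, e⟩
  · exact Submodule.mem_sup_right (Submodule.subset_span ⟨hX, j, hj, e⟩)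

theorem mul_mem_degGE {j k : ℕ} {X Y : Matrix (Fin d) (Fin d) ℂ} (hX : X ∈ degGE lam ⊤ j)
    (hY : Y ∈ degGE lam ⊤ k) : X * Y ∈ degGE lam ⊤ (j + k) := by
  have h1 : degGE lam ⊤ j * degGE lam ⊤ k ≤ degGE lam ⊤ (j + k) := by
    unfold degGE
    rw [Submodule.span_mul_span, Submodule.span_le]
    rintro _ ⟨X, ⟨-, m, hm, eX⟩, Y, ⟨-, n, hn, eY⟩, rfl⟩
    refine Submodule.subset_span ⟨Submodule.mem_top, m + n, add_le_add hm hn, ?_⟩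
    dsimp only
    rw [Nat.cast_add, add_smul, ← smul_mul_assoc, ← mul_smul_comm, ← eX, ← eY, sub_mul, mul_sub]
    noncomm_ring
  exact h1 (Submodule.mul_mem_mul hX hY)

/-- The endomorphism `ad λ` of the space of matrices. -/
def adLam (lam : Matrix (Fin d) (Fin d) ℂ) : Module.End ℂ (Matrix (Fin d) (Fin d) ℂ) :=
  LinearMap.mulLeft ℂ lam - LinearMap.mulRight ℂ lam

variable (lam) in
/-- The degrees are bounded, since `ad λ` has finitely many eigenvalues. -/
theorem exists_degGE_eq_bot : ∃ k, degGE lam ⊤ k = ⊥ := by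
  have hfin := Module.End.finite_hasEigenvalue (adLam lam)
  have hfin' : {n : ℕ | (adLam lam).HasEigenvalue (n : ℂ)}.Finite :=
    hfin.preimage (Nat.cast_injective.injOn)
  obtain ⟨k, hk⟩ := hfin'.bddAbove
  refine ⟨k + 1, (Submodule.span_eq_bot).2 ?_⟩
  rintro X ⟨-, j, hj, e⟩
  by_contra hX
  have := hk (a := j) (Module.End.hasEigenvalue_of_hasEigenvector
    (Module.End.hasEigenvector_iff.2 ⟨Module.End.mem_eigenspace_iff.2 e, hX⟩))
  omega

/-- If a sum of eigenvectors with distinct eigenvalues lies in an invariant subspace, so do its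
terms. -/
theorem mem_of_sum_eigenvectors_mem {V : Type} [AddCommGroup V] [Module ℂ V] (f : V →ₗ[ℂ] V)
    (U : Submodule ℂ V) (hU : ∀ v ∈ U, f v ∈ U) (S : Finset ℕ) (x : ℕ → V)
    (hx : ∀ j ∈ S, f (x j) = (j : ℂ) • x j) (h : ∑ j ∈ S, x j ∈ U) : ∀ j ∈ S, x j ∈ U := by
  classical
  induction S using Finset.induction_on generalizing x with
  | empty => simp
  | insert a S ha ih =>
    have hS : ∀ j ∈ S, x j ∈ U := by
      have h1 := U.sub_mem (hU _ h) (U.smul_mem (a : ℂ) h)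
      rw [Finset.sum_insert ha, map_add, smul_add, hx a (Finset.mem_insert_self _ _),
        add_sub_add_left_eq_sub, map_sum, Finset.smul_sum, ← Finset.sum_sub_distrib] at h1
      have h2 := ih (fun j => f (x j) - (a : ℂ) • x j) (fun j hj => by
        rw [hx j (Finset.mem_insert_of_mem hj), ← sub_smul, map_smul,
          hx j (Finset.mem_insert_of_mem hj), smul_comm]) h1
      intro j hj
      have h3 := h2 j hj
      rw [hx j (Finset.mem_insert_of_mem hj), ← sub_smul] at h3
      have h4 : (j : ℂ) - a ≠ 0 :=
        sub_ne_zero.2 fun e => ha ((Nat.cast_injective (R := ℂ) e) ▸ hj)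
      exact (Submodule.smul_mem_iff U h4).1 h3
    intro j hj
    rcases Finset.mem_insert.1 hj with rfl | hj
    · rw [Finset.sum_insert ha] at h
      exact (U.add_mem_iff_left (U.sum_mem hS)).1 h
    · exact hS j hj

theorem inf_degGE_le {U : Submodule ℂ (Matrix (Fin d) (Fin d) ℂ)}
    (hU : ∀ X ∈ U, lam * X - X * lam ∈ U) (k : ℕ) :
    U ⊓ degGE lam ⊤ k ≤ degGE lam U k := by
  classical
  rintro X ⟨hXU, hX⟩
  have key : ∃ (S : Finset ℕ) (x : ℕ → Matrix (Fin d) (Fin d) ℂ),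
      (∀ j ∈ S, k ≤ j ∧ lam * x j - x j * lam = (j : ℂ) • x j) ∧ X = ∑ j ∈ S, x j := by
    obtain ⟨m, hm⟩ := exists_degGE_eq_bot lam
    have h1 : ∀ n i, m = i + n → ∀ X ∈ degGE lam ⊤ i, ∃ (x : ℕ → Matrix (Fin d) (Fin d) ℂ),
        (∀ j ∈ Finset.Ico i m, lam * x j - x j * lam = (j : ℂ) • x j) ∧
          X = ∑ j ∈ Finset.Ico i m, x j := by
      intro n
      induction n with
      | zero =>
        rintro i hi X hX
        obtain rfl : m = i := hi
        rw [hm, Submodule.mem_bot] at hX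
        exact ⟨0, by simp, by simpa using hX⟩
      | succ n ih =>
        rintro i hi X hX
        obtain ⟨Y, hY, Z, hZ, rfl⟩ := Submodule.mem_sup.1 (degGE_le_sup _ _ hX)
        obtain ⟨x, hx, rfl⟩ := ih (i + 1) (by omega) Z hZ
        refine ⟨Function.update x i Y, fun j hj => ?_, ?_⟩
        · rcases eq_or_ne j i with rfl | hj'
          · rw [Function.update_self]; exact hY.2
          · rw [Function.update_of_ne hj']
            exact hx j (Finset.mem_Ico.2 ⟨by have := (Finset.mem_Ico.1 hj).1; omega,
              (Finset.mem_Ico.1 hj).2⟩)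
        · rw [Finset.sum_eq_sum_Ico_succ_bot (a := i) (by omega), Function.update_self]
          congr 1
          refine Finset.sum_congr rfl fun j hj => ?_
          rw [Function.update_of_ne]
          have := (Finset.mem_Ico.1 hj).1
          omega
    rcases le_total k m with hkm | hkm
    · obtain ⟨x, hx, e⟩ := h1 (m - k) k (by omega) X hX
      exact ⟨_, x, fun j hj => ⟨(Finset.mem_Ico.1 hj).1, hx j hj⟩, e⟩
    · have hX0 := degGE_anti _ hkm hX
      rw [hm, Submodule.mem_bot] at hX0
      exact ⟨∅, 0, by simp, by simpa using hX0⟩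
  obtain ⟨S, x, hx, rfl⟩ := key
  have h := mem_of_sum_eigenvectors_mem (adLam lam) U hU S x (fun j hj => (hx j hj).2) hXU
  exact Submodule.sum_mem _ fun j hj =>
    Submodule.subset_span ⟨h j hj, j, (hx j hj).1, (hx j hj).2⟩

end Degree

/-! ### The Lie algebra -/

section Lie

variable {d : ℕ} (G : LinearAlgebraicGroup d)

theorem inr_mul_inr (X Y : Matrix (Fin d) (Fin d) ℂ) :
    (X.map TrivSqZeroExt.inr * Y.map TrivSqZeroExt.inr : Matrix (Fin d) (Fin d) (DualNumber ℂ)) =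
      0 := by
  ext i j
  · simp [Matrix.mul_apply]
  · simp [Matrix.mul_apply]

theorem algebraMap_mul_inr (X Y : Matrix (Fin d) (Fin d) ℂ) :
    (X.map (algebraMap ℂ _) * Y.map TrivSqZeroExt.inr : Matrix (Fin d) (Fin d) (DualNumber ℂ)) =
      (X * Y).map TrivSqZeroExt.inr := by
  ext i j
  · simp [Matrix.mul_apply, TrivSqZeroExt.fst_sum, TrivSqZeroExt.algebraMap_eq_inl]
  · simp [Matrix.mul_apply, TrivSqZeroExt.snd_sum, TrivSqZeroExt.algebraMap_eq_inl, mul_comm]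

theorem inr_mul_algebraMap (X Y : Matrix (Fin d) (Fin d) ℂ) :
    (X.map TrivSqZeroExt.inr * Y.map (algebraMap ℂ _) : Matrix (Fin d) (Fin d) (DualNumber ℂ)) =
      (X * Y).map TrivSqZeroExt.inr := by
  ext i j
  · simp [Matrix.mul_apply, TrivSqZeroExt.fst_sum, TrivSqZeroExt.algebraMap_eq_inl]
  · simp [Matrix.mul_apply, TrivSqZeroExt.snd_sum, TrivSqZeroExt.algebraMap_eq_inl, mul_comm]

theorem map_inr_add (X Y : Matrix (Fin d) (Fin d) ℂ) :
    ((X + Y).map TrivSqZeroExt.inr : Matrix (Fin d) (Fin d) (DualNumber ℂ)) =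
      X.map TrivSqZeroExt.inr + Y.map TrivSqZeroExt.inr :=
  Matrix.map_add _ (fun _ _ => TrivSqZeroExt.inr_add _ _ _) _ _

theorem map_inr_neg (X : Matrix (Fin d) (Fin d) ℂ) :
    ((-X).map TrivSqZeroExt.inr : Matrix (Fin d) (Fin d) (DualNumber ℂ)) =
      -X.map TrivSqZeroExt.inr := by
  ext i j <;> simp

/-- The inverse of `1 + ε X` is `1 - ε X`. -/
theorem inv_val_of_eq_one_add {g : GL (Fin d) (DualNumber ℂ)} {X : Matrix (Fin d) (Fin d) ℂ}
    (h : g.val = 1 + X.map TrivSqZeroExt.inr) : (g⁻¹).val = 1 - X.map TrivSqZeroExt.inr := by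
  have h1 : g.val * (1 - X.map TrivSqZeroExt.inr) = 1 := by
    rw [h, add_mul, mul_sub, mul_sub, inr_mul_inr]
    noncomm_ring
  calc (g⁻¹).val = (g⁻¹).val * (g.val * (1 - X.map TrivSqZeroExt.inr)) := by rw [h1, mul_one]
    _ = _ := by rw [← mul_assoc, Units.inv_mul, one_mul]

/-- The Lie algebra of `G`, as a subspace of the space of matrices. -/
def lieAlg : Submodule ℂ (Matrix (Fin d) (Fin d) ℂ) where
  carrier := lieSet G
  add_mem' := by
    rintro X Y ⟨g, hg⟩ ⟨h, hh⟩
    refine ⟨g * h, ?_⟩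
    rw [map_mul, Units.val_mul, hg, hh, map_inr_add, add_mul, mul_add, mul_add, inr_mul_inr]
    noncomm_ring
  zero_mem' := ⟨1, by
    rw [map_one, Units.val_one, Matrix.map_zero _ (TrivSqZeroExt.inr_zero ℂ), add_zero]⟩
  smul_mem' := by
    rintro c X ⟨g, hg⟩
    let m : DualNumber ℂ →ₐ[ℂ] DualNumber ℂ := TrivSqZeroExt.map (c • LinearMap.id)
    refine ⟨G.grp.map (CommAlgCat.ofHom m) g, ?_⟩
    change m.mapMatrix (G.mat g).val = _
    rw [hg, map_add, map_one]
    congr 1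
    ext i j <;> simp [m, mul_comm]

/-- Over `ℂ` the adjoint action preserves the Lie algebra. -/
theorem conj_mem_lieAlg (h : G.grp.obj CC) {X : Matrix (Fin d) (Fin d) ℂ} (hX : X ∈ lieAlg G) :
    (G.mat h).val * X * ((G.mat h)⁻¹).val ∈ lieAlg G := by
  obtain ⟨g, hg⟩ := hX
  let k := G.grp.map (str (CommAlgCat.of ℂ (DualNumber ℂ))) h
  refine ⟨k * g * k⁻¹, ?_⟩
  have h1 : (G.mat k).val = (G.mat h).val.map (algebraMap ℂ _) := rfl
  have h2 : ((G.mat k)⁻¹).val = ((G.mat h)⁻¹).val.map (algebraMap ℂ _) := by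
    rw [mat_map, ← map_inv]; rfl
  rw [map_mul, map_mul, map_inv, Units.val_mul, Units.val_mul, hg, mul_add, add_mul, mul_one,
    Units.mul_inv, h1, h2, algebraMap_mul_inr, inr_mul_algebraMap]

variable {G}

theorem eval_eq_zero_of_pts {A : TestAlg} (g : G.grp.obj A)
    {f : MvPolynomial ((Fin d × Fin d) ⊕ (Fin d × Fin d)) ℂ}
    (hf : ∀ h ∈ G.pts, evalGL f h = 0) : evalGL f (G.mat g) = 0 := g.2 f hf

theorem satisfies_of_mem_pts {h : GL (Fin d) ℂ} (hh : h ∈ G.pts) : G.Satisfies h :=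
  fun _ hf => hf h hh

/-- The adjoint action of `G` preserves its Lie algebra. -/
theorem conj_mem_extendScalars_lieAlg {A : TestAlg} (g : G.grp.obj A)
    {X : Matrix (Fin d) (Fin d) A} (hX : X ∈ extendScalars (lieAlg G) A) :
    (G.mat g).val * X * ((G.mat g)⁻¹).val ∈ extendScalars (lieAlg G) A := by
  unfold extendScalars at hX
  induction hX using Submodule.span_induction with
  | zero => simp
  | add X Y _ _ hX hY => rw [mul_add, add_mul]; exact Submodule.add_mem _ hX hY
  | smul r X _ hX =>
    rw [mul_smul_comm, smul_mul_assoc]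
    exact Submodule.smul_mem _ r hX
  | mem X h =>
    obtain ⟨Y, hY, rfl⟩ := h
    refine (mem_extendScalars_iff _ _).2 fun ψ => ?_
    by_contra hn
    obtain ⟨l, hl', hl⟩ := Submodule.exists_le_ker_of_notMem hn
    -- The matrix coefficient of the adjoint action given by a linear form `l` and by `Y`.
    let q : MvPolynomial ((Fin d × Fin d) ⊕ (Fin d × Fin d)) ℂ :=
      ∑ i, ∑ j, MvPolynomial.C (l (Matrix.single i j 1)) * ∑ b, (∑ a,
        MvPolynomial.X (Sum.inl (i, a)) * MvPolynomial.C (Y a b)) * MvPolynomial.X (Sum.inr (b, j))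
    have hq : ∀ {B : Type} [CommRing B] [Algebra ℂ B] (k : GL (Fin d) B), evalGL q k =
        ∑ i, ∑ j, algebraMap ℂ B (l (Matrix.single i j 1)) *
          (k.val * Y.map (algebraMap ℂ B) * (k⁻¹).val) i j := by
      intro B _ _ k
      simp only [q, evalGL, map_sum, map_mul, MvPolynomial.aeval_X, MvPolynomial.algHom_C,
        Matrix.mul_apply]
      rfl
    have hl2 : ∀ W : Matrix (Fin d) (Fin d) ℂ, l W = ∑ i, ∑ j, l (Matrix.single i j 1) * W i j := by
      intro W
      conv_lhs => rw [Matrix.matrix_eq_sum_single W]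
      simp only [map_sum]
      refine Finset.sum_congr rfl fun i _ => Finset.sum_congr rfl fun j _ => ?_
      rw [← mul_one (W i j), ← smul_eq_mul, ← Matrix.smul_single, map_smul, smul_eq_mul,
        smul_eq_mul, mul_comm, mul_one]
    have h0 := eval_eq_zero_of_pts g (f := q) fun h hh => by
      rw [hq]
      have h1 := hl (conj_mem_lieAlg G ⟨h, satisfies_of_mem_pts hh⟩ hY)
      rw [LinearMap.mem_ker, hl2] at h1
      exact h1
    rw [hq] at h0
    refine hl' ?_
    rw [hl2, ← map_zero ψ, ← h0]
    simp only [map_sum, ← Algebra.smul_def, map_smul, smul_eq_mul]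
    rfl

/-- The derivative of the adjoint action: its value at `1 + ε λ` has `ε`-part `[λ, X]`. -/
theorem bracket_mem_lieAlg {lam : Matrix (Fin d) (Fin d) ℂ} (hlam : lam ∈ lieAlg G)
    {X : Matrix (Fin d) (Fin d) ℂ} (hX : X ∈ lieAlg G) : lam * X - X * lam ∈ lieAlg G := by
  obtain ⟨g, hg⟩ := hlam
  have h := conj_mem_extendScalars_lieAlg g
    (map_mem_extendScalars (A := CommAlgCat.of ℂ (DualNumber ℂ)) hX)
  have h1 : (G.mat g).val * X.map (algebraMap ℂ (DualNumber ℂ)) * ((G.mat g)⁻¹).val =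
      X.map (algebraMap ℂ (DualNumber ℂ)) + (lam * X - X * lam).map TrivSqZeroExt.inr := by
    rw [inv_val_of_eq_one_add hg, hg, add_mul, one_mul, inr_mul_algebraMap, add_mul, mul_sub,
      mul_sub, inr_mul_inr, mul_one, mul_one, algebraMap_mul_inr, sub_zero,
      sub_eq_add_neg _ (X * lam), map_inr_add, map_inr_neg]
    abel
  have h2 := (mem_extendScalars_iff _ _).1 h (TrivSqZeroExt.sndHom ℂ ℂ)
  rw [h1] at h2
  convert h2 using 1
  ext i j
  simp [TrivSqZeroExt.algebraMap_eq_inl]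

end Lie

/-! ### Exponentials of elements of positive degree -/

section Exp

variable {d : ℕ} {lam : Matrix (Fin d) (Fin d) ℂ}

/-- A matrix in an extension of scalars is a specialization of one with entries in a polynomial
ring. -/
theorem exists_generic {A : Type} [CommRing A] [Algebra ℂ A]
    {U : Submodule ℂ (Matrix (Fin d) (Fin d) ℂ)} {X : Matrix (Fin d) (Fin d) A}
    (hX : X ∈ extendScalars U A) :
    ∃ (I : Type) (Y : Matrix (Fin d) (Fin d) (MvPolynomial I ℂ)) (φ : MvPolynomial I ℂ →ₐ[ℂ] A),
      Y ∈ extendScalars U (MvPolynomial I ℂ) ∧ Y.map φ = X := by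
  obtain ⟨T, hT⟩ := exists_sum_smul_map X
  let φ : MvPolynomial (Module.Basis.ofVectorSpaceIndex ℂ A) ℂ →ₐ[ℂ] A :=
    MvPolynomial.aeval fun i => Module.Basis.ofVectorSpace ℂ A i
  refine ⟨_, ∑ i ∈ T, (MvPolynomial.X i : MvPolynomial (Module.Basis.ofVectorSpaceIndex ℂ A) ℂ) •
    (X.map ((Module.Basis.ofVectorSpace ℂ A).coord i)).map
      (algebraMap ℂ (MvPolynomial (Module.Basis.ofVectorSpaceIndex ℂ A) ℂ)), φ, ?_, ?_⟩
  · exact Submodule.sum_mem _ fun i _ => Submodule.smul_mem _ _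
      (map_mem_extendScalars ((mem_extendScalars_iff _ _).1 hX _))
  · conv_rhs => rw [hT]
    change φ.mapMatrix _ = _
    rw [map_sum]
    refine Finset.sum_congr rfl fun i _ => ?_
    ext k l
    simp [φ]

theorem mul_mem_extendScalars_degGE {A : Type} [CommRing A] [Algebra ℂ A] {j k : ℕ}
    {X Y : Matrix (Fin d) (Fin d) A} (hX : X ∈ extendScalars (degGE lam ⊤ j) A)
    (hY : Y ∈ extendScalars (degGE lam ⊤ k) A) :
    X * Y ∈ extendScalars (degGE lam ⊤ (j + k)) A :=
  mul_mem_extendScalars (fun _ h _ h' => mul_mem_degGE h h') hX hY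

theorem pow_mem_extendScalars_degGE {A : Type} [CommRing A] [Algebra ℂ A] {j : ℕ}
    {X : Matrix (Fin d) (Fin d) A} (hX : X ∈ extendScalars (degGE lam ⊤ j) A) (n : ℕ) :
    X ^ (n + 1) ∈ extendScalars (degGE lam ⊤ ((n + 1) * j)) A := by
  induction n with
  | zero => simpa using hX
  | succ n ih =>
    rw [pow_succ, add_mul _ 1, one_mul]
    exact mul_mem_extendScalars_degGE ih hX

theorem isNilpotent_of_degGE {A : Type} [CommRing A] [Algebra ℂ A]
    {X : Matrix (Fin d) (Fin d) A} (hX : X ∈ extendScalars (degGE lam ⊤ 1) A) :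
    IsNilpotent X := by
  obtain ⟨k, hk⟩ := exists_degGE_eq_bot lam
  refine ⟨k + 1, extendScalars_bot ?_⟩
  rw [← hk]
  exact extendScalars_mono (degGE_anti _ (by omega)) (pow_mem_extendScalars_degGE hX k)

theorem matrix_pow_eq_zero_of_isNilpotent {R : Type} [CommRing R] [IsDomain R]
    {X : Matrix (Fin d) (Fin d) R} (hX : IsNilpotent X) : X ^ d = 0 := by
  have h := (Matrix.isNilpotent_charpoly_sub_pow_of_isNilpotent hX).eq_zero
  rw [Fintype.card_fin, sub_eq_zero] at h
  have h' := Matrix.aeval_self_charpoly X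
  rwa [h, map_pow, Polynomial.aeval_X] at h'

/-- The `d`-th power of a matrix of positive degree vanishes, by reduction to the case of an
integral domain. -/
theorem pow_eq_zero_of_degGE {A : Type} [CommRing A] [Algebra ℂ A]
    {X : Matrix (Fin d) (Fin d) A} (hX : X ∈ extendScalars (degGE lam ⊤ 1) A) : X ^ d = 0 := by
  obtain ⟨I, Y, φ, hY, rfl⟩ := exists_generic hX
  change φ.mapMatrix Y ^ d = 0
  rw [← map_pow, matrix_pow_eq_zero_of_isNilpotent (isNilpotent_of_degGE hY), map_zero]

theorem nilExp_mul_nilExp_neg {A : TestAlg} {X : Matrix (Fin d) (Fin d) A} (hX : X ^ d = 0) :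
    nilExp X * nilExp (-X) = 1 := by
  let _ : Algebra ℚ A := ((algebraMap ℂ A).comp (algebraMap ℚ ℂ)).toAlgebra
  have h : ∀ Y : Matrix (Fin d) (Fin d) A, Y ^ d = 0 → nilExp Y = IsNilpotent.exp Y := by
    intro Y hY
    rw [IsNilpotent.exp_eq_sum hY]
    refine Finset.sum_congr rfl fun k _ => ?_
    ext i j
    simp only [Matrix.smul_apply, Algebra.smul_def]
    congr 1
    change _ = algebraMap ℂ A (algebraMap ℚ ℂ _)
    simp
  have hX' : (-X) ^ d = 0 := by rw [neg_pow, hX, mul_zero]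
  rw [h X hX, h (-X) hX']
  exact IsNilpotent.exp_mul_exp_neg_self ⟨d, hX⟩

/-- The exponential of `X`, when `X ^ d = 0`, as an invertible matrix. -/
def nilExpUnit {A : TestAlg} (X : Matrix (Fin d) (Fin d) A) (hX : X ^ d = 0) : GL (Fin d) A where
  val := nilExp X
  inv := nilExp (-X)
  val_inv := nilExp_mul_nilExp_neg hX
  inv_val := by
    have h := nilExp_mul_nilExp_neg (X := -X) (by rw [neg_pow, hX, mul_zero])
    rwa [neg_neg] at h

/-- The derivative of `exp(s Z)` is `exp(s Z) Z`. -/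
theorem derivative_nilExp {Z : Matrix (Fin d) (Fin d) ℂ} (hZ : Z ^ d = 0) :
    (nilExp (A := CommAlgCat.of ℂ (Polynomial ℂ))
      ((Polynomial.X : Polynomial ℂ) • Z.map Polynomial.C)).map Polynomial.derivative =
    nilExp (A := CommAlgCat.of ℂ (Polynomial ℂ))
      ((Polynomial.X : Polynomial ℂ) • Z.map Polynomial.C) * Z.map Polynomial.C := by
  rcases d with _ | n
  · exact Subsingleton.elim _ _
  have hpow : ∀ k : ℕ, (Z.map Polynomial.C) ^ k = (Z ^ k).map Polynomial.C := fun k =>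
    (map_pow (Polynomial.C (R := ℂ)).mapMatrix Z k).symm
  unfold nilExp
  change Polynomial.derivative.mapMatrix _ = _
  rw [map_sum, Finset.sum_mul, Finset.sum_range_succ' _ n, Finset.sum_range_succ _ n]
  congr 1
  · refine Finset.sum_congr rfl fun k _ => ?_
    rw [smul_pow, smul_pow, hpow, smul_mul_assoc, smul_mul_assoc, hpow, ← Matrix.map_mul,
      ← pow_succ]
    refine Matrix.ext fun i j => ?_
    simp only [LinearMap.mapMatrix_apply, Matrix.map_apply, Matrix.smul_apply, map_smul,
      smul_eq_mul, Polynomial.derivative_mul, Polynomial.derivative_C, mul_zero, add_zero,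
      Polynomial.derivative_X_pow, Nat.factorial_succ, Nat.cast_mul, mul_inv]
    rw [Polynomial.smul_eq_C_mul, Polynomial.smul_eq_C_mul, Nat.add_sub_cancel, map_mul]
    have hk : (Polynomial.C (((k + 1 : ℕ) : ℂ)⁻¹) * Polynomial.C ((k + 1 : ℕ) : ℂ)) = 1 := by
      rw [← map_mul, inv_mul_cancel₀ (Nat.cast_ne_zero.2 k.succ_ne_zero), map_one]
    linear_combination (Polynomial.C ((k.factorial : ℂ)⁻¹) * Polynomial.X ^ k *
      Polynomial.C ((Z ^ (k + 1)) i j)) * hk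
  · have h : ∀ (c : ℂ) (x : Polynomial ℂ) (Y W : Matrix (Fin (n + 1)) (Fin (n + 1)) (Polynomial ℂ)),
        c • x • Y * W = c • x • (Y * W) := fun c x Y W => by
      rw [smul_mul_assoc, smul_mul_assoc]
    rw [smul_pow (_ : Polynomial ℂ) _ n, hpow n, h, ← Matrix.map_mul, ← pow_succ, hZ]
    refine Matrix.ext fun i j => ?_
    rcases eq_or_ne i j with rfl | hij
    · simp
    · simp [hij]

end Exp

/-! ### One-parameter subgroups -/

section ExpMem

variable {d : ℕ} {G : LinearAlgebraicGroup d} {lam : Matrix (Fin d) (Fin d) ℂ}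

/-- The left invariant vector field on `GL_d` attached to a matrix `Z`. -/
def vectorField (Z : Matrix (Fin d) (Fin d) ℂ) :
    Derivation ℂ (MvPolynomial ((Fin d × Fin d) ⊕ (Fin d × Fin d)) ℂ)
      (MvPolynomial ((Fin d × Fin d) ⊕ (Fin d × Fin d)) ℂ) :=
  MvPolynomial.mkDerivation ℂ (Sum.elim
    (fun ij => ∑ k, MvPolynomial.X (Sum.inl (ij.1, k)) * MvPolynomial.C (Z k ij.2))
    (fun ij => -∑ k, MvPolynomial.C (Z ij.1 k) * MvPolynomial.X (Sum.inr (k, ij.2))))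

theorem evalGL_vectorField_inl {A : Type} [CommRing A] [Algebra ℂ A]
    (Z : Matrix (Fin d) (Fin d) ℂ) (g : GL (Fin d) A) (ij : Fin d × Fin d) :
    evalGL (vectorField Z (MvPolynomial.X (Sum.inl ij))) g =
      (g.val * Z.map (algebraMap ℂ A)) ij.1 ij.2 := by
  rw [vectorField, MvPolynomial.mkDerivation_X]
  simp only [evalGL, Sum.elim_inl, map_sum, map_mul, MvPolynomial.aeval_X, MvPolynomial.algHom_C,
    Matrix.mul_apply]
  rfl

theorem evalGL_vectorField_inr {A : Type} [CommRing A] [Algebra ℂ A]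
    (Z : Matrix (Fin d) (Fin d) ℂ) (g : GL (Fin d) A) (ij : Fin d × Fin d) :
    evalGL (vectorField Z (MvPolynomial.X (Sum.inr ij))) g =
      -(Z.map (algebraMap ℂ A) * (g⁻¹).val) ij.1 ij.2 := by
  rw [vectorField, MvPolynomial.mkDerivation_X]
  simp only [evalGL, Sum.elim_inr, map_sum, map_mul, MvPolynomial.aeval_X, MvPolynomial.algHom_C,
    Matrix.mul_apply, map_neg]
  rfl

theorem evalGL_C {A : Type} [CommRing A] [Algebra ℂ A] (c : ℂ) (g : GL (Fin d) A) :
    evalGL (MvPolynomial.C c) g = algebraMap ℂ A c := MvPolynomial.algHom_C _ _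

theorem evalGL_X {A : Type} [CommRing A] [Algebra ℂ A] (k) (g : GL (Fin d) A) :
    evalGL (MvPolynomial.X k) g = coords g k := MvPolynomial.aeval_X _ _

theorem evalGL_add {A : Type} [CommRing A] [Algebra ℂ A] (p q) (g : GL (Fin d) A) :
    evalGL (p + q) g = evalGL p g + evalGL q g := map_add _ _ _

theorem evalGL_mul {A : Type} [CommRing A] [Algebra ℂ A] (p q) (g : GL (Fin d) A) :
    evalGL (p * q) g = evalGL p g * evalGL q g := map_mul _ _ _

/-- The first order expansion of a function along `h (1 + ε Z)`. -/
theorem evalGL_mul_one_add {Z : Matrix (Fin d) (Fin d) ℂ} {g : GL (Fin d) (DualNumber ℂ)}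
    (hg : g.val = 1 + Z.map TrivSqZeroExt.inr) (h : GL (Fin d) ℂ)
    (f : MvPolynomial ((Fin d × Fin d) ⊕ (Fin d × Fin d)) ℂ) :
    evalGL f (glMap (A := CC) (B := CommAlgCat.of ℂ (DualNumber ℂ)) (str _) h * g) =
      TrivSqZeroExt.inl (evalGL f h) + TrivSqZeroExt.inr (evalGL (vectorField Z f) h) := by
  set k : GL (Fin d) (DualNumber ℂ) :=
    glMap (A := CC) (B := CommAlgCat.of ℂ (DualNumber ℂ)) (str _) h with hk
  have hk1 : k.val = h.val.map (algebraMap ℂ _) := rfl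
  have hk2 : (k⁻¹).val = (h⁻¹).val.map (algebraMap ℂ _) := by
    rw [hk, ← map_inv]; rfl
  induction f using MvPolynomial.induction_on with
  | C c => 
    rw [evalGL_C, evalGL_C, MvPolynomial.derivation_C]
    simp [evalGL, TrivSqZeroExt.algebraMap_eq_inl]
  | add p q hp hq =>
    rw [evalGL_add, evalGL_add, map_add, evalGL_add, hp, hq, TrivSqZeroExt.inl_add,
      TrivSqZeroExt.inr_add]
    abel
  | mul_X p n hp =>
    have hX : coords (k * g) n = TrivSqZeroExt.inl (coords h n) +
        TrivSqZeroExt.inr (evalGL (vectorField Z (MvPolynomial.X n)) h) := by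
      rcases n with ij | ij
      · rw [evalGL_vectorField_inl]
        change (k.val * g.val) ij.1 ij.2 = _
        rw [hg, mul_add, mul_one, hk1, algebraMap_mul_inr]
        rfl
      · rw [evalGL_vectorField_inr]
        change ((k * g)⁻¹).val ij.1 ij.2 = _
        rw [mul_inv_rev, Units.val_mul, inv_val_of_eq_one_add hg, sub_mul, one_mul, hk2,
          inr_mul_algebraMap, TrivSqZeroExt.inr_neg]
        rfl
    rw [evalGL_mul, evalGL_mul, hp, evalGL_X, hX, Derivation.leibniz, evalGL_add, smul_eq_mul,
      smul_eq_mul, evalGL_mul, evalGL_mul, evalGL_X]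
    ext
    · simp
    · simp
      ring

/-- The vector field of an element of the Lie algebra is tangent to the group. -/
theorem vectorField_vanishes {Z : Matrix (Fin d) (Fin d) ℂ} (hZ : Z ∈ lieAlg G)
    {f : MvPolynomial ((Fin d × Fin d) ⊕ (Fin d × Fin d)) ℂ} (hf : ∀ h ∈ G.pts, evalGL f h = 0) :
    ∀ h ∈ G.pts, evalGL (vectorField Z f) h = 0 := by
  intro h hh
  obtain ⟨g, hg⟩ := hZ
  have h1 := eval_eq_zero_of_pts
    (G.grp.map (str _) (⟨h, satisfies_of_mem_pts hh⟩ : G.grp.obj CC) * g) hf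
  rw [map_mul] at h1
  have h2 := congrArg TrivSqZeroExt.snd ((evalGL_mul_one_add hg h f).symm.trans h1)
  simpa using h2

/-- The one-parameter group `exp(s Z)`, over the polynomial ring in `s`. -/
def expCurve (Z : Matrix (Fin d) (Fin d) ℂ) (hZ : Z ^ d = 0) : GL (Fin d) (Polynomial ℂ) :=
  nilExpUnit (A := CommAlgCat.of ℂ (Polynomial ℂ))
    ((Polynomial.X : Polynomial ℂ) • Z.map Polynomial.C) (by
      rw [smul_pow, show (Z.map Polynomial.C) ^ d = (Z ^ d).map Polynomial.C from
        (map_pow (Polynomial.C (R := ℂ)).mapMatrix Z d).symm, hZ,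
        Matrix.map_zero _ (map_zero _), smul_zero])

theorem derivative_evalGL_expCurve (Z : Matrix (Fin d) (Fin d) ℂ) (hZ : Z ^ d = 0)
    (f : MvPolynomial ((Fin d × Fin d) ⊕ (Fin d × Fin d)) ℂ) :
    Polynomial.derivative (evalGL f (expCurve Z hZ)) =
      evalGL (vectorField Z f) (expCurve Z hZ) := by
  induction f using MvPolynomial.induction_on with
  | C c =>
    rw [evalGL_C, MvPolynomial.derivation_C, Polynomial.algebraMap_eq, Polynomial.derivative_C]
    exact (map_zero (MvPolynomial.aeval _)).symm
  | add p q hp hq => rw [evalGL_add, map_add, map_add, hp, hq, evalGL_add]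
  | mul_X p n hp =>
    have hX : Polynomial.derivative (coords (expCurve Z hZ) n) =
        evalGL (vectorField Z (MvPolynomial.X n)) (expCurve Z hZ) := by
      rcases n with ij | ij
      · rw [evalGL_vectorField_inl]
        exact congrFun (congrFun (derivative_nilExp hZ) ij.1) ij.2
      · rw [evalGL_vectorField_inr]
        have h1 := derivative_nilExp (Z := -Z) (by rw [neg_pow, hZ, mul_zero])
        have h2 : (-Z).map Polynomial.C = -Z.map Polynomial.C :=
          Matrix.map_neg _ (map_neg _) _
        rw [h2, smul_neg] at h1
        have h3 := congrFun (congrFun h1 ij.1) ij.2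
        refine h3.trans ?_
        have hc : Commute (Z.map Polynomial.C) (nilExp (A := CommAlgCat.of ℂ (Polynomial ℂ))
            (-((Polynomial.X : Polynomial ℂ) • Z.map Polynomial.C))) := by
          unfold nilExp
          refine Commute.sum_right _ _ _ fun k _ => Commute.smul_right (Commute.pow_right ?_ k) _
          exact ((Commute.refl _).smul_right _).neg_right
        rw [mul_neg, ← hc.eq]
        rfl
    rw [evalGL_mul, Polynomial.derivative_mul, hp, evalGL_X, hX, Derivation.leibniz, evalGL_add,
      smul_eq_mul, smul_eq_mul, evalGL_mul, evalGL_mul, evalGL_X]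
    ring

theorem map_smul_X_eval (Z : Matrix (Fin d) (Fin d) ℂ) (hZ : Z ^ d = 0) (c : ℂ) :
    (expCurve Z hZ).val.map (Polynomial.aeval c) = nilExp (A := CC) (c • Z) := by
  refine (nilExp_map (A := CommAlgCat.of ℂ (Polynomial ℂ)) (B := CC)
    (CommAlgCat.ofHom (Polynomial.aeval c)) _).trans (congrArg (nilExp (A := CC)) ?_)
  ext i j
  simp
  exact mul_comm _ _

/-- The exponential of a nilpotent element of the Lie algebra lies in the group: the Taylor
coefficients of an equation of the group along `exp(s Z)` are its derivatives along the vector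
field of `Z`, and these vanish on the group. -/
theorem nilExp_mem_pts {Z : Matrix (Fin d) (Fin d) ℂ} (hZ : Z ^ d = 0) (hL : Z ∈ lieAlg G) :
    G.Satisfies (nilExpUnit (A := CC) Z hZ) := by
  intro f hf
  have hiter : ∀ n : ℕ, Polynomial.derivative^[n] (evalGL f (expCurve Z hZ)) =
      evalGL ((vectorField Z)^[n] f) (expCurve Z hZ) := by
    intro n
    induction n with
    | zero => rfl
    | succ n ih =>
      rw [Function.iterate_succ_apply', ih, derivative_evalGL_expCurve,
        Function.iterate_succ_apply']
  have hvan : ∀ n : ℕ, ∀ h ∈ G.pts, evalGL ((vectorField Z)^[n] f) h = 0 := by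
    intro n
    induction n with
    | zero => exact hf
    | succ n ih =>
      rw [Function.iterate_succ_apply']
      exact vectorField_vanishes hL ih
  have hmap : ∀ c : ℂ, ∀ p, (Polynomial.aeval c) (evalGL p (expCurve Z hZ)) =
      evalGL p (glMap (A := CommAlgCat.of ℂ (Polynomial ℂ)) (B := CC)
        (CommAlgCat.ofHom (Polynomial.aeval c)) (expCurve Z hZ)) := fun c p =>
    (LinearAlgebraicGroup.evalGL_map (Polynomial.aeval c) p _).symm
  have h0 : glMap (A := CommAlgCat.of ℂ (Polynomial ℂ)) (B := CC)
      (CommAlgCat.ofHom (Polynomial.aeval 0)) (expCurve Z hZ) = 1 := by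
    refine Units.ext ((map_smul_X_eval Z hZ 0).trans ?_)
    rw [zero_smul]
    rcases d with _ | n
    · exact Subsingleton.elim _ _
    · rw [nilExp, Finset.sum_range_succ']
      simp
  have h1 : evalGL f (expCurve Z hZ) = 0 := by
    ext n
    have h2 := Polynomial.coeff_iterate_derivative (k := n) (evalGL f (expCurve Z hZ)) 0
    rw [hiter, Polynomial.coeff_zero_eq_aeval_zero, hmap, h0, hvan n 1 G.pts.one_mem, zero_add,
      Nat.descFactorial_self, nsmul_eq_mul] at h2
    rw [Polynomial.coeff_zero]
    exact (mul_eq_zero.1 h2.symm).resolve_left (Nat.cast_ne_zero.2 n.factorial_ne_zero)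
  have h2 := hmap 1 f
  rw [h1, map_zero] at h2
  refine Eq.trans ?_ h2.symm
  refine congrArg (evalGL f) (Units.ext ?_)
  refine Eq.symm ((map_smul_X_eval Z hZ 1).trans ?_)
  rw [one_smul]
  rfl

/-- The exponential of an element of `𝔫(λ) ⊗ A` is a point of the group. -/
theorem satisfies_nilExp {A : TestAlg} {X : Matrix (Fin d) (Fin d) A}
    (hX : X ∈ extendScalars (degGE lam (lieAlg G) 1) A) (hXd : X ^ d = 0) :
    G.Satisfies (nilExpUnit X hXd) := by
  have hle : degGE lam (lieAlg G) 1 ≤ degGE lam ⊤ 1 := degGE_mono le_top 1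
  obtain ⟨I, Y, φ, hY, rfl⟩ := exists_generic hX
  have hYd := pow_eq_zero_of_degGE (extendScalars_mono hle hY)
  have key : G.Satisfies (nilExpUnit (A := CommAlgCat.of ℂ (MvPolynomial I ℂ)) Y hYd) := by
    intro f hf
    refine MvPolynomial.funext fun t => ?_
    have h1 : Y.map (MvPolynomial.aeval t) ∈ degGE lam (lieAlg G) 1 := by
      have h2 := (mem_extendScalars_iff _ _).1 hY (MvPolynomial.aeval t).toLinearMap
      exact h2
    have hYt : (Y.map (MvPolynomial.aeval t : MvPolynomial I ℂ →ₐ[ℂ] ℂ)) ^ d = 0 := by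
      change (MvPolynomial.aeval t : MvPolynomial I ℂ →ₐ[ℂ] ℂ).mapMatrix Y ^ d = 0
      rw [← map_pow, hYd, map_zero]
    have h3 := nilExp_mem_pts hYt (degGE_le _ _ h1) f hf
    rw [map_zero, ← h3, ← MvPolynomial.coe_aeval_eq_eval]
    refine (LinearAlgebraicGroup.evalGL_map (MvPolynomial.aeval t) f _).symm.trans
      (congrArg (evalGL f) (Units.ext ?_))
    exact nilExp_map (A := CommAlgCat.of ℂ (MvPolynomial I ℂ)) (B := CC)
      (CommAlgCat.ofHom (MvPolynomial.aeval t)) Y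
  have h := key.map G φ
  convert h using 1
  exact Units.ext (nilExp_map (A := CommAlgCat.of ℂ (MvPolynomial I ℂ)) (B := A)
      (CommAlgCat.ofHom φ) Y).symm

end ExpMem

/-! ### The parabolic as a stabilizer -/

section Stabilizer

variable {d : ℕ} {lam : Matrix (Fin d) (Fin d) ℂ}

theorem semiconjBy_exp {x a b : Matrix (Fin d) (Fin d) ℂ} (h : SemiconjBy x a b) :
    SemiconjBy x (NormedSpace.exp a) (NormedSpace.exp b) := by
  open scoped Matrix.Norms.Operator in
  convert SemiconjBy.exp_right h <;> rfl

theorem exp_smul_one {c : ℂ} (hc : Complex.exp c = 1) :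
    NormedSpace.exp (c • (1 : Matrix (Fin d) (Fin d) ℂ)) = 1 := by
  rw [← Matrix.diagonal_one, ← Matrix.diagonal_smul, Matrix.exp_diagonal]
  congr 1
  ext i
  rw [Pi.coe_exp]
  simp [← Complex.exp_eq_exp_ℂ, hc]

/-- Matrices of integral degree commute with `exp(2πiλ)`. -/
theorem alpha_mul_comm {Z : Matrix (Fin d) (Fin d) ℂ} {k : ℕ}
    (hZ : lam * Z - Z * lam = (k : ℂ) • Z) : (alpha lam).val * Z = Z * (alpha lam).val := by
  have h1 : SemiconjBy Z ((2 * Real.pi * Complex.I : ℂ) • lam +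
      (k * (2 * Real.pi * Complex.I) : ℂ) • (1 : Matrix (Fin d) (Fin d) ℂ))
      ((2 * Real.pi * Complex.I : ℂ) • lam) := by
    unfold SemiconjBy
    rw [mul_add, mul_smul_comm, mul_smul_comm, mul_one, smul_mul_assoc,
      sub_eq_iff_eq_add.1 hZ]
    module
  have h2 := semiconjBy_exp h1
  rw [Matrix.exp_add_of_commute _ _ ((Commute.one_right _).smul_right _),
    exp_smul_one (Complex.exp_nat_mul_two_pi_mul_I k), mul_one] at h2
  exact h2.eq.symm

theorem alphaAt_mul_comm {A : TestAlg} {Z : Matrix (Fin d) (Fin d) A} {k : ℕ}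
    (hZ : Z ∈ extendScalars (degGE lam ⊤ k) A) :
    (alphaAt lam A).val * Z = Z * (alphaAt lam A).val := by
  have h0 : ∀ Z ∈ degGE lam ⊤ k, (alpha lam).val * Z = Z * (alpha lam).val := by
    intro Z hZ
    unfold degGE at hZ
    induction hZ using Submodule.span_induction with
    | mem Z h => exact alpha_mul_comm h.2.choose_spec.2
    | zero => rw [mul_zero, zero_mul]
    | add X Y _ _ hX hY => rw [mul_add, add_mul, hX, hY]
    | smul r X _ hX => rw [mul_smul_comm, smul_mul_assoc, hX]
  unfold extendScalars at hZ
  induction hZ using Submodule.span_induction with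
  | mem Z h =>
    obtain ⟨Y, hY, rfl⟩ := h
    change (alpha lam).val.map (algebraMap ℂ A) * Y.map (algebraMap ℂ A) =
      Y.map (algebraMap ℂ A) * (alpha lam).val.map (algebraMap ℂ A)
    rw [← Matrix.map_mul, ← Matrix.map_mul, h0 Y hY]
  | zero => rw [mul_zero, zero_mul]
  | add X Y _ _ hX hY => rw [mul_add, add_mul, hX, hY]
  | smul r X _ hX => rw [mul_smul_comm, smul_mul_assoc, hX]

theorem extendScalars_degGE_anti {A : Type} [CommRing A] [Algebra ℂ A]
    {U : Submodule ℂ (Matrix (Fin d) (Fin d) ℂ)} {j k : ℕ} (h : k ≤ j)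
    {X : Matrix (Fin d) (Fin d) A} (hX : X ∈ extendScalars (degGE lam U j) A) :
    X ∈ extendScalars (degGE lam U k) A :=
  extendScalars_mono (degGE_anti _ h) hX

theorem extendScalars_degGE_top {A : Type} [CommRing A] [Algebra ℂ A]
    {U : Submodule ℂ (Matrix (Fin d) (Fin d) ℂ)} {k : ℕ}
    {X : Matrix (Fin d) (Fin d) A} (hX : X ∈ extendScalars (degGE lam U k) A) :
    X ∈ extendScalars (degGE lam ⊤ k) A :=
  extendScalars_mono (degGE_mono le_top k) hX

theorem map_bracket {A : TestAlg} (ψ : A →ₗ[ℂ] ℂ) (X : Matrix (Fin d) (Fin d) A) :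
    (lamAt lam A * X - X * lamAt lam A).map ψ = lam * X.map ψ - X.map ψ * lam := by
  ext i j
  have h : ∀ (c : ℂ) (a : A), algebraMap ℂ A c * a = c • a := fun c a =>
    (Algebra.smul_def c a).symm
  simp [Matrix.mul_apply, lamAt, h, mul_comm _ (algebraMap ℂ A _), mul_comm _ (lam _ _)]

theorem bracket_mem_degGE {A : TestAlg} {k : ℕ} {X : Matrix (Fin d) (Fin d) A}
    (hX : X ∈ extendScalars (degGE lam ⊤ k) A) :
    lamAt lam A * X - X * lamAt lam A ∈ extendScalars (degGE lam ⊤ k) A := by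
  refine (mem_extendScalars_iff _ _).2 fun ψ => ?_
  rw [map_bracket]
  have h := (mem_extendScalars_iff _ _).1 hX ψ
  generalize X.map ψ = Y at h
  unfold degGE at h
  induction h using Submodule.span_induction with
  | mem Z h =>
    obtain ⟨-, j, hj, e⟩ := h
    rw [e]
    exact Submodule.smul_mem _ _ (Submodule.subset_span ⟨Submodule.mem_top, j, hj, e⟩)
  | zero => simp
  | add X Y _ _ hX hY =>
    rw [mul_add, add_mul, add_sub_add_comm]
    exact Submodule.add_mem _ hX hY
  | smul r X _ hX =>
    rw [mul_smul_comm, smul_mul_assoc, ← smul_sub]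
    exact Submodule.smul_mem _ _ hX

/-- The exponential of `X` is `1 + X` up to terms of higher degree. -/
theorem nilExp_eq_one_add {A : TestAlg} {k : ℕ} {X : Matrix (Fin d) (Fin d) A}
    (hX : X ∈ extendScalars (degGE lam ⊤ (k + 1)) A) :
    ∃ W ∈ extendScalars (degGE lam ⊤ (k + 2)) A, nilExp X = 1 + X + W := by
  have hXd := pow_eq_zero_of_degGE (extendScalars_degGE_anti (by omega) hX)
  refine ⟨∑ j ∈ Finset.range d, (((j + 2).factorial : ℂ)⁻¹) • X ^ (j + 2),
    Submodule.sum_mem _ fun j _ => ?_, ?_⟩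
  · rw [← algebraMap_smul A]
    refine Submodule.smul_mem _ _ (extendScalars_degGE_anti ?_ (pow_mem_extendScalars_degGE hX _))
    rw [add_mul, add_mul, one_mul]
    omega
  · have h : nilExp X = ∑ j ∈ Finset.range (d + 2), ((j.factorial : ℂ)⁻¹) • X ^ j := by
      refine Finset.sum_subset (Finset.range_mono (by omega)) fun j _ hj => ?_
      rw [pow_eq_zero_of_le (by simpa using hj) hXd, smul_zero]
    rw [h, Finset.sum_range_succ', Finset.sum_range_succ']
    simp only [zero_add, Nat.factorial_zero, Nat.factorial_one, Nat.cast_one, inv_one, one_smul,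
      pow_zero, pow_one]
    abel

/-- The inverse of `1 + U`, when `U` has positive degree. -/
theorem inv_sub_one_mem {A : TestAlg} {g : GL (Fin d) A}
    (hg : g.val - 1 ∈ extendScalars (degGE lam ⊤ 1) A) :
    (g⁻¹).val - 1 ∈ extendScalars (degGE lam ⊤ 1) A := by
  set U := g.val - 1 with hU
  have hUd := pow_eq_zero_of_degGE hg
  have h1 : g.val * ∑ i ∈ Finset.range (d + 1), (-U) ^ i = 1 := by
    have h2 := mul_neg_geom_sum (-U) (d + 1)
    rwa [neg_pow, pow_succ U, hUd, zero_mul, mul_zero, sub_zero, sub_neg_eq_add, hU,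
      add_sub_cancel, ← hU] at h2
  have h3 : (g⁻¹).val = ∑ i ∈ Finset.range (d + 1), (-U) ^ i := by
    calc (g⁻¹).val = (g⁻¹).val * (g.val * ∑ i ∈ Finset.range (d + 1), (-U) ^ i) := by
          rw [h1, mul_one]
      _ = _ := by rw [← mul_assoc, Units.inv_mul, one_mul]
  rw [h3, Finset.sum_range_succ', pow_zero, add_sub_cancel_right]
  exact Submodule.sum_mem _ fun i _ => extendScalars_degGE_anti (by omega)
    (pow_mem_extendScalars_degGE (Submodule.neg_mem _ hg) i)

theorem mul_mem_left_of_one {A : TestAlg} {k : ℕ} {g : GL (Fin d) A}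
    (hg : g.val - 1 ∈ extendScalars (degGE lam ⊤ 1) A) {X : Matrix (Fin d) (Fin d) A}
    (hX : X ∈ extendScalars (degGE lam ⊤ k) A) : g.val * X ∈ extendScalars (degGE lam ⊤ k) A := by
  have h : g.val * X = X + (g.val - 1) * X := by noncomm_ring
  rw [h]
  exact Submodule.add_mem _ hX
    (extendScalars_degGE_anti (by omega) (mul_mem_extendScalars_degGE hg hX))

theorem mul_mem_right_of_one {A : TestAlg} {k : ℕ} {g : GL (Fin d) A}
    (hg : g.val - 1 ∈ extendScalars (degGE lam ⊤ 1) A) {X : Matrix (Fin d) (Fin d) A}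
    (hX : X ∈ extendScalars (degGE lam ⊤ k) A) : X * g.val ∈ extendScalars (degGE lam ⊤ k) A := by
  have h : X * g.val = X + X * (g.val - 1) := by noncomm_ring
  rw [h]
  exact Submodule.add_mem _ hX
    (extendScalars_degGE_anti (by omega) (mul_mem_extendScalars_degGE hX hg))

variable {G : LinearAlgebraicGroup d}

theorem mem_degGE_lieAlg (hlam : lam ∈ lieAlg G) {A : TestAlg} {k : ℕ}
    {X : Matrix (Fin d) (Fin d) A} (h : X ∈ extendScalars (lieAlg G) A)
    (h' : X ∈ extendScalars (degGE lam ⊤ k) A) : X ∈ extendScalars (degGE lam (lieAlg G) k) A :=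
  extendScalars_mono (inf_degGE_le (fun _ hX => bracket_mem_lieAlg hlam hX) k)
    (extendScalars_inf _ _ h h')

theorem conj_lamAt_sub_mem (hlam : lam ∈ lieAlg G) {A : TestAlg} (g : G.grp.obj A) :
    (G.mat g).val * lamAt lam A * ((G.mat g)⁻¹).val - lamAt lam A ∈
      extendScalars (lieAlg G) A :=
  Submodule.sub_mem _ (conj_mem_extendScalars_lieAlg g (map_mem_extendScalars hlam))
    (map_mem_extendScalars hlam)

theorem adFlat_le_flatAt {A : TestAlg} {g : GL (Fin d) A}
    (h1 : g.val * lamAt lam A * (g⁻¹).val - lamAt lam A ∈ nilAt G lam A)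
    (h2 : ∀ X ∈ nilAt G lam A, g.val * X * (g⁻¹).val ∈ nilAt G lam A) :
    adFlat g (flatAt G lam A) ≤ flatAt G lam A := by
  rintro _ ⟨X, hX, rfl⟩
  rw [mem_flatAt]
  have h3 := Submodule.add_mem _ h1 (h2 _ ((mem_flatAt G lam A X).1 hX))
  convert h3 using 1
  change g.val * (X * (g⁻¹).val) - lamAt lam A = _
  rw [mul_sub, sub_mul]
  noncomm_ring

theorem adFlat_mono {A : TestAlg} (g : GL (Fin d) A)
    {F F' : AffineSubspace A (Matrix (Fin d) (Fin d) A)} (h : F ≤ F') : adFlat g F ≤ adFlat g F' :=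
  AffineSubspace.map_mono _ h

/-- The stabilizer of the canonical flat in `G(α)`. -/
def flatStabilizer (G : LinearAlgebraicGroup d) (lam : Matrix (Fin d) (Fin d) ℂ) (A : TestAlg) :
    Subgroup ((cent G lam).obj A) where
  carrier := {h | adFlat (G.mat (centIncl G lam h)) (flatAt G lam A) = flatAt G lam A}
  one_mem' := by
    change adFlat (G.mat (centIncl G lam 1)) _ = _
    rw [map_one, map_one, adFlat_one]
  mul_mem' {g h} hg hh := by
    change adFlat (G.mat (centIncl G lam (g * h))) _ = _
    rw [map_mul, map_mul, adFlat_mul, hh, hg]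
  inv_mem' {g} hg := by
    change adFlat (G.mat (centIncl G lam g⁻¹)) _ = _
    rw [map_inv, map_inv]
    conv_lhs => rw [← hg]
    rw [← adFlat_mul, inv_mul_cancel, adFlat_one]

theorem mem_flatStabilizer_of_le {A : TestAlg} {h : (cent G lam).obj A}
    (h1 : adFlat (G.mat (centIncl G lam h)) (flatAt G lam A) ≤ flatAt G lam A)
    (h2 : adFlat (G.mat (centIncl G lam h))⁻¹ (flatAt G lam A) ≤ flatAt G lam A) :
    h ∈ flatStabilizer G lam A := by
  refine le_antisymm h1 ?_
  have h3 := adFlat_mono (G.mat (centIncl G lam h)) h2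
  rwa [← adFlat_mul, mul_inv_cancel, adFlat_one] at h3

theorem bracket_of_degEq {A : TestAlg} {k : ℕ} {U : Submodule ℂ (Matrix (Fin d) (Fin d) ℂ)}
    {X : Matrix (Fin d) (Fin d) A} (hX : X ∈ extendScalars (degEq lam U k) A) :
    lamAt lam A * X - X * lamAt lam A = (k : A) • X := by
  unfold extendScalars at hX
  induction hX using Submodule.span_induction with
  | mem Z h =>
    obtain ⟨Y, hY, rfl⟩ := h
    have e2 := congrArg (fun M : Matrix (Fin d) (Fin d) ℂ => (algebraMap ℂ A).mapMatrix M) hY.2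
    rw [map_sub, map_mul, map_mul] at e2
    refine e2.trans ?_
    ext a b
    simp
  | zero => simp
  | add X Y _ _ hX hY => rw [mul_add, add_mul, add_sub_add_comm, hX, hY, smul_add]
  | smul r X _ hX => rw [mul_smul_comm, smul_mul_assoc, ← smul_sub, hX, smul_comm]

/-- Conjugation by a matrix commuting with `λ` preserves degrees. -/
theorem conj_mem_degGE_of_commute {A : TestAlg} {k : ℕ} {g : GL (Fin d) A}
    (hg : g.val * lamAt lam A = lamAt lam A * g.val) {X : Matrix (Fin d) (Fin d) A}
    (hX : X ∈ extendScalars (degGE lam ⊤ k) A) :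
    g.val * X * (g⁻¹).val ∈ extendScalars (degGE lam ⊤ k) A := by
  have hg' : (g⁻¹).val * lamAt lam A = lamAt lam A * (g⁻¹).val := by
    calc (g⁻¹).val * lamAt lam A = (g⁻¹).val * (lamAt lam A * g.val) * (g⁻¹).val := by
          rw [mul_assoc, mul_assoc, Units.mul_inv, mul_one]
      _ = _ := by rw [← hg, ← mul_assoc, Units.inv_mul, one_mul]
  have h0 : ∀ Y ∈ degGE lam ⊤ k, g.val * Y.map (algebraMap ℂ A) * (g⁻¹).val ∈
      extendScalars (degGE lam ⊤ k) A := by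
    intro Y hY
    unfold degGE at hY
    induction hY using Submodule.span_induction with
    | mem Y h =>
      obtain ⟨-, j, hj, e⟩ := h
      refine extendScalars_mono (degEq_le_degGE _ hj)
        ((mem_extendScalars_iff _ _).2 fun ψ => ⟨Submodule.mem_top, ?_⟩)
      rw [← map_bracket]
      have e1 := bracket_of_degEq (A := A) (k := j)
        (map_mem_extendScalars (show Y ∈ degEq lam ⊤ j from ⟨Submodule.mem_top, e⟩))
      have e3 : lamAt lam A * (g.val * Y.map (algebraMap ℂ A) * (g⁻¹).val) -
          g.val * Y.map (algebraMap ℂ A) * (g⁻¹).val * lamAt lam A =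
          (j : A) • (g.val * Y.map (algebraMap ℂ A) * (g⁻¹).val) := by
        rw [mul_assoc (g.val * _), hg', ← mul_assoc, ← mul_assoc, ← hg, ← smul_mul_assoc,
          ← mul_smul_comm, ← e1]
        noncomm_ring
      rw [e3]
      ext a b
      simp only [Matrix.map_apply, Matrix.smul_apply, smul_eq_mul]
      rw [← nsmul_eq_mul, map_nsmul, nsmul_eq_mul]
    | zero => simp
    | add X Y _ _ hX hY =>
      rw [Matrix.map_add _ (map_add _), mul_add, add_mul]
      exact Submodule.add_mem _ hX hY
    | smul r X _ hX =>
      have e : (r • X).map (algebraMap ℂ A) = algebraMap ℂ A r • X.map (algebraMap ℂ A) := by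
        ext a b
        simp
      rw [e, mul_smul_comm, smul_mul_assoc]
      exact Submodule.smul_mem _ _ hX
  unfold extendScalars at hX
  induction hX using Submodule.span_induction with
  | mem Z h =>
    obtain ⟨Y, hY, rfl⟩ := h
    exact h0 Y hY
  | zero => simp
  | add X Y _ _ hX hY =>
    rw [mul_add, add_mul]
    exact Submodule.add_mem _ hX hY
  | smul r X _ hX =>
    rw [mul_smul_comm, smul_mul_assoc]
    exact Submodule.smul_mem _ _ hX

theorem adFlat_le_of_commute (hlam : lam ∈ lieAlg G) {A : TestAlg} {g : G.grp.obj A}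
    (hg : (G.mat g).val * lamAt lam A = lamAt lam A * (G.mat g).val) :
    adFlat (G.mat g) (flatAt G lam A) ≤ flatAt G lam A := by
  refine adFlat_le_flatAt ?_ fun X hX => ?_
  · rw [hg, mul_assoc, Units.mul_inv, mul_one, sub_self]
    exact Submodule.zero_mem _
  · change X ∈ extendScalars (degGE lam (lieAlg G) 1) A at hX
    exact mem_degGE_lieAlg hlam (conj_mem_extendScalars_lieAlg g
      (extendScalars_mono (degGE_le _ _) hX))
      (conj_mem_degGE_of_commute hg (extendScalars_degGE_top hX))

theorem adFlat_le_of_unipotent (hlam : lam ∈ lieAlg G) {A : TestAlg} {g : G.grp.obj A}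
    (hg : (G.mat g).val - 1 ∈ extendScalars (degGE lam ⊤ 1) A) :
    adFlat (G.mat g) (flatAt G lam A) ≤ flatAt G lam A := by
  refine adFlat_le_flatAt (mem_degGE_lieAlg hlam (conj_lamAt_sub_mem hlam g) ?_) fun X hX => ?_
  · have e : (G.mat g).val * lamAt lam A * ((G.mat g)⁻¹).val - lamAt lam A =
        -(lamAt lam A * ((G.mat g).val - 1) - ((G.mat g).val - 1) * lamAt lam A) *
          ((G.mat g)⁻¹).val := by
      have h1 := Units.mul_inv (G.mat g)
      rw [mul_sub, sub_mul, mul_one, one_mul, sub_sub_sub_cancel_right, neg_sub, sub_mul,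
        mul_assoc (lamAt lam A), h1, mul_one]
    rw [e]
    exact mul_mem_right_of_one (inv_sub_one_mem hg)
      (Submodule.neg_mem _ (bracket_mem_degGE hg))
  · change X ∈ extendScalars (degGE lam (lieAlg G) 1) A at hX
    exact mem_degGE_lieAlg hlam (conj_mem_extendScalars_lieAlg g
      (extendScalars_mono (degGE_le _ _) hX))
      (mul_mem_right_of_one (inv_sub_one_mem hg)
        (mul_mem_left_of_one hg (extendScalars_degGE_top hX)))

theorem parabolic_le_flatStabilizer (hlam : lam ∈ lieAlg G) (A : TestAlg) :
    (parabolic G lam).carrier A ≤ flatStabilizer G lam A := by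
  refine (Subgroup.closure_le _).2 ?_
  rintro h (hh | ⟨X, hX, hh⟩)
  · have hh : (G.mat (centIncl G lam h)).val * lamAt lam A =
        lamAt lam A * (G.mat (centIncl G lam h)).val := hh
    refine mem_flatStabilizer_of_le (adFlat_le_of_commute hlam hh) ?_
    rw [← map_inv]
    refine adFlat_le_of_commute hlam ?_
    rw [map_inv]
    calc ((G.mat (centIncl G lam h))⁻¹).val * lamAt lam A =
          ((G.mat (centIncl G lam h))⁻¹).val * (lamAt lam A * (G.mat (centIncl G lam h)).val) *
            ((G.mat (centIncl G lam h))⁻¹).val := by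
          rw [mul_assoc, mul_assoc, Units.mul_inv, mul_one]
      _ = _ := by rw [← hh, ← mul_assoc, Units.inv_mul, one_mul]
  · have hX1 : X ∈ extendScalars (degGE lam ⊤ (0 + 1)) A :=
      extendScalars_degGE_top (U := lieAlg G) hX
    have hu : (G.mat (centIncl G lam h)).val - 1 ∈ extendScalars (degGE lam ⊤ 1) A := by
      obtain ⟨W, hW, e⟩ := nilExp_eq_one_add hX1
      rw [hh, e, add_assoc, add_sub_cancel_left]
      exact Submodule.add_mem _ hX1 (extendScalars_degGE_anti (by omega) hW)
    refine mem_flatStabilizer_of_le (adFlat_le_of_unipotent hlam hu) ?_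
    rw [← map_inv]
    refine adFlat_le_of_unipotent hlam ?_
    rw [map_inv]
    exact inv_sub_one_mem hu

/-- If `Ad(h) λ` is congruent to `λ` modulo terms of degree `k > 0`, multiplying `h` by the
exponential of an element of degree `k` makes it congruent modulo terms of degree `k + 1`; when
there are no terms of degree `k` left, `h` centralizes `λ`. -/
theorem mem_parabolic_of_conj_sub_mem (hlam : lam ∈ lieAlg G) {A : TestAlg} (n : ℕ) :
    ∀ (k : ℕ), 1 ≤ k → degGE lam ⊤ (k + n) = ⊥ → ∀ h : (cent G lam).obj A,
      (G.mat (centIncl G lam h)).val * lamAt lam A * ((G.mat (centIncl G lam h))⁻¹).val -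
        lamAt lam A ∈ extendScalars (degGE lam ⊤ k) A → h ∈ (parabolic G lam).carrier A := by
  induction n with
  | zero =>
    intro k hk hbot h hh
    rw [add_zero] at hbot
    rw [hbot] at hh
    have h1 := sub_eq_zero.1 (extendScalars_bot hh)
    refine Subgroup.subset_closure (Or.inl ?_)
    change (G.mat (centIncl G lam h)).val * lamAt lam A = _
    conv_rhs => rw [← h1]
    rw [mul_assoc, Units.inv_mul, mul_one]
  | succ n ih =>
    intro k hk hbot h hh
    have hL := mem_degGE_lieAlg hlam (conj_lamAt_sub_mem hlam _) hh
    obtain ⟨X, hX, X', hX', e⟩ := extendScalars_sup _ _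
      (extendScalars_mono (degGE_le_sup (lieAlg G) k) hL)
    obtain ⟨m, rfl⟩ : ∃ m, k = m + 1 := ⟨k - 1, by omega⟩
    have hk0 : ((m + 1 : ℕ) : ℂ) ≠ 0 := Nat.cast_ne_zero.2 (by omega)
    have h2 := bracket_of_degEq hX
    -- `ad λ` multiplies by `m + 1` in degree `m + 1`, so that `[λ, Z] = X`
    set Z : Matrix (Fin d) (Fin d) A := algebraMap ℂ A ((m + 1 : ℕ) : ℂ)⁻¹ • X with hZdef
    have hZ : Z ∈ extendScalars (degEq lam (lieAlg G) (m + 1)) A := Submodule.smul_mem _ _ hX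
    have hZL : Z ∈ extendScalars (degGE lam (lieAlg G) (m + 1)) A :=
      extendScalars_mono (degEq_le_degGE _ le_rfl) hZ
    have hZ1 : Z ∈ extendScalars (degGE lam (lieAlg G) 1) A :=
      extendScalars_degGE_anti hk hZL
    have hbr : lamAt lam A * Z - Z * lamAt lam A = X := by
      rw [hZdef, mul_smul_comm, smul_mul_assoc, ← smul_sub, h2, smul_smul,
        ← map_natCast (algebraMap ℂ A), ← map_mul, inv_mul_cancel₀ hk0, map_one, one_smul]
    have hZd := pow_eq_zero_of_degGE (extendScalars_degGE_top hZ1)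
    obtain ⟨W, hW, eW⟩ := nilExp_eq_one_add (extendScalars_degGE_top hZL)
    let e0 : G.grp.obj A := ⟨nilExpUnit Z hZd, satisfies_nilExp hZ1 hZd⟩
    have he0 : ∀ M : Matrix (Fin d) (Fin d) A, M ∈ extendScalars (degGE lam ⊤ (m + 1)) A →
        (alphaAt lam A).val * M = M * (alphaAt lam A).val := fun M hM => alphaAt_mul_comm hM
    have hec : e0 ∈ (centralizer G lam).carrier A := by
      refine Subgroup.mem_centralizer_singleton_iff.2 (Units.ext ?_)
      change nilExp Z * (alphaAt lam A).val = (alphaAt lam A).val * nilExp Z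
      rw [eW, add_mul, add_mul, mul_add, mul_add, he0 Z (extendScalars_degGE_top hZL),
        he0 W (extendScalars_degGE_anti (by omega) hW), one_mul, mul_one]
    let e1 : (cent G lam).obj A := ⟨e0, hec⟩
    have heP : e1 ∈ (parabolic G lam).carrier A :=
      Subgroup.subset_closure (Or.inr ⟨Z, hZ1, rfl⟩)
    have hu : (nilExpUnit Z hZd).val - 1 ∈ extendScalars (degGE lam ⊤ (m + 1)) A := by
      change nilExp Z - 1 ∈ _
      rw [eW, add_assoc, add_sub_cancel_left]
      exact Submodule.add_mem _ (extendScalars_degGE_top hZL)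
        (extendScalars_degGE_anti (by omega) hW)
    have hu1 := inv_sub_one_mem (extendScalars_degGE_anti hk hu)
    refine ((parabolic G lam).carrier A).mul_mem_cancel_left heP |>.1
      (ih (m + 1 + 1) (by omega) (by rw [← hbot]; congr 1; omega) (e1 * h) ?_)
    rw [map_mul, map_mul]
    change (nilExpUnit Z hZd * G.mat (centIncl G lam h)).val * lamAt lam A *
      ((nilExpUnit Z hZd * G.mat (centIncl G lam h))⁻¹).val - lamAt lam A ∈ _
    set g := G.mat (centIncl G lam h)
    set E := nilExpUnit Z hZd
    have hE : E.val = 1 + Z + W := eW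
    -- the term `X` of degree `m + 1` cancels against `[λ, Z]`, and the other terms have degree at
    -- least `m + 2`
    have e2 : (E * g).val * lamAt lam A * ((E * g)⁻¹).val - lamAt lam A =
        (X' + (E.val - 1) * (X + X') - (lamAt lam A * W - W * lamAt lam A)) * (E⁻¹).val := by
      rw [mul_inv_rev, Units.val_mul, Units.val_mul]
      have h3 : E.val * g.val * lamAt lam A * ((g⁻¹).val * (E⁻¹).val) - lamAt lam A =
          (E.val * (g.val * lamAt lam A * (g⁻¹).val) - lamAt lam A * E.val) * (E⁻¹).val := by
        rw [sub_mul, mul_assoc (lamAt lam A), Units.mul_inv, mul_one]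
        noncomm_ring
      rw [h3, sub_eq_iff_eq_add.1 e]
      congr 1
      have h4 : E.val * lamAt lam A - lamAt lam A * E.val =
          -X - (lamAt lam A * W - W * lamAt lam A) := by
        rw [hE, ← hbr]
        noncomm_ring
      calc E.val * (X + X' + lamAt lam A) - lamAt lam A * E.val =
            E.val * lamAt lam A - lamAt lam A * E.val + X + X' + (E.val - 1) * (X + X') := by
            noncomm_ring
        _ = _ := by rw [h4]; abel
    rw [e2]
    have hXX : X + X' ∈ extendScalars (degGE lam ⊤ (m + 1)) A := by rw [← e]; exact hh
    refine mul_mem_right_of_one hu1 (Submodule.sub_mem _ (Submodule.add_mem _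
      (extendScalars_degGE_top hX') ?_) (bracket_mem_degGE hW))
    exact extendScalars_degGE_anti (by omega) (mul_mem_extendScalars_degGE hu hXX)

/-- `P(λ)` is the stabilizer of the canonical flat in `G(α)`. -/
theorem mem_parabolic_iff (hlam : lam ∈ lieAlg G) {A : TestAlg} (h : (cent G lam).obj A) :
    h ∈ (parabolic G lam).carrier A ↔
      adFlat (G.mat (centIncl G lam h)) (flatAt G lam A) = flatAt G lam A := by
  refine ⟨fun hh => parabolic_le_flatStabilizer hlam A hh, fun hh => ?_⟩
  obtain ⟨n, hn⟩ := exists_degGE_eq_bot lam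
  have h1 : (G.mat (centIncl G lam h)).val * (lamAt lam A * ((G.mat (centIncl G lam h))⁻¹).val) ∈
      flatAt G lam A :=
    hh ▸ AffineSubspace.mem_map_of_mem (conjLin (G.mat (centIncl G lam h))).toAffineMap
      ((mem_flatAt G lam A _).2 (by rw [sub_self]; exact Submodule.zero_mem _))
  rw [← mul_assoc] at h1
  exact mem_parabolic_of_conj_sub_mem hlam n 1 le_rfl
    (le_bot_iff.1 ((degGE_anti _ (by omega)).trans hn.le)) h
    (extendScalars_degGE_top (U := lieAlg G) ((mem_flatAt G lam A _).1 h1))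

end Stabilizer

/-! ### Square roots of matrices -/

section SquareRoot

variable {d : ℕ}

open scoped Kronecker in
/-- The matrix of the linear map `E ↦ w E + E u` on `d × d` matrices. -/
def anticomm {R : Type} [CommRing R] (w u : Matrix (Fin d) (Fin d) R) :
    Matrix (Fin d × Fin d) (Fin d × Fin d) R :=
  1 ⊗ₖ w + u.transpose ⊗ₖ 1

theorem anticomm_mulVec {R : Type} [CommRing R] (w u E : Matrix (Fin d) (Fin d) R) :
    (anticomm w u).mulVec E.vec = (w * E + E * u).vec := by
  rw [anticomm, Matrix.add_mulVec, Matrix.kronecker_mulVec_vec, Matrix.kronecker_mulVec_vec,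
    Matrix.transpose_one, mul_one, one_mul, Matrix.transpose_transpose]
  rfl

theorem anticomm_map {R S : Type} [CommRing R] [CommRing S] (φ : R →+* S)
    (w u : Matrix (Fin d) (Fin d) R) :
    (anticomm w u).map φ = anticomm (w.map φ) (u.map φ) := by
  ext ⟨i, j⟩ ⟨k, l⟩
  simp only [anticomm, Matrix.map_apply, Matrix.add_apply, Matrix.kroneckerMap_apply,
    Matrix.transpose_apply, map_add, map_mul, Matrix.one_apply]
  congr 2 <;> split_ifs <;> simp

theorem anticomm_one {R : Type} [CommRing R] :
    anticomm (1 : Matrix (Fin d) (Fin d) R) 1 = (2 : R) • 1 := by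
  rw [anticomm, Matrix.transpose_one, Matrix.one_kronecker_one, two_smul]

/-- The equations for a square root `u` of `t`, together with an inverse `V` of the matrix
`anticomm u u`, which is the derivative of `u ↦ u²`. -/
def IsSqrt {R S : Type} [CommRing R] [CommRing S] [Algebra R S] (t : Matrix (Fin d) (Fin d) R)
    (u : Matrix (Fin d) (Fin d) S) (V : Matrix (Fin d × Fin d) (Fin d × Fin d) S) : Prop :=
  u * u = t.map (algebraMap R S) ∧ anticomm u u * V = 1

theorem mul_eq_zero_of_mem {R l m n : Type} [CommRing R] [Fintype m] {I : Ideal R}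
    (hI : I ^ 2 = ⊥) {M : Matrix l m R} {N : Matrix m n R} (hM : ∀ i j, M i j ∈ I)
    (hN : ∀ i j, N i j ∈ I) : M * N = 0 := by
  ext i j
  rw [Matrix.mul_apply]
  refine Finset.sum_eq_zero fun k _ => ?_
  have h := Ideal.mul_mem_mul (hM i k) (hN k j)
  rwa [← pow_two, hI, Ideal.mem_bot] at h

theorem mk_map_eq_iff {R m n : Type} [CommRing R] (I : Ideal R) {M N : Matrix m n R} :
    M.map (Ideal.Quotient.mk I) = N.map (Ideal.Quotient.mk I) ↔ ∀ i j, (M - N) i j ∈ I := by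
  rw [← Matrix.ext_iff]
  exact forall_congr' fun i => forall_congr' fun j => Ideal.Quotient.eq

theorem exists_map_mk_eq {R m n : Type} [CommRing R] (I : Ideal R) (M : Matrix m n (R ⧸ I)) :
    ∃ N : Matrix m n R, N.map (Ideal.Quotient.mk I) = M :=
  ⟨fun i j => (Ideal.Quotient.mk_surjective (M i j)).choose,
    Matrix.ext fun i j => (Ideal.Quotient.mk_surjective (M i j)).choose_spec⟩

theorem mul_apply_mem {R l m n : Type} [CommRing R] [Fintype m] {I : Ideal R}
    (M : Matrix l m R) {N : Matrix m n R} (hN : ∀ i j, N i j ∈ I) (i j) : (M * N) i j ∈ I := by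
  rw [Matrix.mul_apply]
  exact I.sum_mem fun k _ => I.mul_mem_left _ (hN k j)

/-- Square roots with invertible derivative lift along square-zero extensions, by Newton's
method. -/
theorem IsSqrt.lift {R B : Type} [CommRing R] [CommRing B] [Algebra R B] {I : Ideal B}
    (hI : I ^ 2 = ⊥) {t : Matrix (Fin d) (Fin d) R} {u : Matrix (Fin d) (Fin d) (B ⧸ I)}
    {V : Matrix (Fin d × Fin d) (Fin d × Fin d) (B ⧸ I)} (h : IsSqrt t u V) :
    ∃ (u' : Matrix (Fin d) (Fin d) B) (V' : Matrix (Fin d × Fin d) (Fin d × Fin d) B),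
      IsSqrt t u' V' ∧ u'.map (Ideal.Quotient.mk I) = u ∧ V'.map (Ideal.Quotient.mk I) = V := by
  obtain ⟨u₀, rfl⟩ := exists_map_mk_eq I u
  obtain ⟨V₀, rfl⟩ := exists_map_mk_eq I V
  obtain ⟨h1, h2⟩ := h
  set N := u₀ * u₀ - t.map (algebraMap R B) with hN
  have hNI : ∀ i j, N i j ∈ I := (mk_map_eq_iff I).1 (by
    rw [Matrix.map_mul, h1, Matrix.map_map]
    rfl)
  have hDI : ∀ i j, (anticomm u₀ u₀ * V₀ - 1) i j ∈ I := (mk_map_eq_iff I).1 (by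
    rw [Matrix.map_mul, anticomm_map, h2, Matrix.map_one _ (map_zero _) (map_one _)])
  -- the correction `E` solves the linearized equation `u₀ E + E u₀ = t - u₀²`
  let E : Matrix (Fin d) (Fin d) B := fun i j => -(V₀.mulVec N.vec) (j, i)
  have hEvec : E.vec = -(V₀.mulVec N.vec) := rfl
  have hEI : ∀ i j, E i j ∈ I := fun i j =>
    I.neg_mem (I.sum_mem fun k _ => I.mul_mem_left _ (hNI k.2 k.1))
  have hE : u₀ * E + E * u₀ = -N := by
    refine Matrix.vec_bijective.injective ?_
    have h3 : anticomm u₀ u₀ * V₀ = 1 + (anticomm u₀ u₀ * V₀ - 1) := by abel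
    have h4 : (anticomm u₀ u₀ * V₀ - 1).mulVec N.vec = 0 := by
      funext k
      refine Finset.sum_eq_zero fun l _ => ?_
      have h := Ideal.mul_mem_mul (hDI k l) (hNI l.2 l.1)
      rwa [← pow_two, hI, Ideal.mem_bot] at h
    rw [← anticomm_mulVec, hEvec, Matrix.mulVec_neg, Matrix.mulVec_mulVec, h3, Matrix.add_mulVec,
      h4, Matrix.one_mulVec, add_zero]
    rfl
  have hu : (u₀ + E).map (Ideal.Quotient.mk I) = u₀.map (Ideal.Quotient.mk I) :=
    (mk_map_eq_iff I).2 fun i j => by rw [add_sub_cancel_left]; exact hEI i j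
  set M := anticomm (u₀ + E) (u₀ + E) * V₀ - 1 with hM
  have hMI : ∀ i j, M i j ∈ I := (mk_map_eq_iff I).1 (by
    rw [Matrix.map_mul, anticomm_map, hu, h2, Matrix.map_one _ (map_zero _) (map_one _)])
  refine ⟨u₀ + E, V₀ * (1 - M), ⟨?_, ?_⟩, hu, (mk_map_eq_iff I).2 fun i j => ?_⟩
  · calc (u₀ + E) * (u₀ + E) = u₀ * u₀ + (u₀ * E + E * u₀) + E * E := by noncomm_ring
      _ = _ := by rw [hE, mul_eq_zero_of_mem hI hEI hEI, hN]; abel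
  · rw [← mul_assoc, sub_eq_iff_eq_add.1 hM.symm]
    calc (M + 1) * (1 - M) = 1 - M * M := by noncomm_ring
      _ = 1 := by rw [mul_eq_zero_of_mem hI hMI hMI, sub_zero]
  · rw [mul_sub, mul_one, sub_sub_cancel_left]
    exact I.neg_mem (mul_apply_mem _ hMI i j)

/-- Square roots of `t` with invertible derivative are represented by a smooth algebra. -/
theorem exists_universal_sqrt {R : Type} [CommRing R] (t : Matrix (Fin d) (Fin d) R) :
    ∃ (S : Type) (_ : CommRing S) (_ : Algebra R S) (u : Matrix (Fin d) (Fin d) S)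
      (V : Matrix (Fin d × Fin d) (Fin d × Fin d) S), Algebra.Smooth R S ∧ IsSqrt t u V ∧
      ∀ (B : Type) [CommRing B] [Algebra R B] (u' : Matrix (Fin d) (Fin d) B)
        (V' : Matrix (Fin d × Fin d) (Fin d × Fin d) B), IsSqrt t u' V' →
        ∃ φ : S →ₐ[R] B, u.map φ = u' ∧ V.map φ = V' := by
  let n := (Fin d × Fin d) ⊕ ((Fin d × Fin d) × (Fin d × Fin d))
  let P := MvPolynomial n R
  let u₀ : Matrix (Fin d) (Fin d) P := fun i j => MvPolynomial.X (Sum.inl (i, j))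
  let V₀ : Matrix (Fin d × Fin d) (Fin d × Fin d) P := fun i j => MvPolynomial.X (Sum.inr (i, j))
  let s : Set P := Set.range (fun k : Fin d × Fin d =>
      (u₀ * u₀ - t.map (algebraMap R P)) k.1 k.2) ∪
    Set.range (fun k : (Fin d × Fin d) × (Fin d × Fin d) => (anticomm u₀ u₀ * V₀ - 1) k.1 k.2)
  let J : Ideal P := Ideal.span s
  have hJ : J.FG := ⟨(Set.toFinite s).toFinset, by rw [Set.Finite.coe_toFinset]⟩
  have huniv : ∀ (B : Type) [CommRing B] [Algebra R B] (u' : Matrix (Fin d) (Fin d) B)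
      (V' : Matrix (Fin d × Fin d) (Fin d × Fin d) B), IsSqrt t u' V' →
      ∃ φ : (P ⧸ J) →ₐ[R] B, (u₀.map (Ideal.Quotient.mk J)).map φ = u' ∧
        (V₀.map (Ideal.Quotient.mk J)).map φ = V' := by
    intro B _ _ u' V' h
    let ψ : P →ₐ[R] B := MvPolynomial.aeval
      (Sum.elim (fun k => u' k.1 k.2) (fun k => V' k.1 k.2))
    have hu : u₀.map ψ = u' := Matrix.ext fun i j => MvPolynomial.aeval_X _ (Sum.inl (i, j))
    have hV : V₀.map ψ = V' := Matrix.ext fun i j => MvPolynomial.aeval_X _ (Sum.inr (i, j))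
    have h1 : (u₀ * u₀ - t.map (algebraMap R P)).map ψ = 0 := by
      rw [Matrix.map_sub _ (map_sub ψ), Matrix.map_mul, hu, h.1, Matrix.map_map, sub_eq_zero]
      ext i j
      simp
    have h2 : (anticomm u₀ u₀ * V₀ - 1).map ψ = 0 := by
      rw [Matrix.map_sub _ (map_sub ψ), Matrix.map_mul, hV,
        Matrix.map_one _ (map_zero _) (map_one _)]
      have h3 := anticomm_map ψ.toRingHom u₀ u₀
      have h4 : u₀.map ψ.toRingHom = u' := hu
      rw [h4] at h3
      exact sub_eq_zero.2 ((congrArg (· * V') h3).trans h.2)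
    have hle : ∀ a ∈ J, ψ a = 0 := by
      intro a ha
      refine (Ideal.span_le.2 ?_ : J ≤ RingHom.ker ψ) ha
      rintro _ (⟨k, rfl⟩ | ⟨k, rfl⟩)
      · exact congrFun (congrFun h1 k.1) k.2
      · exact congrFun (congrFun h2 k.1) k.2
    exact ⟨Ideal.Quotient.liftₐ J ψ hle, hu, hV⟩
  have hsqrt : IsSqrt t (u₀.map (Ideal.Quotient.mk J)) (V₀.map (Ideal.Quotient.mk J)) := by
    constructor
    · rw [← Matrix.map_mul]
      change _ = t.map ((Ideal.Quotient.mk J).comp (algebraMap R P))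
      rw [RingHom.coe_comp, ← Matrix.map_map]
      exact (mk_map_eq_iff J).2 fun i j => Ideal.subset_span (Or.inl ⟨(i, j), rfl⟩)
    · rw [← anticomm_map, ← Matrix.map_mul,
        ← Matrix.map_one (Ideal.Quotient.mk J) (map_zero _) (map_one _)]
      exact (mk_map_eq_iff J).2 fun i j => Ideal.subset_span (Or.inr ⟨(i, j), rfl⟩)
  have hfp : Algebra.FinitePresentation R (P ⧸ J) := Algebra.FinitePresentation.quotient hJ
  refine ⟨P ⧸ J, inferInstance, inferInstance, u₀.map (Ideal.Quotient.mk J),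
    V₀.map (Ideal.Quotient.mk J), ⟨Algebra.FormallySmooth.of_comp_surjective ?_, hfp⟩, hsqrt,
    huniv⟩
  -- formal smoothness: points modulo a square-zero ideal are square roots, and these lift
  intro B _ _ I hI f
  have hf : IsSqrt t ((u₀.map (Ideal.Quotient.mk J)).map f)
      ((V₀.map (Ideal.Quotient.mk J)).map f) := by
    constructor
    · rw [← Matrix.map_mul, hsqrt.1, Matrix.map_map]
      ext i j
      simp
    · have h3 := anticomm_map f.toRingHom (u₀.map (Ideal.Quotient.mk J))
        (u₀.map (Ideal.Quotient.mk J))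
      have h4 := congrArg (fun M => M.map f) hsqrt.2
      rw [Matrix.map_mul, Matrix.map_one _ (map_zero _) (map_one _)] at h4
      exact (congrArg (· * _) h3.symm).trans h4
  obtain ⟨u', V', h', hu', hV'⟩ := hf.lift hI
  obtain ⟨φ, hφu, hφV⟩ := huniv B u' V' h'
  refine ⟨φ, Ideal.Quotient.algHom_ext _ (MvPolynomial.algHom_ext fun k => ?_)⟩
  rcases k with ⟨i, j⟩ | ⟨i, j⟩
  · have h5 := congrFun (congrFun hu' i) j
    rw [← hφu] at h5
    exact h5
  · have h5 := congrFun (congrFun hV' i) j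
    rw [← hφV] at h5
    exact h5

end SquareRoot

/-! ### Unipotent square roots of points of an algebraic group -/

section Unipotent

/-- The functions `ℕ → C` which are given by polynomials. -/
def polyFun (C : Type) [CommRing C] : Subalgebra C (ℕ → C) :=
  (Polynomial.aeval fun m : ℕ => (m : C)).range

theorem mem_polyFun_iff {C : Type} [CommRing C] {φ : ℕ → C} :
    φ ∈ polyFun C ↔ ∃ P : Polynomial C, ∀ m : ℕ, φ m = P.eval (m : C) := by
  have h : ∀ (P : Polynomial C) (m : ℕ),
      (Polynomial.aeval fun m : ℕ => (m : C)) P m = P.eval (m : C) := by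
    intro P m
    rw [← Polynomial.coe_aeval_eq_eval]
    exact (Polynomial.aeval_algHom_apply (Pi.evalAlgHom C (fun _ : ℕ => C) m) _ P).symm
  exact ⟨fun ⟨P, hP⟩ => ⟨P, fun m => by rw [← h, ← hP]; rfl⟩,
    fun ⟨P, hP⟩ => ⟨P, funext fun m => (h P m).trans (hP m).symm⟩⟩

variable {C : Type} [CommRing C] [Algebra ℂ C]

theorem choose_mem_polyFun (j : ℕ) : (fun m : ℕ => ((m.choose j : ℕ) : C)) ∈ polyFun C := by
  refine mem_polyFun_iff.2 ⟨Polynomial.C (algebraMap ℂ C (j.factorial : ℂ)⁻¹) *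
    descPochhammer C j, fun m => ?_⟩
  rw [Polynomial.eval_mul, Polynomial.eval_C, descPochhammer_eval_eq_descFactorial,
    Nat.descFactorial_eq_factorial_mul_choose, Nat.cast_mul, ← mul_assoc,
    ← map_natCast (algebraMap ℂ C) j.factorial, ← map_mul,
    inv_mul_cancel₀ (Nat.cast_ne_zero.2 j.factorial_ne_zero), map_one, one_mul]

/-- The entries of the powers of a unipotent matrix are polynomials in the exponent. -/
theorem pow_apply_mem_polyFun {d : ℕ} {M : Matrix (Fin d) (Fin d) C} (hM : IsNilpotent (M - 1))
    (i j : Fin d) : (fun m : ℕ => (M ^ m) i j) ∈ polyFun C := by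
  obtain ⟨k, hk⟩ := hM
  have h : (fun m : ℕ => (M ^ m) i j) =
      ∑ l ∈ Finset.range k, ((M - 1) ^ l) i j • fun m : ℕ => ((m.choose l : ℕ) : C) := by
    funext m
    have h1 : M ^ m = ∑ l ∈ Finset.range (m + 1), (m.choose l) • (M - 1) ^ l := by
      conv_lhs => rw [← sub_add_cancel M 1]
      rw [(Commute.one_right (M - 1)).add_pow]
      refine Finset.sum_congr rfl fun l _ => ?_
      rw [one_pow, mul_one, nsmul_eq_mul, (Nat.cast_commute _ _).eq]
    have h2 : M ^ m = ∑ l ∈ Finset.range (m + 1 + k), (m.choose l) • (M - 1) ^ l := by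
      rw [h1]
      refine Finset.sum_subset (Finset.range_mono (by omega)) fun l _ hl => ?_
      rw [Nat.choose_eq_zero_of_lt (by simpa using hl), zero_smul]
    have h3 : M ^ m = ∑ l ∈ Finset.range k, (m.choose l) • (M - 1) ^ l := by
      rw [h2]
      refine (Finset.sum_subset (Finset.range_mono (by omega)) fun l _ hl => ?_).symm
      rw [pow_eq_zero_of_le (by simpa using hl) hk, smul_zero]
    rw [h3, Matrix.sum_apply, Finset.sum_apply]
    refine Finset.sum_congr rfl fun l _ => ?_
    rw [Matrix.smul_apply, Pi.smul_apply, smul_eq_mul, nsmul_eq_mul, mul_comm]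
  rw [h]
  exact Subalgebra.sum_mem _ fun l _ => Subalgebra.smul_mem _ (choose_mem_polyFun l) _

/-- A polynomial function vanishing at all even numbers vanishes. -/
theorem eq_zero_of_mem_polyFun {φ : ℕ → C} (hφ : φ ∈ polyFun C) (h : ∀ m, φ (2 * m) = 0) (m : ℕ) :
    φ m = 0 := by
  obtain ⟨P, hP⟩ := mem_polyFun_iff.1 hφ
  rw [hP]
  -- a linear form on `C` reduces the claim to polynomials over `ℂ`, which have finitely many roots
  refine (Module.forall_dual_apply_eq_zero_iff ℂ _).1 fun ψ => ?_
  let Q : Polynomial ℂ := ∑ i ∈ P.support, Polynomial.monomial i (ψ (P.coeff i))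
  have hQ : ∀ n : ℕ, Q.eval (n : ℂ) = ψ (P.eval (n : C)) := by
    intro n
    rw [Polynomial.eval_finsetSum, Polynomial.eval_eq_sum, Polynomial.sum, map_sum]
    refine Finset.sum_congr rfl fun i _ => ?_
    have e : P.coeff i * (n : C) ^ i = ((n : ℂ) ^ i) • P.coeff i := by
      rw [Algebra.smul_def, mul_comm, map_pow, map_natCast]
    rw [Polynomial.eval_monomial, e, map_smul, smul_eq_mul, mul_comm]
  have h0 : Q = 0 := by
    refine Polynomial.eq_zero_of_infinite_isRoot Q (Set.Infinite.mono ?_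
      (Set.infinite_range_of_injective (f := fun m : ℕ => ((2 * m : ℕ) : ℂ)) fun a b hab => ?_))
    · rintro _ ⟨m, rfl⟩
      change Q.eval _ = 0
      rw [hQ, ← hP, h, map_zero]
    · have := Nat.cast_injective hab
      omega
  rw [← hQ, h0, Polynomial.eval_zero]

/-- A unipotent matrix whose square lies in an algebraic group lies in the group, because the
group is defined by equations, and the powers depend polynomially on the exponent. -/
theorem LinearAlgebraicGroup.satisfies_of_mul_self {d : ℕ} (G : LinearAlgebraicGroup d)
    {u : GL (Fin d) C} (hu : IsNilpotent (u.val - 1)) (h : G.Satisfies (u * u)) :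
    G.Satisfies u := by
  intro f hf
  have hu' : IsNilpotent ((u⁻¹).val - 1) := by
    have e : (u⁻¹).val - 1 = -(u⁻¹).val * (u.val - 1) := by
      rw [mul_sub, neg_mul, Units.inv_mul, mul_one]
      abel
    rw [e]
    refine Commute.isNilpotent_mul_left ?_ hu
    refine Commute.sub_right (Commute.neg_left ?_) (Commute.one_right _)
    change (u⁻¹).val * u.val = u.val * (u⁻¹).val
    rw [Units.inv_mul, Units.mul_inv]
  have hc : ∀ k, (fun m : ℕ => coords (u ^ m) k) ∈ polyFun C := by
    rintro (k | k)
    · simpa [coords] using pow_apply_mem_polyFun hu k.1 k.2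
    · have h1 := pow_apply_mem_polyFun hu' k.1 k.2
      have e : (fun m : ℕ => coords (u ^ m) (Sum.inr k)) =
          fun m => (((u⁻¹).val) ^ m) k.1 k.2 := by
        funext m
        change (((u ^ m)⁻¹).val) k.1 k.2 = _
        rw [← inv_pow]
        rfl
      rwa [e]
  have hmem : (fun m : ℕ => evalGL f (u ^ m)) ∈ polyFun C := by
    have e : (fun m : ℕ => evalGL f (u ^ m)) =
        MvPolynomial.aeval (fun k => fun m : ℕ => coords (u ^ m) k) f := by
      funext m
      refine Eq.trans ?_ (AlgHom.congr_fun (MvPolynomial.comp_aeval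
        (fun k => fun m : ℕ => coords (u ^ m) k) (Pi.evalAlgHom ℂ (fun _ : ℕ => C) m)) f).symm
      rfl
    rw [e]
    let Tc : Subalgebra ℂ (ℕ → C) := (polyFun C).restrictScalars ℂ
    have h2 : MvPolynomial.aeval (fun k => (⟨_, hc k⟩ : Tc)) f ∈ (⊤ : Subalgebra ℂ Tc) := trivial
    have h3 : MvPolynomial.aeval (fun k => fun m : ℕ => coords (u ^ m) k) f =
        Tc.val (MvPolynomial.aeval (fun k => (⟨_, hc k⟩ : Tc)) f) :=
      (AlgHom.congr_fun (MvPolynomial.comp_aeval (fun k => (⟨_, hc k⟩ : Tc)) Tc.val) f).symm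
    rw [h3]
    exact (MvPolynomial.aeval (fun k => (⟨_, hc k⟩ : Tc)) f).2
  -- an equation of the group vanishes at `u ^ (2 m)`, and so at `u`
  have h4 := eq_zero_of_mem_polyFun hmem (fun m => by
    have h5 : ∀ m : ℕ, G.Satisfies ((u * u) ^ m) := by
      intro m
      induction m with
      | zero => rw [pow_zero]; exact G.satisfies_one
      | succ m ih => rw [pow_succ]; exact G.satisfies_mul ih h
    rw [pow_mul, pow_two]
    exact h5 m f hf) 1
  rwa [pow_one] at h4

theorem pow_apply_mem {R : Type} [CommRing R] {d : ℕ} {I : Ideal R} {M : Matrix (Fin d) (Fin d) R}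
    (hM : ∀ i j, M i j ∈ I) (k : ℕ) : ∀ i j, (M ^ k) i j ∈ I ^ k := by
  induction k with
  | zero => intro i j; rw [pow_zero I, Ideal.one_eq_top]; exact trivial
  | succ k ih =>
    intro i j
    rw [pow_succ, pow_succ, Matrix.mul_apply]
    exact (I ^ k * I).sum_mem fun l _ => Ideal.mul_mem_mul (ih i l) (hM l j)

/-- Near a `ℂ`-point where it is trivial, a square root of a point of an algebraic group lies in
the group: it does so formally at this point, and Krull's intersection theorem applies. -/
theorem LinearAlgebraicGroup.exists_satisfies_away [IsNoetherianRing C] {d : ℕ}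
    (G : LinearAlgebraicGroup d) (q : C →ₐ[ℂ] ℂ) {u : GL (Fin d) C} (hu : u.val.map q = 1)
    (h : G.Satisfies (u * u)) :
    ∃ r : C, q r ≠ 0 ∧ ∀ f, (∀ h ∈ G.pts, evalGL f h = 0) → r * evalGL f u = 0 := by
  set n : Ideal C := RingHom.ker q with hn
  let J : Ideal C := Ideal.span {x | ∃ f, (∀ h ∈ G.pts, evalGL f h = 0) ∧ x = evalGL f u}
  -- modulo each power of the maximal ideal `n`, the matrix `u` is unipotent, and lies in the group
  have hpow : ∀ f, (∀ h ∈ G.pts, evalGL f h = 0) → ∀ k : ℕ, evalGL f u ∈ n ^ k := by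
    intro f hf k
    let φ : C →ₐ[ℂ] C ⧸ n ^ k := Ideal.Quotient.mkₐ ℂ (n ^ k)
    rw [← Ideal.Quotient.eq_zero_iff_mem]
    change φ (evalGL f u) = 0
    rw [← evalGL_map]
    refine G.satisfies_of_mul_self ⟨k, ?_⟩ ?_ f hf
    · change (φ.mapMatrix u.val - 1) ^ k = 0
      rw [← map_one φ.mapMatrix, ← map_sub, ← map_pow]
      ext i j
      refine Ideal.Quotient.eq_zero_iff_mem.2 (pow_apply_mem (fun i j => ?_) k i j)
      rw [hn, RingHom.mem_ker, Matrix.sub_apply, map_sub]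
      have e := congrFun (congrFun hu i) j
      rw [Matrix.map_apply] at e
      rw [e, Matrix.one_apply, Matrix.one_apply]
      split_ifs <;> simp
    · rw [← map_mul]
      exact h.map G φ
  -- by Krull's theorem an element of all powers of `n` is fixed by an element of `n`
  have hJ : J ≤ n • J := by
    refine Ideal.span_le.2 ?_
    rintro _ ⟨f, hf, rfl⟩
    have h1 : evalGL f u ∈ (⨅ i : ℕ, n ^ i • (⊤ : Submodule C C)) := by
      rw [Submodule.mem_iInf]
      intro k
      rw [smul_eq_mul, Ideal.mul_top]
      exact hpow f hf k
    obtain ⟨r, hr⟩ := (Ideal.mem_iInf_smul_pow_eq_bot_iff n _).1 h1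
    rw [← hr]
    exact Submodule.smul_mem_smul r.2 (Ideal.subset_span ⟨f, hf, rfl⟩)
  obtain ⟨r, hr1, hr⟩ := Submodule.exists_sub_one_mem_and_smul_eq_zero_of_fg_of_le_smul n J
    (IsNoetherian.noetherian J) hJ
  refine ⟨r, fun h0 => ?_, fun f hf => hr _ (Ideal.subset_span ⟨f, hf, rfl⟩)⟩
  have h2 : q (r - 1) = 0 := hr1
  rw [map_sub, h0, map_one] at h2
  norm_num at h2

/-- Near a `ℂ`-point where both are trivial, two square roots of the same matrix agree. -/
theorem exists_mul_sub_eq_zero {d : ℕ} (q : C →ₐ[ℂ] ℂ) {u w : Matrix (Fin d) (Fin d) C}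
    (hu : u.map q = 1) (hw : w.map q = 1) (h : w * w = u * u) :
    ∃ r : C, q r ≠ 0 ∧ r • w = r • u := by
  -- `w - u` is killed by `E ↦ w E + E u`, whose determinant at the point is a power of `2`
  refine ⟨(anticomm w u).det, ?_, ?_⟩
  · have h1 := (q : C →+* ℂ).map_det (anticomm w u)
    have h2 := anticomm_map (q : C →+* ℂ) w u
    have h3 : w.map (q : C →+* ℂ) = 1 := hw
    have h4 : u.map (q : C →+* ℂ) = 1 := hu
    rw [h3, h4, anticomm_one] at h2
    have h5 : q (anticomm w u).det = ((2 : ℂ) • (1 : Matrix (Fin d × Fin d) _ ℂ)).det :=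
      h1.trans (congrArg Matrix.det h2)
    rw [h5, Matrix.det_smul, Matrix.det_one, mul_one]
    exact pow_ne_zero _ two_ne_zero
  · have h1 : (anticomm w u).mulVec (w - u).vec = 0 := by
      rw [anticomm_mulVec, ← Matrix.vec_zero]
      congr 1
      calc w * (w - u) + (w - u) * u = w * w - u * u := by noncomm_ring
        _ = 0 := by rw [h, sub_self]
    have h2 := congrArg ((anticomm w u).adjugate.mulVec) h1
    rw [Matrix.mulVec_mulVec, Matrix.adjugate_mul, Matrix.smul_mulVec, Matrix.one_mulVec,
      Matrix.mulVec_zero] at h2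
    rw [← sub_eq_zero, ← smul_sub]
    exact Matrix.vec_eq_zero_iff.1 h2

end Unipotent

/-! ### Local transitivity of twisted conjugation -/

section Transitivity

/-- Localization near a `ℂ`-point. -/
theorem exists_localization {S : TestAlg} (q : S ⟶ CC) {r : S} (hr : q.hom r ≠ 0) :
    ∃ (B : TestAlg) (f : S ⟶ B) (q' : B ⟶ CC), f ≫ q' = q ∧ f.hom.toRingHom.Flat ∧
      f.hom.toRingHom.FinitePresentation ∧ ∀ x y : S, r * x = r * y → f.hom x = f.hom y := by
  have hu : ∀ y : Submonoid.powers r, IsUnit (q.hom y) := by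
    rintro ⟨_, n, rfl⟩
    rw [map_pow]
    exact (IsUnit.mk0 _ hr).pow n
  refine ⟨CommAlgCat.of ℂ (Localization.Away r),
    CommAlgCat.ofHom (IsScalarTower.toAlgHom ℂ S (Localization.Away r)),
    CommAlgCat.ofHom (IsLocalization.liftAlgHom (M := Submonoid.powers r) hu), ?_, ?_, ?_, ?_⟩
  · refine CommAlgCat.hom_ext (AlgHom.ext fun x => ?_)
    change IsLocalization.liftAlgHom (M := Submonoid.powers r) hu
      (algebraMap S (Localization.Away r) x) = q.hom x
    rw [IsLocalization.liftAlgHom_apply, IsLocalization.lift_eq]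
    rfl
  · exact (RingHom.flat_algebraMap_iff (R := S) (S := Localization.Away r)).2
      (IsLocalization.flat (Localization.Away r) (Submonoid.powers r))
  · exact RingHom.finitePresentation_algebraMap.2
      (IsLocalization.Away.finitePresentation (S := Localization.Away r) r)
  · intro x y h
    exact (IsLocalization.eq_iff_exists (Submonoid.powers r) (Localization.Away r)).2
      ⟨⟨r, 1, pow_one r⟩, h⟩

variable {d : ℕ} {G : LinearAlgebraicGroup d} {η : G.grp ⟶ G.grp}
  {lam : Matrix (Fin d) (Fin d) ℂ}

theorem str_CC : str CC = 𝟙 CC := CommAlgCat.hom_ext (Subsingleton.elim (α := ℂ →ₐ[ℂ] ℂ) _ _)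

theorem glMap_id {A : TestAlg} (g : GL (Fin d) A) : glMap (𝟙 A) g = g := rfl

theorem glMap_comp {A B C : TestAlg} (f : A ⟶ B) (h : B ⟶ C) (g : GL (Fin d) A) :
    glMap (f ≫ h) g = glMap h (glMap f g) := rfl

theorem alphaAt_CC : alphaAt lam CC = alpha lam := by rw [alphaAt, str_CC, glMap_id]

theorem grp_ext {A : TestAlg} {g h : G.grp.obj A} (e : (G.mat g).val = (G.mat h).val) : g = h :=
  mat_injective G A (Units.ext e)

theorem map_map_grp (𝔾 : GrpPresh) {A B C : TestAlg} (f : A ⟶ B) (h : B ⟶ C) (g : 𝔾.obj A) :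
    𝔾.map h (𝔾.map f g) = 𝔾.map (f ≫ h) g := by simp

theorem map_str (𝔾 : GrpPresh) {A B : TestAlg} (f : A ⟶ B) (g : 𝔾.obj CC) :
    𝔾.map f (𝔾.map (str A) g) = 𝔾.map (str B) g := by rw [map_map_grp, str_comp]

/-- The specialization of a solution of `s η(s) = α` at a `ℂ`-point. -/
def specialize {A : TestAlg} {s : G.grp.obj A} (hs : G.mat (s * η.app A s) = alphaAt lam A)
    (p : A ⟶ CC) : TwistedPts G η lam :=
  ⟨G.grp.map p s, by
    rw [nat_grp, ← map_mul, mat_map, hs, alphaAt_map, alphaAt_CC]⟩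

/-- If `u² = s σ⁻¹` and `u` is inverted by `g ↦ σ η(g) σ⁻¹`, then `s` is the twisted conjugate
of `σ` by `u`, and `u` centralizes `α`. -/
theorem exists_cent_of_sqrt (hη : η ≫ η = 𝟙 _) {A : TestAlg} {s σ u : G.grp.obj A}
    (hs : G.mat (s * η.app A s) = alphaAt lam A) (hσ : G.mat (σ * η.app A σ) = alphaAt lam A)
    (hu : u * u = s * σ⁻¹) (hι : (σ * η.app A u * σ⁻¹)⁻¹ = u) :
    ∃ k : (cent G lam).obj A, s = centIncl G lam k * σ * (η.app A (centIncl G lam k))⁻¹ := by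
  have h1 : s = u * σ * (η.app A u)⁻¹ := by
    have h2 : s = u * u * σ := by rw [hu, inv_mul_cancel_right]
    rw [h2]
    conv_lhs => rw [mul_assoc u u σ]; enter [2, 1]; rw [← hι]
    group
  refine ⟨⟨u, Subgroup.mem_centralizer_singleton_iff.2 ?_⟩, h1⟩
  have h3 : s * η.app A s = u * (σ * η.app A σ) * u⁻¹ := by
    rw [h1, map_mul, map_mul, map_inv, invol_grp hη]
    group
  rw [← hs, ← map_mul, ← map_mul]
  conv_rhs => rw [h3]
  rw [inv_mul_cancel_right, map_mul G.mat u, map_mul G.mat u, hs, hσ]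

/-- Near a `ℂ`-point of a test scheme of finite type, for the étale topology, every solution of
`s η(s) = α` is a twisted conjugate of its value `σ` at the point: the conjugating element is the
square root of `s σ⁻¹` which is trivial at the point. -/
theorem exists_flat_nhds (hη : η ≫ η = 𝟙 _) {A : TestAlg} [Algebra.FiniteType ℂ A]
    {s : G.grp.obj A} (hs : G.mat (s * η.app A s) = alphaAt lam A) (p : A ⟶ CC) :
    ∃ (B : TestAlg) (f : A ⟶ B) (q : B ⟶ CC), f ≫ q = p ∧ f.hom.toRingHom.Flat ∧
      f.hom.toRingHom.FinitePresentation ∧ ∃ k : (cent G lam).obj B,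
        G.grp.map f s = centIncl G lam k * G.grp.map (str B) (specialize hs p).1 *
          (η.app B (centIncl G lam k))⁻¹ := by
  set σ : G.grp.obj CC := (specialize hs p).1 with hσdef
  have hσ : ∀ B : TestAlg, G.mat (G.grp.map (str B) σ * η.app B (G.grp.map (str B) σ)) =
      alphaAt lam B := fun B => mat_twisted G η lam (specialize hs p) B
  have hpσ : G.grp.map p s = σ := rfl
  set t : G.grp.obj A := s * (G.grp.map (str A) σ)⁻¹ with ht
  have hpt : G.grp.map p t = 1 := by
    rw [ht, map_mul, map_inv, map_str, str_CC, CategoryTheory.Functor.map_id, hpσ]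
    exact mul_inv_cancel σ
  -- the scheme of square roots of `t = s σ⁻¹` is smooth over `Spec A`
  obtain ⟨S, _, _, u, V, hS, hsq, huniv⟩ := exists_universal_sqrt (G.mat t).val
  let _ : Algebra ℂ S := ((algebraMap A S).comp (algebraMap ℂ A)).toAlgebra
  have : IsScalarTower ℂ A S := IsScalarTower.of_algebraMap_eq fun _ => rfl
  let f₀ : A ⟶ CommAlgCat.of ℂ S := CommAlgCat.ofHom (IsScalarTower.toAlgHom ℂ A S)
  have hflat₀ : f₀.hom.toRingHom.Flat :=
    (RingHom.flat_algebraMap_iff (R := A) (S := S)).2 inferInstance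
  have hfp₀ : f₀.hom.toRingHom.FinitePresentation :=
    RingHom.finitePresentation_algebraMap.2 (inferInstance : Algebra.FinitePresentation A S)
  have hft : Algebra.FiniteType ℂ S := Algebra.FiniteType.trans (S := A) inferInstance inferInstance
  have hnoeth : IsNoetherianRing S := Algebra.FiniteType.isNoetherianRing ℂ S
  -- the square root `1` of `t` at the given point
  obtain ⟨q₀, hq₀, hq₀u⟩ : ∃ q₀ : CommAlgCat.of ℂ S ⟶ CC, f₀ ≫ q₀ = p ∧ u.map q₀.hom = 1 := by
    let _ : Algebra A ℂ := p.hom.toRingHom.toAlgebra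
    have : IsScalarTower ℂ A ℂ := IsScalarTower.of_algebraMap_eq fun c => (p.hom.commutes c).symm
    obtain ⟨φ, hφ, -⟩ := huniv ℂ 1 ((2 : ℂ)⁻¹ • 1) ⟨by
      rw [mul_one]
      exact (congrArg (fun g => (G.mat g).val) hpt).symm, by
      rw [anticomm_one, smul_mul_smul_comm, mul_one, mul_inv_cancel₀ two_ne_zero, one_smul]⟩
    refine ⟨CommAlgCat.ofHom (φ.restrictScalars ℂ), ?_, hφ⟩
    ext a
    exact φ.commutes a
  let u₀ : GL (Fin d) S :=
    { val := u
      inv := u * ((glMap f₀ (G.mat t))⁻¹).val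
      val_inv := by
        rw [← mul_assoc, hsq.1]
        exact Units.mul_inv (glMap f₀ (G.mat t))
      inv_val := by
        rw [mul_eq_one_comm, ← mul_assoc, hsq.1]
        exact Units.mul_inv (glMap f₀ (G.mat t)) }
  have hu₀ : u₀ * u₀ = glMap f₀ (G.mat t) := Units.ext hsq.1
  -- the square root lies in the group near the point
  obtain ⟨r₁, hr₁, hr₁f⟩ := G.exists_satisfies_away q₀.hom (u := u₀) hq₀u
    (hu₀ ▸ (G.grp.map f₀ t).2)
  obtain ⟨B₁, f₁, q₁, hq₁, hflat₁, hfp₁, hloc₁⟩ := exists_localization q₀ hr₁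
  let g₁ : G.grp.obj B₁ := ⟨glMap f₁ u₀, fun f hf => by
    refine (LinearAlgebraicGroup.evalGL_map f₁.hom f u₀).trans ?_
    rw [← map_zero f₁.hom]
    exact hloc₁ _ _ ((hr₁f f hf).trans (mul_zero r₁).symm)⟩
  have hg₁ : g₁ * g₁ = G.grp.map (f₀ ≫ f₁) t := by
    apply mat_injective
    change glMap f₁ u₀ * glMap f₁ u₀ = glMap f₁ (glMap f₀ (G.mat t))
    rw [← map_mul, hu₀]
  have hqg₁ : G.grp.map q₁ g₁ = 1 := by
    apply grp_ext
    change (u.map f₁.hom).map q₁.hom = 1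
    rw [← hq₀u, ← hq₁]
    rfl
  -- its inverse and its image under the twisted involution agree near the point
  set w₁ : G.grp.obj B₁ :=
    (G.grp.map (str B₁) σ * η.app B₁ g₁ * (G.grp.map (str B₁) σ)⁻¹)⁻¹ with hw₁
  have hqw₁ : G.grp.map q₁ w₁ = 1 := by
    rw [hw₁, map_inv, map_mul, map_mul, map_inv, ← nat_grp, hqg₁, map_one]
    group
  have hww : w₁ * w₁ = g₁ * g₁ := by
    have e1 : w₁ * w₁ =
        (G.grp.map (str B₁) σ * η.app B₁ (g₁ * g₁) * (G.grp.map (str B₁) σ)⁻¹)⁻¹ := by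
      rw [hw₁, map_mul]
      group
    have hs₁ : G.mat (G.grp.map (f₀ ≫ f₁) s * η.app B₁ (G.grp.map (f₀ ≫ f₁) s)) =
        alphaAt lam B₁ := by rw [nat_grp, ← map_mul, mat_map, hs, alphaAt_map]
    have e2 := mat_injective G B₁ (hs₁.trans (hσ B₁).symm)
    rw [e1, hg₁, ht, map_mul (G.grp.map (f₀ ≫ f₁)).hom, map_inv (G.grp.map (f₀ ≫ f₁)).hom, map_str]
    generalize G.grp.map (f₀ ≫ f₁) s = s' at e2
    generalize G.grp.map (str B₁) σ = σ' at e2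
    rw [map_mul, map_inv]
    have e3 : η.app B₁ s' = s'⁻¹ * σ' * η.app B₁ σ' := by
      rw [mul_assoc, ← e2, inv_mul_cancel_left]
    rw [e3]
    group
  obtain ⟨r₂, hr₂, hr₂u⟩ := exists_mul_sub_eq_zero q₁.hom (u := (G.mat g₁).val)
    (w := (G.mat w₁).val) (congrArg (fun g => (G.mat g).val) hqg₁)
    (congrArg (fun g => (G.mat g).val) hqw₁) (congrArg (fun g => (G.mat g).val) hww)
  obtain ⟨B₂, f₂, q₂, hq₂, hflat₂, hfp₂, hloc₂⟩ := exists_localization q₁ hr₂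
  have hwg : G.grp.map f₂ w₁ = G.grp.map f₂ g₁ := by
    apply grp_ext
    ext i j
    exact hloc₂ _ _ (congrFun (congrFun hr₂u i) j)
  refine ⟨B₂, f₀ ≫ f₁ ≫ f₂, q₂, ?_, ?_, ?_, ?_⟩
  · rw [Category.assoc, Category.assoc, hq₂, hq₁, hq₀]
  · exact RingHom.Flat.comp hflat₀ (RingHom.Flat.comp hflat₁ hflat₂)
  · exact RingHom.FinitePresentation.comp (RingHom.FinitePresentation.comp hfp₂ hfp₁) hfp₀
  · refine exists_cent_of_sqrt hη (u := G.grp.map f₂ g₁) ?_ (hσ B₂) ?_ ?_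
    · rw [nat_grp, ← map_mul, mat_map, hs, alphaAt_map]
    · rw [← map_mul, hg₁, ht, map_map_grp, Category.assoc, map_mul, map_inv, map_str]
    · rw [← map_str G.grp f₂, nat_grp, ← map_mul, ← map_inv, ← map_mul, ← map_inv]
      exact hwg

end Transitivity

/-! ### Passage to complex points -/

section Spreading

/-- The Nullstellensatz: the closed points of a test scheme of finite type are its `ℂ`-points. -/
theorem exists_point_of_isMaximal {A : TestAlg} [Algebra.FiniteType ℂ A] (m : Ideal A)
    [m.IsMaximal] : ∃ p : A ⟶ CC, RingHom.ker p.hom = m := by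
  let _ := Ideal.Quotient.field m
  have h1 : Algebra.FiniteType ℂ (A ⧸ m) := inferInstance
  have h2 : Module.Finite ℂ (A ⧸ m) := finite_of_finite_type_of_isJacobsonRing ℂ (A ⧸ m)
  have h3 : Function.Bijective (algebraMap ℂ (A ⧸ m)) :=
    IsAlgClosed.algebraMap_bijective_of_isIntegral
  let e : ℂ ≃ₐ[ℂ] A ⧸ m := AlgEquiv.ofBijective (Algebra.ofId ℂ (A ⧸ m)) h3
  refine ⟨CommAlgCat.ofHom ((e.symm : A ⧸ m →ₐ[ℂ] ℂ).comp (Ideal.Quotient.mkₐ ℂ m)), ?_⟩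
  ext x
  rw [RingHom.mem_ker, ← Ideal.Quotient.eq_zero_iff_mem]
  exact e.symm.map_eq_zero_iff

theorem exists_point {A : TestAlg} [Algebra.FiniteType ℂ A] (hA : Nontrivial A) :
    Nonempty (A ⟶ CC) := by
  obtain ⟨m, hm⟩ := Ideal.exists_maximal A
  exact ⟨(exists_point_of_isMaximal m).choose⟩

/-- On a test scheme of finite type, it is enough to cover neighbourhoods of the `ℂ`-points:
flat morphisms of finite presentation are open, and the scheme is quasi-compact. -/
theorem cov_of_flat_nhds {A : TestAlg} [Algebra.FiniteType ℂ A]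
    {W : ∀ B : TestAlg, (A ⟶ B) → Prop}
    (hW : ∀ {B C : TestAlg} (f : A ⟶ B) (g : B ⟶ C), W B f → W C (f ≫ g))
    (h : ∀ p : A ⟶ CC, ∃ (B : TestAlg) (f : A ⟶ B) (q : B ⟶ CC), f ≫ q = p ∧
      f.hom.toRingHom.Flat ∧ f.hom.toRingHom.FinitePresentation ∧ W B f) : Cov A W := by
  rcases subsingleton_or_nontrivial A with hA | hA
  · exact .zero hA
  -- a set of points is good if it lies in the image of one flat morphism of finite presentation
  -- over which `W` holds locally
  let P : Set (PrimeSpectrum A) → Prop := fun U => ∃ (B : TestAlg) (f : A ⟶ B),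
    f.hom.toRingHom.Flat ∧ f.hom.toRingHom.FinitePresentation ∧
      U ⊆ Set.range (PrimeSpectrum.comap f.hom.toRingHom) ∧ Cov B fun C g => W C (f ≫ g)
  have hP : P Set.univ := by
    refine isCompact_univ.induction_on (p := P) ?_ ?_ ?_ ?_
    · obtain ⟨p⟩ := exists_point hA
      obtain ⟨B, f, -, -, h1, h2, h3⟩ := h p
      exact ⟨B, f, h1, h2, Set.empty_subset _, .base fun C g => hW f g h3⟩
    · rintro U V hUV ⟨B, f, h1, h2, h3, h4⟩
      exact ⟨B, f, h1, h2, hUV.trans h3, h4⟩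
    · rintro U₁ U₂ ⟨B₁, f₁, h1, h2, h3, h4⟩ ⟨B₂, f₂, k1, k2, k3, k4⟩
      refine ⟨CommAlgCat.of ℂ (B₁ × B₂), CommAlgCat.ofHom (f₁.hom.prod f₂.hom),
        prod_of_ofLocalizationSpanTarget RingHom.Flat.ofLocalizationSpanTarget
          RingHom.Flat.respectsIso h1 k1,
        prod_of_ofLocalizationSpanTarget RingHom.finitePresentation_ofLocalizationSpanTarget
          RingHom.finitePresentation_respectsIso h2 k2, ?_, ?_⟩
      · rintro x (hx | hx)
        · obtain ⟨y, rfl⟩ := h3 hx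
          exact ⟨PrimeSpectrum.comap (RingHom.fst B₁ B₂) y, rfl⟩
        · obtain ⟨y, rfl⟩ := k3 hx
          exact ⟨PrimeSpectrum.comap (RingHom.snd B₁ B₂) y, rfl⟩
      · exact .split (CommAlgCat.ofHom (AlgHom.fst ℂ B₁ B₂))
          (CommAlgCat.ofHom (AlgHom.snd ℂ B₁ B₂)) Function.bijective_id h4 k4
    · intro x _
      obtain ⟨m, hm, hxm⟩ := Ideal.exists_le_maximal x.asIdeal x.2.ne_top
      obtain ⟨p, hp⟩ := exists_point_of_isMaximal m
      obtain ⟨B, f, q, rfl, h1, h2, h3⟩ := h p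
      refine ⟨Set.range (PrimeSpectrum.comap f.hom.toRingHom), ?_, B, f, h1, h2, subset_rfl,
        .base fun C g => hW f g h3⟩
      have hopen : IsOpen (Set.range (PrimeSpectrum.comap f.hom.toRingHom)) := by
        let _ : Algebra A B := f.hom.toRingHom.toAlgebra
        have : Module.Flat A B := h1
        have : Algebra.FinitePresentation A B := h2
        exact (PrimeSpectrum.isOpenMap_comap_of_hasGoingDown_of_finitePresentation
          (R := A) (S := B)).isOpen_range
      have hmem : (⟨m, hm.isPrime⟩ : PrimeSpectrum A) ∈
          Set.range (PrimeSpectrum.comap f.hom.toRingHom) := by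
        refine ⟨⟨RingHom.ker q.hom.toRingHom, RingHom.ker_isPrime q.hom.toRingHom⟩, ?_⟩
        refine PrimeSpectrum.ext (Eq.trans ?_ hp)
        rfl
      rw [nhdsWithin_univ]
      exact hopen.mem_nhds
        (((PrimeSpectrum.le_iff_specializes _ _).1 hxm).mem_open hopen hmem)
  obtain ⟨B, f, h1, h2, h3, h4⟩ := hP
  exact .cover f ⟨RingHom.FaithfullyFlat.iff_flat_and_comap_surjective.2
    ⟨h1, fun x => h3 (Set.mem_univ x)⟩, h2⟩ h4

variable {d : ℕ} {G : LinearAlgebraicGroup d} {η : G.grp ⟶ G.grp}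
  {lam : Matrix (Fin d) (Fin d) ℂ}

theorem glMap_injective {A B : TestAlg} {f : A ⟶ B} (hf : Function.Injective f.hom) :
    Function.Injective (glMap (d := d) f) := fun g h e => Units.ext (by
  have e' : (glMap f g).val = (glMap f h).val := by rw [e]
  ext i j
  exact hf (congrFun (congrFun e' i) j))

/-- Points of an algebraic group are defined over finitely generated algebras. -/
theorem exists_finiteType_model {A : TestAlg} (s : G.grp.obj A) :
    ∃ (R : TestAlg) (ι : R ⟶ A) (s₀ : G.grp.obj R), Algebra.FiniteType ℂ R ∧
      Function.Injective ι.hom ∧ G.grp.map ι s₀ = s := by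
  let T : Subalgebra ℂ A := Algebra.adjoin ℂ (Set.range (coords (G.mat s)))
  have hT : ∀ k, coords (G.mat s) k ∈ T := fun k => Algebra.subset_adjoin ⟨k, rfl⟩
  let M : Matrix (Fin d) (Fin d) T := fun i j => ⟨_, hT (Sum.inl (i, j))⟩
  let N : Matrix (Fin d) (Fin d) T := fun i j => ⟨_, hT (Sum.inr (i, j))⟩
  have hMN : M * N = 1 := by
    refine Matrix.map_injective Subtype.val_injective ?_
    change T.val.mapMatrix (M * N) = T.val.mapMatrix 1
    rw [map_mul, map_one]
    exact Units.mul_inv (G.mat s)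
  let g : GL (Fin d) T := ⟨M, N, hMN, mul_eq_one_comm.1 hMN⟩
  let ι : CommAlgCat.of ℂ T ⟶ A := CommAlgCat.ofHom T.val
  have hι : Function.Injective ι.hom := Subtype.val_injective
  have hg : glMap ι g = G.mat s := Units.ext rfl
  refine ⟨CommAlgCat.of ℂ T, ι, ⟨g, fun f hf => hι ?_⟩, ?_, hι, mat_injective G A hg⟩
  · rw [map_zero, ← LinearAlgebraicGroup.evalGL_map]
    change evalGL f (glMap ι g) = 0
    rw [hg]
    exact s.2 f hf
  · exact T.fg_iff_finiteType.1
      (Subalgebra.fg_def.2 ⟨_, Set.finite_range _, rfl⟩)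

/-- Locally, every solution of `s η(s) = α` is a twisted conjugate of a `ℂ`-point. -/
theorem cov_twisted_conj (hη : η ≫ η = 𝟙 _) {A : TestAlg} {s : G.grp.obj A}
    (hs : G.mat (s * η.app A s) = alphaAt lam A) :
    Cov A fun B f => ∃ (σ : TwistedPts G η lam) (k : (cent G lam).obj B),
      G.grp.map f s = centIncl G lam k * G.grp.map (str B) σ.1 *
        (η.app B (centIncl G lam k))⁻¹ := by
  obtain ⟨R, ι, s₀, hR, hι, rfl⟩ := exists_finiteType_model s
  have hs₀ : G.mat (s₀ * η.app R s₀) = alphaAt lam R := by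
    refine glMap_injective hι ?_
    rw [alphaAt_map, ← hs, nat_grp, ← map_mul, mat_map]
  have hcov : Cov R fun B f => ∃ (σ : TwistedPts G η lam) (k : (cent G lam).obj B),
      G.grp.map f s₀ = centIncl G lam k * G.grp.map (str B) σ.1 *
        (η.app B (centIncl G lam k))⁻¹ := by
    refine cov_of_flat_nhds ?_ fun p => ?_
    · rintro B C f g ⟨σ, k, e⟩
      refine ⟨σ, (cent G lam).map g k, ?_⟩
      rw [← map_map_grp, e, map_mul, map_mul, map_inv, map_str, ← nat_grp]
      rfl
    · obtain ⟨B, f, q, h1, h2, h3, k, h4⟩ := exists_flat_nhds hη hs₀ p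
      exact ⟨B, f, q, h1, h2, h3, specialize hs₀ p, k, h4⟩
  refine (hcov.pullback ι).mono fun B f => ?_
  rintro ⟨σ, k, e⟩
  exact ⟨σ, k, by rw [map_map_grp, e]⟩

/-- Solutions of `σ η(σ) = α` over `ℂ` which become conjugate over some nonempty test scheme are
conjugate. -/
theorem twisted_conj_of_nontrivial {A : TestAlg} (hA : Nontrivial A) {σ σ' : TwistedPts G η lam}
    (k : (cent G lam).obj A) (e : G.grp.map (str A) σ'.1 = centIncl G lam k *
      G.grp.map (str A) σ.1 * (η.app A (centIncl G lam k))⁻¹) :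
    (twistedSetoid G η lam).r σ σ' := by
  -- specialize the conjugating element at a `ℂ`-point of an algebra over which it is defined
  obtain ⟨R, ι, k₀, hR, hι, hk⟩ := exists_finiteType_model (centIncl G lam k)
  have hk₀ : k₀ ∈ (centralizer G lam).carrier R := by
    refine Subgroup.mem_centralizer_singleton_iff.2 (glMap_injective hι ?_)
    rw [map_mul, map_mul, ← mat_map, hk, alphaAt_map]
    exact Subgroup.mem_centralizer_singleton_iff.1 k.2
  have e₀ : G.grp.map (str R) σ'.1 = k₀ * G.grp.map (str R) σ.1 * (η.app R k₀)⁻¹ := by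
    refine mat_injective G R (glMap_injective hι ?_)
    rw [← mat_map, ← mat_map, map_mul (G.grp.map ι).hom, map_mul (G.grp.map ι).hom,
      map_inv (G.grp.map ι).hom, ← nat_grp, hk, map_str, map_str, e]
  obtain ⟨p⟩ := exists_point (A := R) ι.hom.toRingHom.domain_nontrivial
  refine ⟨(cent G lam).map p ⟨k₀, hk₀⟩, ?_⟩
  have e₁ := congrArg (G.grp.map p) e₀
  rw [map_mul (G.grp.map p).hom, map_mul (G.grp.map p).hom, map_inv (G.grp.map p).hom, ← nat_grp,
    map_str, map_str, str_CC, CategoryTheory.Functor.map_id] at e₁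
  exact e₁

end Spreading

/-! ### Algebraic groups are fppf sheaves -/

section GroupSheaves

/-- The affine space with coordinates indexed by `ι`, as a presheaf of sets. -/
def affineSpacePresh (ι : Type) : Presh where
  obj A := ι → A
  map f := TypeCat.ofHom fun x i => f.hom (x i)
  map_id _ := rfl
  map_comp _ _ := rfl

theorem isFppfSheaf_affineSpacePresh (ι : Type) : IsFppfSheaf (affineSpacePresh ι) where
  zero A hA := ⟨(fun _ => 0 : ι → A), trivial, fun y _ =>
    funext fun i => hA.elim ((y : ι → A) i) 0⟩
  prod A B x y := ⟨(fun i => (x i, y i) : ι → A × B), ⟨rfl, rfl⟩, fun z ⟨h₁, h₂⟩ =>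
    funext fun i => Prod.ext (congrFun h₁ i) (congrFun h₂ i)⟩
  descent {A B} f hf x hx := by
    have h := fun i : ι => isFppfSheaf_affineLine.descent f hf ((x : ι → B) i)
      fun C u v e => congrFun (hx C u v e) i
    exact ⟨(fun i => (h i).choose : ι → A), funext fun i => (h i).choose_spec.1,
      fun y hy => funext fun i => (h i).choose_spec.2 _ (congrFun hy i)⟩

variable {d : ℕ}

/-- Being the entries of a matrix and of its inverse is a local condition on a point of affine
space. -/
theorem isFppfSheaf_glGrp : IsFppfSheaf (setOf (glGrp d)) := by
  refine isFppfSheaf_of_injective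
    (isFppfSheaf_affineSpacePresh ((Fin d × Fin d) ⊕ (Fin d × Fin d)))
    { app := fun A => TypeCat.ofHom (X := GL (Fin d) A) (Y := _ → A) fun g => coords g
      naturality := fun A B f => by
        refine ConcreteCategory.hom_ext _ _ fun g : GL (Fin d) A => ?_
        exact funext fun k => LinearAlgebraicGroup.coords_map f.hom.toRingHom g k } ?_ ?_
  · intro A g h e
    refine Units.ext ?_
    ext i j
    exact congrFun e (Sum.inl (i, j))
  · intro A c H
    have H' : Cov A fun B f => ∃ y : GL (Fin d) B, ∀ k, coords y k = f.hom ((c : _ → A) k) :=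
      H.mono fun B f ⟨y, hy⟩ => ⟨y, fun k => congrFun hy k⟩
    let M : Matrix (Fin d) (Fin d) A := fun i j => (c : _ → A) (Sum.inl (i, j))
    let N : Matrix (Fin d) (Fin d) A := fun i j => (c : _ → A) (Sum.inr (i, j))
    have hMN : M * N = 1 := by
      ext i j
      refine elem_ext_of_cov H' fun B f ⟨y, hy⟩ => ?_
      have hM : f.hom.mapMatrix M = y.val := by ext i j; exact (hy (Sum.inl (i, j))).symm
      have hN : f.hom.mapMatrix N = (y⁻¹).val := by ext i j; exact (hy (Sum.inr (i, j))).symm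
      change f.hom.mapMatrix (M * N) i j = f.hom.mapMatrix 1 i j
      rw [map_mul, hM, hN, Units.mul_inv, map_one]
    refine ⟨(⟨M, N, hMN, mul_eq_one_comm.1 hMN⟩ : GL (Fin d) A), funext fun k => ?_⟩
    rcases k with k | k <;> rfl

/-- A presheaf of subgroups of a sheaf of groups is a sheaf if membership is local. -/
theorem isFppfSheaf_toGrp {𝔾 : GrpPresh} (h : IsFppfSheaf (setOf 𝔾)) (K : SubgroupPresh 𝔾)
    (hK : ∀ {A : TestAlg} (g : 𝔾.obj A),
      Cov A (fun B f => 𝔾.map f g ∈ K.carrier B) → g ∈ K.carrier A) :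
    IsFppfSheaf (setOf K.toGrp) := by
  refine isFppfSheaf_of_injective h
    { app := fun A => TypeCat.ofHom (X := K.carrier A) (Y := 𝔾.obj A) fun g => g.1
      naturality := fun _ _ _ => rfl } (fun A => Subtype.val_injective) (fun A g H => ?_)
  refine ⟨⟨g, hK g (H.mono fun B f ⟨y, hy⟩ => ?_)⟩, rfl⟩
  exact (show y.1 = 𝔾.map f g from hy) ▸ y.2

variable {G : LinearAlgebraicGroup d} {lam : Matrix (Fin d) (Fin d) ℂ}

theorem isFppfSheaf_grp (G : LinearAlgebraicGroup d) : IsFppfSheaf (setOf G.grp) :=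
  isFppfSheaf_toGrp isFppfSheaf_glGrp G.sub fun {A} g H f hf =>
    elem_ext_of_cov H fun B h hB => by
      rw [map_zero]
      exact (LinearAlgebraicGroup.evalGL_map h.hom f (show GL (Fin d) A from g)).symm.trans
        (hB f hf)

theorem gl_ext_of_cov {A : TestAlg} {W : ∀ B : TestAlg, (A ⟶ B) → Prop} (H : Cov A W)
    {g h : GL (Fin d) A} (e : ∀ B (f : A ⟶ B), W B f → glMap f g = glMap f h) : g = h :=
  isFppfSheaf_glGrp.sep H e

theorem isFppfSheaf_cent (G : LinearAlgebraicGroup d) (lam : Matrix (Fin d) (Fin d) ℂ) :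
    IsFppfSheaf (setOf (cent G lam)) :=
  isFppfSheaf_toGrp (isFppfSheaf_grp G) _ fun {A} g H => by
    refine Subgroup.mem_centralizer_singleton_iff.2 (gl_ext_of_cov H fun B f h => ?_)
    rw [map_mul, map_mul, alphaAt_map]
    exact Subgroup.mem_centralizer_singleton_iff.1 h

end GroupSheaves

/-! ### Faithfully flat descent of submodules -/

section Submodules

variable {ι : Type}

/-- Base change of a submodule of a free module. -/
def mapSub {A B : TestAlg} (f : A ⟶ B) (N : Submodule A (ι → A)) : Submodule B (ι → B) :=
  Submodule.span B ((fun (x : ι → A) i => f.hom (x i)) '' N)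

theorem mapSub_span {A B : TestAlg} (f : A ⟶ B) (s : Set (ι → A)) :
    mapSub f (Submodule.span A s) = Submodule.span B ((fun x i => f.hom (x i)) '' s) := by
  refine le_antisymm (Submodule.span_le.2 ?_)
    (Submodule.span_mono (Set.image_mono Submodule.subset_span))
  rintro _ ⟨x, hx, rfl⟩
  induction hx using Submodule.span_induction with
  | mem x h => exact Submodule.subset_span ⟨x, h, rfl⟩
  | zero => simp only [Pi.zero_apply, map_zero]; exact Submodule.zero_mem _
  | add x y _ _ hx hy => simp only [Pi.add_apply, map_add]; exact Submodule.add_mem _ hx hy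
  | smul r x _ hx =>
    simp only [Pi.smul_apply, smul_eq_mul, map_mul]
    exact Submodule.smul_mem _ _ hx

/-- The presheaf of submodules of the free modules on `ι`. -/
def subPresh (ι : Type) : Presh where
  obj A := Submodule A (ι → A)
  map f := TypeCat.ofHom (mapSub f)
  map_id A := by
    refine ConcreteCategory.hom_ext _ _ fun N : Submodule A (ι → A) => ?_
    change Submodule.span A ((fun x => x) '' (N : Set (ι → A))) = N
    rw [Set.image_id', Submodule.span_eq]
  map_comp f g := by
    refine ConcreteCategory.hom_ext _ _ fun N : Submodule _ (ι → _) => ?_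
    change mapSub (f ≫ g) N = mapSub g (mapSub f N)
    rw [mapSub.eq_def f N, mapSub_span, Set.image_image]
    rfl

/-- Base change along a surjection is the image. -/
theorem exists_of_mem_mapSub {A B : TestAlg} {f : A ⟶ B} (hf : Function.Surjective f.hom)
    {N : Submodule A (ι → A)} {y : ι → B} (hy : y ∈ mapSub f N) :
    ∃ x ∈ N, ∀ i, f.hom (x i) = y i := by
  unfold mapSub at hy
  induction hy using Submodule.span_induction with
  | mem x h =>
    obtain ⟨x, hx, rfl⟩ := h
    exact ⟨x, hx, fun _ => rfl⟩
  | zero => exact ⟨0, N.zero_mem, fun _ => map_zero _⟩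
  | add x y _ _ hx hy =>
    obtain ⟨x', hx', ex⟩ := hx
    obtain ⟨y', hy', ey⟩ := hy
    exact ⟨x' + y', N.add_mem hx' hy', fun i => by simp [ex, ey]⟩
  | smul r x _ hx =>
    obtain ⟨x', hx', ex⟩ := hx
    obtain ⟨r', rfl⟩ := hf r
    exact ⟨r' • x', N.smul_mem _ hx', fun i => by simp [ex]⟩

variable [Fintype ι] [DecidableEq ι]

/-- A submodule is recovered from its base change along a faithfully flat morphism. -/
theorem mem_of_mem_mapSub {A B : TestAlg} {f : A ⟶ B} (hf : IsFppf f) {N : Submodule A (ι → A)}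
    {x : ι → A} (hx : (fun i => f.hom (x i)) ∈ mapSub f N) : x ∈ N := by
  let _ : Algebra A B := f.hom.toRingHom.toAlgebra
  have : Module.FaithfullyFlat A B := hf.1
  -- the map `B^ι → B ⊗ (A^ι/N)`, which kills the base change of `N`
  let Ψ : (ι → B) →ₗ[B] TensorProduct A B ((ι → A) ⧸ N) :=
    ∑ i, (LinearMap.toSpanSingleton B _ ((1 : B) ⊗ₜ[A] N.mkQ (Pi.single i 1))).comp
      (LinearMap.proj i)
  have hΨ : ∀ x : ι → A, Ψ (fun i => f.hom (x i)) = (1 : B) ⊗ₜ[A] N.mkQ x := by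
    intro x
    have e : x = ∑ i, x i • (Pi.single i 1 : ι → A) := by
      simp_rw [← Pi.single_smul, smul_eq_mul, mul_one]
      exact (Finset.univ_sum_single x).symm
    conv_rhs => rw [e, map_sum, TensorProduct.tmul_sum]
    rw [LinearMap.sum_apply]
    refine Finset.sum_congr rfl fun i _ => ?_
    rw [map_smul, TensorProduct.tmul_smul]
    change f.hom (x i) • ((1 : B) ⊗ₜ[A] N.mkQ (Pi.single i 1)) = _
    rw [TensorProduct.smul_tmul', TensorProduct.smul_tmul', Algebra.smul_def (x i), smul_eq_mul]
    rfl
  have h0 : Ψ (fun i => f.hom (x i)) = 0 := by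
    refine (Submodule.span_le.2 ?_ : mapSub f N ≤ LinearMap.ker Ψ) hx
    rintro _ ⟨y, hy, rfl⟩
    change Ψ _ = 0
    have e : N.mkQ y = 0 := (Submodule.Quotient.mk_eq_zero N).2 hy
    rw [hΨ, e, TensorProduct.tmul_zero]
  rw [hΨ] at h0
  refine (Submodule.Quotient.mk_eq_zero N).1
    (Module.FaithfullyFlat.tensorProduct_mk_injective (A := A) (B := B) ((ι → A) ⧸ N) ?_)
  exact h0.trans (TensorProduct.tmul_zero _ _).symm

/-- Descent of submodules along a faithfully flat morphism. -/
theorem exists_mapSub_eq {A B : TestAlg} {f : A ⟶ B} (hf : IsFppf f) {N' : Submodule B (ι → B)}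
    (h : ∀ (C : TestAlg) (u v : B ⟶ C), f ≫ u = f ≫ v → mapSub u N' = mapSub v N') :
    ∃ N : Submodule A (ι → A), mapSub f N = N' := by
  let _ : Algebra A B := f.hom.toRingHom.toAlgebra
  have : IsScalarTower ℂ A B := IsScalarTower.of_algebraMap_eq fun c => (f.hom.commutes c).symm
  have : Module.FaithfullyFlat A B := hf.1
  let F : (ι → A) →ₗ[A] (ι → B) := (Algebra.linearMap A B).compLeft ι
  let Q : Type := (ι → B) ⧸ N'.restrictScalars A
  let π : (ι → B) →ₗ[A] Q := (N'.restrictScalars A).mkQ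
  have hπ : ∀ x, π x = 0 ↔ x ∈ N' := fun x => Submodule.Quotient.mk_eq_zero _
  let j : (ι → A) →ₗ[A] Q := π.comp F
  let N : Submodule A (ι → A) := LinearMap.ker j
  refine ⟨N, le_antisymm (Submodule.span_le.2 ?_) fun v hv => ?_⟩
  · rintro _ ⟨x, hx, rfl⟩
    exact (hπ _).1 hx
  -- the map `(b ⊗ c) e_i ↦ b ⊗ c e_i` kills the second base change of `N'`
  let q : ι → (B →ₗ[A] Q) := fun i => π.comp (LinearMap.single A (fun _ : ι => B) i)
  let Φ : (ι → TensorProduct A B B) →ₗ[A] TensorProduct A B Q :=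
    ∑ i, ((q i).lTensor B).comp (LinearMap.proj i)
  let p₁ : B ⟶ CommAlgCat.of ℂ (TensorProduct A B B) :=
    CommAlgCat.ofHom Algebra.TensorProduct.includeLeft
  let p₂ : B ⟶ CommAlgCat.of ℂ (TensorProduct A B B) :=
    CommAlgCat.ofHom ((Algebra.TensorProduct.includeRight :
      B →ₐ[A] TensorProduct A B B).restrictScalars ℂ)
  have hp : f ≫ p₁ = f ≫ p₂ := by
    ext a
    change (algebraMap A B a) ⊗ₜ[A] (1 : B) = (1 : B) ⊗ₜ[A] (algebraMap A B a)
    rw [Algebra.algebraMap_eq_smul_one, TensorProduct.tmul_smul, TensorProduct.smul_tmul']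
  have hΦ : ∀ (b c : B) (w : ι → B),
      Φ (fun i => (b ⊗ₜ[A] c) * ((1 : B) ⊗ₜ[A] w i)) = b ⊗ₜ[A] π (c • w) := by
    intro b c w
    have e : c • w = ∑ i, Pi.single i (c * w i) := (Finset.univ_sum_single (c • w)).symm
    rw [e, map_sum, TensorProduct.tmul_sum, LinearMap.sum_apply]
    refine Finset.sum_congr rfl fun i _ => ?_
    change (q i).lTensor B ((b ⊗ₜ[A] c) * ((1 : B) ⊗ₜ[A] w i)) = _
    rw [Algebra.TensorProduct.tmul_mul_tmul, mul_one, LinearMap.lTensor_tmul]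
    rfl
  have hker : ∀ z ∈ mapSub p₂ N', Φ z = 0 := by
    intro z hz
    suffices H : ∀ s : TensorProduct A B B, Φ (s • z) = 0 by simpa using H 1
    unfold mapSub at hz
    induction hz using Submodule.span_induction with
    | mem z hz =>
      obtain ⟨w, hw, rfl⟩ := hz
      intro s
      induction s using TensorProduct.induction_on with
      | zero => rw [zero_smul, map_zero]
      | tmul b c =>
        have e : π (c • w) = 0 := (hπ _).2 (N'.smul_mem c hw)
        exact (hΦ b c w).trans (by rw [e, TensorProduct.tmul_zero])
      | add s s' hs hs' => rw [add_smul, map_add, hs, hs', add_zero]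
    | zero => intro s; rw [smul_zero, map_zero]
    | add x y _ _ hx hy => intro s; rw [smul_add, map_add, hx, hy, add_zero]
    | smul r x _ hx => intro s; rw [smul_smul, hx]
  have hv' : Φ (fun i => (v i) ⊗ₜ[A] (1 : B)) = 0 := by
    refine hker _ ?_
    rw [← h _ p₁ p₂ hp]
    exact Submodule.subset_span ⟨v, hv, rfl⟩
  -- `v` comes from an element `t` of `B ⊗ A^ι` which dies in `B ⊗ (B^ι/N')`, and so, by flatness,
  -- comes from `B ⊗ N`
  let t : TensorProduct A B (ι → A) := ∑ i, (v i) ⊗ₜ[A] (Pi.single i 1 : ι → A)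
  have ht : j.lTensor B t = 0 := by
    rw [← hv', map_sum, LinearMap.sum_apply]
    refine Finset.sum_congr rfl fun i _ => ?_
    rw [LinearMap.lTensor_tmul]
    change _ = (q i).lTensor B (v i ⊗ₜ[A] 1)
    rw [LinearMap.lTensor_tmul]
    congr 1
    refine congrArg π (funext fun k => ?_)
    change algebraMap A B ((Pi.single i 1 : ι → A) k) = (Pi.single i 1 : ι → B) k
    rw [Pi.single_apply, Pi.single_apply]
    split_ifs <;> simp
  have hex : Function.Exact (N.subtype.lTensor B) (j.lTensor B) :=
    Module.Flat.lTensor_exact B (LinearMap.exact_subtype_ker_map j)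
  obtain ⟨t', ht'⟩ := (hex t).1 ht
  let m : TensorProduct A B (ι → A) →ₗ[A] (ι → B) :=
    TensorProduct.lift (LinearMap.mk₂ A (fun (b : B) (x : ι → A) => b • F x)
      (fun b c x => add_smul b c _) (fun a b x => smul_assoc a b _)
      (fun b x y => by rw [map_add, smul_add]) (fun a b x => by rw [map_smul, smul_comm]))
  have hmt : m t = v := by
    rw [map_sum]
    refine Eq.trans ?_ (Finset.univ_sum_single v)
    refine Finset.sum_congr rfl fun i _ => funext fun k => ?_
    change v i * algebraMap A B ((Pi.single i 1 : ι → A) k) = (Pi.single i (v i) : ι → B) k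
    rw [Pi.single_apply, Pi.single_apply]
    split_ifs <;> simp
  rw [← hmt, ← ht']
  clear ht'
  induction t' using TensorProduct.induction_on with
  | zero => rw [map_zero, map_zero]; exact Submodule.zero_mem _
  | tmul b x =>
    exact Submodule.smul_mem _ b (Submodule.subset_span ⟨x.1, x.2, rfl⟩)
  | add x y hx hy => rw [map_add, map_add]; exact Submodule.add_mem _ hx hy

/-- Submodules of free modules of finite rank form a sheaf. -/
theorem isFppfSheaf_subPresh : IsFppfSheaf (subPresh ι) where
  zero A hA := ⟨(⊤ : Submodule A (ι → A)), trivial, fun N _ => by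
    refine top_le_iff (α := Submodule A (ι → A)) |>.1 fun x _ => ?_
    rw [Subsingleton.elim x 0]
    exact Submodule.zero_mem _⟩
  prod A B N₁ N₂ := by
    let p₁ : CommAlgCat.of ℂ (A × B) ⟶ A := CommAlgCat.ofHom (AlgHom.fst ℂ A B)
    let p₂ : CommAlgCat.of ℂ (A × B) ⟶ B := CommAlgCat.ofHom (AlgHom.snd ℂ A B)
    have hp₁ : Function.Surjective p₁.hom := Prod.fst_surjective
    have hp₂ : Function.Surjective p₂.hom := Prod.snd_surjective
    let M₁ : Submodule A (ι → A) := N₁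
    let M₂ : Submodule B (ι → B) := N₂
    let N : Submodule (A × B) (ι → A × B) :=
      { carrier := {z | (fun i => (z i).1) ∈ M₁ ∧ (fun i => (z i).2) ∈ M₂}
        add_mem' := fun hx hy => ⟨M₁.add_mem hx.1 hy.1, M₂.add_mem hx.2 hy.2⟩
        zero_mem' := ⟨M₁.zero_mem, M₂.zero_mem⟩
        smul_mem' := fun c _ hx => ⟨M₁.smul_mem c.1 hx.1, M₂.smul_mem c.2 hx.2⟩ }
    refine ⟨N, ⟨?_, ?_⟩, fun N' ⟨h₁, h₂⟩ => ?_⟩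
    · change mapSub p₁ N = M₁
      refine le_antisymm (Submodule.span_le.2 ?_) fun x hx => ?_
      · rintro _ ⟨z, hz, rfl⟩
        exact hz.1
      · exact Submodule.subset_span ⟨fun i => (x i, 0), ⟨hx, M₂.zero_mem⟩, rfl⟩
    · change mapSub p₂ N = M₂
      refine le_antisymm (Submodule.span_le.2 ?_) fun x hx => ?_
      · rintro _ ⟨z, hz, rfl⟩
        exact hz.2
      · exact Submodule.subset_span ⟨fun i => (0, x i), ⟨M₁.zero_mem, hx⟩, rfl⟩
    · change mapSub p₁ N' = M₁ at h₁
      change mapSub p₂ N' = M₂ at h₂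
      refine le_antisymm (α := Submodule (A × B) (ι → A × B)) (fun z hz => ⟨?_, ?_⟩) fun z hz => ?_
      · rw [← h₁]; exact Submodule.subset_span ⟨z, hz, rfl⟩
      · rw [← h₂]; exact Submodule.subset_span ⟨z, hz, rfl⟩
      · obtain ⟨x, hx, ex⟩ := exists_of_mem_mapSub hp₁ (h₁ ▸ hz.1)
        obtain ⟨y, hy, ey⟩ := exists_of_mem_mapSub hp₂ (h₂ ▸ hz.2)
        have e : z = ((1, 0) : A × B) • x + ((0, 1) : A × B) • y := by
          funext i
          refine Prod.ext ?_ ?_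
          · change (z i).1 = 1 * (x i).1 + 0 * (y i).1
            rw [one_mul, zero_mul, add_zero]
            exact (ex i).symm
          · change (z i).2 = 0 * (x i).2 + 1 * (y i).2
            rw [one_mul, zero_mul, zero_add]
            exact (ey i).symm
        rw [e]
        exact Submodule.add_mem _ (Submodule.smul_mem _ _ hx) (Submodule.smul_mem _ _ hy)
  descent {A B} f hf N' h := by
    obtain ⟨N, hN⟩ := exists_mapSub_eq hf h
    refine ⟨N, hN, fun M hM => ?_⟩
    have hM : mapSub f M = N' := hM
    refine le_antisymm (α := Submodule A (ι → A)) (fun x hx => ?_) fun x hx => ?_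
    · refine mem_of_mem_mapSub hf ?_
      rw [hN, ← hM]
      exact Submodule.subset_span ⟨x, hx, rfl⟩
    · refine mem_of_mem_mapSub hf ?_
      rw [hM, ← hN]
      exact Submodule.subset_span ⟨x, hx, rfl⟩

end Submodules

/-! ### Descent of affine subspaces and of geometric parameters -/

section AffineSubspaces

variable {d : ℕ}

/-- The point of projective space, in homogeneous coordinates, of a point of the affine space of
matrices. -/
def homog {A : Type} [CommRing A] (X : Matrix (Fin d) (Fin d) A) : Option (Fin d × Fin d) → A :=
  fun o => o.elim 1 fun ij => X ij.1 ij.2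

/-- The linear cone over an affine subspace of the space of matrices. -/
def cone {A : Type} [CommRing A] (F : AffineSubspace A (Matrix (Fin d) (Fin d) A)) :
    Submodule A (Option (Fin d × Fin d) → A) :=
  Submodule.span A (homog '' (F : Set (Matrix (Fin d) (Fin d) A)))

theorem homog_affine {A : Type} [CommRing A] (c : A) (X Y Z : Matrix (Fin d) (Fin d) A) :
    homog (c • (X -ᵥ Y) +ᵥ Z) = c • (homog X - homog Y) + homog Z := by
  funext o
  rcases o with _ | ij
  · simp [homog]
  · simp [homog]

theorem homog_mem_cone_iff {A : Type} [CommRing A]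
    {F : AffineSubspace A (Matrix (Fin d) (Fin d) A)}
    (hF : (F : Set (Matrix (Fin d) (Fin d) A)).Nonempty)
    {X : Matrix (Fin d) (Fin d) A} : homog X ∈ cone F ↔ X ∈ F := by
  refine ⟨fun h => ?_, fun h => Submodule.subset_span ⟨X, h, rfl⟩⟩
  obtain ⟨p, hp⟩ := hF
  have hp : p ∈ F := hp
  -- linear extension of `X ↦ X - p`
  let T : (Option (Fin d × Fin d) → A) →ₗ[A] Matrix (Fin d) (Fin d) A :=
    { toFun := fun z => Matrix.of fun i j => z (some (i, j)) - z none * p i j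
      map_add' := fun z w => Matrix.ext fun i j => by
        simp only [Matrix.of_apply, Matrix.add_apply, Pi.add_apply]
        ring
      map_smul' := fun c z => Matrix.ext fun i j => by
        simp only [Matrix.of_apply, Matrix.smul_apply, Pi.smul_apply, smul_eq_mul,
          RingHom.id_apply]
        ring }
  have hT : ∀ Y, T (homog Y) = Y - p := fun Y => by ext i j; simp [T, homog]
  have h1 : cone F ≤ F.direction.comap T := by
    refine Submodule.span_le.2 ?_
    rintro _ ⟨Y, hY, rfl⟩
    change T (homog Y) ∈ F.direction
    have hY : Y ∈ F := hY
    rw [hT]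
    exact AffineSubspace.vsub_mem_direction hY hp
  have h2 : T (homog X) ∈ F.direction := h1 h
  rw [hT] at h2
  have h3 := AffineSubspace.vadd_mem_of_mem_direction h2 hp
  rwa [vadd_eq_add, sub_add_cancel] at h3

theorem cone_baseChange {A B : TestAlg} (f : A ⟶ B)
    (F : AffineSubspace A (Matrix (Fin d) (Fin d) A)) :
    cone (baseChange f F) = mapSub f (cone F) := by
  have e : (fun (x : Option (Fin d × Fin d) → A) i => f.hom (x i)) ''
      (homog '' (F : Set (Matrix (Fin d) (Fin d) A))) = homog ''
        ((fun X : Matrix (Fin d) (Fin d) A => X.map f.hom) ''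
          (F : Set (Matrix (Fin d) (Fin d) A))) := by
    rw [Set.image_image, Set.image_image]
    congr 1
    funext X o
    rcases o with _ | ij
    · exact map_one f.hom
    · rfl
  rw [cone.eq_def F, mapSub_span, e]
  refine le_antisymm (Submodule.span_le.2 ?_)
    (Submodule.span_mono (Set.image_mono (subset_affineSpan B _)))
  rintro _ ⟨X, hX, rfl⟩
  refine affineSpan_induction (p := fun X => homog X ∈ Submodule.span B (homog ''
    ((fun X : Matrix (Fin d) (Fin d) A => X.map f.hom) '' (F : Set (Matrix (Fin d) (Fin d) A))))) hX
    (fun X h => Submodule.subset_span ⟨X, h, rfl⟩) fun c X Y Z hX hY hZ => ?_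
  rw [homog_affine]
  exact Submodule.add_mem _ (Submodule.smul_mem _ _ (Submodule.sub_mem _ hX hY)) hZ

theorem baseChange_nonempty {A B : TestAlg} (f : A ⟶ B)
    {F : AffineSubspace A (Matrix (Fin d) (Fin d) A)}
    (hF : (F : Set (Matrix (Fin d) (Fin d) A)).Nonempty) :
    (baseChange f F : Set (Matrix (Fin d) (Fin d) B)).Nonempty :=
  (affineSpan_nonempty B).2 (hF.image _)

/-- The nonempty affine subspaces of the space of matrices. -/
abbrev NonemptyFlat (d : ℕ) (A : Type) [CommRing A] : Type :=
  {F : AffineSubspace A (Matrix (Fin d) (Fin d) A) //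
    (F : Set (Matrix (Fin d) (Fin d) A)).Nonempty}

/-- The presheaf of nonempty affine subspaces of the space of matrices. -/
def affPresh (d : ℕ) : Presh where
  obj A := NonemptyFlat d A
  map {A B} f := TypeCat.ofHom
    (X := NonemptyFlat d A)
    (Y := NonemptyFlat d B)
    fun F => ⟨baseChange f F.1, baseChange_nonempty f F.2⟩
  map_id A := ConcreteCategory.hom_ext _ _
    fun F : NonemptyFlat d A =>
      Subtype.ext (baseChange_id F.1)
  map_comp {A _ _} f g := ConcreteCategory.hom_ext _ _
    fun F : NonemptyFlat d A =>
      Subtype.ext (baseChange_comp f g F.1)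

/-- A submodule whose image under the first projection is everything, locally, has an element
with first coordinate `1`. -/
theorem exists_mem_none_eq_one {A : TestAlg} {L : Submodule A (Option (Fin d × Fin d) → A)}
    (H : Cov A fun _ f => ∃ z ∈ mapSub f L, z none = 1) : ∃ z ∈ L, z none = 1 := by
  let I : Submodule A (Unit → A) := L.map (LinearMap.funLeft A A fun _ : Unit => none)
  have htop : ∀ {B : TestAlg} {J : Submodule B (Unit → B)}, (fun _ => 1) ∈ J → J = ⊤ := by
    intro B J hJ
    refine top_le_iff.1 fun z _ => ?_
    have h := J.smul_mem (z ()) hJ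
    have e : z () • (fun _ : Unit => (1 : B)) = z := funext fun _ => mul_one _
    rwa [e] at h
  have hI : I = ⊤ := by
    refine (isFppfSheaf_subPresh (ι := Unit)).sep (x := I) (y := (⊤ : Submodule A (Unit → A))) H
      fun B f ⟨z, hz, hz1⟩ => ?_
    change mapSub f I = mapSub f ⊤
    have h1 : mapSub f L ≤ (mapSub f I).comap (LinearMap.funLeft B B fun _ : Unit => none) := by
      refine Submodule.span_le.2 ?_
      rintro _ ⟨x, hx, rfl⟩
      exact Submodule.subset_span ⟨fun _ => x none, ⟨x, hx, rfl⟩, rfl⟩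
    have h2 : (fun _ : Unit => z none) ∈ mapSub f I := h1 hz
    rw [hz1] at h2
    rw [htop h2, htop (J := mapSub f ⊤)]
    exact Submodule.subset_span ⟨fun _ => 1, trivial, funext fun _ => map_one f.hom⟩
  obtain ⟨z, hz, e⟩ : (fun _ : Unit => (1 : A)) ∈ I := hI ▸ trivial
  exact ⟨z, hz, congrFun e ()⟩

/-- The affine subspace cut out of a linear cone. -/
def slice {A : Type} [CommRing A] (L : Submodule A (Option (Fin d × Fin d) → A)) :
    AffineSubspace A (Matrix (Fin d) (Fin d) A) where
  carrier := {X | homog X ∈ L}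
  smul_vsub_vadd_mem' c X Y Z hX hY hZ := by
    change homog _ ∈ L
    rw [homog_affine]
    exact L.add_mem (L.smul_mem _ (L.sub_mem hX hY)) hZ

theorem homog_of {A : Type} [CommRing A] {z : Option (Fin d × Fin d) → A} (hz : z none = 1) :
    homog (Matrix.of fun i j => z (some (i, j))) = z := by
  funext o
  rcases o with _ | ij
  · exact hz.symm
  · rfl

theorem cone_slice {A : Type} [CommRing A] {L : Submodule A (Option (Fin d × Fin d) → A)}
    {z : Option (Fin d × Fin d) → A} (hz : z ∈ L) (hz1 : z none = 1) : cone (slice L) = L := by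
  have key : ∀ w ∈ L, w none = 1 → w ∈ cone (slice L) := fun w hw hw1 =>
    Submodule.subset_span ⟨_, show homog _ ∈ L from (homog_of hw1).symm ▸ hw, homog_of hw1⟩
  refine le_antisymm (Submodule.span_le.2 ?_) fun w hw => ?_
  · rintro _ ⟨X, hX, rfl⟩
    exact hX
  · have e : w = (w none - 1) • z + (w - (w none - 1) • z) := by abel
    rw [e]
    refine Submodule.add_mem _ (Submodule.smul_mem _ _ (key z hz hz1))
      (key _ (L.sub_mem hw (L.smul_mem _ hz)) ?_)
    simp [hz1]

/-- Nonempty affine subspaces form a sheaf, because submodules do: an affine subspace is the slice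
of its cone by the hyperplane where the additional coordinate is `1`. -/
theorem isFppfSheaf_affPresh : IsFppfSheaf (affPresh d) := by
  refine isFppfSheaf_of_injective (isFppfSheaf_subPresh (ι := Option (Fin d × Fin d)))
    { app := fun A => TypeCat.ofHom
        (X := NonemptyFlat d A)
        (Y := Submodule A (Option (Fin d × Fin d) → A)) fun F => cone F.1
      naturality := fun A B f => ConcreteCategory.hom_ext _ _
        fun F : NonemptyFlat d A =>
          cone_baseChange f F.1 } ?_ ?_
  · intro A F F' e
    refine Subtype.ext (SetLike.ext fun X => ?_)
    have e : cone F.1 = cone F'.1 := e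
    rw [← homog_mem_cone_iff F.2, ← homog_mem_cone_iff F'.2, e]
  · intro A L H
    obtain ⟨z, hz, hz1⟩ := exists_mem_none_eq_one (L := L) (H.mono fun B f ⟨F, hF⟩ => by
      have hF : cone F.1 = mapSub f L := hF
      obtain ⟨X, hX⟩ := F.2
      exact ⟨homog X, hF ▸ (homog_mem_cone_iff F.2).2 hX, rfl⟩)
    exact ⟨⟨slice L, _, show homog _ ∈ _ from (homog_of hz1).symm ▸ hz⟩, cone_slice hz hz1⟩

theorem aff_ext_of_cov {A : TestAlg} {F F' : AffineSubspace A (Matrix (Fin d) (Fin d) A)}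
    (hF : (F : Set (Matrix (Fin d) (Fin d) A)).Nonempty)
    (hF' : (F' : Set (Matrix (Fin d) (Fin d) A)).Nonempty)
    (H : Cov A fun _ f => baseChange f F = baseChange f F') : F = F' :=
  congrArg Subtype.val (isFppfSheaf_affPresh.sep (x := ⟨F, hF⟩) (y := ⟨F', hF'⟩) H
    fun _ _ h => Subtype.ext h)

variable {G : LinearAlgebraicGroup d} {lam : Matrix (Fin d) (Fin d) ℂ}

theorem flatAt_nonempty (A : TestAlg) :
    (flatAt G lam A : Set (Matrix (Fin d) (Fin d) A)).Nonempty :=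
  ⟨_, AffineSubspace.self_mem_mk' _ _⟩

theorem adFlat_nonempty {A : TestAlg} (g : GL (Fin d) A)
    {F : AffineSubspace A (Matrix (Fin d) (Fin d) A)}
    (hF : (F : Set (Matrix (Fin d) (Fin d) A)).Nonempty) :
    (adFlat g F : Set (Matrix (Fin d) (Fin d) A)).Nonempty :=
  hF.image _

/-- Membership in the parabolic is local, because it is the stabilizer of a flat. -/
theorem isFppfSheaf_comap_parabolic (hlam : lam ∈ lieAlg G) (ι : cent G lam ⟶ cent G lam) :
    IsFppfSheaf (setOf ((parabolic G lam).comap ι).toGrp) :=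
  isFppfSheaf_toGrp (isFppfSheaf_cent G lam) _ fun {A} g H => by
    change ι.app A g ∈ (parabolic G lam).carrier A
    rw [mem_parabolic_iff hlam]
    refine aff_ext_of_cov (adFlat_nonempty _ (flatAt_nonempty A)) (flatAt_nonempty A)
      (H.mono fun B f h => ?_)
    have h : ι.app B ((cent G lam).map f g) ∈ (parabolic G lam).carrier B := h
    rw [mem_parabolic_iff hlam, nat_grp] at h
    rw [baseChange_adFlat, baseChange_flatAt]
    exact h

/-- Locally a canonical flat `F` is `Ad(g) F(λ)`, and `e(F) = g α g⁻¹`. -/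
theorem IsFlatWithExp.cov {A : TestAlg} {F : AffineSubspace A (Matrix (Fin d) (Fin d) A)}
    {c : GL (Fin d) A} (H : IsFlatWithExp G lam A F c) :
    Cov A fun B f => ∃ g : G.grp.obj B, baseChange f F = adFlat (G.mat g) (flatAt G lam B) ∧
      glMap f c = G.mat g * alphaAt lam B * (G.mat g)⁻¹ :=
  FppfLocally.cov H fun B C f h ⟨g, hF, hc⟩ => ⟨G.grp.map h g, by
    rw [baseChange_comp, hF, baseChange_adFlat, baseChange_flatAt, mat_map], by
    rw [glMap_comp, hc, map_mul, map_mul, map_inv, alphaAt_map, mat_map]⟩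

theorem IsFlatWithExp.nonempty {A : TestAlg} {F : AffineSubspace A (Matrix (Fin d) (Fin d) A)}
    {c : GL (Fin d) A} (H : IsFlatWithExp G lam A F c) :
    (F : Set (Matrix (Fin d) (Fin d) A)).Nonempty := by
  obtain ⟨B, f, -, g, hF, -⟩ := H
  have h : (baseChange f F : Set (Matrix (Fin d) (Fin d) B)).Nonempty :=
    hF ▸ adFlat_nonempty _ (flatAt_nonempty B)
  exact ((affineSpan_nonempty B).1 h).of_image

theorem exists_grp_prod {A B : TestAlg} (g : G.grp.obj A) (h : G.grp.obj B) :
    ∃ k : G.grp.obj (CommAlgCat.of ℂ (A × B)),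
      G.grp.map (CommAlgCat.ofHom (AlgHom.fst ℂ A B)) k = g ∧
        G.grp.map (CommAlgCat.ofHom (AlgHom.snd ℂ A B)) k = h := by
  obtain ⟨k, hk, -⟩ := (isFppfSheaf_grp G).prod A B g h
  exact ⟨k, hk⟩

/-- Being a canonical flat is a local property. -/
theorem isFlatWithExp_of_cov {A : TestAlg} {F : AffineSubspace A (Matrix (Fin d) (Fin d) A)}
    (hF : (F : Set (Matrix (Fin d) (Fin d) A)).Nonempty) {c : GL (Fin d) A}
    (H : Cov A fun B f => IsFlatWithExp G lam B (baseChange f F) (glMap f c)) :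
    IsFlatWithExp G lam A F c := by
  have H' : Cov A fun B f => ∃ g : G.grp.obj B,
      baseChange f F = adFlat (G.mat g) (flatAt G lam B) ∧
        glMap f c = G.mat g * alphaAt lam B * (G.mat g)⁻¹ :=
    H.trans fun B f h => h.cov.mono fun C k ⟨g, h1, h2⟩ => ⟨g, by rw [baseChange_comp, h1],
      by rw [glMap_comp, h2]⟩
  -- over the zero algebra there is nothing to prove, and over a product of two algebras the
  -- conjugating elements are put together
  refine H'.fppfLocally (fun B f hB => ⟨1, ?_, ?_⟩) fun B₁ B₂ f₁ f₂ => ?_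
  · exact aff_ext_of_cov (baseChange_nonempty f hF) (adFlat_nonempty _ (flatAt_nonempty B))
      (.zero hB)
  · exact gl_ext_of_cov (W := fun _ _ => False) (.zero hB) fun _ _ h => h.elim
  · rintro ⟨g₁, hF₁, hc₁⟩ ⟨g₂, hF₂, hc₂⟩
    obtain ⟨g, e₁, e₂⟩ := exists_grp_prod g₁ g₂
    let f : A ⟶ CommAlgCat.of ℂ (B₁ × B₂) := CommAlgCat.ofHom (f₁.hom.prod f₂.hom)
    have hf₁ : f ≫ CommAlgCat.ofHom (AlgHom.fst ℂ B₁ B₂) = f₁ := rfl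
    have hf₂ : f ≫ CommAlgCat.ofHom (AlgHom.snd ℂ B₁ B₂) = f₂ := rfl
    have split : ∀ {W : ∀ C : TestAlg, (CommAlgCat.of ℂ (B₁ × B₂) ⟶ C) → Prop},
        (∀ C l, W C (CommAlgCat.ofHom (AlgHom.fst ℂ B₁ B₂) ≫ l)) →
        (∀ C l, W C (CommAlgCat.ofHom (AlgHom.snd ℂ B₁ B₂) ≫ l)) → Cov _ W := fun h₁ h₂ =>
      .split (CommAlgCat.ofHom (AlgHom.fst ℂ B₁ B₂)) (CommAlgCat.ofHom (AlgHom.snd ℂ B₁ B₂))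
        Function.bijective_id (.base h₁) (.base h₂)
    refine ⟨g, ?_, ?_⟩
    · refine aff_ext_of_cov (baseChange_nonempty f hF) (adFlat_nonempty _ (flatAt_nonempty _))
        (split (fun C l => ?_) fun C l => ?_)
      · rw [baseChange_comp, ← baseChange_comp f, hf₁, hF₁, baseChange_comp _ l,
          baseChange_adFlat _ (G.mat g), baseChange_flatAt, ← mat_map, e₁]
        rfl
      · rw [baseChange_comp, ← baseChange_comp f, hf₂, hF₂, baseChange_comp _ l,
          baseChange_adFlat _ (G.mat g), baseChange_flatAt, ← mat_map, e₂]
        rfl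
    · refine gl_ext_of_cov (W := fun C l => (∃ l', l = CommAlgCat.ofHom (AlgHom.fst ℂ B₁ B₂) ≫ l') ∨
        ∃ l', l = CommAlgCat.ofHom (AlgHom.snd ℂ B₁ B₂) ≫ l')
        (split (fun C l => Or.inl ⟨l, rfl⟩) fun C l => Or.inr ⟨l, rfl⟩) ?_
      rintro C _ (⟨l, rfl⟩ | ⟨l, rfl⟩)
      · have e : glMap (CommAlgCat.ofHom (AlgHom.fst ℂ B₁ B₂))
            (G.mat g * alphaAt lam _ * (G.mat g)⁻¹) =
              G.mat g₁ * alphaAt lam B₁ * (G.mat g₁)⁻¹ := by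
          rw [map_mul, map_mul, map_inv, alphaAt_map, ← mat_map, e₁]
          rfl
        rw [glMap_comp, ← glMap_comp f, hf₁, hc₁, glMap_comp _ l, e]
      · have e : glMap (CommAlgCat.ofHom (AlgHom.snd ℂ B₁ B₂))
            (G.mat g * alphaAt lam _ * (G.mat g)⁻¹) =
              G.mat g₂ * alphaAt lam B₂ * (G.mat g₂)⁻¹ := by
          rw [map_mul, map_mul, map_inv, alphaAt_map, ← mat_map, e₂]
          rfl
        rw [glMap_comp, ← glMap_comp f, hf₂, hc₂, glMap_comp _ l, e]

theorem gal2_eq {c c' : Gal2} (h : c ≠ 1) (h' : c' ≠ 1) : c = c' := by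
  revert c c'
  decide

/-- Geometric parameters form a sheaf: the condition `y² = e(F)` is local. -/
theorem isFppfSheaf_paramPresh {η : G.grp ⟶ G.grp} (hη : η ≫ η = 𝟙 _) :
    IsFppfSheaf (paramPresh G hη lam) := by
  refine isFppfSheaf_of_injective (isFppfSheaf_prodPresh (isFppfSheaf_grp G) isFppfSheaf_affPresh)
    { app := fun A => TypeCat.ofHom (X := ParamSet G hη lam A)
        (Y := G.grp.obj A ×
          NonemptyFlat d A)
        fun x => (x.1.1.left, ⟨x.1.2, IsFlatWithExp.nonempty x.2.2⟩)
      naturality := fun _ _ _ => rfl } ?_ ?_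
  · intro A x y e
    exact Subtype.ext (Prod.ext (SemidirectProduct.ext (congrArg Prod.fst e)
      (gal2_eq x.2.1 y.2.1)) (congrArg (fun p => p.2.1) e))
  · intro A p H
    have key : ∀ (s : G.grp.obj A) (F : AffineSubspace A (Matrix (Fin d) (Fin d) A)),
        (F : Set (Matrix (Fin d) (Fin d) A)).Nonempty →
        (Cov A fun B f => ∃ y : ParamSet G hη lam B,
          y.1.1.left = G.grp.map f s ∧ y.1.2 = baseChange f F) →
        ∃ y : ParamSet G hη lam A, y.1.1.left = s ∧ y.1.2 = F := by
      intro s F hF H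
      have h1 : (Multiplicative.ofAdd 1 : Gal2) ≠ 1 := by decide
      have h2 : IsFlatWithExp G lam A F (G.mat (s * η.app A s)) := by
        refine isFlatWithExp_of_cov hF (H.mono fun B f ⟨y, hy1, hy2⟩ => ?_)
        have h3 := y.2.2
        rw [left_sq G hη _ y.2.1, hy1, hy2, nat_grp, ← map_mul, mat_map] at h3
        exact h3
      refine ⟨⟨(⟨s, Multiplicative.ofAdd 1⟩, F), h1, ?_⟩, rfl, rfl⟩
      rw [left_sq G hη ⟨s, Multiplicative.ofAdd 1⟩ h1]
      exact h2
    obtain ⟨y, hy1, hy2⟩ := key p.1 p.2.1 p.2.2 (H.mono fun B f ⟨y, hy⟩ =>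
      ⟨y, congrArg Prod.fst hy, congrArg (fun p => p.2.1) hy⟩)
    exact ⟨y, Prod.ext hy1 (Subtype.ext hy2)⟩

end AffineSubspaces

/-! ### Charts of the stack of geometric parameters -/

section ParameterCharts

variable {d : ℕ} {G : LinearAlgebraicGroup d} {η : G.grp ⟶ G.grp} (hη : η ≫ η = 𝟙 G.grp)
  {lam : Matrix (Fin d) (Fin d) ℂ}

theorem centIncl_injective {A : TestAlg} :
    Function.Injective (centIncl G lam : (cent G lam).obj A →* G.grp.obj A) :=
  Subtype.val_injective

theorem centIncl_map {A B : TestAlg} (f : A ⟶ B) (k : (cent G lam).obj A) :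
    centIncl G lam ((cent G lam).map f k) = G.grp.map f (centIncl G lam k) := rfl

theorem isFlatWithExp_flatAt (A : TestAlg) :
    IsFlatWithExp G lam A (flatAt G lam A) (alphaAt lam A) :=
  ⟨A, 𝟙 A, IsFppf.of_bijective Function.bijective_id, 1, by
    rw [baseChange_flatAt, map_one, adFlat_one], by
    rw [alphaAt_map, map_one, one_mul, inv_one, mul_one]⟩

theorem ofAdd_one_ne_one : (Multiplicative.ofAdd 1 : Gal2) ≠ 1 := by
  decide

/-- The geometric parameter `(sγ, F(λ))` attached to a point `s` with `s η(s) = α`. -/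
def stdParam {A : TestAlg} (s : G.grp.obj A) (hs : G.mat (s * η.app A s) = alphaAt lam A) :
    ParamSet G hη lam A :=
  ⟨(⟨s, Multiplicative.ofAdd 1⟩, flatAt G lam A), ofAdd_one_ne_one, by
    rw [left_sq G hη ⟨s, Multiplicative.ofAdd 1⟩ ofAdd_one_ne_one]
    exact hs ▸ isFlatWithExp_flatAt A⟩

theorem stdParam_congr {A : TestAlg} {s s' : G.grp.obj A} (e : s = s')
    (hs : G.mat (s * η.app A s) = alphaAt lam A) (hs' : G.mat (s' * η.app A s') = alphaAt lam A) :
    stdParam hη s hs = stdParam hη s' hs' := by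
  subst e
  rfl

theorem stdParam_cond_map {A B : TestAlg} (f : A ⟶ B) {s : G.grp.obj A}
    (hs : G.mat (s * η.app A s) = alphaAt lam A) :
    G.mat (G.grp.map f s * η.app B (G.grp.map f s)) = alphaAt lam B := by
  rw [nat_grp, ← map_mul, mat_map, hs, alphaAt_map]

theorem stdParam_map {A B : TestAlg} (f : A ⟶ B) (s : G.grp.obj A)
    (hs : G.mat (s * η.app A s) = alphaAt lam A) :
    (paramPresh G hη lam).map f (stdParam hη s hs) =
      stdParam hη (G.grp.map f s) (stdParam_cond_map f hs) :=
  Subtype.ext (Prod.ext rfl (baseChange_flatAt G lam f))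

/-- Twisted conjugation `g • s = g s η(g)⁻¹`. -/
def twistConj (η : G.grp ⟶ G.grp) {A : TestAlg} (g s : G.grp.obj A) : G.grp.obj A :=
  g * s * (η.app A g)⁻¹

theorem twistConj_mul {A : TestAlg} (g h s : G.grp.obj A) :
    twistConj η (g * h) s = twistConj η g (twistConj η h s) := by
  simp only [twistConj, map_mul, mul_inv_rev, mul_assoc]

theorem twistConj_one {A : TestAlg} (s : G.grp.obj A) : twistConj η 1 s = s := by
  simp [twistConj]

theorem twistConj_map {A B : TestAlg} (f : A ⟶ B) (g s : G.grp.obj A) :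
    G.grp.map f (twistConj η g s) = twistConj η (G.grp.map f g) (G.grp.map f s) := by
  simp only [twistConj]
  rw [map_mul, map_mul, map_inv, nat_grp]

theorem twistConj_inv_eq_iff {A : TestAlg} {g s s' : G.grp.obj A} :
    twistConj η g⁻¹ s = s' ↔ s = twistConj η g s' := by
  constructor
  · rintro rfl
    rw [← twistConj_mul, mul_inv_cancel, twistConj_one]
  · rintro rfl
    rw [← twistConj_mul, inv_mul_cancel, twistConj_one]

theorem twistConj_sq (hη : η ≫ η = 𝟙 G.grp) {A : TestAlg} (g s : G.grp.obj A) :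
    twistConj η g s * η.app A (twistConj η g s) = g * (s * η.app A s) * g⁻¹ := by
  simp only [twistConj]
  rw [map_mul, map_mul, map_inv, invol_grp hη]
  group

variable {hη} in
/-- A point of `G` carrying one standard parameter to another lies in the parabolic: it
stabilizes the flat `F(λ)`, and commutes with `α`, the square of both parameters. -/
theorem act_stdParam_eq_iff (hlam : lam ∈ lieAlg G) {A : TestAlg} {g s s' : G.grp.obj A}
    (hs : G.mat (s * η.app A s) = alphaAt lam A)
    (hs' : G.mat (s' * η.app A s') = alphaAt lam A) :
    (paramAction G hη lam).act g (stdParam hη s hs) = stdParam hη s' hs' ↔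
      twistConj η g s = s' ∧ ∃ p ∈ (parabolic G lam).carrier A, centIncl G lam p = g := by
  have hl : (lConj G hη g (stdParam hη s hs).1.1).left = twistConj η g s :=
    lConj_left G hη g _ (stdParam hη s hs).2.1
  constructor
  · intro h
    have h : (lConj G hη g (stdParam hη s hs).1.1, adFlat (G.mat g) (flatAt G lam A)) =
      (stdParam hη s' hs').1 := congrArg Subtype.val h
    have h1 : twistConj η g s = s' := hl ▸ congrArg (fun x => x.1.left) h
    have h2 : adFlat (G.mat g) (flatAt G lam A) = flatAt G lam A := congrArg Prod.snd h
    have h3 : g ∈ (centralizer G lam).carrier A := by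
      refine Subgroup.mem_centralizer_singleton_iff.2 ?_
      have h4 := hs'
      rw [← h1, twistConj_sq hη, map_mul, map_mul, hs, map_inv, mul_inv_eq_iff_eq_mul] at h4
      exact h4
    exact ⟨h1, ⟨g, h3⟩, (mem_parabolic_iff hlam (⟨g, h3⟩ : (cent G lam).obj A)).2 h2, rfl⟩
  · rintro ⟨h1, p, hp, rfl⟩
    refine Subtype.ext (Prod.ext (SemidirectProduct.ext (hl.trans h1) ?_)
      ((mem_parabolic_iff hlam p).1 hp))
    exact lConj_right G hη _ _

/-- Locally every geometric parameter is conjugate to one with flat `F(λ)`. -/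
theorem cov_stdParam {A : TestAlg} (x : ParamSet G hη lam A) :
    Cov A fun B f => ∃ (g s : G.grp.obj B) (hs : G.mat (s * η.app B s) = alphaAt lam B),
      (paramPresh G hη lam).map f x = (paramAction G hη lam).act g (stdParam hη s hs) := by
  refine x.2.2.cov.mono fun B f ⟨g, hF, hc⟩ => ?_
  let t : G.grp.obj B := G.grp.map f x.1.1.left
  have hs : G.mat (twistConj η g⁻¹ t * η.app B (twistConj η g⁻¹ t)) = alphaAt lam B := by
    rw [left_sq G hη _ x.2.1, ← mat_map, map_mul, ← nat_grp] at hc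
    change G.mat (t * η.app B t) = _ at hc
    rw [twistConj_sq hη, inv_inv, map_mul, map_mul, hc, map_inv]
    group
  refine ⟨g, _, hs, Subtype.ext (Prod.ext (SemidirectProduct.ext ?_ ?_) hF)⟩
  · refine Eq.trans ?_ (lConj_left G hη g _ (stdParam hη _ hs).2.1).symm
    exact twistConj_inv_eq_iff.1 rfl
  · exact (gal2_eq x.2.1 (stdParam hη _ hs).2.1).trans
      (lConj_right G hη g (stdParam hη _ hs).1.1).symm

section Sigma

variable {σ : TwistedPts G η lam} {A : TestAlg}

theorem mem_symmetricSubgroup_iff (k : (cent G lam).obj A) :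
    k ∈ (symmetricSubgroup G η lam σ).carrier A ↔
      twistConj η (centIncl G lam k) (G.grp.map (str A) σ.1) = G.grp.map (str A) σ.1 := by
  change G.grp.map (str A) σ.1 * η.app A (centIncl G lam k) * (G.grp.map (str A) σ.1)⁻¹ =
    centIncl G lam k ↔ _ * _ * _ = _
  rw [mul_inv_eq_iff_eq_mul, mul_inv_eq_iff_eq_mul, eq_comm]

/-- The point `h⁻¹ σ η(h)` attached to a point `h` of `G(α)`. -/
def sigmaPt (σ : TwistedPts G η lam) (h : (cent G lam).obj A) : G.grp.obj A :=
  twistConj η (centIncl G lam h)⁻¹ (G.grp.map (str A) σ.1)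

theorem mat_sigmaPt (hη : η ≫ η = 𝟙 G.grp) (σ : TwistedPts G η lam) (h : (cent G lam).obj A) :
    G.mat (sigmaPt σ h * η.app A (sigmaPt σ h)) = alphaAt lam A := by
  have hh : G.mat (centIncl G lam h) * alphaAt lam A = alphaAt lam A * G.mat (centIncl G lam h) :=
    Subgroup.mem_centralizer_singleton_iff.1 h.2
  rw [sigmaPt, twistConj_sq hη, inv_inv, map_mul, map_mul, mat_twisted, map_inv, mul_assoc, ← hh,
    inv_mul_cancel_left]

theorem sigmaPt_map {B : TestAlg} (f : A ⟶ B) (h : (cent G lam).obj A) :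
    sigmaPt σ ((cent G lam).map f h) = G.grp.map f (sigmaPt σ h) := by
  simp only [sigmaPt]
  rw [twistConj_map, map_inv, map_str, centIncl_map]

theorem sigmaPt_mul (h g : (cent G lam).obj A) :
    sigmaPt σ (h * g) = twistConj η (centIncl G lam g)⁻¹ (sigmaPt σ h) := by
  simp only [sigmaPt]
  rw [map_mul, mul_inv_rev, twistConj_mul]

/-- Points of `G(α)` give the same point exactly if they differ by the symmetric subgroup. -/
theorem sigmaPt_eq_iff (h h' : (cent G lam).obj A) :
    sigmaPt σ h = sigmaPt σ h' ↔ h' * h⁻¹ ∈ (symmetricSubgroup G η lam σ).carrier A := by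
  rw [mem_symmetricSubgroup_iff, sigmaPt, sigmaPt, eq_comm, twistConj_inv_eq_iff,
    ← twistConj_mul, map_mul, map_inv, eq_comm]

/-- A point `p` carries the parameter of `h` to that of `h'` exactly if `h'` lies in the coset
`K_σ(α) h p⁻¹`. -/
theorem act_sigmaPt_iff (p h h' : (cent G lam).obj A) :
    twistConj η (centIncl G lam p) (sigmaPt σ h) = sigmaPt σ h' ↔
      h' * p * h⁻¹ ∈ (symmetricSubgroup G η lam σ).carrier A := by
  rw [eq_comm, ← twistConj_inv_eq_iff, ← sigmaPt_mul, eq_comm, sigmaPt_eq_iff]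

theorem existsUnique_doubleCoset (hlam : lam ∈ lieAlg G) (σ : TwistedPts G η lam)
    {g : G.grp.obj A} {h h' : (cent G lam).obj A}
    (e : (paramAction G hη lam).act g (stdParam hη _ (mat_sigmaPt hη σ h)) =
      stdParam hη _ (mat_sigmaPt hη σ h')) :
    ∃! q : (symmetricSubgroup G η lam σ).carrier A × (parabolic G lam).carrier A,
      centIncl G lam q.2.1 = g ∧ q.1.1 * h * (q.2.1)⁻¹ = h' := by
  obtain ⟨e, p, hp, rfl⟩ := (act_stdParam_eq_iff hlam _ _).1 e
  refine ⟨(⟨h' * p * h⁻¹, (act_sigmaPt_iff p h h').1 e⟩, ⟨p, hp⟩), ⟨rfl, by group⟩, ?_⟩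
  rintro ⟨⟨k, hk⟩, p', hp'⟩ ⟨h1, h2⟩
  have h1 : p' = p := centIncl_injective h1
  subst h1
  refine Prod.ext (Subtype.ext ?_) rfl
  change k = h' * p' * h⁻¹
  rw [← h2]
  group

/-- Parameters attached to different classes in `Σ(η, α)` are not conjugate over any nonzero
algebra. -/
theorem rel_of_act_stdParam (hlam : lam ∈ lieAlg G) (hA : Nontrivial A)
    {σ' : TwistedPts G η lam} {g : G.grp.obj A} {h h' : (cent G lam).obj A}
    (e : (paramAction G hη lam).act g (stdParam hη _ (mat_sigmaPt hη σ h)) =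
      stdParam hη _ (mat_sigmaPt hη σ' h')) : (twistedSetoid G η lam).r σ σ' := by
  obtain ⟨e, p, hp, rfl⟩ := (act_stdParam_eq_iff hlam _ _).1 e
  refine twisted_conj_of_nontrivial hA (h' * p * h⁻¹) ?_
  have e' := twistConj_inv_eq_iff.1 e.symm
  change _ = twistConj η _ _
  rw [e', sigmaPt, map_mul, map_mul, map_inv, twistConj_mul, twistConj_mul]

theorem exists_conj_rep {rep : SigmaSet G η lam → TwistedPts G η lam}
    (hrep : ∀ c, Quotient.mk (twistedSetoid G η lam) (rep c) = c) (σ : TwistedPts G η lam) :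
    ∃ (c : SigmaSet G η lam) (h : (cent G lam).obj CC),
      σ.1 = twistConj η (centIncl G lam h) (rep c).1 :=
  ⟨Quotient.mk _ σ, Quotient.exact (hrep (Quotient.mk _ σ))⟩

/-- Locally every solution of `s η(s) = α` is `h⁻¹ σ η(h)` for a representative `σ`. -/
theorem cov_sigmaPt (hη : η ≫ η = 𝟙 _) {rep : SigmaSet G η lam → TwistedPts G η lam}
    (hrep : ∀ c, Quotient.mk (twistedSetoid G η lam) (rep c) = c) {s : G.grp.obj A}
    (hs : G.mat (s * η.app A s) = alphaAt lam A) :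
    Cov A fun B f => ∃ (c : SigmaSet G η lam) (h : (cent G lam).obj B),
      G.grp.map f s = sigmaPt (rep c) h := by
  refine (cov_twisted_conj hη hs).mono fun B f ⟨σ, k, hk⟩ => ?_
  have hk : G.grp.map f s = twistConj η (centIncl G lam k) (G.grp.map (str B) σ.1) := hk
  obtain ⟨c, h, hh⟩ := exists_conj_rep hrep σ
  refine ⟨c, (k * (cent G lam).map (str B) h)⁻¹, ?_⟩
  rw [sigmaPt, map_inv, inv_inv, hk, hh, twistConj_map, map_mul, twistConj_mul, centIncl_map]

/-- The solutions of `t ι_σ(t) = 1` are the solutions of `s η(s) = α`, shifted by `σ`. -/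
theorem mul_twistedInvolution_eq_one_iff (t : (cent G lam).obj A) :
    t * (twistedInvolution G hη lam σ).app A t = 1 ↔
      G.mat (centIncl G lam t * G.grp.map (str A) σ.1 *
        η.app A (centIncl G lam t * G.grp.map (str A) σ.1)) = alphaAt lam A := by
  have h1 : centIncl G lam (t * (twistedInvolution G hη lam σ).app A t) =
      centIncl G lam t * (G.grp.map (str A) σ.1 * η.app A (centIncl G lam t) *
        (G.grp.map (str A) σ.1)⁻¹) := rfl
  have key : ∀ t s t' s' : G.grp.obj A,
      t * (s * t' * s⁻¹) = 1 ↔ t * s * (t' * s') = s * s' := fun t s t' s' => by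
    rw [← mul_left_inj (s * s'), one_mul]
    have h : t * (s * t' * s⁻¹) * (s * s') = t * s * (t' * s') := by group
    rw [h]
  rw [← centIncl_injective.eq_iff, map_one, h1, key _ _ _ (η.app A (G.grp.map (str A) σ.1)),
    ← map_mul, ← (mat_injective G A).eq_iff, mat_twisted]

end Sigma

variable {hη} in
/-- Charts of the stack of geometric parameters by double cosets: for a representative `σ` of a
class in `Σ(η, α)`, a point `h` of `G(α)` gives the parameter `(h⁻¹ σ η(h) γ, F(λ))`. -/
def sigmaCharts (hlam : lam ∈ lieAlg G) {rep : SigmaSet G η lam → TwistedPts G η lam}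
    (hrep : ∀ c, Quotient.mk (twistedSetoid G η lam) (rep c) = c) :
    Charts (paramAction G hη lam) (SigmaSet G η lam) where
  Q c := prodGrp (symmetricSubgroup G η lam (rep c)).toGrp (parabolic G lam).toGrp
  Y _ := setOf (cent G lam)
  b c := doubleCoset (symmetricSubgroup G η lam (rep c)) (parabolic G lam)
  ρ c {A} := (centIncl G lam).comp
    (((parabolic G lam).carrier A).subtype.comp (MonoidHom.snd _ _))
  ρ_map _ _ _ _ _ := rfl
  φ c {A} (h : (cent G lam).obj A) := stdParam hη _ (mat_sigmaPt hη (rep c) h)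
  φ_map c {A B} f h := (stdParam_congr hη (sigmaPt_map f h) _
    (stdParam_cond_map f (mat_sigmaPt hη (rep c) h))).trans (stdParam_map hη f _ _).symm
  φ_act c {A} q h := ((act_stdParam_eq_iff hlam _ _).2
    ⟨(show ∀ k ∈ (symmetricSubgroup G η lam (rep c)).carrier A, ∀ h p : (cent G lam).obj A,
        twistConj η (centIncl G lam p) (sigmaPt (rep c) h) = sigmaPt (rep c) (k * h * p⁻¹) from
      fun k hk h p => by
        rw [act_sigmaPt_iff, inv_mul_cancel_right, mul_inv_cancel_right]
        exact hk) q.1.1 q.1.2 h q.2.1, q.2.1, q.2.2, rfl⟩).symm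
  existsUnique {c A g h h'} e := existsUnique_doubleCoset hη hlam (rep c) e
  disjoint {c c' A g h h'} hc e := by
    by_contra hA
    have hr := rel_of_act_stdParam hη hlam (not_subsingleton_iff_nontrivial.1 hA) e
    exact hc (by rw [← hrep c, ← hrep c']; exact Quotient.sound hr)
  cov {A} x := by
    refine (cov_stdParam hη x).trans fun B f ⟨g, s, hs, e⟩ => ?_
    refine (cov_sigmaPt hη hrep hs).mono fun C f' ⟨c, h, hh⟩ => ⟨c, G.grp.map f' g, h, ?_⟩
    have e1 : (paramPresh G hη lam).map (f ≫ f') x =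
        (paramPresh G hη lam).map f' ((paramPresh G hη lam).map f x) := by simp
    rw [e1, e]
    refine ((paramAction G hη lam).map_act f' g _).trans (congrArg _ ?_)
    exact (stdParam_map hη f' s hs).trans (stdParam_congr hη hh _ _)

variable {hη} in
/-- A single chart of the stack of geometric parameters: a point `t` of `G(α)` with
`t ι_σ(t) = 1` gives the parameter `(t σ γ, F(λ))`. -/
def antiFixedChart (hlam : lam ∈ lieAlg G) (σ : TwistedPts G η lam) :
    Charts (paramAction G hη lam) Unit where
  Q _ := (parabolic G lam).toGrp
  Y _ := antiFixed (twistedInvolution G hη lam σ)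
  b _ := antiAction (twistedInvolution_sq G hη lam σ) (parabolic G lam)
  ρ _ {A} := (centIncl G lam).comp ((parabolic G lam).carrier A).subtype
  ρ_map _ _ _ _ _ := rfl
  φ _ {A} t := stdParam hη _ ((mul_twistedInvolution_eq_one_iff hη t.1).1 t.2)
  φ_map _ {A B} f t := by
    refine (stdParam_congr hη ?_ _ (stdParam_cond_map f
      ((mul_twistedInvolution_eq_one_iff hη t.1).1 t.2))).trans (stdParam_map hη f _ _).symm
    rw [map_mul, map_str]
    rfl
  φ_act _ {A} p t := by
    refine ((act_stdParam_eq_iff hlam _ _).2 ⟨?_, p.1, p.2, rfl⟩).symm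
    have key : ∀ p t s q : G.grp.obj A, p * (t * s) * q⁻¹ = p * t * (s * q * s⁻¹)⁻¹ * s :=
      fun p t s q => by group
    exact key _ _ _ _
  existsUnique {_ A g t t'} e := by
    obtain ⟨e, p, hp, rfl⟩ := (act_stdParam_eq_iff hlam _ _).1 e
    refine ⟨⟨p, hp⟩, ⟨rfl, Subtype.ext (centIncl_injective ?_)⟩,
      fun p' h => Subtype.ext (centIncl_injective h.1)⟩
    have key : ∀ p t s q t' : G.grp.obj A, p * (t * s) * q⁻¹ = t' * s →
        p * t * (s * q * s⁻¹)⁻¹ = t' := fun p t s q t' h => by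
      rw [eq_mul_inv_of_mul_eq h.symm]
      group
    exact key _ _ _ _ _ e
  disjoint h := absurd rfl h
  cov {A} x := by
    refine (cov_stdParam hη x).mono fun B f ⟨g, s, hs, e⟩ => ?_
    -- `s η(s) = σ η(σ) = α` implies `η(s) s = η(σ) σ = η(α)`, so that `s σ⁻¹` commutes with `α`
    have ht : s * (G.grp.map (str B) σ.1)⁻¹ ∈ (centralizer G lam).carrier B := by
      refine Subgroup.mem_centralizer_singleton_iff.2 ?_
      have h1 : s * η.app B s = G.grp.map (str B) σ.1 * η.app B (G.grp.map (str B) σ.1) :=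
        mat_injective G B (by rw [hs, mat_twisted])
      have h2 := congrArg (η.app B) h1
      rw [map_mul, map_mul, invol_grp hη, invol_grp hη] at h2
      rw [← mat_twisted G η lam σ B, ← map_mul, ← map_mul]
      refine congrArg G.mat ?_
      have key : ∀ s s' q q' : G.grp.obj B, s * s' = q * q' → s' * s = q' * q →
          s * q⁻¹ * (q * q') = q * q' * (s * q⁻¹) := fun s s' q q' h h' => by
        have h3 : s * q' = s * s' * s * q⁻¹ := by
          rw [mul_assoc s s' s, h']
          group
        rw [mul_assoc, inv_mul_cancel_left, h3, h, mul_assoc]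
      exact key _ _ _ _ h1 h2
    let t : (cent G lam).obj B := ⟨_, ht⟩
    have e1 : s = centIncl G lam t * G.grp.map (str B) σ.1 := (inv_mul_cancel_right _ _).symm
    exact ⟨(), g, ⟨t, (mul_twistedInvolution_eq_one_iff hη t).2 (e1 ▸ hs)⟩,
      e.trans (congrArg _ (stdParam_congr hη e1 _ _))⟩

end ParameterCharts

end ABV

end

open ABV
theorem mainTheorem4 {d : ℕ} (G : LinearAlgebraicGroup d) (η : G.grp ⟶ G.grp)
    (hη : η ≫ η = 𝟙 G.grp) (lam : Matrix (Fin d) (Fin d) ℂ) (hlam : lam ∈ lieSet G)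
    (hss : Module.End.IsSemisimple (Matrix.toLin' lam)) :
    (∀ rep : SigmaSet G η lam → TwistedPts G η lam,
      (∀ c, Quotient.mk (twistedSetoid G η lam) (rep c) = c) →
      StackEquiv (QuotientStack.π (paramAction G hη lam))
        (Coprod.π fun c : SigmaSet G η lam => QuotientStack.π
          (doubleCoset (symmetricSubgroup G η lam (rep c)) (parabolic G lam)))) ∧
    (∀ (σ : TwistedPts G η lam) (P' : SubgroupPresh (cent G lam))
      (hP' : P' = (parabolic G lam).comap (twistedInvolution G hη lam σ)),
      StackEquiv (QuotientStack.π (paramAction G hη lam))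
        (HomotopyFixed.π (swapAction (twistedInvolution_sq G hη lam σ) hP'))) := by
  have hlam : lam ∈ lieAlg G := hlam
  refine ⟨fun rep hrep => (sigmaCharts (hη := hη) hlam hrep).stackEquiv (isFppfSheaf_grp G)
    (isFppfSheaf_paramPresh hη) fun _ => isFppfSheaf_cent G lam, fun σ P' hP' => ?_⟩
  have hP's : IsFppfSheaf (setOf P'.toGrp) := hP' ▸ isFppfSheaf_comap_parabolic hlam _
  exact (((antiFixedChart (hη := hη) hlam σ).stackEquiv (isFppfSheaf_grp G)
    (isFppfSheaf_paramPresh hη) fun _ => isFppfSheaf_antiFixed (isFppfSheaf_cent G lam)).trans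
    (stackEquiv_coprodUnit (QuotientStack.π
      (antiAction (twistedInvolution_sq G hη lam σ) (parabolic G lam))))).trans
        (stackEquiv_homotopyFixed _ hP' hP's)
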